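/- Let $H$ be a separable complex Hilbert space of infinite dimension. Give $U(H)$ the compact-open topology and let $\pi:U(H)\to PU(H)=U(H)/U(1)$ be the quotient. $I=[0,1]$. **Twisted vectorial bundles.** For an open set $U$ of a space $X$, an object $(E,h)$ of $\mathcal{HF}(U)$ is a $\mathbb Z_2$-graded Hermitian vector bundle $E\to U$ of finite (locally constant) rank with a Hermitian map $h:E\to E$ of degree $1$. A morphism $(E,h)\to(E',h')$ is represented by a degree $0$ map of vector bundles $\varphi$ with $\varphi h=h'\varphi$; $\varphi\doteq\varphi'$ (the same morphism) if every point has an open neighbourhood $V$ and a $\mu>0$ such that $\varphi_y=\varphi'_y$ on the sum of the eigenspaces of $h_y^2$ with eigenvalue $<\mu$ for all $y\in V$. Let $P\to X$ be a principal $PU(H)$-bundle. Given local sections $s,s'$ of $P$ over $U$, a morphism $(s,(E,h))\to(s',(E',h'))$ is represented by $(g,\varphi)$ with $g:U\to U(H)$ continuous, $s'\pi(g)=s$, and $\varphi$ as above; $(g,\varphi)$ and $(g',\varphi')$ are identified if $g=g'\zeta$, $\varphi\doteq\zeta\varphi'$ for a continuous $\zeta:U\to U(1)$. A $P$-twisted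 vectorial bundle $\mathbb E=(\{U_\alpha\},s_\alpha,g_{\alpha\beta},(E_\alpha,h_\alpha),\varphi_{\alpha\beta})$ consists of an open cover $\{U_\alpha\}$ of $X$, local sections $s_\alpha$ of $P$ over $U_\alpha$, $(E_\alpha,h_\alpha)\in\mathcal{HF}(U_\alpha)$ and representatives $\Phi_{\alpha\beta}=(g_{\alpha\beta},\varphi_{\alpha\beta})$ over $U_\alpha\cap U_\beta$ of morphisms from $(s_\beta,(E_\beta,h_\beta))$ to $(s_\alpha,(E_\alpha,h_\alpha))$, such that $\Phi_{\alpha\beta}\Phi_{\beta\alpha}=1$ and $\Phi_{\alpha\beta}\Phi_{\beta\gamma}=\Phi_{\alpha\gamma}$ as morphisms. Homomorphisms $\mathbb E'\to\mathbb E$ are families of morphisms $(s'_{\alpha'},(E'_{\alpha'},h'_{\alpha'}))\to(s_\alpha,(E_\alpha,h_\alpha))$ over $U_\alpha\cap U'_{\alpha'}$ compatible with the $\Phi$'s; isomorphisms are the invertible ones. The support $\operatorname{Supp}\mathbb E$ is the closure of the set of $x\in X$ at which some $(h_\alpha)_x$ is not invertible. **The groups.** For $Y\subset X$, $KF_P(X,Y)$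 is the set of homotopy classes of $P$-twisted vectorial bundles $\mathbb E$ with $\operatorname{Supp}\mathbb E\cap Y=\emptyset$; a homotopy is a $(P\times I)$-twisted vectorial bundle over $X\times I$ whose support does not meet $Y\times I$ and whose restrictions to $X\times\{0\}$, $X\times\{1\}$ are isomorphic to the given ones. For $k\ge0$, $$KF_P^{-k}(X,Y)=KF_{P\times I^k}(X\times I^k,\ Y\times I^k\cup X\times\partial I^k),\qquad KF^1_P(X,Y)=KF_P^{-1}(X,Y).$$ Let $\widehat{\mathcal C}$ be the category of triples $(X,Y;P)$ with $X$ a CW complex, $Y\subset X$ a subcomplex and $P\to X$ a principal $PU(H)$-bundle; a morphism $(f,F):(X',Y';P')\to(X,Y;P)$ is a continuous $f:X'\to X$ with $f(Y')\subset Y$ and a bundle map $F:P'\to P$ covering $f$. Put $KF^n_P(X)=KF^n_P(X,\emptyset)$. **Statement.** For $(X,Y;P)\in\widehat{\mathcal C}$ and $n\le1$ the sets $KF^n_P(X,Y)$ are abelian groups with addition induced by the direct sum of twisted vectorial bundles having the same $(U_\alpha,s_\alpha,g_{\alpha\beta})$; pull-back along $(f,F)$ induces homomorphisms $(f,F)^*$,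 functorially; and: 1. (Homotopy) If $(f_0,F_0)$ and $(f_1,F_1)$ are homotopic (through a morphism $(X'\times I,Y'\times I;P'\times I)\to(X,Y;P)$), then $(f_0,F_0)^*=(f_1,F_1)^*$ on all $KF^n$, $n\le 1$. 2. (Excision) For subcomplexes $A,B\subset X$ and $n\le1$ the inclusion induces an isomorphism $KF^n_{P|_{A\cup B}}(A\cup B,B)\cong KF^n_{P|_A}(A,A\cap B)$. 3. ("Exactness") For $k\ge0$ let $\mathcal X=X\times I^k\times\{0\}\cup(Y\times I^k\cup X\times\partial I^k)\times I$ and $\mathcal Z=Y\times I^k\times\{1\}\cup X\times\partial I^k\times I$, and write $KF(\mathcal X,\cdot)$ for $KF_{(P\times I^{k+1})|_{\mathcal X}}(\mathcal X,\cdot)$. The maps $$r^*:KF(\mathcal X,\ X\times I^k\times\{0\}\cup\mathcal Z)\to KF^{-k-1}_{P|_Y}(Y),\qquad p^*:KF_P^{-k}(X,Y)\to KF(\mathcal X,\mathcal Z)$$ induced by the inclusion $Y\times I^{k+1}\to\mathcal X$ and the projection $\mathcal X\to X\times I^k$ are bijective. Let $j^*:KF(\mathcal X,X\times I^k\times\{0\}\cup\mathcal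 Z)\to KF(\mathcal X,\mathcal Z)$ be induced by the inclusion of pairs and $\delta_{-k-1}=(p^*)^{-1}j^*(r^*)^{-1}:KF^{-k-1}_{P|_Y}(Y)\to KF^{-k}_P(X,Y)$. These maps are homomorphisms, natural in $(X,Y;P)$. Let further $\beta:KF^0_P(X,Y)\to KF^{-2}_P(X,Y)$ be given by multiplication with the Thom class: $\beta(\mathbb E)$ has the cover $\{U_\alpha\times D^2\}$ and pulled back $s_\alpha,g_{\alpha\beta}$, the bundles $E_\alpha\otimes F$ with $F=F^0\oplus F^1$, $F^i=\mathbb C$, the Hermitian maps $h_\alpha\otimes1+\epsilon\otimes T_z$ with $T_z=\begin{pmatrix}0&\bar z\\z&0\end{pmatrix}$, $z\in D^2\subset\mathbb C$, and $\epsilon=\pm1$ on the even/odd part of $E_\alpha$, and the maps $\varphi_{\alpha\beta}\otimes1$; here $(I^2,\partial I^2)$ is identified with $(D^2,S^1)$ by any homeomorphism. Then $\beta$ is a well-defined natural homomorphism. With the natural homomorphism $\delta_0=\delta_{-2}\circ\beta:KF^0_{P|_Y}(Y)\to KF^1_P(X,Y)$ and the maps induced by the inclusions, $$\cdots\to KF^{-1}_{P|_Y}(Y)\overset{\delta_{-1}}\to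 KF^0_P(X,Y)\to KF^0_P(X)\to KF^0_{P|_Y}(Y)\overset{\delta_0}\to KF^1_P(X,Y)$$ is a natural complex, exact at $KF_P^{-k}(X)$, $KF_P^{-k}(X,Y)$ and $KF_{P|_Y}^{-k-1}(Y)$ for all $k\ge0$ (at $KF^0_{P|_Y}(Y)$ only the composition is claimed to vanish). 4. (Additivity) For a family $\{(X_\lambda,Y_\lambda;P_\lambda)\}_{\lambda\in\Lambda}$ in $\widehat{\mathcal C}$ and $n\le1$ the inclusions $X_\lambda\to\coprod_\lambda X_\lambda$ induce an isomorphism $$KF^n_{\coprod P_\lambda}\big(\textstyle\coprod_\lambda X_\lambda,\coprod_\lambda Y_\lambda\big)\cong\prod_\lambda KF^n_{P_\lambda}(X_\lambda,Y_\lambda).$$ -/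

import Mathlib

open Set Topology
open scoped unitInterval InnerProductSpace

universe u w

noncomputable section

namespace TwK

/-! ### The groups `U(H)` and `PU(H)` -/

section UnitaryGroup

variable (H : Type w) [NormedAddCommGroup H] [InnerProductSpace ℂ H]

/-- The unitary group `U(H)`. -/
def UGroup : Type w := H ≃ₗᵢ[ℂ] H

instance : Group (UGroup H) := inferInstanceAs (Group (H ≃ₗᵢ[ℂ] H))

variable {H} in
/-- The unitary operator underlying an element of `U(H)`. -/
def UGroup.op (g : UGroup H) : H ≃ₗᵢ[ℂ] H := g

/-- The underlying continuous map of a unitary operator. -/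
def UGroup.toContinuousMap (g : UGroup H) : C(H, H) := ⟨g.op, g.op.continuous⟩

/-- `U(H)` carries the compact-open topology. -/
instance : TopologicalSpace (UGroup H) :=
  TopologicalSpace.induced (UGroup.toContinuousMap H) inferInstance

/-- The scalar operators of modulus one, `U(1) → U(H)`. -/
def scalar : Circle →* UGroup H where
  toFun z := show H ≃ₗᵢ[ℂ] H from
    { LinearEquiv.smulOfUnit (Circle.toUnits z) with
      norm_map' := fun v => by
        change ‖(z : ℂ) • v‖ = ‖v‖
        rw [norm_smul, Circle.norm_coe, one_mul] }
  map_one' := by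
    refine LinearIsometryEquiv.ext fun v => ?_
    change ((1 : Circle) : ℂ) • v = v
    simp
  map_mul' a b := by
    refine LinearIsometryEquiv.ext fun v => ?_
    change ((a * b : Circle) : ℂ) • v = (a : ℂ) • ((b : ℂ) • v)
    rw [Circle.coe_mul, mul_smul]

theorem scalar_op (z : Circle) (v : H) : (scalar H z).op v = (z : ℂ) • v := rfl

theorem scalar_injective [Nontrivial H] : Function.Injective (scalar H) := by
  intro a b hab
  obtain ⟨v, hv⟩ := exists_ne (0 : H)
  have h : (a : ℂ) • v = (b : ℂ) • v := by
    rw [← scalar_op, ← scalar_op, hab]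
  exact Circle.ext (smul_left_injective ℂ hv h)

instance : (scalar H).range.Normal where
  conj_mem := by
    rintro _ ⟨z, rfl⟩ g
    refine ⟨z, ?_⟩
    rw [eq_mul_inv_iff_mul_eq]
    refine LinearIsometryEquiv.ext fun v => ?_
    change (z : ℂ) • g.op v = g.op ((z : ℂ) • v)
    exact (g.op.map_smul _ _).symm

/-- The projective unitary group `PU(H) = U(H) / U(1)`. -/
def PU : Type w := UGroup H ⧸ (scalar H).range

instance : Group (PU H) := inferInstanceAs (Group (UGroup H ⧸ (scalar H).range))

/-- `PU(H)` carries the quotient topology of the compact-open topology. -/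
instance : TopologicalSpace (PU H) :=
  inferInstanceAs (TopologicalSpace (UGroup H ⧸ (scalar H).range))

/-- The projection `π : U(H) → PU(H)`. -/
def toPU : UGroup H →* PU H := QuotientGroup.mk' (scalar H).range

end UnitaryGroup

/-! ### Principal bundles -/

section Principal

/-- A locally trivial principal `G`-bundle over `X`: a space with a continuous
right `G`-action which is free and transitive on the fibres of the projection, with continuous
translation function `div` (`p · div p q = q` for `p`, `q` in the same fibre) and with continuous
local sections.  Equivalently, `X` is covered by open sets over which the space is equivariantly
homeomorphic to `U × G`. -/
structure PrincipalBundle (G : Type w) [Group G] [TopologicalSpace G]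
    (X : Type u) [TopologicalSpace X] where
  Total : Type u
  [top : TopologicalSpace Total]
  proj : Total → X
  continuous_proj : Continuous proj
  act : Total → G → Total
  continuous_act : Continuous fun q : Total × G => act q.1 q.2
  act_one : ∀ p, act p 1 = p
  act_mul : ∀ p a b, act p (a * b) = act (act p a) b
  proj_act : ∀ p a, proj (act p a) = proj p
  div : Total → Total → G
  act_div : ∀ p q, proj p = proj q → act p (div p q) = q
  div_act : ∀ p a, div p (act p a) = a
  continuousOn_div : ContinuousOn (fun q : Total × Total => div q.1 q.2)
    {q | proj q.1 = proj q.2}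
  exists_section : ∀ x, ∃ U : Set X, IsOpen U ∧ x ∈ U ∧
    ∃ τ : X → Total, ContinuousOn τ U ∧ ∀ y ∈ U, proj (τ y) = y

attribute [instance] PrincipalBundle.top

variable {G : Type w} [Group G] [TopologicalSpace G]
variable {X : Type u} [TopologicalSpace X] {X' : Type u} [TopologicalSpace X']
variable {B : Type u} [TopologicalSpace B] {B' : Type u} [TopologicalSpace B']

namespace PrincipalBundle

/-- A bundle map `P' → P` covering `f`. -/
structure Hom (P' : PrincipalBundle G X') (P : PrincipalBundle G X) (f : C(X', X)) where
  toFun : P'.Total → P.Total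
  continuous_toFun : Continuous toFun
  proj_toFun : ∀ p, P.proj (toFun p) = f (P'.proj p)
  map_act : ∀ p a, toFun (P'.act p a) = P.act (toFun p) a

/-- The identity bundle map. -/
def Hom.id (P : PrincipalBundle G X) : Hom P P (ContinuousMap.id X) :=
  ⟨_root_.id, continuous_id, fun _ => rfl, fun _ _ => rfl⟩

/-- The composition of bundle maps. -/
def Hom.comp {P'' : PrincipalBundle G B'} {P' : PrincipalBundle G X'} {P : PrincipalBundle G X}
    {f : C(X', X)} {f' : C(B', X')} (F : Hom P' P f) (F' : Hom P'' P' f') :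
    Hom P'' P (f.comp f') where
  toFun p := F.toFun (F'.toFun p)
  continuous_toFun := F.continuous_toFun.comp F'.continuous_toFun
  proj_toFun p := by rw [F.proj_toFun, F'.proj_toFun]; rfl
  map_act p a := by rw [F'.map_act, F.map_act]

/-- The pull-back bundle `f^*P`. -/
def pullback (P : PrincipalBundle G X) (f : C(X', X)) : PrincipalBundle G X' where
  Total := {q : X' × P.Total // f q.1 = P.proj q.2}
  proj q := q.1.1
  continuous_proj := by fun_prop
  act q a := ⟨(q.1.1, P.act q.1.2 a), by rw [P.proj_act]; exact q.2⟩
  continuous_act := by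
    refine Continuous.subtype_mk (Continuous.prodMk (by fun_prop) ?_) _
    exact P.continuous_act.comp
      (Continuous.prodMk (continuous_snd.comp (continuous_subtype_val.comp continuous_fst))
        continuous_snd)
  act_one q := Subtype.ext (Prod.ext rfl (P.act_one _))
  act_mul q a b := Subtype.ext (Prod.ext rfl (P.act_mul _ _ _))
  proj_act _ _ := rfl
  div p q := P.div p.1.2 q.1.2
  act_div p q h := Subtype.ext (Prod.ext h (P.act_div _ _ (by
    rw [← p.2, ← q.2]; exact congrArg f h)))
  div_act _ _ := P.div_act _ _
  continuousOn_div := by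
    refine P.continuousOn_div.comp
      (f := fun q : {q : X' × P.Total // f q.1 = P.proj q.2} ×
        {q : X' × P.Total // f q.1 = P.proj q.2} => (q.1.1.2, q.2.1.2)) ?_ ?_
    · exact Continuous.continuousOn (by fun_prop)
    · intro q hq
      change P.proj q.1.1.2 = P.proj q.2.1.2
      rw [← q.1.2, ← q.2.2]
      exact congrArg f hq
  exists_section x := by
    classical
    obtain ⟨U, hU, hx, τ, hτ, hs⟩ := P.exists_section (f x)
    let q₀ : {q : X' × P.Total // f q.1 = P.proj q.2} := ⟨(x, τ (f x)), (hs _ hx).symm⟩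
    refine ⟨f ⁻¹' U, hU.preimage f.continuous, hx,
      fun y => if h : f y = P.proj (τ (f y)) then ⟨(y, τ (f y)), h⟩ else q₀, ?_, ?_⟩
    · refine (Topology.IsInducing.continuousOn_iff
        (g := (Subtype.val : {q : X' × P.Total // f q.1 = P.proj q.2} → X' × P.Total))
        Topology.IsInducing.subtypeVal).2 ?_
      have : ContinuousOn (fun y => (y, τ (f y))) (f ⁻¹' U) :=
        continuousOn_id.prodMk (hτ.comp f.continuous.continuousOn fun _ h => h)
      refine this.congr fun y hy => ?_
      have h : f y = P.proj (τ (f y)) := (hs _ hy).symm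
      simp [Function.comp, dif_pos h]
    · intro y hy
      have h : f y = P.proj (τ (f y)) := (hs _ hy).symm
      simp [dif_pos h]

/-- The canonical bundle map `f^*P → P`. -/
def pullbackHom (P : PrincipalBundle G X) (f : C(X', X)) : Hom (P.pullback f) P f where
  toFun q := q.1.2
  continuous_toFun := continuous_snd.comp continuous_subtype_val
  proj_toFun q := q.2.symm
  map_act _ _ := rfl

/-- A bundle map `P' → P` covering `b ∘ k` induces a bundle map `P' → b^*P` covering `k`. -/
def Hom.lift {P' : PrincipalBundle G X'} {P : PrincipalBundle G X} {f : C(X', X)}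
    (F : Hom P' P f) (b : C(B, X)) (k : C(X', B)) (hk : ∀ x, b (k x) = f x) :
    Hom P' (P.pullback b) k where
  toFun p := ⟨(k (P'.proj p), F.toFun p), (hk _).trans (F.proj_toFun p).symm⟩
  continuous_toFun := Continuous.subtype_mk
    ((k.continuous.comp P'.continuous_proj).prodMk F.continuous_toFun) _
  proj_toFun _ := rfl
  map_act p a := Subtype.ext (Prod.ext (congrArg k (P'.proj_act p a)) (F.map_act p a))

/-- A bundle map `F : P' → P` covering `f` induces a bundle map `a^*P' → b^*P` covering `k`
whenever `b ∘ k = f ∘ a`. -/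
def Hom.pullbackMap {P' : PrincipalBundle G X'} {P : PrincipalBundle G X} {f : C(X', X)}
    (F : Hom P' P f) (a : C(B', X')) (b : C(B, X)) (k : C(B', B))
    (hk : ∀ x, b (k x) = f (a x)) : Hom (P'.pullback a) (P.pullback b) k :=
  (F.comp (P'.pullbackHom a)).lift b k hk

/-- The product bundle `P × K → X × K`. -/
abbrev prod (P : PrincipalBundle G X) (K : Type) [TopologicalSpace K] :
    PrincipalBundle G (X × K) :=
  P.pullback ⟨Prod.fst, continuous_fst⟩

/-- The inclusion `x ↦ (x, t)`. -/
def sliceMap (X : Type u) [TopologicalSpace X] (t : I) : C(X, X × I) :=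
  ⟨fun x => (x, t), by fun_prop⟩

/-- The inclusion `P → P × I` of the slice at `t`. -/
def slice (P : PrincipalBundle G X) (t : I) : Hom P (P.prod I) (sliceMap X t) where
  toFun p := ⟨((P.proj p, t), p), rfl⟩
  continuous_toFun := by
    refine Continuous.subtype_mk (Continuous.prodMk (Continuous.prodMk P.continuous_proj
      continuous_const) continuous_id) _
  proj_toFun _ := rfl
  map_act p a := Subtype.ext (Prod.ext (Prod.ext (P.proj_act p a) rfl) rfl)

/-- The bundle map `F × id : P' × K → P × K`. -/
def Hom.prodMap {P' : PrincipalBundle G X'} {P : PrincipalBundle G X} {f : C(X', X)}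
    (F : Hom P' P f) (K : Type) [TopologicalSpace K] :
    Hom (P'.prod K) (P.prod K) (f.prodMap (ContinuousMap.id K)) :=
  F.pullbackMap _ _ _ fun _ => rfl

theorem exists_mem_fiber (P : PrincipalBundle G X) (x : X) : ∃ p, P.proj p = x := by
  obtain ⟨U, _, hx, τ, _, hs⟩ := P.exists_section x
  exact ⟨τ x, hs x hx⟩

/-- The section of `P'` induced from a section `s` of `P` by a bundle map `P' → P`: the unique
one which is mapped to `s ∘ f`. -/
def Hom.comapSection {P' : PrincipalBundle G X'} {P : PrincipalBundle G X} {f : C(X', X)}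
    (F : Hom P' P f) (s : X → P.Total) (x : X') : P'.Total :=
  P'.act (P'.exists_mem_fiber x).choose
    (P.div (F.toFun (P'.exists_mem_fiber x).choose) (s (f x)))

section comapSection

variable {P' : PrincipalBundle G X'} {P : PrincipalBundle G X} {f : C(X', X)}
  (F : Hom P' P f) (s : X → P.Total)

theorem Hom.proj_comapSection (x : X') : P'.proj (F.comapSection s x) = x := by
  rw [Hom.comapSection, P'.proj_act]
  exact (P'.exists_mem_fiber x).choose_spec

theorem Hom.toFun_comapSection {x : X'} (hs : P.proj (s (f x)) = f x) :
    F.toFun (F.comapSection s x) = s (f x) := by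
  rw [Hom.comapSection, F.map_act, P.act_div]
  rw [F.proj_toFun, (P'.exists_mem_fiber x).choose_spec, hs]

theorem Hom.injOn {p q : P'.Total} (h : P'.proj p = P'.proj q) (hF : F.toFun p = F.toFun q) :
    p = q := by
  have h1 := P'.act_div p q h
  have h2 : F.toFun p = P.act (F.toFun p) (P'.div p q) := by rw [← F.map_act, h1, ← hF]
  have h3 : P'.div p q = 1 := by
    have h4 := P.div_act (F.toFun p) (P'.div p q)
    have h5 := P.div_act (F.toFun p) 1
    rw [← h2] at h4
    rw [P.act_one] at h5
    exact h4.symm.trans h5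
  rw [← h1, h3, P'.act_one]

theorem Hom.eq_comapSection {x : X'} {p : P'.Total} (hp : P'.proj p = x)
    (hF : F.toFun p = s (f x)) : p = F.comapSection s x := by
  refine F.injOn (by rw [hp, F.proj_comapSection]) ?_
  rw [hF, F.toFun_comapSection]
  rw [← hF, F.proj_toFun, hp]

theorem Hom.continuousOn_comapSection {U : Set X} (hs : ContinuousOn s U)
    (hsp : ∀ x ∈ U, P.proj (s x) = x) : ContinuousOn (F.comapSection s) (f ⁻¹' U) := by
  intro x hx
  obtain ⟨V, hV, hxV, τ, hτ, hτp⟩ := P'.exists_section x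
  have key : ContinuousOn (fun y => P'.act (τ y) (P.div (F.toFun (τ y)) (s (f y))))
      (f ⁻¹' U ∩ V) := by
    have hτ' : ContinuousOn τ (f ⁻¹' U ∩ V) := hτ.mono inter_subset_right
    refine P'.continuous_act.comp_continuousOn (hτ'.prodMk ?_)
    refine P.continuousOn_div.comp (f := fun y => (F.toFun (τ y), s (f y))) ?_ ?_
    · refine (F.continuous_toFun.comp_continuousOn hτ').prodMk ?_
      exact hs.comp f.continuous.continuousOn fun y hy => hy.1
    · intro y hy
      change P.proj (F.toFun (τ y)) = P.proj (s (f y))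
      rw [F.proj_toFun, hτp y hy.2, hsp _ hy.1]
  have key2 : ContinuousOn (F.comapSection s) (f ⁻¹' U ∩ V) := by
    refine key.congr fun y hy => ?_
    symm
    apply F.eq_comapSection
    · rw [P'.proj_act, hτp y hy.2]
    · rw [F.map_act, P.act_div]
      rw [F.proj_toFun, hτp y hy.2, hsp _ hy.1]
  exact (continuousWithinAt_inter (hV.mem_nhds hxV)).1 (key2 x ⟨hx, hxV⟩)

end comapSection

end PrincipalBundle

end Principal

/-! ### Hermitian vector bundles and the category `HF(U)` -/

section HF

variable {X : Type u} [TopologicalSpace X] {X' : Type u} [TopologicalSpace X']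

/-- A Hermitian vector bundle of finite (locally constant) rank over the open subset `U` of `X`:
a family of Hermitian vector spaces, with an atlas of local orthonormal frames over open sets
covering `U` whose transition functions are continuous.  (The family is indexed by all points
of `X`; only the fibres over `U` play a role.) -/
structure HermBundle (X : Type u) [TopologicalSpace X] (U : Set X) where
  Fib : X → Type u
  [normed : ∀ x, NormedAddCommGroup (Fib x)]
  [inner : ∀ x, InnerProductSpace ℂ (Fib x)]
  ι : Type u
  dom : ι → Set X
  isOpen_dom : ∀ i, IsOpen (dom i)
  iUnion_dom : ⋃ i, dom i = U
  rk : ι → Type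
  [finite_rk : ∀ i, Finite (rk i)]
  frame : ∀ i, rk i → ∀ x, Fib x
  orthonormal : ∀ i, ∀ x ∈ dom i, Orthonormal ℂ fun k => frame i k x
  span_eq_top : ∀ i, ∀ x ∈ dom i, Submodule.span ℂ (range fun k => frame i k x) = ⊤
  continuousOn_transition : ∀ i j k l,
    ContinuousOn (fun x => ⟪frame i k x, frame j l x⟫_ℂ) (dom i ∩ dom j)

attribute [instance] HermBundle.normed HermBundle.inner HermBundle.finite_rk

/-- Continuity over `W` of a family of linear maps between the fibres of two Hermitian vector
bundles: its matrix coefficients in the local frames are continuous. -/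
def ContinuousHomOn {U U' : Set X} (E : HermBundle X U) (E' : HermBundle X U') (W : Set X)
    (A : ∀ x, E.Fib x →ₗ[ℂ] E'.Fib x) : Prop :=
  ∀ i j k l, ContinuousOn (fun x => ⟪E'.frame j l x, A x (E.frame i k x)⟫_ℂ)
    (W ∩ (E.dom i ∩ E'.dom j))

namespace HermBundle

theorem finiteDimensional_fib {U : Set X} (E : HermBundle X U) {x : X} (hx : x ∈ U) :
    FiniteDimensional ℂ (E.Fib x) := by
  rw [← E.iUnion_dom] at hx
  obtain ⟨i, hi⟩ := mem_iUnion.1 hx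
  exact ⟨(finite_range _).toFinset, by rw [Finite.coe_toFinset]; exact E.span_eq_top i x hi⟩

/-- The pull-back of a Hermitian vector bundle. -/
def pullback {U : Set X} (E : HermBundle X U) (f : C(X', X)) : HermBundle X' (f ⁻¹' U) where
  Fib x := E.Fib (f x)
  normed x := E.normed (f x)
  inner x := E.inner (f x)
  ι := E.ι
  dom i := f ⁻¹' E.dom i
  isOpen_dom i := (E.isOpen_dom i).preimage f.continuous
  iUnion_dom := by rw [← preimage_iUnion, E.iUnion_dom]
  rk := E.rk
  frame i k x := E.frame i k (f x)
  orthonormal i x hx := E.orthonormal i (f x) hx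
  span_eq_top i x hx := E.span_eq_top i (f x) hx
  continuousOn_transition i j k l :=
    (E.continuousOn_transition i j k l).comp f.continuous.continuousOn fun _ h => h

/-- The local frames of an orthogonal direct sum. -/
def sumFrame {U : Set X} (E E' : HermBundle X U) (i : E.ι × E'.ι) :
    E.rk i.1 ⊕ E'.rk i.2 → ∀ x, WithLp 2 (E.Fib x × E'.Fib x)
  | .inl k, x => WithLp.toLp 2 (E.frame i.1 k x, 0)
  | .inr k, x => WithLp.toLp 2 (0, E'.frame i.2 k x)

/-- The orthogonal direct sum of Hermitian vector bundles. -/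
def sum {U : Set X} (E E' : HermBundle X U) : HermBundle X U where
  Fib x := WithLp 2 (E.Fib x × E'.Fib x)
  ι := E.ι × E'.ι
  dom i := E.dom i.1 ∩ E'.dom i.2
  isOpen_dom i := (E.isOpen_dom i.1).inter (E'.isOpen_dom i.2)
  iUnion_dom := by
    rw [iUnion_prod', ← iUnion_inter_iUnion, E.iUnion_dom, E'.iUnion_dom, inter_self]
  rk i := E.rk i.1 ⊕ E'.rk i.2
  frame i k x := E.sumFrame E' i k x
  orthonormal i x hx := by
    classical
    have h1 := orthonormal_iff_ite.1 (E.orthonormal i.1 x hx.1)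
    have h2 := orthonormal_iff_ite.1 (E'.orthonormal i.2 x hx.2)
    rw [orthonormal_iff_ite]
    rintro (k | k) (l | l) <;> simp [sumFrame, h1, h2, WithLp.prod_inner_apply]
  span_eq_top i x hx := by
    rw [eq_top_iff]
    have h1 : ∀ v : E.Fib x, (WithLp.toLp 2 (v, 0) : WithLp 2 (E.Fib x × E'.Fib x)) ∈
        Submodule.span ℂ (range fun k => E.sumFrame E' i k x) := fun v => by
      have hv : v ∈ Submodule.span ℂ (range fun k => E.frame i.1 k x) := by
        rw [E.span_eq_top i.1 x hx.1]; trivial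
      induction hv using Submodule.span_induction with
      | mem v hv =>
        obtain ⟨k, rfl⟩ := hv
        exact Submodule.subset_span ⟨.inl k, rfl⟩
      | zero => exact Submodule.zero_mem _
      | add a b _ _ ha hb => simpa [← WithLp.toLp_add] using Submodule.add_mem _ ha hb
      | smul c a _ ha => simpa [← WithLp.toLp_smul] using Submodule.smul_mem _ c ha
    have h2 : ∀ v : E'.Fib x, (WithLp.toLp 2 (0, v) : WithLp 2 (E.Fib x × E'.Fib x)) ∈
        Submodule.span ℂ (range fun k => E.sumFrame E' i k x) := fun v => by
      have hv : v ∈ Submodule.span ℂ (range fun k => E'.frame i.2 k x) := by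
        rw [E'.span_eq_top i.2 x hx.2]; trivial
      induction hv using Submodule.span_induction with
      | mem v hv =>
        obtain ⟨k, rfl⟩ := hv
        exact Submodule.subset_span ⟨.inr k, rfl⟩
      | zero => exact Submodule.zero_mem _
      | add a b _ _ ha hb => simpa [← WithLp.toLp_add] using Submodule.add_mem _ ha hb
      | smul c a _ ha => simpa [← WithLp.toLp_smul] using Submodule.smul_mem _ c ha
    rintro v -
    have := Submodule.add_mem _ (h1 v.fst) (h2 v.snd)
    rw [← WithLp.toLp_add, Prod.mk_add_mk, add_zero, zero_add] at this
    exact this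
  continuousOn_transition i j := by
    have hs1 : E.dom i.1 ∩ E'.dom i.2 ∩ (E.dom j.1 ∩ E'.dom j.2) ⊆ E.dom i.1 ∩ E.dom j.1 :=
      fun x hx => ⟨hx.1.1, hx.2.1⟩
    have hs2 : E.dom i.1 ∩ E'.dom i.2 ∩ (E.dom j.1 ∩ E'.dom j.2) ⊆ E'.dom i.2 ∩ E'.dom j.2 :=
      fun x hx => ⟨hx.1.2, hx.2.2⟩
    have h1 := fun k l => (E.continuousOn_transition i.1 j.1 k l).mono hs1
    have h2 := fun k l => (E'.continuousOn_transition i.2 j.2 k l).mono hs2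
    rintro (k | k) (l | l) <;>
      simp [sumFrame, h1, h2, WithLp.prod_inner_apply, continuousOn_const]

end HermBundle

/-- A linear map between orthogonal direct sums with the matrix `(a b; c d)`. -/
def blockMap {V₁ V₂ W₁ W₂ : Type u}
    [NormedAddCommGroup V₁] [InnerProductSpace ℂ V₁] [NormedAddCommGroup V₂]
    [InnerProductSpace ℂ V₂] [NormedAddCommGroup W₁] [InnerProductSpace ℂ W₁]
    [NormedAddCommGroup W₂] [InnerProductSpace ℂ W₂]
    (a : V₁ →ₗ[ℂ] W₁) (b : V₂ →ₗ[ℂ] W₁) (c : V₁ →ₗ[ℂ] W₂) (d : V₂ →ₗ[ℂ] W₂) :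
    WithLp 2 (V₁ × V₂) →ₗ[ℂ] WithLp 2 (W₁ × W₂) where
  toFun v := WithLp.toLp 2 (a v.fst + b v.snd, c v.fst + d v.snd)
  map_add' v w := by
    refine WithLp.ofLp_injective 2 (Prod.ext ?_ ?_) <;> simp <;> abel
  map_smul' r v := by
    refine WithLp.ofLp_injective 2 (Prod.ext ?_ ?_) <;> simp

theorem withLp_ext {V₁ V₂ : Type u} {v w : WithLp 2 (V₁ × V₂)} (h1 : v.fst = w.fst)
    (h2 : v.snd = w.snd) : v = w := WithLp.ofLp_injective 2 (Prod.ext h1 h2)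

section blockMap

variable {V₁ V₂ W₁ W₂ : Type u}
    [NormedAddCommGroup V₁] [InnerProductSpace ℂ V₁] [NormedAddCommGroup V₂]
    [InnerProductSpace ℂ V₂] [NormedAddCommGroup W₁] [InnerProductSpace ℂ W₁]
    [NormedAddCommGroup W₂] [InnerProductSpace ℂ W₂]
    (a : V₁ →ₗ[ℂ] W₁) (b : V₂ →ₗ[ℂ] W₁) (c : V₁ →ₗ[ℂ] W₂) (d : V₂ →ₗ[ℂ] W₂)

theorem blockMap_apply (v : WithLp 2 (V₁ × V₂)) : blockMap a b c d v =
    WithLp.toLp 2 (a v.fst + b v.snd, c v.fst + d v.snd) := rfl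

@[simp] theorem blockMap_fst (v : WithLp 2 (V₁ × V₂)) :
    (blockMap a b c d v).fst = a v.fst + b v.snd := rfl

@[simp] theorem blockMap_snd (v : WithLp 2 (V₁ × V₂)) :
    (blockMap a b c d v).snd = c v.fst + d v.snd := rfl

theorem inner_blockMap_inl_inl (v : V₁) (w : W₁) :
    ⟪(WithLp.toLp 2 (w, 0) : WithLp 2 (W₁ × W₂)), blockMap a b c d (WithLp.toLp 2 (v, 0))⟫_ℂ =
      ⟪w, a v⟫_ℂ := by
  simp [WithLp.prod_inner_apply, blockMap_apply]

theorem inner_blockMap_inl_inr (v : V₁) (w : W₂) :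
    ⟪(WithLp.toLp 2 (0, w) : WithLp 2 (W₁ × W₂)), blockMap a b c d (WithLp.toLp 2 (v, 0))⟫_ℂ =
      ⟪w, c v⟫_ℂ := by
  simp [WithLp.prod_inner_apply, blockMap_apply]

theorem inner_blockMap_inr_inl (v : V₂) (w : W₁) :
    ⟪(WithLp.toLp 2 (w, 0) : WithLp 2 (W₁ × W₂)), blockMap a b c d (WithLp.toLp 2 (0, v))⟫_ℂ =
      ⟪w, b v⟫_ℂ := by
  simp [WithLp.prod_inner_apply, blockMap_apply]

theorem inner_blockMap_inr_inr (v : V₂) (w : W₂) :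
    ⟪(WithLp.toLp 2 (0, w) : WithLp 2 (W₁ × W₂)), blockMap a b c d (WithLp.toLp 2 (0, v))⟫_ℂ =
      ⟪w, d v⟫_ℂ := by
  simp [WithLp.prod_inner_apply, blockMap_apply]

theorem blockMap_symm {A : V₁ →ₗ[ℂ] V₁} {B : V₂ →ₗ[ℂ] V₁} {C : V₁ →ₗ[ℂ] V₂} {D : V₂ →ₗ[ℂ] V₂}
    (hA : ∀ v w, ⟪A v, w⟫_ℂ = ⟪v, A w⟫_ℂ) (hD : ∀ v w, ⟪D v, w⟫_ℂ = ⟪v, D w⟫_ℂ)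
    (hB : ∀ v w, ⟪B v, w⟫_ℂ = ⟪v, C w⟫_ℂ) (hC : ∀ v w, ⟪C v, w⟫_ℂ = ⟪v, B w⟫_ℂ)
    (v w : WithLp 2 (V₁ × V₂)) :
    ⟪blockMap A B C D v, w⟫_ℂ = ⟪v, blockMap A B C D w⟫_ℂ := by
  rw [WithLp.prod_inner_apply, WithLp.prod_inner_apply]
  change ⟪A v.fst + B v.snd, w.fst⟫_ℂ + ⟪C v.fst + D v.snd, w.snd⟫_ℂ =
    ⟪v.fst, A w.fst + B w.snd⟫_ℂ + ⟪v.snd, C w.fst + D w.snd⟫_ℂ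
  simp only [inner_add_left, inner_add_right, hA, hB, hC, hD]
  ring

theorem blockMap_comm {φ : V₁ →ₗ[ℂ] W₁} {ψ : V₂ →ₗ[ℂ] W₂}
    {A : V₁ →ₗ[ℂ] V₁} {B : V₂ →ₗ[ℂ] V₁} {C : V₁ →ₗ[ℂ] V₂} {D : V₂ →ₗ[ℂ] V₂}
    {A' : W₁ →ₗ[ℂ] W₁} {B' : W₂ →ₗ[ℂ] W₁} {C' : W₁ →ₗ[ℂ] W₂} {D' : W₂ →ₗ[ℂ] W₂}
    (hA : ∀ v, φ (A v) = A' (φ v)) (hB : ∀ v, φ (B v) = B' (ψ v))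
    (hC : ∀ v, ψ (C v) = C' (φ v)) (hD : ∀ v, ψ (D v) = D' (ψ v))
    (v : WithLp 2 (V₁ × V₂)) :
    blockMap φ 0 0 ψ (blockMap A B C D v) = blockMap A' B' C' D' (blockMap φ 0 0 ψ v) := by
  simp [blockMap_apply, hA, hB, hC, hD]

theorem blockMap_sq {A : V₁ →ₗ[ℂ] V₁} {D : V₂ →ₗ[ℂ] V₂} (hA : ∀ v, A (A v) = v)
    (hD : ∀ v, D (D v) = v) (v : WithLp 2 (V₁ × V₂)) :
    blockMap A 0 0 D (blockMap A 0 0 D v) = v := by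
  simp only [blockMap_apply, WithLp.toLp_fst, WithLp.toLp_snd, LinearMap.zero_apply, add_zero,
    zero_add, hA, hD]
  rfl

theorem blockMap_odd {A : V₁ →ₗ[ℂ] V₁} {B : V₂ →ₗ[ℂ] V₁} {C : V₁ →ₗ[ℂ] V₂} {D : V₂ →ₗ[ℂ] V₂}
    {e : V₁ →ₗ[ℂ] V₁} {e' : V₂ →ₗ[ℂ] V₂}
    (hA : ∀ v, A (e v) = -e (A v)) (hB : ∀ v, B (e' v) = -e (B v))
    (hC : ∀ v, C (e v) = -e' (C v)) (hD : ∀ v, D (e' v) = -e' (D v))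
    (v : WithLp 2 (V₁ × V₂)) :
    blockMap A B C D (blockMap e 0 0 e' v) = -blockMap e 0 0 e' (blockMap A B C D v) := by
  simp only [blockMap_apply, WithLp.toLp_fst, WithLp.toLp_snd, LinearMap.zero_apply, add_zero,
    zero_add, hA, hB, hC, hD, map_add, ← WithLp.toLp_neg, Prod.neg_mk, neg_add]

theorem blockMap_thom {A e : V₁ →ₗ[ℂ] V₁} (he : ∀ v, e (e v) = v)
    (hA : ∀ v, A (e v) = -e (A v)) (z : ℂ) (v : WithLp 2 (V₁ × V₁)) :
    blockMap A (star z • e) (z • e) A (blockMap A (star z • e) (z • e) A v) =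
      WithLp.toLp 2 (A (A v.fst) + ((‖z‖ ^ 2 : ℝ) : ℂ) • v.fst,
        A (A v.snd) + ((‖z‖ ^ 2 : ℝ) : ℂ) • v.snd) := by
  have hz : star z * z = ((‖z‖ ^ 2 : ℝ) : ℂ) := by
    rw [Complex.star_def, Complex.conj_mul', Complex.ofReal_pow]
  have hz' : z * star z = ((‖z‖ ^ 2 : ℝ) : ℂ) := by rw [mul_comm, hz]
  refine withLp_ext ?_ ?_
  · simp only [blockMap_fst, blockMap_snd, map_add, LinearMap.smul_apply, map_smul,
      hA, he, smul_smul, hz', smul_neg, WithLp.toLp_fst]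
    abel
  · simp only [blockMap_fst, blockMap_snd, map_add, LinearMap.smul_apply, map_smul,
      hA, he, smul_smul, hz, smul_neg, WithLp.toLp_snd]
    abel

/-- The sum of the eigenspaces of `h²` for the eigenvalues `< μ`. -/
def lowSpace {V : Type u} [NormedAddCommGroup V] [InnerProductSpace ℂ V] (h : V →ₗ[ℂ] V) (μ : ℝ) :
    Submodule ℂ V :=
  ⨆ (l : ℝ) (_ : l < μ), Module.End.eigenspace (h * h : Module.End ℂ V) (l : ℂ)

theorem lowSpace_mono {V : Type u} [NormedAddCommGroup V] [InnerProductSpace ℂ V]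
    (h : V →ₗ[ℂ] V) {a b : ℝ} (hab : a ≤ b) : lowSpace h a ≤ lowSpace h b :=
  iSup_mono fun _ => iSup_mono' fun hl => ⟨hl.trans_le hab, le_rfl⟩

theorem mem_lowSpace {V : Type u} [NormedAddCommGroup V] [InnerProductSpace ℂ V]
    {h : V →ₗ[ℂ] V} {l μ : ℝ} (hl : l < μ) {v : V} (hv : h (h v) = (l : ℂ) • v) :
    v ∈ lowSpace h μ :=
  Submodule.mem_iSup_of_mem l (Submodule.mem_iSup_of_mem hl (Module.End.mem_eigenspace_iff.2 hv))

theorem lowSpace_induction {V : Type u} [NormedAddCommGroup V] [InnerProductSpace ℂ V]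
    {h : V →ₗ[ℂ] V} {μ : ℝ} {p : V → Prop} {v : V} (hv : v ∈ lowSpace h μ)
    (hp : ∀ l : ℝ, l < μ → ∀ v, h (h v) = (l : ℂ) • v → p v) (h0 : p 0)
    (hadd : ∀ v w, p v → p w → p (v + w)) : p v := by
  refine Submodule.iSup_induction _ (motive := p) hv (fun l v hv => ?_) h0 hadd
  refine Submodule.iSup_induction _ (motive := p) hv (fun hl v hv => ?_) h0 hadd
  exact hp l hl v (Module.End.mem_eigenspace_iff.1 hv)

theorem lowSpace_block {A : V₁ →ₗ[ℂ] V₁} {D : V₂ →ₗ[ℂ] V₂}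
    {M : WithLp 2 (V₁ × V₂) →ₗ[ℂ] WithLp 2 (V₁ × V₂)} {c : ℝ} (hc : 0 ≤ c)
    (hM : ∀ v, M (M v) = WithLp.toLp 2 (A (A v.fst) + (c : ℂ) • v.fst,
      D (D v.snd) + (c : ℂ) • v.snd)) {μ : ℝ} {v : WithLp 2 (V₁ × V₂)} (hv : v ∈ lowSpace M μ) :
    v.fst ∈ lowSpace A μ ∧ v.snd ∈ lowSpace D μ := by
  have key : ∀ l : ℝ, l < μ → ∀ v, M (M v) = (l : ℂ) • v →
      v.fst ∈ lowSpace A μ ∧ v.snd ∈ lowSpace D μ := by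
    intro l hl v hv
    rw [hM v] at hv
    have h1 : A (A v.fst) + (c : ℂ) • v.fst = (l : ℂ) • v.fst := by
      have h0 := congrArg WithLp.fst hv
      rwa [WithLp.smul_fst] at h0
    have h2 : D (D v.snd) + (c : ℂ) • v.snd = (l : ℂ) • v.snd := by
      have h0 := congrArg WithLp.snd hv
      rwa [WithLp.smul_snd] at h0
    have hl' : l - c < μ := by linarith
    refine ⟨mem_lowSpace hl' ?_, mem_lowSpace hl' ?_⟩
    · rw [Complex.ofReal_sub, sub_smul, ← h1, add_sub_cancel_right]
    · rw [Complex.ofReal_sub, sub_smul, ← h2, add_sub_cancel_right]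
  exact lowSpace_induction (p := fun v => v.fst ∈ lowSpace A μ ∧ v.snd ∈ lowSpace D μ) hv key
    ⟨Submodule.zero_mem _, Submodule.zero_mem _⟩
    fun v w hv hw => ⟨Submodule.add_mem _ hv.1 hw.1, Submodule.add_mem _ hv.2 hw.2⟩

theorem blockMap_blockMap_diag (A : V₁ →ₗ[ℂ] V₁) (D : V₂ →ₗ[ℂ] V₂) (v : WithLp 2 (V₁ × V₂)) :
    blockMap A 0 0 D (blockMap A 0 0 D v) =
      WithLp.toLp 2 (A (A v.fst) + ((0 : ℝ) : ℂ) • v.fst,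
        D (D v.snd) + ((0 : ℝ) : ℂ) • v.snd) := by
  simp [blockMap_apply]

theorem blockMap_comp_diag {U₁ U₂ : Type u} [NormedAddCommGroup U₁] [InnerProductSpace ℂ U₁]
    [NormedAddCommGroup U₂] [InnerProductSpace ℂ U₂] (φ : V₁ →ₗ[ℂ] W₁) (ψ : V₂ →ₗ[ℂ] W₂)
    (φ' : U₁ →ₗ[ℂ] V₁) (ψ' : U₂ →ₗ[ℂ] V₂) :
    blockMap φ 0 0 ψ ∘ₗ blockMap φ' 0 0 ψ' = blockMap (φ ∘ₗ φ') 0 0 (ψ ∘ₗ ψ') := by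
  refine LinearMap.ext fun v => withLp_ext ?_ ?_ <;> simp

theorem blockMap_id : blockMap (LinearMap.id : V₁ →ₗ[ℂ] V₁) 0 0 (LinearMap.id : V₂ →ₗ[ℂ] V₂) =
    LinearMap.id := by
  refine LinearMap.ext fun v => withLp_ext ?_ ?_ <;> simp

theorem smul_blockMap_diag (c : ℂ) (φ : V₁ →ₗ[ℂ] W₁) (ψ : V₂ →ₗ[ℂ] W₂) :
    c • blockMap φ 0 0 ψ = blockMap (c • φ) 0 0 (c • ψ) := by
  refine LinearMap.ext fun v => withLp_ext ?_ ?_ <;> simp [blockMap_apply]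

theorem blockMap_eq {φ φ' : V₁ →ₗ[ℂ] W₁} {ψ ψ' : V₂ →ₗ[ℂ] W₂} {v : WithLp 2 (V₁ × V₂)}
    (h1 : φ v.fst = φ' v.fst) (h2 : ψ v.snd = ψ' v.snd) :
    blockMap φ 0 0 ψ v = blockMap φ' 0 0 ψ' v := by
  simp [blockMap_apply, h1, h2]

theorem blockMap_bijective_diag {φ : V₁ →ₗ[ℂ] W₁} {ψ : V₂ →ₗ[ℂ] W₂} (hφ : Function.Bijective φ)
    (hψ : Function.Bijective ψ) : Function.Bijective (blockMap φ 0 0 ψ) := by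
  constructor
  · intro v w h
    have h1 := congrArg WithLp.fst h
    have h2 := congrArg WithLp.snd h
    simp only [blockMap_fst, blockMap_snd, LinearMap.zero_apply, add_zero, zero_add] at h1 h2
    exact withLp_ext (hφ.1 h1) (hψ.1 h2)
  · intro w
    obtain ⟨a, ha⟩ := hφ.2 w.fst
    obtain ⟨b, hb⟩ := hψ.2 w.snd
    exact ⟨WithLp.toLp 2 (a, b), withLp_ext (by simp [ha]) (by simp [hb])⟩

theorem blockMap_thom_bijective [FiniteDimensional ℂ V₁] {A e : V₁ →ₗ[ℂ] V₁}
    (he : ∀ v, e (e v) = v) (hA : ∀ v, A (e v) = -e (A v))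
    (hA' : ∀ v w, ⟪A v, w⟫_ℂ = ⟪v, A w⟫_ℂ) {z : ℂ} (hz : z ≠ 0 ∨ Function.Bijective A) :
    Function.Bijective (blockMap A (star z • e) (z • e) A) := by
  have key : ∀ a : V₁, A (A a) + ((‖z‖ ^ 2 : ℝ) : ℂ) • a = 0 → a = 0 := by
    intro a ha
    have h1 : ((‖A a‖ ^ 2 : ℝ) : ℂ) + ((‖z‖ ^ 2 * ‖a‖ ^ 2 : ℝ) : ℂ) = 0 := by
      have h2 := congrArg (fun v => ⟪a, v⟫_ℂ) ha
      simp only [inner_add_right, inner_smul_right, inner_zero_right] at h2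
      rw [← hA', inner_self_eq_norm_sq_to_K, inner_self_eq_norm_sq_to_K] at h2
      push_cast at h2 ⊢
      exact h2
    have h3 : ‖A a‖ ^ 2 + ‖z‖ ^ 2 * ‖a‖ ^ 2 = 0 := by exact_mod_cast h1
    rcases hz with hz | hz
    · have h4 : ‖z‖ ^ 2 * ‖a‖ ^ 2 = 0 := by nlinarith [sq_nonneg ‖A a‖, sq_nonneg (‖z‖ * ‖a‖)]
      have h5 : ‖z‖ ≠ 0 := norm_ne_zero_iff.2 hz
      have h6 : ‖a‖ ^ 2 = 0 := (mul_eq_zero.1 h4).resolve_left (pow_ne_zero 2 h5)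
      exact norm_eq_zero.1 (pow_eq_zero_iff two_ne_zero |>.1 h6)
    · have h4 : ‖A a‖ ^ 2 = 0 := by nlinarith [sq_nonneg ‖A a‖, sq_nonneg (‖z‖ * ‖a‖)]
      have h5 : A a = 0 := norm_eq_zero.1 (pow_eq_zero_iff two_ne_zero |>.1 h4)
      exact hz.1 (h5.trans (map_zero A).symm)
  have inj : Function.Injective (blockMap A (star z • e) (z • e) A) := by
    rw [← LinearMap.ker_eq_bot, LinearMap.ker_eq_bot']
    intro v hv
    have h1 := blockMap_thom he hA z v
    rw [hv, map_zero] at h1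
    have h2 := congrArg WithLp.fst h1
    have h3 := congrArg WithLp.snd h1
    exact withLp_ext (key _ h2.symm) (key _ h3.symm)
  have : FiniteDimensional ℂ (WithLp 2 (V₁ × V₁)) :=
    (WithLp.linearEquiv 2 ℂ (V₁ × V₁)).symm.finiteDimensional
  exact ⟨inj, LinearMap.injective_iff_surjective.1 inj⟩

end blockMap

/-- Block matrices of continuous families are continuous. -/
theorem ContinuousHomOn.blockMap {U U' : Set X} {E₁ E₂ : HermBundle X U} {F₁ F₂ : HermBundle X U'}
    {W : Set X} {a : ∀ x, E₁.Fib x →ₗ[ℂ] F₁.Fib x} {b : ∀ x, E₂.Fib x →ₗ[ℂ] F₁.Fib x}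
    {c : ∀ x, E₁.Fib x →ₗ[ℂ] F₂.Fib x} {d : ∀ x, E₂.Fib x →ₗ[ℂ] F₂.Fib x}
    (ha : ContinuousHomOn E₁ F₁ W a) (hb : ContinuousHomOn E₂ F₁ W b)
    (hc : ContinuousHomOn E₁ F₂ W c) (hd : ContinuousHomOn E₂ F₂ W d) :
    ContinuousHomOn (E₁.sum E₂) (F₁.sum F₂) W
      fun x => TwK.blockMap (a x) (b x) (c x) (d x) := by
  intro i j
  have hs : ∀ x ∈ W ∩ ((E₁.sum E₂).dom i ∩ (F₁.sum F₂).dom j),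
      x ∈ W ∧ (x ∈ E₁.dom i.1 ∧ x ∈ E₂.dom i.2) ∧ (x ∈ F₁.dom j.1 ∧ x ∈ F₂.dom j.2) :=
    fun x hx => hx
  rintro (k | k) (l | l)
  · refine ((ha i.1 j.1 k l).mono fun x hx => ?_).congr fun x _ => inner_blockMap_inl_inl _ _ _ _ _ _
    exact ⟨(hs x hx).1, (hs x hx).2.1.1, (hs x hx).2.2.1⟩
  · refine ((hc i.1 j.2 k l).mono fun x hx => ?_).congr fun x _ => inner_blockMap_inl_inr _ _ _ _ _ _
    exact ⟨(hs x hx).1, (hs x hx).2.1.1, (hs x hx).2.2.2⟩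
  · refine ((hb i.2 j.1 k l).mono fun x hx => ?_).congr fun x _ => inner_blockMap_inr_inl _ _ _ _ _ _
    exact ⟨(hs x hx).1, (hs x hx).2.1.2, (hs x hx).2.2.1⟩
  · refine ((hd i.2 j.2 k l).mono fun x hx => ?_).congr fun x _ => inner_blockMap_inr_inr _ _ _ _ _ _
    exact ⟨(hs x hx).1, (hs x hx).2.1.2, (hs x hx).2.2.2⟩

theorem ContinuousHomOn.zero {U U' : Set X} (E : HermBundle X U) (E' : HermBundle X U')
    (W : Set X) : ContinuousHomOn E E' W 0 := fun i j k l => by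
  simpa using continuousOn_const

theorem ContinuousHomOn.smul {U U' : Set X} {E : HermBundle X U} {E' : HermBundle X U'}
    {W : Set X} {A : ∀ x, E.Fib x →ₗ[ℂ] E'.Fib x} (hA : ContinuousHomOn E E' W A)
    (c : C(X, ℂ)) : ContinuousHomOn E E' W fun x => c x • A x := fun i j k l => by
  simp only [LinearMap.smul_apply, inner_smul_right]
  exact c.continuous.continuousOn.mul (hA i j k l)

/-- An object `(E, h)` of `HF(U)`: a Hermitian vector bundle `E` with a `ℤ/2`-grading, encoded by
the self-adjoint involution `ε` which is `1` on the even and `-1` on the odd part, and a Hermitian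
map `h : E → E` of degree `1`. -/
structure HFObj (X : Type u) [TopologicalSpace X] (U : Set X) extends HermBundle X U where
  ε : ∀ x, Fib x →ₗ[ℂ] Fib x
  h : ∀ x, Fib x →ₗ[ℂ] Fib x
  continuous_ε : ContinuousHomOn toHermBundle toHermBundle U ε
  continuous_h : ContinuousHomOn toHermBundle toHermBundle U h
  ε_symm : ∀ x ∈ U, ∀ v w, ⟪ε x v, w⟫_ℂ = ⟪v, ε x w⟫_ℂ
  ε_sq : ∀ x ∈ U, ∀ v, ε x (ε x v) = v
  h_symm : ∀ x ∈ U, ∀ v w, ⟪h x v, w⟫_ℂ = ⟪v, h x w⟫_ℂ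
  h_odd : ∀ x ∈ U, ∀ v, h x (ε x v) = -ε x (h x v)

namespace HFObj

variable {U : Set X}

/-- The space `(E, h)_{x, < μ}`: the sum of the eigenspaces of `h_x²` for eigenvalues `< μ`. -/
def low (E : HFObj X U) (x : X) (μ : ℝ) : Submodule ℂ (E.Fib x) :=
  lowSpace (E.h x) μ

/-- The pull-back of `(E, h)`. -/
def pullback (E : HFObj X U) (f : C(X', X)) : HFObj X' (f ⁻¹' U) where
  toHermBundle := E.toHermBundle.pullback f
  ε x := E.ε (f x)
  h x := E.h (f x)
  continuous_ε i j k l := (E.continuous_ε i j k l).comp f.continuous.continuousOn fun _ h => h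
  continuous_h i j k l := (E.continuous_h i j k l).comp f.continuous.continuousOn fun _ h => h
  ε_symm x hx := E.ε_symm (f x) hx
  ε_sq x hx := E.ε_sq (f x) hx
  h_symm x hx := E.h_symm (f x) hx
  h_odd x hx := E.h_odd (f x) hx

/-- The direct sum `(E ⊕ E', h ⊕ h')`. -/
def sum (E E' : HFObj X U) : HFObj X U where
  toHermBundle := E.toHermBundle.sum E'.toHermBundle
  ε x := blockMap (E.ε x) 0 0 (E'.ε x)
  h x := blockMap (E.h x) 0 0 (E'.h x)
  continuous_ε := .blockMap E.continuous_ε (.zero _ _ _) (.zero _ _ _) E'.continuous_ε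
  continuous_h := .blockMap E.continuous_h (.zero _ _ _) (.zero _ _ _) E'.continuous_h
  ε_symm x hx := blockMap_symm (E.ε_symm x hx) (E'.ε_symm x hx) (by simp) (by simp)
  ε_sq x hx := blockMap_sq (E.ε_sq x hx) (E'.ε_sq x hx)
  h_symm x hx := blockMap_symm (E.h_symm x hx) (E'.h_symm x hx) (by simp) (by simp)
  h_odd x hx := blockMap_odd (E.h_odd x hx) (by simp) (by simp) (E'.h_odd x hx)

/-- The graded tensor product of `(E, h)` with the trivial bundle `F = F⁰ ⊕ F¹`, `Fⁱ = ℂ`,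
equipped with `T = (0 conj z; z 0)`, for a complex-valued function `z`.
Under `E ⊗ F = E ⊗ F⁰ ⊕ E ⊗ F¹ = E ⊕ E`, the grading is `ε ⊗ ε_F = (ε 0; 0 -ε)` and the Hermitian
map is `h ⊗ 1 + ε ⊗ T = (h  conj z ε; z ε  h)`. -/
def thom (E : HFObj X U) (z : C(X, ℂ)) : HFObj X U where
  toHermBundle := E.toHermBundle.sum E.toHermBundle
  ε x := blockMap (E.ε x) 0 0 ((-1 : ℂ) • E.ε x)
  h x := blockMap (E.h x) (star z x • E.ε x) (z x • E.ε x) (E.h x)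
  continuous_ε := .blockMap E.continuous_ε (.zero _ _ _) (.zero _ _ _)
    (E.continuous_ε.smul (.const X (-1)))
  continuous_h := .blockMap E.continuous_h (E.continuous_ε.smul _) (E.continuous_ε.smul _)
    E.continuous_h
  ε_symm x hx := blockMap_symm (E.ε_symm x hx) (by simp [E.ε_symm x hx]) (by simp) (by simp)
  ε_sq x hx := blockMap_sq (E.ε_sq x hx) (by simp [E.ε_sq x hx])
  h_symm x hx := blockMap_symm (E.h_symm x hx) (E.h_symm x hx)
    (by simp [E.ε_symm x hx, mul_comm]) (by simp [E.ε_symm x hx, mul_comm])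
  h_odd x hx := blockMap_odd (E.h_odd x hx) (by simp) (by simp) (by simp [E.h_odd x hx])

theorem low_sum_le (E E' : HFObj X U) {x : X} {μ : ℝ} {v : WithLp 2 (E.Fib x × E'.Fib x)}
    (hv : v ∈ (E.sum E').low x μ) : v.fst ∈ E.low x μ ∧ v.snd ∈ E'.low x μ :=
  lowSpace_block (M := blockMap (E.h x) 0 0 (E'.h x)) le_rfl
    (fun _ => blockMap_blockMap_diag _ _ _) hv

theorem low_thom_le (E : HFObj X U) (z : C(X, ℂ)) {x : X} (hx : x ∈ U) {μ : ℝ}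
    {v : WithLp 2 (E.Fib x × E.Fib x)}
    (hv : v ∈ (E.thom z).low x μ) : v.fst ∈ E.low x μ ∧ v.snd ∈ E.low x μ :=
  lowSpace_block (M := blockMap (E.h x) (star (z x) • E.ε x) (z x • E.ε x) (E.h x))
    (sq_nonneg ‖z x‖) (fun v => blockMap_thom (E.ε_sq x hx) (E.h_odd x hx) (z x) v) hv

end HFObj

/-- A degree `0` bundle map over `W` commuting with the Hermitian maps. -/
def IsHFHom {U U' : Set X} (E : HFObj X U) (E' : HFObj X U') (W : Set X)
    (φ : ∀ x, E.Fib x →ₗ[ℂ] E'.Fib x) : Prop :=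
  ContinuousHomOn E.toHermBundle E'.toHermBundle W φ ∧
    (∀ x ∈ W, ∀ v, φ x (E.ε x v) = E'.ε x (φ x v)) ∧
    ∀ x ∈ W, ∀ v, φ x (E.h x v) = E'.h x (φ x v)

/-- The relation `φ ≑ φ'` over `W`, defining equality of morphisms in `HF(W)`: locally on `W`,
the two maps agree on the low eigenspaces of the square of the Hermitian map. -/
def LowEq {U U' : Set X} (E : HFObj X U) (E' : HFObj X U') (W : Set X)
    (φ φ' : ∀ x, E.Fib x →ₗ[ℂ] E'.Fib x) : Prop :=
  ∀ x ∈ W, ∃ μ > 0, ∃ V : Set X, IsOpen V ∧ x ∈ V ∧ V ⊆ W ∧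
    ∀ y ∈ V, ∀ v ∈ E.low y μ, φ y v = φ' y v

/-- Block diagonal maps between direct sums are morphisms. -/
theorem IsHFHom.sum {U U' : Set X} {E₁ E₂ : HFObj X U} {E₁' E₂' : HFObj X U'} {W : Set X}
    {φ : ∀ x, E₁.Fib x →ₗ[ℂ] E₁'.Fib x} {ψ : ∀ x, E₂.Fib x →ₗ[ℂ] E₂'.Fib x}
    (hφ : IsHFHom E₁ E₁' W φ) (hψ : IsHFHom E₂ E₂' W ψ) :
    IsHFHom (E₁.sum E₂) (E₁'.sum E₂') W fun x => blockMap (φ x) 0 0 (ψ x) :=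
  ⟨.blockMap hφ.1 (.zero _ _ _) (.zero _ _ _) hψ.1,
    fun x hx => blockMap_comm (hφ.2.1 x hx) (by simp) (by simp) (hψ.2.1 x hx),
    fun x hx => blockMap_comm (hφ.2.2 x hx) (by simp) (by simp) (hψ.2.2 x hx)⟩

theorem IsHFHom.thom {U U' : Set X} {E : HFObj X U} {E' : HFObj X U'} {W : Set X}
    {φ : ∀ x, E.Fib x →ₗ[ℂ] E'.Fib x} (hφ : IsHFHom E E' W φ) (z : C(X, ℂ)) :
    IsHFHom (E.thom z) (E'.thom z) W fun x => blockMap (φ x) 0 0 (φ x) :=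
  ⟨.blockMap hφ.1 (.zero _ _ _) (.zero _ _ _) hφ.1,
    fun x hx => blockMap_comm (hφ.2.1 x hx) (by simp) (by simp) (by simp [hφ.2.1 x hx]),
    fun x hx => blockMap_comm (hφ.2.2 x hx) (by simp [hφ.2.1 x hx]) (by simp [hφ.2.1 x hx])
      (hφ.2.2 x hx)⟩

theorem LowEq.sum {U U' : Set X} {E₁ E₂ : HFObj X U} {E₁' E₂' : HFObj X U'} {W : Set X}
    {φ φ' : ∀ x, E₁.Fib x →ₗ[ℂ] E₁'.Fib x} {ψ ψ' : ∀ x, E₂.Fib x →ₗ[ℂ] E₂'.Fib x}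
    (hφ : LowEq E₁ E₁' W φ φ') (hψ : LowEq E₂ E₂' W ψ ψ') :
    LowEq (E₁.sum E₂) (E₁'.sum E₂') W (fun x => blockMap (φ x) 0 0 (ψ x))
      fun x => blockMap (φ' x) 0 0 (ψ' x) := by
  intro x hx
  obtain ⟨μ, hμ, V, hV, hxV, hVW, h⟩ := hφ x hx
  obtain ⟨μ', hμ', V', hV', hxV', hVW', h'⟩ := hψ x hx
  refine ⟨min μ μ', lt_min hμ hμ', V ∩ V', hV.inter hV', ⟨hxV, hxV'⟩,
    inter_subset_left.trans hVW, fun y hy v hv => ?_⟩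
  have hv' := E₁.low_sum_le E₂ hv
  exact blockMap_eq (h y hy.1 _ (lowSpace_mono _ (min_le_left _ _) hv'.1))
    (h' y hy.2 _ (lowSpace_mono _ (min_le_right _ _) hv'.2))

theorem LowEq.thom {U U' : Set X} {E : HFObj X U} {E' : HFObj X U'} {W : Set X} (hWU : W ⊆ U)
    {φ φ' : ∀ x, E.Fib x →ₗ[ℂ] E'.Fib x}
    (hφ : LowEq E E' W φ φ') (z : C(X, ℂ)) :
    LowEq (E.thom z) (E'.thom z) W (fun x => blockMap (φ x) 0 0 (φ x))
      fun x => blockMap (φ' x) 0 0 (φ' x) := by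
  intro x hx
  obtain ⟨μ, hμ, V, hV, hxV, hVW, h⟩ := hφ x hx
  refine ⟨μ, hμ, V, hV, hxV, hVW, fun y hy v hv => ?_⟩
  have hv' := E.low_thom_le z (hWU (hVW hy)) hv
  exact blockMap_eq (h y hy _ hv'.1) (h y hy _ hv'.2)

theorem IsHFHom.pullback {U U' : Set X} {E : HFObj X U} {E' : HFObj X U'} {W : Set X}
    {φ : ∀ x, E.Fib x →ₗ[ℂ] E'.Fib x} (hφ : IsHFHom E E' W φ) (f : C(X', X)) :
    IsHFHom (E.pullback f) (E'.pullback f) (f ⁻¹' W) fun x => φ (f x) :=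
  ⟨fun i j k l => (hφ.1 i j k l).comp f.continuous.continuousOn fun _ h => h,
    fun x hx v => hφ.2.1 (f x) hx v, fun x hx v => hφ.2.2 (f x) hx v⟩

theorem LowEq.pullback {U U' : Set X} {E : HFObj X U} {E' : HFObj X U'} {W : Set X}
    {φ φ' : ∀ x, E.Fib x →ₗ[ℂ] E'.Fib x} (hφ : LowEq E E' W φ φ') (f : C(X', X)) :
    LowEq (E.pullback f) (E'.pullback f) (f ⁻¹' W) (fun x => φ (f x)) fun x => φ' (f x) := by
  intro x hx
  obtain ⟨μ, hμ, V, hV, hxV, hVW, h⟩ := hφ (f x) hx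
  exact ⟨μ, hμ, f ⁻¹' V, hV.preimage f.continuous, hxV, preimage_mono hVW,
    fun y hy v hv => h (f y) hy v hv⟩

end HF

/-! ### Twisted vectorial bundles -/

section KF

variable {H : Type w} [NormedAddCommGroup H] [InnerProductSpace ℂ H]
variable {X : Type u} [TopologicalSpace X] {X' : Type u} [TopologicalSpace X']

/-- Representatives `(g, φ)` of morphisms `(s, (E, h)) → (s', (E', h'))` in `HF_P`. -/
structure PreHom (H : Type w) [NormedAddCommGroup H] [InnerProductSpace ℂ H]
    {U U' : Set X} (E : HFObj X U) (E' : HFObj X U') where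
  g : X → UGroup H
  φ : ∀ x, E.Fib x →ₗ[ℂ] E'.Fib x

namespace PreHom

variable {U U' U'' : Set X} {E : HFObj X U} {E' : HFObj X U'} {E'' : HFObj X U''}

/-- The identity. -/
def id (E : HFObj X U) : PreHom H E E := ⟨fun _ => 1, fun _ => LinearMap.id⟩

/-- The composition. -/
def comp (Φ' : PreHom H E' E'') (Φ : PreHom H E E') : PreHom H E E'' :=
  ⟨fun x => Φ'.g x * Φ.g x, fun x => Φ'.φ x ∘ₗ Φ.φ x⟩

/-- `(g, φ)` represents a morphism `(s, (E, h)) → (s', (E', h'))` in `HF_P(W)`: `g : W → U(H)` is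
continuous with `s' π(g) = s`, and `φ` represents a morphism in `HF(W)`. -/
def IsMor (P : PrincipalBundle (PU H) X) (s s' : X → P.Total) (W : Set X)
    (Φ : PreHom H E E') : Prop :=
  ContinuousOn Φ.g W ∧ (∀ x ∈ W, P.act (s' x) (toPU H (Φ.g x)) = s x) ∧ IsHFHom E E' W Φ.φ

/-- Equality of morphisms in `HF_P(W)`: `(g, φ) ∼ (g' ζ, φ' ζ)` for a function `ζ : W → U(1)`,
where the maps of vector bundles are compared by `≑`. -/
def Rel (W : Set X) (Φ Φ' : PreHom H E E') : Prop :=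
  ∃ ζ : X → Circle, ContinuousOn ζ W ∧ (∀ x ∈ W, Φ.g x = Φ'.g x * scalar H (ζ x)) ∧
    LowEq E E' W Φ.φ fun x => (ζ x : ℂ) • Φ'.φ x

/-- The pull-back of a representative. -/
def pullback (Φ : PreHom H E E') (f : C(X', X)) : PreHom H (E.pullback f) (E'.pullback f) :=
  ⟨fun x => Φ.g (f x), fun x => Φ.φ (f x)⟩

theorem Rel.pullback {W : Set X} {Φ Φ' : PreHom H E E'} (h : Rel W Φ Φ') (f : C(X', X)) :
    Rel (f ⁻¹' W) (Φ.pullback f) (Φ'.pullback f) := by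
  obtain ⟨ζ, hζ, hg, hφ⟩ := h
  exact ⟨fun x => ζ (f x), hζ.comp f.continuous.continuousOn fun _ h => h,
    fun x hx => hg (f x) hx, hφ.pullback f⟩

theorem IsMor.pullback {P : PrincipalBundle (PU H) X} {P' : PrincipalBundle (PU H) X'}
    {f : C(X', X)} (F : P'.Hom P f) {s s' : X → P.Total} {t t' : X' → P'.Total} {W : Set X}
    {Φ : PreHom H E E'} (h : Φ.IsMor P s s' W)
    (ht : ∀ x, f x ∈ W → P'.proj (t x) = x ∧ F.toFun (t x) = s (f x))
    (ht' : ∀ x, f x ∈ W → P'.proj (t' x) = x ∧ F.toFun (t' x) = s' (f x)) :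
    (Φ.pullback f).IsMor P' t t' (f ⁻¹' W) := by
  refine ⟨h.1.comp f.continuous.continuousOn fun _ h => h, fun x hx => ?_, h.2.2.pullback f⟩
  apply F.injOn
  · rw [P'.proj_act, (ht x hx).1, (ht' x hx).1]
  · rw [F.map_act, (ht x hx).2, (ht' x hx).2]
    exact h.2.1 (f x) hx

end PreHom

/-- The part `(𝒰, s_α, g_αβ)` of the data of a `P`-twisted vectorial bundle which concerns `P`: an
open cover `𝒰 = {U_α}` of `X`, local sections `s_α : U_α → P` and lifts
`g_αβ : U_α ∩ U_β → U(H)` of the transition functions, `s_α π(g_αβ) = s_β`.  (Sections and lifts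
are extended arbitrarily outside of the open sets on which they are considered.) -/
structure TwistData (P : PrincipalBundle (PU H) X) where
  ι : Type u
  U : ι → Set X
  isOpen_U : ∀ α, IsOpen (U α)
  iUnion_U : ⋃ α, U α = univ
  s : ι → X → P.Total
  continuousOn_s : ∀ α, ContinuousOn (s α) (U α)
  proj_s : ∀ α, ∀ x ∈ U α, P.proj (s α x) = x
  g : ι → ι → X → UGroup H
  continuousOn_g : ∀ α β, ContinuousOn (g α β) (U α ∩ U β)
  act_g : ∀ α β, ∀ x ∈ U α ∩ U β, P.act (s α x) (toPU H (g α β x)) = s β x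

/-- The remaining data `((E_α, h_α), φ_αβ)` of a `P`-twisted vectorial bundle: objects of
`HF(U_α)`, and morphisms `Φ_αβ = (g_αβ, φ_αβ)` in `HF_P(U_α ∩ U_β)` with `Φ_αβ Φ_βα = 1` and
`Φ_αβ Φ_βγ = Φ_αγ`. -/
structure VBData {P : PrincipalBundle (PU H) X} (D : TwistData P) where
  E : ∀ α, HFObj X (D.U α)
  φ : ∀ α β x, (E β).Fib x →ₗ[ℂ] (E α).Fib x
  isHFHom : ∀ α β, IsHFHom (E β) (E α) (D.U α ∩ D.U β) (φ α β)
  inv : ∀ α β, PreHom.Rel (D.U α ∩ D.U β)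
    (PreHom.comp ⟨D.g α β, φ α β⟩ ⟨D.g β α, φ β α⟩) (PreHom.id (E α))
  cocycle : ∀ α β γ, PreHom.Rel (D.U α ∩ D.U β ∩ D.U γ)
    (PreHom.comp ⟨D.g α β, φ α β⟩ ⟨D.g β γ, φ β γ⟩) ⟨D.g α γ, φ α γ⟩

/-- A `P`-twisted vectorial bundle: an object of `KF_P(X)`. -/
structure TwistedVB (P : PrincipalBundle (PU H) X) where
  D : TwistData P
  V : VBData D

namespace TwistedVB

variable {P : PrincipalBundle (PU H) X} {P' : PrincipalBundle (PU H) X'}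

/-- The morphisms `Φ_αβ`. -/
def Φ (𝔼 : TwistedVB P) (α β : 𝔼.D.ι) : PreHom H (𝔼.V.E β) (𝔼.V.E α) :=
  ⟨𝔼.D.g α β, 𝔼.V.φ α β⟩

/-- A family `Ψ_αα'` represents a homomorphism `𝔼' → 𝔼` in `KF_P(X)`. -/
def IsHom (𝔼' 𝔼 : TwistedVB P)
    (Ψ : ∀ (α : 𝔼.D.ι) (α' : 𝔼'.D.ι), PreHom H (𝔼'.V.E α') (𝔼.V.E α)) : Prop :=
  (∀ α α', (Ψ α α').IsMor P (𝔼'.D.s α') (𝔼.D.s α) (𝔼.D.U α ∩ 𝔼'.D.U α')) ∧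
  (∀ α α' β', PreHom.Rel (𝔼.D.U α ∩ 𝔼'.D.U α' ∩ 𝔼'.D.U β')
    ((Ψ α α').comp (𝔼'.Φ α' β')) (Ψ α β')) ∧
  ∀ α β β', PreHom.Rel (𝔼.D.U α ∩ 𝔼.D.U β ∩ 𝔼'.D.U β')
    ((𝔼.Φ α β).comp (Ψ β β')) (Ψ α β')

/-- `Ψ ∘ Ψ'` is the identity of `𝔼`, for `Ψ' : 𝔼 → 𝔼'` and `Ψ : 𝔼' → 𝔼`: the identity of `𝔼` is
the homomorphism with the components `Φ_αβ`, and the components of the composition are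
determined by their restrictions `Ψ_αα' Ψ'_α'β` to the open sets `U_α ∩ U'_α' ∩ U_β`. -/
def IsLeftInverse (𝔼' 𝔼 : TwistedVB P)
    (Ψ : ∀ (α : 𝔼.D.ι) (α' : 𝔼'.D.ι), PreHom H (𝔼'.V.E α') (𝔼.V.E α))
    (Ψ' : ∀ (α' : 𝔼'.D.ι) (α : 𝔼.D.ι), PreHom H (𝔼.V.E α) (𝔼'.V.E α')) : Prop :=
  ∀ α α' β, PreHom.Rel (𝔼.D.U α ∩ 𝔼'.D.U α' ∩ 𝔼.D.U β)
    ((Ψ α α').comp (Ψ' α' β)) (𝔼.Φ α β)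

/-- Isomorphism of twisted vectorial bundles: existence of a homomorphism admitting an inverse. -/
def Iso (𝔼' 𝔼 : TwistedVB P) : Prop :=
  ∃ (Ψ : ∀ (α : 𝔼.D.ι) (α' : 𝔼'.D.ι), PreHom H (𝔼'.V.E α') (𝔼.V.E α))
    (Ψ' : ∀ (α' : 𝔼'.D.ι) (α : 𝔼.D.ι), PreHom H (𝔼.V.E α) (𝔼'.V.E α')),
    IsHom 𝔼' 𝔼 Ψ ∧ IsHom 𝔼 𝔼' Ψ' ∧ IsLeftInverse 𝔼' 𝔼 Ψ Ψ' ∧ IsLeftInverse 𝔼 𝔼' Ψ' Ψ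

/-- The support of a twisted vectorial bundle. -/
def supp (𝔼 : TwistedVB P) : Set X :=
  closure {x | ∃ α, x ∈ 𝔼.D.U α ∧ ¬ Function.Bijective ((𝔼.V.E α).h x)}

end TwistedVB

section pullback

variable {P : PrincipalBundle (PU H) X} {P' : PrincipalBundle (PU H) X'} {f : C(X', X)}

/-- The pull-back of `(𝒰, s_α, g_αβ)` along a bundle map `F : P' → P` covering `f`: the cover
`f⁻¹(U_α)`, the sections mapped to `s_α ∘ f` by `F`, and the lifts `g_αβ ∘ f`. -/
def TwistData.pullback (D : TwistData P) (F : P'.Hom P f) : TwistData P' where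
  ι := D.ι
  U α := f ⁻¹' D.U α
  isOpen_U α := (D.isOpen_U α).preimage f.continuous
  iUnion_U := by rw [← preimage_iUnion, D.iUnion_U, preimage_univ]
  s α := F.comapSection (D.s α)
  continuousOn_s α := F.continuousOn_comapSection _ (D.continuousOn_s α) (D.proj_s α)
  proj_s α x _ := F.proj_comapSection _ x
  g α β x := D.g α β (f x)
  continuousOn_g α β := (D.continuousOn_g α β).comp f.continuous.continuousOn fun _ h => h
  act_g α β x hx := by
    apply F.injOn
    · rw [P'.proj_act, F.proj_comapSection, F.proj_comapSection]
    · rw [F.map_act, F.toFun_comapSection _ (D.proj_s α _ hx.1),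
        F.toFun_comapSection _ (D.proj_s β _ hx.2)]
      exact D.act_g α β (f x) hx

/-- The pull-back of a twisted vectorial bundle along a bundle map covering `f`. -/
def TwistedVB.pullback (𝔼 : TwistedVB P) (F : P'.Hom P f) : TwistedVB P' where
  D := 𝔼.D.pullback F
  V :=
    { E := fun α => (𝔼.V.E α).pullback f
      φ := fun α β x => 𝔼.V.φ α β (f x)
      isHFHom := fun α β => (𝔼.V.isHFHom α β).pullback f
      inv := fun α β => (𝔼.V.inv α β).pullback f
      cocycle := fun α β γ => (𝔼.V.cocycle α β γ).pullback f }

theorem TwistedVB.supp_pullback_subset (𝔼 : TwistedVB P) (F : P'.Hom P f) :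
    (𝔼.pullback F).supp ⊆ f ⁻¹' 𝔼.supp :=
  closure_minimal (fun _ hx => subset_closure hx) (isClosed_closure.preimage f.continuous)

end pullback

section sum

namespace PreHom

theorem Rel.congr {U U' : Set X} {E : HFObj X U} {E' : HFObj X U'} {W : Set X}
    {Φ Φ' Ψ Ψ' : PreHom H E E'} (h : Rel W Φ Φ') (h1 : Ψ = Φ) (h2 : Ψ' = Φ') : Rel W Ψ Ψ' := by
  rw [h1, h2]; exact h

theorem Rel.sum [Nontrivial H] {U U' : Set X} {E₁ E₂ : HFObj X U} {E₁' E₂' : HFObj X U'}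
    {W : Set X} {g g' : X → UGroup H} {φ φ' : ∀ x, E₁.Fib x →ₗ[ℂ] E₁'.Fib x}
    {ψ ψ' : ∀ x, E₂.Fib x →ₗ[ℂ] E₂'.Fib x}
    (h : Rel W (⟨g, φ⟩ : PreHom H E₁ E₁') ⟨g', φ'⟩)
    (h' : Rel W (⟨g, ψ⟩ : PreHom H E₂ E₂') ⟨g', ψ'⟩) :
    Rel W (⟨g, fun x => blockMap (φ x) 0 0 (ψ x)⟩ : PreHom H (E₁.sum E₂) (E₁'.sum E₂'))
      ⟨g', fun x => blockMap (φ' x) 0 0 (ψ' x)⟩ := by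
  obtain ⟨ζ, hζ, hg, hφ⟩ := h
  obtain ⟨ζ', hζ', hg', hψ⟩ := h'
  have heq : ∀ x ∈ W, ζ' x = ζ x := fun x hx => scalar_injective H
    (mul_left_cancel ((hg' x hx).symm.trans (hg x hx)))
  have hψ' : LowEq E₂ E₂' W ψ fun x => (ζ x : ℂ) • ψ' x := by
    intro x hx
    obtain ⟨μ, hμ, V, hV, hxV, hVW, h⟩ := hψ x hx
    refine ⟨μ, hμ, V, hV, hxV, hVW, fun y hy v hv => ?_⟩
    have h1 : ψ y v = (ζ' y : ℂ) • ψ' y v := h y hy v hv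
    rw [heq y (hVW hy)] at h1
    exact h1
  refine ⟨ζ, hζ, hg, fun x hx => ?_⟩
  obtain ⟨μ, hμ, V, hV, hxV, hVW, h⟩ := hφ.sum hψ' x hx
  exact ⟨μ, hμ, V, hV, hxV, hVW, fun y hy v hv => (h y hy v hv).trans
    (congrArg (fun A => A v) (smul_blockMap_diag (ζ y : ℂ) (φ' y) (ψ' y)).symm)⟩

theorem Rel.thom {U U' : Set X} {E : HFObj X U} {E' : HFObj X U'} {W : Set X} (hWU : W ⊆ U)
    {g g' : X → UGroup H} {φ φ' : ∀ x, E.Fib x →ₗ[ℂ] E'.Fib x}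
    (h : Rel W (⟨g, φ⟩ : PreHom H E E') ⟨g', φ'⟩) (z : C(X, ℂ)) :
    Rel W (⟨g, fun x => blockMap (φ x) 0 0 (φ x)⟩ : PreHom H (E.thom z) (E'.thom z))
      ⟨g', fun x => blockMap (φ' x) 0 0 (φ' x)⟩ := by
  obtain ⟨ζ, hζ, hg, hφ⟩ := h
  refine ⟨ζ, hζ, hg, fun x hx => ?_⟩
  obtain ⟨μ, hμ, V, hV, hxV, hVW, h⟩ := hφ.thom hWU z x hx
  exact ⟨μ, hμ, V, hV, hxV, hVW, fun y hy v hv => (h y hy v hv).trans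
    (congrArg (fun A => A v) (smul_blockMap_diag (ζ y : ℂ) (φ' y) (φ' y)).symm)⟩

end PreHom

variable {P : PrincipalBundle (PU H) X}

/-- The direct sum of two twisted vectorial bundles with the same `(𝒰, s_α, g_αβ)`. -/
def VBData.sum [Nontrivial H] {D : TwistData P} (V V' : VBData D) : VBData D where
  E α := (V.E α).sum (V'.E α)
  φ α β x := blockMap (V.φ α β x) 0 0 (V'.φ α β x)
  isHFHom α β := (V.isHFHom α β).sum (V'.isHFHom α β)
  inv α β := ((V.inv α β).sum (V'.inv α β)).congr
    (congrArg (PreHom.mk _) (funext fun _ => blockMap_comp_diag _ _ _ _))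
    (congrArg (PreHom.mk _) (funext fun _ => blockMap_id.symm))
  cocycle α β γ := ((V.cocycle α β γ).sum (V'.cocycle α β γ)).congr
    (congrArg (PreHom.mk _) (funext fun _ => blockMap_comp_diag _ _ _ _)) rfl

/-- The product of a twisted vectorial bundle with `(F, T)`, `T = (0 conj z; z 0)`, where `z` is
a complex-valued function on the base. -/
def VBData.thom {D : TwistData P} (V : VBData D) (z : C(X, ℂ)) : VBData D where
  E α := (V.E α).thom z
  φ α β x := blockMap (V.φ α β x) 0 0 (V.φ α β x)
  isHFHom α β := (V.isHFHom α β).thom z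
  inv α β := ((V.inv α β).thom (fun _ hx => hx.1) z).congr
    (congrArg (PreHom.mk _) (funext fun _ => blockMap_comp_diag _ _ _ _))
    (congrArg (PreHom.mk _) (funext fun _ => blockMap_id.symm))
  cocycle α β γ := ((V.cocycle α β γ).thom (fun _ hx => hx.2) z).congr
    (congrArg (PreHom.mk _) (funext fun _ => blockMap_comp_diag _ _ _ _)) rfl

theorem TwistedVB.supp_sum_subset [Nontrivial H] {D : TwistData P} (V V' : VBData D) :
    (⟨D, V.sum V'⟩ : TwistedVB P).supp ⊆
      (⟨D, V⟩ : TwistedVB P).supp ∪ (⟨D, V'⟩ : TwistedVB P).supp := by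
  refine closure_minimal ?_ (isClosed_closure.union isClosed_closure)
  rintro x ⟨α, hα, hx⟩
  by_contra hcon
  have h1 : Function.Bijective ((V.E α).h x) := by
    by_contra h
    exact hcon (Or.inl (subset_closure ⟨α, hα, h⟩))
  have h2 : Function.Bijective ((V'.E α).h x) := by
    by_contra h
    exact hcon (Or.inr (subset_closure ⟨α, hα, h⟩))
  exact hx (blockMap_bijective_diag h1 h2)

/-- `β(𝔼)` is invertible away from `{z = 0}` and away from the support of `𝔼`. -/
theorem TwistedVB.supp_thom_subset {D : TwistData P} (V : VBData D) (z : C(X, ℂ)) :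
    (⟨D, V.thom z⟩ : TwistedVB P).supp ⊆ (⟨D, V⟩ : TwistedVB P).supp ∩ {x | z x = 0} := by
  refine closure_minimal ?_
    (isClosed_closure.inter (isClosed_singleton.preimage z.continuous))
  rintro x ⟨α, hα, hx⟩
  have hfin := (V.E α).finiteDimensional_fib hα
  have key : ∀ h : z x ≠ 0 ∨ Function.Bijective ((V.E α).h x), False := fun h =>
    hx (blockMap_thom_bijective ((V.E α).ε_sq x hα) ((V.E α).h_odd x hα)
      ((V.E α).h_symm x hα) h)
  exact ⟨subset_closure ⟨α, hα, fun h => key (Or.inr h)⟩,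
    by_contra fun h => key (Or.inl h)⟩

end sum

/-! ### The groups `KF` -/

variable {P : PrincipalBundle (PU H) X} {P' : PrincipalBundle (PU H) X'} {f : C(X', X)}

/-- An object of `KF_P(X, Y)`: a twisted vectorial bundle whose support does not meet `Y`. -/
structure RelVB (P : PrincipalBundle (PU H) X) (Y : Set X) where
  𝔼 : TwistedVB P
  disjoint : Disjoint 𝔼.supp Y

/-- The direct sum of two objects of `KF_P(X, Y)` with the same `(𝒰, s_α, g_αβ)`. -/
def RelVB.sum [Nontrivial H] {Y : Set X} {D : TwistData P} (V V' : VBData D)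
    (hV : Disjoint (⟨D, V⟩ : TwistedVB P).supp Y)
    (hV' : Disjoint (⟨D, V'⟩ : TwistedVB P).supp Y) : RelVB P Y where
  𝔼 := ⟨D, V.sum V'⟩
  disjoint := (hV.union_left hV').mono_left (TwistedVB.supp_sum_subset V V')

/-- The pull-back `KF_P(X, Y) → KF_P'(X', Y')` of objects. -/
def RelVB.pullback {Y : Set X} {Y' : Set X'} (𝔼 : RelVB P Y) (F : P'.Hom P f)
    (hf : MapsTo f Y' Y) : RelVB P' Y' where
  𝔼 := 𝔼.𝔼.pullback F
  disjoint := by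
    refine Disjoint.mono_left (𝔼.𝔼.supp_pullback_subset F) ?_
    exact (𝔼.disjoint.preimage f).mono_right hf

/-- Homotopy of objects of `KF_P(X, Y)`: there is an object of `KF_{P × I}(X × I, Y × I)` whose
restrictions to `X × {i}` are isomorphic to the given objects, `i = 0, 1`. -/
def RelVB.Homotopic {Y : Set X} (𝔼₀ 𝔼₁ : RelVB P Y) : Prop :=
  ∃ 𝔽 : RelVB (P.prod I) (Y ×ˢ (univ : Set I)),
    (𝔽.𝔼.pullback (P.slice 0)).Iso 𝔼₀.𝔼 ∧ (𝔽.𝔼.pullback (P.slice 1)).Iso 𝔼₁.𝔼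

/-- `KF_P(X, Y)`: the homotopy classes of objects of `KF_P(X, Y)` (the quotient by the equivalence
relation generated by homotopy). -/
def KF (P : PrincipalBundle (PU H) X) (Y : Set X) := Quot (RelVB.Homotopic (P := P) (Y := Y))

/-- The homotopy class of an object. -/
def KF.mk {Y : Set X} (𝔼 : RelVB P Y) : KF P Y := Quot.mk _ 𝔼

/-- Pull-backs respect homotopies. -/
theorem RelVB.Homotopic.pullback {Y : Set X} {Y' : Set X'} (F : P'.Hom P f)
    (hf : MapsTo f Y' Y) {𝔼₀ 𝔼₁ : RelVB P Y} (h : Homotopic 𝔼₀ 𝔼₁) :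
    Homotopic (𝔼₀.pullback F hf) (𝔼₁.pullback F hf) := by
  obtain ⟨𝔽, h0, h1⟩ := h
  have key : ∀ (t : I) (𝔼 : RelVB P Y), (𝔽.𝔼.pullback (P.slice t)).Iso 𝔼.𝔼 →
      ((𝔽.𝔼.pullback (F.prodMap I)).pullback (P'.slice t)).Iso (𝔼.𝔼.pullback F) := by
    rintro t 𝔼 ⟨Ψ, Ψ', hΨ, hΨ', hl, hr⟩
    have hs : ∀ α x, f x ∈ 𝔼.𝔼.D.U α →
        P'.proj ((𝔼.𝔼.pullback F).D.s α x) = x ∧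
        F.toFun ((𝔼.𝔼.pullback F).D.s α x) = 𝔼.𝔼.D.s α (f x) := fun α x hx =>
      ⟨F.proj_comapSection _ x, F.toFun_comapSection _ (𝔼.𝔼.D.proj_s α _ hx)⟩
    have hs' : ∀ α x, (f x, t) ∈ 𝔽.𝔼.D.U α →
        P'.proj (((𝔽.𝔼.pullback (F.prodMap I)).pullback (P'.slice t)).D.s α x) = x ∧
        F.toFun (((𝔽.𝔼.pullback (F.prodMap I)).pullback (P'.slice t)).D.s α x) =
          (𝔽.𝔼.pullback (P.slice t)).D.s α (f x) := fun α x hx => by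
      refine ⟨PrincipalBundle.Hom.proj_comapSection _ _ x, ?_⟩
      refine PrincipalBundle.Hom.eq_comapSection _ _ ?_ ?_
      · rw [F.proj_toFun]
        exact congrArg f (PrincipalBundle.Hom.proj_comapSection _ _ x)
      · have h1 := (P'.slice t).toFun_comapSection
          ((𝔽.𝔼.pullback (F.prodMap I)).D.s α) (x := x)
          (PrincipalBundle.Hom.proj_comapSection _ _ _)
        have h2 := (F.prodMap I).toFun_comapSection (𝔽.𝔼.D.s α) (x := (x, t))
          (𝔽.𝔼.D.proj_s α _ hx)
        refine Eq.trans ?_ ((congrArg (F.prodMap I).toFun h1).trans h2)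
        exact Subtype.ext (Prod.ext (Prod.ext (F.proj_toFun _) rfl) rfl)
    refine ⟨fun α α' => (Ψ α α').pullback f, fun α α' => (Ψ' α α').pullback f,
      ⟨fun α α' => ?_, fun α α' β' => (hΨ.2.1 α α' β').pullback f,
        fun α β β' => (hΨ.2.2 α β β').pullback f⟩,
      ⟨fun α α' => ?_, fun α α' β' => (hΨ'.2.1 α α' β').pullback f,
        fun α β β' => (hΨ'.2.2 α β β').pullback f⟩,
      fun α α' β => (hl α α' β).pullback f, fun α α' β => (hr α α' β).pullback f⟩
    · exact (hΨ.1 α α').pullback F (fun x hx => hs' α' x hx.2) (fun x hx => hs α x hx.1)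
    · exact (hΨ'.1 α α').pullback F (fun x hx => hs α' x hx.2) (fun x hx => hs' α x hx.1)
  exact ⟨𝔽.pullback (F.prodMap I) fun x hx => ⟨hf hx.1, trivial⟩, key 0 _ h0, key 1 _ h1⟩

/-- The map `KF_P(X, Y) → KF_P'(X', Y')` induced by a bundle map `P' → P` covering
`f : (X', Y') → (X, Y)`. -/
def KF.map {Y : Set X} {Y' : Set X'} (F : P'.Hom P f) (hf : MapsTo f Y' Y) :
    KF P Y → KF P' Y' :=
  Quot.map (fun 𝔼 => 𝔼.pullback F hf) fun _ _ h => h.pullback F hf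

end KF

/-! ### CW pairs with `PU(H)`-bundles -/

section CW

open Topology.RelCWComplex

variable {Z : Type u} [TopologicalSpace Z]

theorem exists_openCell [T2Space Z] {X : Set Z} [Topology.CWComplex X] {x : Z} (hx : x ∈ X) :
    ∃ n, ∃ i : cell X n, x ∈ openCell n i := by
  rw [← union_iUnion_openCell_eq_complex (C := X)] at hx
  simpa using hx

variable [T2Space Z] {X : Set Z} [Topology.CWComplex X]

theorem mem_subcomplex_iff (A : Subcomplex X) {n : ℕ} {i : cell X n} {x : Z}
    (hx : x ∈ openCell n i) : x ∈ A ↔ i ∈ A.I n :=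
  ⟨fun h => by_contra fun hi => disjoint_left.1
    (Subcomplex.disjoint_openCell_subcomplex_of_not_mem A hi) hx h,
    fun h => Subcomplex.openCell_subset_of_mem A h hx⟩

/-- The empty subcomplex. -/
def subBot (X : Set Z) [Topology.CWComplex X] : Subcomplex X :=
  .mk ∅ (fun _ => ∅) isClosed_empty <| by simp

/-- The intersection of two subcomplexes. -/
def subInf (A B : Subcomplex X) : Subcomplex X :=
  .mk (A ∩ B) (fun n => A.I n ∩ B.I n) (A.closed'.inter B.closed') <| by
    ext x
    simp only [empty_union, mem_iUnion, Subtype.exists, exists_prop, mem_inter_iff]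
    constructor
    · rintro ⟨n, i, hi, hx⟩
      exact ⟨(mem_subcomplex_iff A hx).2 hi.1, (mem_subcomplex_iff B hx).2 hi.2⟩
    · rintro ⟨hA, hB⟩
      obtain ⟨n, i, hx⟩ := exists_openCell (Subcomplex.subset_complex A hA)
      exact ⟨n, i, ⟨(mem_subcomplex_iff A hx).1 hA, (mem_subcomplex_iff B hx).1 hB⟩, hx⟩

/-- The union of two subcomplexes. -/
def subSup (A B : Subcomplex X) : Subcomplex X :=
  .mk (A ∪ B) (fun n => A.I n ∪ B.I n) (A.closed'.union B.closed') <| by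
    ext x
    simp only [empty_union, mem_iUnion, Subtype.exists, exists_prop, mem_union]
    constructor
    · rintro ⟨n, i, hi, hx⟩
      exact hi.imp (mem_subcomplex_iff A hx).2 (mem_subcomplex_iff B hx).2
    · intro h
      obtain ⟨n, i, hx⟩ := exists_openCell (X := X)
        (h.elim (fun h => Subcomplex.subset_complex A h) fun h => Subcomplex.subset_complex B h)
      exact ⟨n, i, h.imp (mem_subcomplex_iff A hx).1 (mem_subcomplex_iff B hx).1, hx⟩

/-- A subcomplex `B ⊆ A` of `X` as a subcomplex of `A`. -/
def subOf (A B : Subcomplex X) (h : (B : Set Z) ⊆ A) : Subcomplex (A : Set Z) :=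
  .mk B (fun n => {i | i.1 ∈ B.I n}) B.closed' <| by
    ext x
    simp only [empty_union, mem_iUnion]
    constructor
    · rintro ⟨n, ⟨i, hi⟩, hx⟩
      exact (mem_subcomplex_iff B (i := i.1) hx).2 hi
    · intro hB
      obtain ⟨n, i, hx⟩ := exists_openCell (Subcomplex.subset_complex B hB)
      exact ⟨n, ⟨⟨i, (mem_subcomplex_iff A hx).1 (h hB)⟩, (mem_subcomplex_iff B hx).1 hB⟩, hx⟩

end CW

/-- The inclusion of a subset into a bigger one. -/
def inclMap {Z : Type u} [TopologicalSpace Z] {A B : Set Z} (h : A ⊆ B) : C(A, B) :=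
  ⟨inclusion h, continuous_inclusion h⟩

/-- An object `(X, Y; P)` of the category `Ĉ`: a CW complex `X` (realized as a subset of a Hausdorff
space), a subcomplex `Y` of `X` and a principal `PU(H)`-bundle `P → X`. -/
structure CWTriple (H : Type w) [NormedAddCommGroup H] [InnerProductSpace ℂ H] where
  Z : Type u
  [top : TopologicalSpace Z]
  [t2 : T2Space Z]
  X : Set Z
  [cw : Topology.CWComplex X]
  Y : Topology.CWComplex.Subcomplex X
  P : PrincipalBundle (PU H) X

attribute [instance] CWTriple.top CWTriple.t2 CWTriple.cw

namespace CWTriple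

variable {H : Type w} [NormedAddCommGroup H] [InnerProductSpace ℂ H]

/-- `Y` as a subset of the space `X`. -/
def YX (T : CWTriple.{u} H) : Set T.X := {x | (x : T.Z) ∈ T.Y}

/-- A morphism `(f, F) : (X', Y'; P') → (X, Y; P)` of `Ĉ`. -/
structure Hom (T' T : CWTriple.{u} H) where
  f : C(T'.X, T.X)
  mapsTo : MapsTo f T'.YX T.YX
  F : T'.P.Hom T.P f

/-- The identity. -/
def Hom.id (T : CWTriple.{u} H) : Hom T T :=
  ⟨ContinuousMap.id T.X, fun _ h => h, .id T.P⟩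

/-- The composition of morphisms. -/
def Hom.comp {T'' T' T : CWTriple.{u} H} (φ : Hom T' T) (ψ : Hom T'' T') : Hom T'' T :=
  ⟨φ.f.comp ψ.f, φ.mapsTo.comp ψ.mapsTo, φ.F.comp ψ.F⟩

/-- Homotopy of morphisms of `Ĉ`: existence of a morphism
`(X' × I, Y' × I; P' × I) → (X, Y; P)` restricting to the given ones at the ends. -/
def Hom.Homotopic {T' T : CWTriple.{u} H} (φ₀ φ₁ : Hom T' T) : Prop :=
  ∃ (h : C(T'.X × I, T.X)) (K : (T'.P.prod I).Hom T.P h), MapsTo h (T'.YX ×ˢ univ) T.YX ∧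
    (∀ x, h (x, 0) = φ₀.f x) ∧ (∀ x, h (x, 1) = φ₁.f x) ∧
    (∀ p, K.toFun ((T'.P.slice 0).toFun p) = φ₀.F.toFun p) ∧
    ∀ p, K.toFun ((T'.P.slice 1).toFun p) = φ₁.F.toFun p

/-- The pair `(A, B; P|_A)` for subcomplexes `B ⊆ A` of `X`. -/
def restrict (T : CWTriple.{u} H) (A B : Topology.CWComplex.Subcomplex T.X)
    (h : (B : Set T.Z) ⊆ A) : CWTriple.{u} H where
  Z := T.Z
  X := A
  Y := subOf A B h
  P := T.P.pullback (inclMap (Topology.CWComplex.Subcomplex.subset_complex A))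

/-- The object `(X, ∅; P)`. -/
def abs (T : CWTriple.{u} H) : CWTriple.{u} H where
  Z := T.Z
  X := T.X
  Y := subBot T.X
  P := T.P

/-- The object `(Y, ∅; P|_Y)`. -/
def sub (T : CWTriple.{u} H) : CWTriple.{u} H := T.restrict T.Y (subBot T.X) (empty_subset _)

/-- The inclusion `(A, B; P|_A) → (X, Y; P)` for subcomplexes `B ⊆ A` of `X` with `B ⊆ Y`. -/
def restrictHom (T : CWTriple.{u} H) (A B : Topology.CWComplex.Subcomplex T.X)
    (h : (B : Set T.Z) ⊆ A) (hB : (B : Set T.Z) ⊆ T.Y) : (T.restrict A B h).Hom T where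
  f := inclMap (Topology.CWComplex.Subcomplex.subset_complex A)
  mapsTo _ hx := hB hx
  F := T.P.pullbackHom _

/-- The inclusion `(A, B; P|_A) → (A', B'; P|_A')` for `A ⊆ A'` and `B ⊆ B'`. -/
def restrictMap (T : CWTriple.{u} H) (A B A' B' : Topology.CWComplex.Subcomplex T.X)
    (h : (B : Set T.Z) ⊆ A) (h' : (B' : Set T.Z) ⊆ A') (hA : (A : Set T.Z) ⊆ A')
    (hB : (B : Set T.Z) ⊆ B') : (T.restrict A B h).Hom (T.restrict A' B' h') where
  f := inclMap hA
  mapsTo _ hx := hB hx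
  F := (PrincipalBundle.Hom.id T.P).pullbackMap _ _ (inclMap hA) fun _ => rfl

/-- The inclusion `(A, A ∩ B; P|_A) → (A ∪ B, B; P|_{A ∪ B})`. -/
def excisionHom (T : CWTriple.{u} H) (A B : Topology.CWComplex.Subcomplex T.X) :
    (T.restrict A (subInf A B) inter_subset_left).Hom
      (T.restrict (subSup A B) B subset_union_right) :=
  T.restrictMap _ _ _ _ _ _ subset_union_left inter_subset_right

/-- The inclusion `(X, ∅; P) → (X, Y; P)`. -/
def absHom (T : CWTriple.{u} H) : T.abs.Hom T where
  f := (ContinuousMap.id T.X : C(T.X, T.X))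
  mapsTo _ hx := hx.elim
  F := .id T.P

/-- The inclusion `(Y, ∅; P|_Y) → (X, ∅; P)`. -/
def subHom (T : CWTriple.{u} H) : T.sub.Hom T.abs :=
  T.abs.restrictHom T.Y (subBot T.X) (empty_subset _) (empty_subset _)

/-- The restriction `Y' → Y` of a morphism. -/
def Hom.subMap {T' T : CWTriple.{u} H} (φ : Hom T' T) :
    C((T'.Y : Set T'.Z), (T.Y : Set T.Z)) :=
  ⟨fun y => ⟨(φ.f ⟨y.1, Topology.CWComplex.Subcomplex.subset_complex T'.Y y.2⟩).1,
    φ.mapsTo y.2⟩, by fun_prop⟩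

/-- The morphism `(Y', ∅; P'|_Y') → (Y, ∅; P|_Y)` induced by a morphism. -/
def Hom.sub {T' T : CWTriple.{u} H} (φ : Hom T' T) : T'.sub.Hom T.sub where
  f := φ.subMap
  mapsTo _ hx := hx.elim
  F := φ.F.pullbackMap _ _ _ fun _ => rfl

/-- The morphism `(X', ∅; P') → (X, ∅; P)` induced by a morphism. -/
def Hom.abs {T' T : CWTriple.{u} H} (φ : Hom T' T) : T'.abs.Hom T.abs where
  f := φ.f
  mapsTo _ hx := hx.elim
  F := φ.F

/-! ### The groups `KF^{-k}` -/

/-- The subset `Y × I^k ∪ X × ∂I^k` of `X × I^k`. -/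
def relSet (T : CWTriple.{u} H) (k : ℕ) : Set (T.X × (Fin k → I)) :=
  T.YX ×ˢ univ ∪ univ ×ˢ Cube.boundary (Fin k)

/-- `KF_P^{-k}(X, Y) = KF_{P × I^k}(X × I^k, Y × I^k ∪ X × ∂I^k)`, for `k ≥ 0`. -/
def KF (T : CWTriple.{u} H) (k : ℕ) := TwK.KF (T.P.prod (Fin k → I)) (T.relSet k)

/-- The class of an object in `KF_P^{-k}(X, Y)`. -/
def cls (T : CWTriple.{u} H) (k : ℕ) (𝔼 : RelVB (T.P.prod (Fin k → I)) (T.relSet k)) : T.KF k :=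
  KF.mk 𝔼

/-- `KF_P^1(X, Y) = KF_P^{-1}(X, Y)`. -/
abbrev KFone (T : CWTriple.{u} H) := T.KF 1

theorem Hom.mapsTo_relSet {T' T : CWTriple.{u} H} (φ : Hom T' T) (k : ℕ) :
    MapsTo (φ.f.prodMap (ContinuousMap.id (Fin k → I))) (T'.relSet k) (T.relSet k) :=
  fun _ hx => hx.imp (fun h => ⟨φ.mapsTo h.1, trivial⟩) fun h => ⟨trivial, h.2⟩

/-- The map `(f, F)^* : KF_P^{-k}(X, Y) → KF_P'^{-k}(X', Y')`. -/
def Hom.map {T' T : CWTriple.{u} H} (φ : Hom T' T) (k : ℕ) : T.KF k → T'.KF k :=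
  KF.map (φ.F.prodMap (Fin k → I)) (φ.mapsTo_relSet k)

/-! ### The construction of the connecting homomorphism -/

/-- The first coordinates of a point of the cube `I^{k+1} = I^k × I`. -/
def initial {k : ℕ} (t : Fin (k + 1) → I) : Fin k → I := fun i => t i.castSucc

/-- `𝒳 = X × I^k × {0} ∪ (Y × I^k ∪ X × ∂I^k) × I`, as a subset of `X × I^{k+1}`. -/
def bigX (T : CWTriple.{u} H) (k : ℕ) : Set (T.X × (Fin (k + 1) → I)) :=
  {q | q.2 (Fin.last k) = 0 ∨ (q.1, initial q.2) ∈ T.relSet k}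

/-- The bundle `(P × I^{k+1})|_𝒳`. -/
def bigP (T : CWTriple.{u} H) (k : ℕ) : PrincipalBundle (PU H) (T.bigX k) :=
  (T.P.prod (Fin (k + 1) → I)).pullback ⟨Subtype.val, continuous_subtype_val⟩

/-- `𝒵 = Y × I^k × {1} ∪ X × ∂I^k × I`, as a subset of `𝒳`. -/
def bigZ (T : CWTriple.{u} H) (k : ℕ) : Set (T.bigX k) :=
  {q | (q.1.1 ∈ T.YX ∧ q.1.2 (Fin.last k) = 1) ∨ initial q.1.2 ∈ Cube.boundary (Fin k)}

/-- `X × I^k × {0} ∪ 𝒵`, as a subset of `𝒳`. -/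
def bigZ₀ (T : CWTriple.{u} H) (k : ℕ) : Set (T.bigX k) :=
  {q | q.1.2 (Fin.last k) = 0} ∪ T.bigZ k

/-- The map `KF(𝒳, X × I^k × {0} ∪ 𝒵) → KF(𝒳, 𝒵)` induced by the inclusion. -/
def bigIncl (T : CWTriple.{u} H) (k : ℕ) :
    TwK.KF (T.bigP k) (T.bigZ₀ k) → TwK.KF (T.bigP k) (T.bigZ k) :=
  KF.map (PrincipalBundle.Hom.id _) fun _ hx => Or.inr hx

/-- The inclusion `Y × I^{k+1} → 𝒳`. -/
def bigSubMap (T : CWTriple.{u} H) (k : ℕ) : C(T.sub.X × (Fin (k + 1) → I), T.bigX k) :=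
  ⟨fun q => ⟨(T.subHom.f q.1, q.2), Or.inr (Or.inl ⟨q.1.2, trivial⟩)⟩, by
    refine Continuous.subtype_mk ?_ _
    exact (T.subHom.f.continuous.comp continuous_fst).prodMk continuous_snd⟩

theorem mapsTo_bigSubMap (T : CWTriple.{u} H) (k : ℕ) :
    MapsTo (T.bigSubMap k) (T.sub.relSet (k + 1)) (T.bigZ₀ k) := by
  rintro q (hq | ⟨-, i, hi⟩)
  · exact hq.1.elim
  · induction i using Fin.lastCases with
    | last => exact hi.imp (fun h => h) fun h => Or.inl ⟨q.1.2, h⟩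
    | cast i => exact Or.inr (Or.inr ⟨i, hi⟩)

/-- The restriction map `KF(𝒳, X × I^k × {0} ∪ 𝒵) → KF_{P|_Y}^{-k-1}(Y)`. -/
def bigRes (T : CWTriple.{u} H) (k : ℕ) :
    TwK.KF (T.bigP k) (T.bigZ₀ k) → T.sub.KF (k + 1) :=
  KF.map ((T.subHom.F.prodMap (Fin (k + 1) → I)).lift _ (T.bigSubMap k) fun _ => rfl)
    (T.mapsTo_bigSubMap k)

/-- The projection `𝒳 → X × I^k`. -/
def bigProjMap (T : CWTriple.{u} H) (k : ℕ) : C(T.bigX k, T.X × (Fin k → I)) :=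
  ⟨fun q => (q.1.1, initial q.1.2), by unfold initial; fun_prop⟩

theorem mapsTo_bigProjMap (T : CWTriple.{u} H) (k : ℕ) :
    MapsTo (T.bigProjMap k) (T.bigZ k) (T.relSet k) :=
  fun _ hx => hx.imp (fun h => ⟨h.1, trivial⟩) fun h => ⟨trivial, h⟩

/-- The map `KF_P^{-k}(X, Y) → KF(𝒳, 𝒵)` induced by the projection. -/
def bigProj (T : CWTriple.{u} H) (k : ℕ) : T.KF k → TwK.KF (T.bigP k) (T.bigZ k) :=
  KF.map ((((T.P.pullbackHom _).comp ((T.P.prod (Fin (k + 1) → I)).pullbackHom _)).lift _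
    (T.bigProjMap k) fun _ => rfl : (T.bigP k).Hom (T.P.prod (Fin k → I)) (T.bigProjMap k)))
    (T.mapsTo_bigProjMap k)

/-! ### Multiplication with the Thom class -/

/-- A homeomorphism `θ` from the square `I²` to the unit disk `D² ⊂ ℂ` which maps `∂I²` to `S¹`. -/
structure DiskParam where
  θ : (Fin 2 → I) ≃ₜ Metric.closedBall (0 : ℂ) 1
  mem_sphere : ∀ t, (θ t : ℂ) ∈ Metric.sphere (0 : ℂ) 1 ↔ t ∈ Cube.boundary (Fin 2)

/-- The unit square in the plane. -/
def squareHomeo : (Fin 2 → I) ≃ₜ (Icc (0 : ℝ) 1 ×ℂ Icc (0 : ℝ) 1) where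
  toFun t := ⟨⟨t 0, t 1⟩, (t 0).2, (t 1).2⟩
  invFun z := ![⟨z.1.re, z.2.1⟩, ⟨z.1.im, z.2.2⟩]
  left_inv t := by
    funext i
    fin_cases i <;> rfl
  right_inv _ := rfl
  continuous_toFun := by
    refine Continuous.subtype_mk (Complex.equivRealProdCLM.symm.continuous.comp
      (f := fun t : Fin 2 → I => ((t 0 : ℝ), (t 1 : ℝ))) ?_) _
    fun_prop
  continuous_invFun := by
    refine continuous_pi fun i => ?_
    fin_cases i
    · exact Continuous.subtype_mk (Complex.continuous_re.comp continuous_subtype_val) _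
    · exact Continuous.subtype_mk (Complex.continuous_im.comp continuous_subtype_val) _

instance : Nonempty DiskParam := by
  have hcl : IsClosed (Icc (0 : ℝ) 1 ×ℂ Icc (0 : ℝ) 1) := isClosed_Icc.reProdIm isClosed_Icc
  have hint : interior (Icc (0 : ℝ) 1 ×ℂ Icc (0 : ℝ) 1) = Ioo (0 : ℝ) 1 ×ℂ Ioo (0 : ℝ) 1 := by
    rw [Complex.interior_reProdIm, interior_Icc]
  obtain ⟨e, -, h2, h3⟩ := exists_homeomorph_image_interior_closure_frontier_eq_unitBall
    (s := Icc (0 : ℝ) 1 ×ℂ Icc (0 : ℝ) 1) (((convex_Icc (0 : ℝ) 1).linear_preimage Complex.reLm).inter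
      ((convex_Icc (0 : ℝ) 1).linear_preimage Complex.imLm))
    ⟨⟨1 / 2, 1 / 2⟩, by rw [hint]; exact ⟨by norm_num, by norm_num⟩⟩
    (Metric.isBounded_Icc 0 1 |>.reProdIm (Metric.isBounded_Icc 0 1))
  rw [hcl.closure_eq] at h2
  rw [hcl.frontier_eq, hint] at h3
  refine ⟨⟨squareHomeo.trans ((e.image _).trans (Homeomorph.setCongr h2)), fun t => ?_⟩⟩
  change e (squareHomeo t).1 ∈ _ ↔ _
  rw [← h3, e.injective.mem_set_image]
  have h0 := (t 0).2
  have h1 := (t 1).2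
  change (_ ∧ ¬ ((0 < (t 0 : ℝ) ∧ (t 0 : ℝ) < 1) ∧ (0 < (t 1 : ℝ) ∧ (t 1 : ℝ) < 1))) ↔
    ∃ i, t i = 0 ∨ t i = 1
  rw [Fin.exists_fin_two, and_iff_right (squareHomeo t).2]
  simp only [Subtype.ext_iff]
  change _ ↔ ((t 0 : ℝ) = 0 ∨ (t 0 : ℝ) = 1) ∨ ((t 1 : ℝ) = 0 ∨ (t 1 : ℝ) = 1)
  constructor
  · intro h
    by_contra hc
    push Not at hc
    exact h ⟨⟨lt_of_le_of_ne h0.1 (Ne.symm hc.1.1), lt_of_le_of_ne h0.2 hc.1.2⟩,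
      lt_of_le_of_ne h1.1 (Ne.symm hc.2.1), lt_of_le_of_ne h1.2 hc.2.2⟩
  · rintro ((h | h) | (h | h)) ⟨⟨a, b⟩, c, d⟩ <;> linarith

/-- The function `(x, t) ↦ θ(t)` on `X × I²`. -/
def DiskParam.z (θ : DiskParam) (T : CWTriple.{u} H) : C(T.X × (Fin 2 → I), ℂ) :=
  ⟨fun q => θ.θ q.2, continuous_subtype_val.comp (θ.θ.continuous.comp continuous_snd)⟩

/-- The bundle map `P × I² → P × I⁰`. -/
def squareProj (T : CWTriple.{u} H) : (T.P.prod (Fin 2 → I)).Hom (T.P.prod (Fin 0 → I))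
    ⟨fun q => (q.1, Fin.elim0), by fun_prop⟩ :=
  (T.P.pullbackHom _).lift _ _ fun _ => rfl

/-- The object `β(𝔼)` obtained by multiplying `𝔼` with the Thom class `(F, T)` of `D²`, where
`D² ≅ I²` by `θ`. -/
def thom (T : CWTriple.{u} H) (θ : DiskParam)
    (𝔼 : RelVB (T.P.prod (Fin 0 → I)) (T.relSet 0)) :
    RelVB (T.P.prod (Fin 2 → I)) (T.relSet 2) where
  𝔼 := ⟨(𝔼.𝔼.pullback T.squareProj).D, (𝔼.𝔼.pullback T.squareProj).V.thom (θ.z T)⟩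
  disjoint := by
    rw [disjoint_left]
    intro q hq hq'
    have h := TwistedVB.supp_thom_subset _ _ hq
    rcases hq' with hq' | hq'
    · exact disjoint_left.1 𝔼.disjoint (𝔼.𝔼.supp_pullback_subset T.squareProj h.1)
        (Or.inl ⟨hq'.1, trivial⟩)
    · have h1 := (θ.mem_sphere q.2).2 hq'.2
      have h2 : (θ.θ q.2 : ℂ) = 0 := h.2
      rw [h2] at h1
      simp at h1

end CWTriple

/-! ### Disjoint unions -/

namespace PrincipalBundle

variable {G : Type w} [Group G] [TopologicalSpace G] {Λ : Type u} {B : Λ → Type u}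
  [∀ l, TopologicalSpace (B l)] (P : ∀ l, PrincipalBundle G (B l))

open Classical in
/-- The translation function of a disjoint union. -/
def sigmaDiv (p q : Σ l, (P l).Total) : G :=
  if h : q.1 = p.1 then (P p.1).div p.2 (h ▸ q.2) else 1

theorem sigmaDiv_mk (l : Λ) (p q : (P l).Total) : sigmaDiv P ⟨l, p⟩ ⟨l, q⟩ = (P l).div p q := by
  simp [sigmaDiv]

/-- The inclusion of a summand. -/
def sigmaMk (l : Λ) (p : (P l).Total) : Σ l, (P l).Total := ⟨l, p⟩

theorem isOpenEmbedding_sigmaMk (l : Λ) : IsOpenEmbedding (sigmaMk P l) :=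
  @IsOpenEmbedding.sigmaMk Λ (fun l => (P l).Total) _ l

/-- The projection of a disjoint union. -/
def sigmaProj (p : Σ l, (P l).Total) : Σ l, B l := ⟨p.1, (P p.1).proj p.2⟩

/-- The disjoint union of principal bundles. -/
def sigma : PrincipalBundle G (Σ l, B l) where
  Total := Σ l, (P l).Total
  proj := sigmaProj P
  continuous_proj := continuous_sigma fun l => continuous_sigmaMk.comp (P l).continuous_proj
  act p a := ⟨p.1, (P p.1).act p.2 a⟩
  continuous_act := by
    rw [continuous_iff_continuousAt]
    rintro ⟨⟨l, p⟩, a⟩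
    have h := (isOpenEmbedding_sigmaMk P l).prodMap (.id : IsOpenEmbedding (id : G → G))
    exact (h.continuousAt_iff (x := (p, a))).1
      ((isOpenEmbedding_sigmaMk P l).continuous.comp (P l).continuous_act).continuousAt
  act_one p := congrArg (Sigma.mk p.1) ((P p.1).act_one p.2)
  act_mul p a b := congrArg (Sigma.mk p.1) ((P p.1).act_mul p.2 a b)
  proj_act p a := congrArg (Sigma.mk p.1) ((P p.1).proj_act p.2 a)
  div := sigmaDiv P
  act_div := by
    rintro ⟨l, p⟩ ⟨l', q⟩ h
    obtain rfl : l = l' := congrArg Sigma.fst h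
    rw [sigmaDiv_mk]
    exact congrArg (Sigma.mk l) ((P l).act_div p q (eq_of_heq (Sigma.mk.inj h).2))
  div_act p a := (sigmaDiv_mk P _ _ _).trans ((P p.1).div_act p.2 a)
  continuousOn_div := by
    rintro ⟨⟨l, p⟩, ⟨l', q⟩⟩ h
    obtain rfl : l = l' := congrArg Sigma.fst h
    have he := (isOpenEmbedding_sigmaMk P l).prodMap (isOpenEmbedding_sigmaMk P l)
    have h1 := (P l).continuousOn_div (p, q) (eq_of_heq (Sigma.mk.inj h).2)
    have h2 : Filter.Tendsto (fun x : (P l).Total × (P l).Total => (P l).div x.1 x.2)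
        (𝓝[{x | (P l).proj x.1 = (P l).proj x.2}] (p, q)) (𝓝 ((P l).div p q)) := h1
    have h3 := he.map_nhdsWithin_preimage_eq
      {x : (Σ l, (P l).Total) × Σ l, (P l).Total | sigmaProj P x.1 = sigmaProj P x.2} (p, q)
    have h4 : Prod.map (sigmaMk P l) (sigmaMk P l) ⁻¹'
        {x : (Σ l, (P l).Total) × Σ l, (P l).Total | sigmaProj P x.1 = sigmaProj P x.2} =
        {x | (P l).proj x.1 = (P l).proj x.2} := by
      ext x
      exact ⟨fun hx => eq_of_heq (Sigma.mk.inj hx).2, fun hx => congrArg (Sigma.mk l) hx⟩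
    rw [h4] at h3
    change Filter.Tendsto _ (𝓝[_] (Prod.map (sigmaMk P l) (sigmaMk P l) (p, q))) _
    rw [← h3, Filter.tendsto_map'_iff]
    refine (h2.congr fun x : (P l).Total × (P l).Total => (sigmaDiv_mk P l x.1 x.2).symm).trans ?_
    exact le_of_eq (congrArg 𝓝 (sigmaDiv_mk P l p q).symm)
  exists_section := by
    rintro ⟨l, x⟩
    obtain ⟨U, hU, hx, τ, hτ, hs⟩ := (P l).exists_section x
    obtain ⟨p, hp⟩ := (P l).exists_mem_fiber x
    have hinj : Function.Injective (Sigma.mk l : B l → Σ l, B l) := sigma_mk_injective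
    let ρ : (Σ l, B l) → Σ l, (P l).Total :=
      Function.extend (Sigma.mk l) (fun y => ⟨l, τ y⟩) fun _ => ⟨l, p⟩
    have hρ : ∀ y, ρ ⟨l, y⟩ = ⟨l, τ y⟩ := fun y => hinj.extend_apply _ _ y
    refine ⟨Sigma.mk l '' U, isOpenMap_sigmaMk U hU, mem_image_of_mem _ hx, ρ, ?_, ?_⟩
    · rintro _ ⟨y, hy, rfl⟩
      refine ContinuousAt.continuousWithinAt ?_
      rw [← IsOpenEmbedding.sigmaMk.continuousAt_iff]
      have h1 : ContinuousAt (fun y => sigmaMk P l (τ y)) y :=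
        (isOpenEmbedding_sigmaMk P l).continuous.continuousAt.comp (hτ.continuousAt (hU.mem_nhds hy))
      exact h1.congr (Filter.Eventually.of_forall fun y => (hρ y).symm)
    · rintro _ ⟨y, hy, rfl⟩
      rw [hρ]
      exact congrArg (Sigma.mk l) (hs y hy)

/-- The inclusion into a disjoint union. -/
def sigmaIncl (l : Λ) : Hom (P l) (sigma P) ⟨Sigma.mk l, continuous_sigmaMk⟩ where
  toFun := sigmaMk P l
  continuous_toFun := (isOpenEmbedding_sigmaMk P l).continuous
  proj_toFun _ := rfl
  map_act _ _ := rfl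

end PrincipalBundle

namespace CWTriple

variable {H : Type w} [NormedAddCommGroup H] [InnerProductSpace ℂ H] {Λ : Type u}

section cells

variable {Z : Λ → Type u}

open Classical in
/-- A partial equivalence to a summand as a partial equivalence to the disjoint union. -/
def sigmaEquiv {E : Type} [Zero E] (l : Λ) (e : PartialEquiv E (Z l)) :
    PartialEquiv E (Σ l, Z l) where
  toFun v := ⟨l, e v⟩
  invFun z := if h : z.1 = l then e.symm (h ▸ z.2) else 0
  source := e.source
  target := Sigma.mk l '' e.target
  map_source' _ hv := mem_image_of_mem _ (e.map_source hv)
  map_target' := by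
    rintro _ ⟨z, hz, rfl⟩
    simpa using e.map_target hz
  left_inv' _ hv := by simpa using e.left_inv hv
  right_inv' := by
    rintro _ ⟨z, hz, rfl⟩
    simp [e.right_inv hz]

theorem sigmaEquiv_image {E : Type} [Zero E] (l : Λ) (e : PartialEquiv E (Z l)) (S : Set E) :
    sigmaEquiv l e '' S = Sigma.mk l '' (e '' S) :=
  (image_image (Sigma.mk l) e S).symm

variable [∀ l, TopologicalSpace (Z l)] (X : ∀ l, Set (Z l))

/-- The disjoint union `∐ X_l` as a subset of `∐ Z_l`. -/
def coprodSet : Set (Σ l, Z l) := {z | z.2 ∈ X z.1}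

/-- The inclusion `X_l → ∐ X_l`. -/
def coprodInclMap (l : Λ) : C(X l, coprodSet X) where
  toFun x := ⟨⟨l, x.1⟩, x.2⟩
  continuous_toFun :=
    Continuous.subtype_mk (continuous_sigmaMk.comp continuous_subtype_val) _

open Topology.RelCWComplex in
/-- The disjoint union of CW complexes. -/
instance coprodCW [∀ l, Topology.CWComplex (X l)] : Topology.CWComplex (coprodSet X) where
  cell n := Σ l, cell (X l) n
  map n i := sigmaEquiv i.1 (map n i.2)
  source_eq n i := source_eq n i.2
  continuousOn n i := continuous_sigmaMk.comp_continuousOn (continuousOn n i.2)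
  continuousOn_symm n i := by
    rintro _ ⟨z, hz, rfl⟩
    have h : Filter.Tendsto (map n i.2).symm (𝓝[(map n i.2).target] z)
        (𝓝 ((map n i.2).symm z)) := continuousOn_symm n i.2 z hz
    have h1 : ∀ z, (sigmaEquiv i.1 (map n i.2)).symm ⟨i.1, z⟩ = (map n i.2).symm z := fun z =>
      dif_pos (rfl : i.1 = i.1)
    change Filter.Tendsto _ (𝓝[Sigma.mk i.1 '' _] _) (𝓝 ((sigmaEquiv i.1 (map n i.2)).symm _))
    rw [← IsOpenEmbedding.sigmaMk.isEmbedding.map_nhdsWithin_eq, Filter.tendsto_map'_iff, h1]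
    exact h.congr fun z => (h1 z).symm
  pairwiseDisjoint' := by
    rintro ⟨n, l, i⟩ - ⟨n', l', i'⟩ - hne
    change Disjoint (sigmaEquiv l (map n i) '' _) (sigmaEquiv l' (map n' i') '' _)
    rw [sigmaEquiv_image, sigmaEquiv_image, disjoint_left]
    rintro _ ⟨z, hz, rfl⟩ ⟨z', hz', h⟩
    obtain rfl : l' = l := congrArg Sigma.fst h
    obtain rfl : z' = z := eq_of_heq (Sigma.mk.inj h).2
    refine disjoint_left.1 (pairwiseDisjoint (C := X l') (mem_univ ⟨n, i⟩)
      (mem_univ ⟨n', i'⟩) ?_) hz hz'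
    intro h'
    apply hne
    cases h'
    rfl
  mapsTo' n i := by
    obtain ⟨l, i⟩ := i
    obtain ⟨J, hJ⟩ := Topology.CWComplex.mapsTo (C := X l) n i
    refine ⟨fun m => (J m).map ⟨Sigma.mk l, sigma_mk_injective⟩, fun v hv => ?_⟩
    have h := hJ hv
    simp only [mem_iUnion, exists_prop] at h ⊢
    obtain ⟨m, hm, j, hj, hvj⟩ := h
    refine ⟨m, hm, ⟨l, j⟩, Finset.mem_map_of_mem _ hj, ?_⟩
    rw [sigmaEquiv_image]
    exact mem_image_of_mem (Sigma.mk l) hvj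
  closed' A hA h := by
    rw [isClosed_sigma_iff]
    intro l
    refine Topology.RelCWComplex.closed' (C := X l) _ (fun z hz => hA hz) ⟨fun n j => ?_, ?_⟩
    · have h1 := isClosed_sigma_iff.1 (h n ⟨l, j⟩) l
      rw [sigmaEquiv_image, preimage_inter, preimage_image_eq _ sigma_mk_injective] at h1
      exact h1
    · rw [inter_empty]; exact isClosed_empty
  union' := by
    ext ⟨l, z⟩
    have h := Topology.CWComplex.union (C := X l)
    simp only [mem_iUnion]
    constructor
    · rintro ⟨n, ⟨l', i⟩, v, hv, h'⟩
      obtain rfl : l' = l := congrArg Sigma.fst h'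
      obtain rfl : map n i v = z := eq_of_heq (Sigma.mk.inj h').2
      exact closedCell_subset_complex n i (mem_image_of_mem _ hv)
    · intro hz
      have hz' : z ∈ X l := hz
      rw [← h] at hz'
      obtain ⟨n, i, v, hv, rfl⟩ := by simpa only [mem_iUnion] using hz'
      exact ⟨n, ⟨l, i⟩, v, hv, rfl⟩

open Topology.RelCWComplex in
/-- The disjoint union of subcomplexes. -/
def coprodSub [∀ l, T2Space (Z l)] [∀ l, Topology.CWComplex (X l)]
    (Y : ∀ l, Topology.CWComplex.Subcomplex (X l)) :
    Topology.CWComplex.Subcomplex (coprodSet X) :=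
  .mk (coprodSet fun l => Y l) (fun n => {i | i.2 ∈ (Y i.1).I n})
    (isClosed_sigma_iff.2 fun l => (Y l).closed') <| by
    ext ⟨l, z⟩
    simp only [empty_union, mem_iUnion]
    constructor
    · rintro ⟨n, ⟨⟨l', i⟩, hi⟩, v, hv, h'⟩
      obtain rfl : l' = l := congrArg Sigma.fst h'
      obtain rfl : map n i v = z := eq_of_heq (Sigma.mk.inj h').2
      exact (mem_subcomplex_iff (Y l') (i := i) (mem_image_of_mem _ hv)).2 hi
    · intro hz
      have hz' : z ∈ Y l := hz
      obtain ⟨n, i, hi⟩ := exists_openCell (Subcomplex.subset_complex (Y l) hz')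
      obtain ⟨v, hv, rfl⟩ := id hi
      exact ⟨n, ⟨⟨l, i⟩, (mem_subcomplex_iff (Y l) hi).1 hz'⟩, v, hv, rfl⟩

/-- The natural map from `∐ X_l`, as a subset of `∐ Z_l`, to the disjoint union of spaces. -/
def coprodMap : C(coprodSet X, Σ l, X l) where
  toFun z := ⟨z.1.1, z.1.2, z.2⟩
  continuous_toFun := by
    rw [continuous_def]
    intro W hW
    have h := isOpen_sigma_iff.1 hW
    choose V hV hVW using fun l => isOpen_induced_iff.1 (h l)
    refine ⟨{z | z.2 ∈ V z.1}, isOpen_sigma_iff.2 hV, ?_⟩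
    ext ⟨⟨l, z⟩, hz⟩
    have h1 : ((⟨z, hz⟩ : X l) ∈ Subtype.val ⁻¹' V l) ↔ (⟨z, hz⟩ : X l) ∈ Sigma.mk l ⁻¹' W := by
      rw [hVW]
    exact h1

end cells

/-- The disjoint union `(∐ X_l, ∐ Y_l; ∐ P_l)`. -/
def coprod (T : Λ → CWTriple.{u} H) : CWTriple.{u} H where
  Z := Σ l, (T l).Z
  X := coprodSet fun l => (T l).X
  Y := coprodSub (fun l => (T l).X) fun l => (T l).Y
  P := (PrincipalBundle.sigma fun l => (T l).P).pullback (coprodMap fun l => (T l).X)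

/-- The inclusion `(X_l, Y_l; P_l) → (∐ X_l, ∐ Y_l; ∐ P_l)`. -/
def coprodIncl (T : Λ → CWTriple.{u} H) (l : Λ) : (T l).Hom (coprod T) where
  f := coprodInclMap (fun l => (T l).X) l
  mapsTo _ hx := hx
  F := (PrincipalBundle.sigmaIncl (fun l => (T l).P) l).lift _ _ fun _ => rfl

end CWTriple

end TwK

end

open TwK

/-!
# Twisted `K`-theory by vectorial bundles

*Germs and refinements.* A morphism of local pieces `(s, (E, h))` only matters through its germs,
and the germs at a point form a category (`GObj`). All constructions are carried out for bundles
`TV` over an open part of the base. `TV.Sub 𝔸 𝔹` means that the charts of `𝔸` are identified with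
parts of charts of `𝔹`; `TV.Compat 𝔸 𝔹` is a system of isomorphisms on the overlap of the domains.
Compatible bundles can be glued (`TV.CompatData.glue`) and everything can be pulled back along
bundle maps which are only defined over an open set (`TV.pull`). Two classes agree exactly if they
are the ends of a concordance (`TV.conc_of_cls_eq`): isomorphisms at the ends of a homotopy are
absorbed by gluing in constant bundles, and homotopies are composed by gluing.

*The group structure.* Since `U(H) → PU(H)` has local sections, two systems of local sections of `P`
have a common refinement on which they differ by lifts to `U(H)` (`LTD.exists_gauge_gauge`), and
bundles can be transported to it (`Gauge.exists_sub`). Hence classes can be added. If the Hermitian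
map of the source is invertible at a point, any two germs there agree (`GObj.hom_ext_of_inv`),
because there are no eigenvalues near zero and two lifts to `U(H)` differ by a function with values
in `U(1)`. So all invertible bundles are isomorphic and represent zero. The inverse of `E` is `E`
with the opposite grading: the Hermitian map `h ⊗ 1 + ε ⊗ T_t` has square `h² ⊗ 1 + t²`, it equals
the direct sum for `t = 0`, and it is invertible for `t = 1` (`KF.exists_neg`). The same formula
with `z ∈ D²` instead of `t` shows that multiplication with the Thom class is defined on classes
(`KF.thom`).

*Extension by zero.* A bundle over an open set which is invertible outside of a closed subset of the
base can be glued with the zero bundle over the complement (`TV.exists_ext`), and the result is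
unique up to homotopy. Applied to bundles and to concordances this is excision
(`KF.map_bijective_of_excision`). Additivity follows by disjoint unions.

*The use of cells.* Equivariant maps out of `P` can be constructed one cell at a time, because `P`
has sections over cells (`PrincipalBundle.hasSection_Icc`, `Cells.exists_extension`). This is used
twice. A bundle over a CW complex admits an equivariant map to the infinite join of copies of
`PU(H)`; the sets on which a coordinate of this map is defined carry sections, and, once they are
shrunk, the transition functions between these lift to `U(H)`, so that there is a zero bundle
(`Cells.nonempty_twistData`). And the retraction of `X × I` onto `X × 0 ∪ Y × I` is covered by a map
of bundles (`Cells.exists_retraction`), which is the homotopy extension property.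

*Exactness.* By the retraction the projection from `𝒳` to `X × I^k` is a homotopy equivalence of
pairs (`CWTriple.bijective_bigProj`), and the restriction from `𝒳` to `Y × I^{k+1}` is an instance
of excision (`CWTriple.bijective_bigRes`). A null-homotopy of a class is a bundle over one more
interval, and it can be read as a preimage under the preceding map of the sequence
(`CWTriple.exact_absHom_subHom`, `CWTriple.exact_delta_absHom`, `CWTriple.exact_subHom_delta`). The
composition at `KF⁰(Y)` vanishes since `β` is natural.
-/

noncomputable section

namespace TwK

open CategoryTheory

/-! ### The topological groups `U(H)` and `PU(H)` -/

section UnitaryTopology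

open Filter

variable {H : Type w} [NormedAddCommGroup H] [InnerProductSpace ℂ H]

/-- On the unitary group the compact-open topology is the topology of pointwise convergence, since
unitary operators are equicontinuous. -/
theorem UGroup.tendsto_iff {α : Type*} {l : Filter α} {F : α → UGroup H} {g : UGroup H} :
    Tendsto F l (𝓝 g) ↔ ∀ v, Tendsto (fun a => (F a).op v) l (𝓝 (g.op v)) := by
  have hind : IsInducing (UGroup.toContinuousMap H) := ⟨rfl⟩
  rw [hind.tendsto_nhds_iff, ContinuousMap.tendsto_iff_forall_isCompact_tendstoUniformlyOn]
  constructor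
  · intro h v
    exact (h {v} isCompact_singleton).tendsto_at (mem_singleton v)
  · intro h K hK
    rw [Metric.tendstoUniformlyOn_iff]
    intro ε hε
    obtain ⟨t, -, ht, hKt⟩ := hK.finite_cover_balls (e := ε / 3) (by positivity)
    have h1 : ∀ᶠ a in l, ∀ v ∈ t, dist (g.op v) ((F a).op v) < ε / 3 := by
      rw [eventually_all_finite ht]
      intro v _
      have := (Metric.tendsto_nhds.1 (h v)) (ε / 3) (by positivity)
      filter_upwards [this] with a ha
      rwa [dist_comm]
    filter_upwards [h1] with a ha x hx
    obtain ⟨v, hv, hxv⟩ := mem_iUnion₂.1 (hKt hx)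
    have h2 : dist (g.op x) (g.op v) < ε / 3 := by rw [g.op.dist_map]; exact hxv
    have h3 : dist ((F a).op v) ((F a).op x) < ε / 3 := by
      rw [(F a).op.dist_map, dist_comm]; exact hxv
    calc dist (g.op x) ((F a).op x)
        ≤ dist (g.op x) (g.op v) + dist (g.op v) ((F a).op v) + dist ((F a).op v) ((F a).op x) :=
          dist_triangle4 _ _ _ _
      _ < ε / 3 + ε / 3 + ε / 3 := by gcongr; exact ha v hv
      _ = ε := by ring

theorem UGroup.continuous_op (v : H) : Continuous fun g : UGroup H => g.op v :=
  continuous_iff_continuousAt.2 fun _ => UGroup.tendsto_iff.1 tendsto_id v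

theorem UGroup.op_mul (g g' : UGroup H) (v : H) : (g * g').op v = g.op (g'.op v) := rfl

theorem UGroup.op_op_inv (g : UGroup H) (v : H) : g.op ((g⁻¹).op v) = v := by
  rw [← UGroup.op_mul, mul_inv_cancel]; rfl

/-- Multiplication is jointly continuous for pointwise convergence because unitary operators are
isometric: `‖q (q' v) - q (g' v)‖ = ‖q' v - g' v‖`. -/
instance : IsTopologicalGroup (UGroup H) where
  continuous_mul := by
    rw [continuous_iff_continuousAt]
    rintro ⟨g, g'⟩
    refine UGroup.tendsto_iff.2 fun v => ?_
    have h1 : Tendsto (fun q : UGroup H × UGroup H => q.1.op (g'.op v)) (𝓝 (g, g'))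
        (𝓝 (g.op (g'.op v))) :=
      ((UGroup.continuous_op (g'.op v)).comp continuous_fst).continuousAt
    have h2 : Tendsto (fun q : UGroup H × UGroup H => q.2.op v) (𝓝 (g, g')) (𝓝 (g'.op v)) :=
      ((UGroup.continuous_op v).comp continuous_snd).continuousAt
    have h3 : Tendsto (fun q : UGroup H × UGroup H => ‖q.2.op v - g'.op v‖) (𝓝 (g, g'))
        (𝓝 0) := by
      have := (h2.sub_const (g'.op v)).norm
      simpa using this
    have h4 : Tendsto (fun q : UGroup H × UGroup H => q.1.op (q.2.op v) - q.1.op (g'.op v))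
        (𝓝 (g, g')) (𝓝 0) := by
      refine squeeze_zero_norm (fun q => ?_) h3
      rw [← map_sub, q.1.op.norm_map]
    have h5 := h4.add h1
    simp only [sub_add_cancel, zero_add] at h5
    exact h5
  continuous_inv := by
    rw [continuous_iff_continuousAt]
    intro g
    refine UGroup.tendsto_iff.2 fun v => ?_
    have h1 : Tendsto (fun q : UGroup H => q.op ((g⁻¹).op v)) (𝓝 g) (𝓝 v) := by
      have := (UGroup.continuous_op ((g⁻¹).op v)).continuousAt (x := g)
      simpa [ContinuousAt, UGroup.op_op_inv] using this
    have h2 : Tendsto (fun q : UGroup H => v - q.op ((g⁻¹).op v)) (𝓝 g) (𝓝 0) := by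
      have := (tendsto_const_nhds (x := v)).sub h1
      simpa using this
    have h3 : Tendsto (fun q : UGroup H => (q⁻¹).op v - (g⁻¹).op v) (𝓝 g) (𝓝 0) := by
      refine squeeze_zero_norm (fun q => ?_) (by simpa using h2.norm)
      have : v - q.op ((g⁻¹).op v) = q.op ((q⁻¹).op v - (g⁻¹).op v) := by
        rw [map_sub, UGroup.op_op_inv]
      rw [this, q.op.norm_map]
    have h4 := h3.add_const ((g⁻¹).op v)
    simpa using h4

instance : IsTopologicalGroup (PU H) :=
  inferInstanceAs (IsTopologicalGroup (UGroup H ⧸ (scalar H).range))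

theorem continuous_toPU : Continuous (toPU H) :=
  show Continuous (QuotientGroup.mk : UGroup H → UGroup H ⧸ (scalar H).range) from
    QuotientGroup.continuous_mk

theorem isOpenMap_toPU : IsOpenMap (toPU H) :=
  show IsOpenMap (QuotientGroup.mk : UGroup H → UGroup H ⧸ (scalar H).range) from
    QuotientGroup.isOpenMap_coe

theorem toPU_surjective : Function.Surjective (toPU H) := QuotientGroup.mk'_surjective _

theorem toPU_scalar (z : Circle) : toPU H (scalar H z) = 1 :=
  (QuotientGroup.eq_one_iff _).2 ⟨z, rfl⟩

theorem toPU_eq_iff {g g' : UGroup H} : toPU H g = toPU H g' ↔ ∃ z, g = g' * scalar H z := by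
  constructor
  · intro h
    obtain ⟨z, hz⟩ := QuotientGroup.eq.1 (show (QuotientGroup.mk g' : UGroup H ⧸ (scalar H).range) =
      QuotientGroup.mk g from h.symm)
    exact ⟨z, by rw [hz, mul_inv_cancel_left]⟩
  · rintro ⟨z, rfl⟩
    rw [map_mul, toPU_scalar, mul_one]

theorem scalar_comm (z : Circle) (g : UGroup H) : scalar H z * g = g * scalar H z :=
  LinearIsometryEquiv.ext fun v => (g.op.map_smul (z : ℂ) v).symm

theorem continuous_scalar : Continuous (scalar H) := by
  rw [continuous_iff_continuousAt]
  intro z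
  refine UGroup.tendsto_iff.2 fun v => ?_
  have hc : Continuous fun z : Circle => (z : ℂ) := continuous_subtype_val
  exact (hc.smul (continuous_const (y := v))).continuousAt

/-- Two continuous lifts of the same map to `PU(H)` differ by a continuous function with values
in `U(1)`. -/
theorem continuousOn_of_eq_mul_scalar [Nontrivial H] {X : Type*} [TopologicalSpace X] {W : Set X}
    {g g' : X → UGroup H} {ζ : X → Circle} (hg : ContinuousOn g W) (hg' : ContinuousOn g' W)
    (h : ∀ x ∈ W, g x = g' x * scalar H (ζ x)) : ContinuousOn ζ W := by
  obtain ⟨v, hv⟩ := exists_ne (0 : H)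
  have h1 : ContinuousOn (fun x => ⟪v, ((g' x)⁻¹ * g x).op v⟫_ℂ / ⟪v, v⟫_ℂ) W := by
    refine ContinuousOn.div_const ?_ _
    refine ContinuousOn.inner continuousOn_const ?_
    exact (UGroup.continuous_op v).comp_continuousOn (hg'.inv.mul hg)
  have hi : IsInducing (fun z : Circle => (z : ℂ)) := IsInducing.subtypeVal
  refine hi.continuousOn_iff.2 (h1.congr fun x hx => ?_)
  have h2 : (g' x)⁻¹ * g x = scalar H (ζ x) := by rw [h x hx, inv_mul_cancel_left]
  change (ζ x : ℂ) = ⟪v, ((g' x)⁻¹ * g x).op v⟫_ℂ / ⟪v, v⟫_ℂ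
  rw [h2, scalar_op, inner_smul_right, mul_div_cancel_right₀ _ (inner_self_ne_zero.2 hv)]

/-- The projection `U(H) → PU(H)` has continuous local sections: on the set of the operators `g`
with `⟪v, g v⟫ ≠ 0` the phase of `g` can be normalized so that `⟪v, g v⟫ > 0`. -/
theorem exists_local_section [Nontrivial H] (p : PU H) :
    ∃ O : Set (PU H), IsOpen O ∧ p ∈ O ∧ ∃ l : PU H → UGroup H, ContinuousOn l O ∧
      ∀ q ∈ O, toPU H (l q) = q := by
  obtain ⟨v, hv⟩ := exists_ne (0 : H)
  -- the case `p = 1`; the general one follows by translation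
  have key : ∃ O : Set (PU H), IsOpen O ∧ (1 : PU H) ∈ O ∧ ∃ l : PU H → UGroup H,
      ContinuousOn l O ∧ ∀ q ∈ O, toPU H (l q) = q := by
    let a : UGroup H → ℂ := fun g => ⟪v, g.op v⟫_ℂ
    have ha : Continuous a := continuous_const.inner (UGroup.continuous_op v)
    let N : Set (UGroup H) := {g | a g ≠ 0}
    have hN : IsOpen N := isOpen_ne_fun ha continuous_const
    have hmul : ∀ (z : Circle) g, a (g * scalar H z) = z * a g := fun z g => by
      change ⟪v, g.op ((z : ℂ) • v)⟫_ℂ = _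
      rw [map_smul, inner_smul_right]
    let ph : UGroup H → Circle := fun g =>
      if h : a g ≠ 0 then ⟨a g / ‖a g‖, mem_sphere_zero_iff_norm.2 (by
        rw [norm_div, Complex.norm_real, norm_norm, div_self (norm_ne_zero_iff.2 h)])⟩ else 1
    have hphv : ∀ g ∈ N, (ph g : ℂ) = a g / ‖a g‖ := fun g hg =>
      congrArg (fun z : Circle => (z : ℂ)) (dif_pos (show a g ≠ 0 from hg))
    have hphm : ∀ g ∈ N, ∀ z : Circle, ph (g * scalar H z) = z * ph g := by
      intro g hg z
      have h2 : g * scalar H z ∈ N := by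
        change a (g * scalar H z) ≠ 0
        rw [hmul]; exact mul_ne_zero (Circle.coe_ne_zero z) hg
      refine Circle.ext ?_
      rw [hphv _ h2, hmul, norm_mul, Circle.norm_coe, one_mul, Circle.coe_mul, hphv g hg,
        mul_div_assoc]
    have hphc : ContinuousOn ph N := by
      have hi : IsInducing (fun z : Circle => (z : ℂ)) := IsInducing.subtypeVal
      refine hi.continuousOn_iff.2 (ContinuousOn.congr (f := fun g => a g / ‖a g‖) ?_ hphv)
      refine ha.continuousOn.div (Complex.continuous_ofReal.comp ha.norm).continuousOn ?_
      intro g hg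
      exact Complex.ofReal_ne_zero.2 (norm_ne_zero_iff.2 hg)
    let n : UGroup H → UGroup H := fun g => g * scalar H (ph g)⁻¹
    have hn : ContinuousOn n N :=
      continuousOn_id.mul (continuous_scalar.comp_continuousOn hphc.inv)
    have hnm : ∀ g ∈ N, ∀ z : Circle, n (g * scalar H z) = n g := by
      intro g hg z
      simp only [n]
      rw [hphm g hg z, mul_assoc, ← map_mul, mul_inv, mul_inv_cancel_left]
    refine ⟨toPU H '' N, isOpenMap_toPU _ hN, ⟨1, ?_, map_one _⟩,
      fun q => n (Function.surjInv toPU_surjective q), ?_, ?_⟩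
    · change ⟪v, v⟫_ℂ ≠ 0
      exact inner_self_ne_zero.2 hv
    · rintro _ ⟨g, hg, rfl⟩
      refine ContinuousAt.continuousWithinAt ?_
      have h1 : ∀ g ∈ N, n (Function.surjInv toPU_surjective (toPU H g)) = n g := by
        intro g hg
        obtain ⟨z, hz⟩ := toPU_eq_iff.1 (Function.surjInv_eq toPU_surjective (toPU H g))
        rw [hz, hnm g hg]
      rw [ContinuousAt, ← isOpenMap_toPU.map_nhds_eq continuous_toPU.continuousAt,
        tendsto_map'_iff, h1 g hg]
      have h2 : Tendsto n (𝓝 g) (𝓝 (n g)) := hn.continuousAt (hN.mem_nhds hg)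
      refine h2.congr' ?_
      filter_upwards [hN.mem_nhds hg] with g hg
      exact (h1 g hg).symm
    · intro q _
      simp only [n]
      rw [map_mul, toPU_scalar, mul_one, Function.surjInv_eq toPU_surjective]
  obtain ⟨O, hO, h1, l, hl, hlq⟩ := key
  obtain ⟨g, rfl⟩ := toPU_surjective p
  refine ⟨(fun q => (toPU H g)⁻¹ * q) ⁻¹' O, hO.preimage (continuous_const.mul continuous_id),
    by simpa using h1, fun q => g * l ((toPU H g)⁻¹ * q), ?_, ?_⟩
  · exact continuousOn_const.mul (hl.comp (by fun_prop) fun _ h => h)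
  · intro q hq
    rw [map_mul, hlq _ hq, mul_inv_cancel_left]

end UnitaryTopology

/-! ### Continuous families of linear maps -/

section Continuity

variable {X : Type u} [TopologicalSpace X] {X' : Type u} [TopologicalSpace X']

namespace HermBundle

theorem exists_mem_dom {U : Set X} (E : HermBundle X U) {x : X} (hx : x ∈ U) :
    ∃ i, x ∈ E.dom i := by
  rw [← E.iUnion_dom] at hx
  exact mem_iUnion.1 hx

theorem dom_subset {U : Set X} (E : HermBundle X U) (i : E.ι) : E.dom i ⊆ U :=
  (subset_iUnion E.dom i).trans E.iUnion_dom.le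

theorem isOpen {U : Set X} (E : HermBundle X U) : IsOpen U :=
  E.iUnion_dom ▸ isOpen_iUnion E.isOpen_dom

theorem sum_inner_smul_frame {U : Set X} (E : HermBundle X U) {i : E.ι} [Fintype (E.rk i)] {x : X}
    (hx : x ∈ E.dom i) (v : E.Fib x) :
    ∑ k, ⟪E.frame i k x, v⟫_ℂ • E.frame i k x = v := by
  have h := (OrthonormalBasis.mk (E.orthonormal i x hx) (E.span_eq_top i x hx).ge).sum_repr' v
  simpa using h

/-- The pull-back of a Hermitian vector bundle along a map which is only required to be continuous
on an open set `O`; it is a bundle over the part of `O` that is mapped to `U`. -/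
def ppull {U : Set X} (E : HermBundle X U) (f : X' → X) (O : Set X') (hO : IsOpen O)
    (hf : ContinuousOn f O) : HermBundle X' (O ∩ f ⁻¹' U) where
  Fib x := E.Fib (f x)
  normed x := E.normed (f x)
  inner x := E.inner (f x)
  ι := E.ι
  dom i := O ∩ f ⁻¹' E.dom i
  isOpen_dom i := hf.isOpen_inter_preimage hO (E.isOpen_dom i)
  iUnion_dom := by rw [← inter_iUnion, ← preimage_iUnion, E.iUnion_dom]
  rk := E.rk
  frame i k x := E.frame i k (f x)
  orthonormal i x hx := E.orthonormal i (f x) hx.2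
  span_eq_top i x hx := E.span_eq_top i (f x) hx.2
  continuousOn_transition i j k l :=
    (E.continuousOn_transition i j k l).comp (hf.mono fun _ h => h.1.1) fun _ h => ⟨h.1.2, h.2.2⟩

end HermBundle

namespace ContinuousHomOn

variable {U U' U'' : Set X} {E : HermBundle X U} {E' : HermBundle X U'} {E'' : HermBundle X U''}
  {W : Set X}

theorem mono {W' : Set X} {A : ∀ x, E.Fib x →ₗ[ℂ] E'.Fib x} (h : ContinuousHomOn E E' W A)
    (hW : W' ⊆ W) : ContinuousHomOn E E' W' A := fun i j k l =>
  (h i j k l).mono (inter_subset_inter_left _ hW)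

/-- A family of linear maps which maps local frames to local frames is continuous. -/
theorem of_frame {A : ∀ x, E.Fib x →ₗ[ℂ] E'.Fib x} (r : E.ι → E'.ι)
    (e : ∀ i, E.rk i → E'.rk (r i))
    (h : ∀ i, ∀ x ∈ W ∩ E.dom i, x ∈ E'.dom (r i) ∧
      ∀ k, A x (E.frame i k x) = E'.frame (r i) (e i k) x) : ContinuousHomOn E E' W A := by
  intro i j k l
  refine ((E'.continuousOn_transition j (r i) l (e i k)).mono fun x hx => ?_).congr fun x hx => ?_
  · exact ⟨hx.2.2, (h i x ⟨hx.1, hx.2.1⟩).1⟩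
  · rw [(h i x ⟨hx.1, hx.2.1⟩).2 k]

theorem comp {A : ∀ x, E.Fib x →ₗ[ℂ] E'.Fib x} {B : ∀ x, E'.Fib x →ₗ[ℂ] E''.Fib x}
    (hB : ContinuousHomOn E' E'' W B) (hA : ContinuousHomOn E E' W A) (hW : W ⊆ U') :
    ContinuousHomOn E E'' W fun x => B x ∘ₗ A x := by
  intro i j k l x hx
  obtain ⟨m, hm⟩ := E'.exists_mem_dom (hW hx.1)
  have := Fintype.ofFinite (E'.rk m)
  have key : ContinuousOn (fun y => ∑ n, ⟪E'.frame m n y, A y (E.frame i k y)⟫_ℂ *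
      ⟪E''.frame j l y, B y (E'.frame m n y)⟫_ℂ) (W ∩ (E.dom i ∩ E''.dom j) ∩ E'.dom m) := by
    refine continuousOn_finsetSum _ fun n _ => ContinuousOn.mul ?_ ?_
    · exact (hA i m k n).mono fun y hy => ⟨hy.1.1, hy.1.2.1, hy.2⟩
    · exact (hB m j n l).mono fun y hy => ⟨hy.1.1, hy.2, hy.1.2.2⟩
  have key2 : ContinuousOn (fun y => ⟪E''.frame j l y, (B y ∘ₗ A y) (E.frame i k y)⟫_ℂ)
      (W ∩ (E.dom i ∩ E''.dom j) ∩ E'.dom m) := by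
    refine key.congr fun y hy => ?_
    change ⟪E''.frame j l y, B y (A y (E.frame i k y))⟫_ℂ = _
    conv_lhs => rw [← E'.sum_inner_smul_frame hy.2 (A y (E.frame i k y))]
    simp only [map_sum, map_smul, inner_sum, inner_smul_right]
  exact (continuousWithinAt_inter ((E'.isOpen_dom m).mem_nhds hm)).1 (key2 x ⟨hx, hm⟩)

theorem smulOn {A : ∀ x, E.Fib x →ₗ[ℂ] E'.Fib x} (hA : ContinuousHomOn E E' W A) {c : X → ℂ}
    (hc : ContinuousOn c W) : ContinuousHomOn E E' W fun x => c x • A x := fun i j k l => by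
  simp only [LinearMap.smul_apply, inner_smul_right]
  exact (hc.mono inter_subset_left).mul (hA i j k l)

theorem ppull {A : ∀ x, E.Fib x →ₗ[ℂ] E'.Fib x} (hA : ContinuousHomOn E E' W A) {f : X' → X}
    {O : Set X'} (hO : IsOpen O) (hf : ContinuousOn f O) {W' : Set X'} (hW : MapsTo f W' W)
    (hWO : W' ⊆ O) :
    ContinuousHomOn (E.ppull f O hO hf) (E'.ppull f O hO hf) W' fun x => A (f x) :=
  fun i j k l => (hA i j k l).comp (hf.mono fun _ h => hWO h.1) fun _ h =>
    ⟨hW h.1, h.2.1.2, h.2.2.2⟩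

end ContinuousHomOn

/-- Transport between fibres over points which are equal (and zero otherwise). -/
def HermBundle.move {U : Set X} (E : HermBundle X U) (a b : X) : E.Fib a →ₗ[ℂ] E.Fib b :=
  open Classical in if h : a = b then h ▸ LinearMap.id else 0

theorem HermBundle.move_self {U : Set X} (E : HermBundle X U) (a : X) :
    E.move a a = LinearMap.id := dif_pos rfl

theorem HermBundle.move_frame {U : Set X} (E : HermBundle X U) {a b : X} (h : a = b) (i : E.ι)
    (k : E.rk i) : E.move a b (E.frame i k a) = E.frame i k b := by
  subst h; rw [E.move_self]; rfl

theorem HermBundle.move_move {U : Set X} (E : HermBundle X U) {a b : X} (h : a = b)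
    (v : E.Fib a) : E.move b a (E.move a b v) = v := by
  subst h; rw [E.move_self]; rfl

theorem HermBundle.move_comm {U U' : Set X} (E : HermBundle X U) (E' : HermBundle X U')
    (φ : ∀ x, E.Fib x →ₗ[ℂ] E'.Fib x) {a b : X} (h : a = b) (v : E.Fib a) :
    E'.move a b (φ a v) = φ b (E.move a b v) := by
  subst h; rw [E.move_self, E'.move_self]; rfl

namespace HFObj

variable {U : Set X}

/-- The pull-back of `(E, h)` along a map which is continuous on an open set `O`. -/
def ppull (E : HFObj X U) (f : X' → X) (O : Set X') (hO : IsOpen O) (hf : ContinuousOn f O) :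
    HFObj X' (O ∩ f ⁻¹' U) where
  toHermBundle := E.toHermBundle.ppull f O hO hf
  ε x := E.ε (f x)
  h x := E.h (f x)
  continuous_ε := E.continuous_ε.ppull hO hf (fun _ h => h.2) inter_subset_left
  continuous_h := E.continuous_h.ppull hO hf (fun _ h => h.2) inter_subset_left
  ε_symm x hx := E.ε_symm (f x) hx.2
  ε_sq x hx := E.ε_sq (f x) hx.2
  h_symm x hx := E.h_symm (f x) hx.2
  h_odd x hx := E.h_odd (f x) hx.2

/-- The Hermitian map is invertible at `x`. -/
def Inv (E : HFObj X U) (x : X) : Prop := Function.Bijective (E.h x)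

theorem inv_of_injective (E : HFObj X U) {x : X} (hx : x ∈ U)
    (h : ∀ v, E.h x v = 0 → v = 0) : E.Inv x := by
  have := E.finiteDimensional_fib hx
  have inj : Function.Injective (E.h x) := (injective_iff_map_eq_zero _).2 h
  exact ⟨inj, LinearMap.injective_iff_surjective.1 inj⟩

theorem mem_low_of_h_eq_zero (E : HFObj X U) {x : X} {μ : ℝ} (hμ : 0 < μ) {v : E.Fib x}
    (hv : E.h x v = 0) : v ∈ E.low x μ :=
  mem_lowSpace hμ (by rw [hv, map_zero, Complex.ofReal_zero, zero_smul])

open scoped Matrix in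
/-- Near a point at which `h` is invertible the eigenvalues of `h²` are bounded away from zero:
a lower bound for `h²` in a local frame is given by the determinant and the adjugate of its matrix,
which depend continuously on the point. -/
theorem exists_low_eq_bot (E : HFObj X U) {x : X} (hx : x ∈ U) (hinv : E.Inv x) :
    ∃ V : Set X, IsOpen V ∧ x ∈ V ∧ V ⊆ U ∧ ∃ μ > 0, ∀ y ∈ V, E.Inv y ∧ E.low y μ = ⊥ := by
  classical
  obtain ⟨i, hi⟩ := E.exists_mem_dom hx
  have := Fintype.ofFinite (E.rk i)
  let M : X → Matrix (E.rk i) (E.rk i) ℂ := fun y =>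
    Matrix.of fun l k => ⟪E.frame i l y, E.h y (E.frame i k y)⟫_ℂ
  have hM : ContinuousOn M (E.dom i) := by
    refine continuousOn_pi.2 fun l => continuousOn_pi.2 fun k => ?_
    exact (E.continuous_h i i k l).mono fun y hy => ⟨E.dom_subset i hy, hy, hy⟩
  let c : ∀ y, E.Fib y → E.rk i → ℂ := fun y v k => ⟪E.frame i k y, v⟫_ℂ
  have hc0 : ∀ y ∈ E.dom i, ∀ v, c y v = 0 → v = 0 := by
    intro y hy v hv
    rw [← E.sum_inner_smul_frame hy v]
    refine Finset.sum_eq_zero fun k _ => ?_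
    have : ⟪E.frame i k y, v⟫_ℂ = 0 := congrFun hv k
    rw [this, zero_smul]
  have hcM : ∀ y ∈ E.dom i, ∀ v, c y (E.h y v) = M y *ᵥ c y v := by
    intro y hy v
    funext l
    change ⟪E.frame i l y, E.h y v⟫_ℂ = ∑ k, ⟪E.frame i l y, E.h y (E.frame i k y)⟫_ℂ * c y v k
    conv_lhs => rw [← E.sum_inner_smul_frame hy v]
    simp only [map_sum, map_smul, inner_sum, inner_smul_right]
    exact Finset.sum_congr rfl fun k _ => mul_comm _ _
  have hdet : (M x).det ≠ 0 := by
    intro h0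
    obtain ⟨w, hw, hMw⟩ := Matrix.exists_mulVec_eq_zero_iff.2 h0
    have hcw : c x (∑ k, w k • E.frame i k x) = w := by
      funext l
      have ho := orthonormal_iff_ite.1 (E.orthonormal i x hi)
      simp [c, ho]
    have h1 : E.h x (∑ k, w k • E.frame i k x) = 0 := by
      apply hc0 x hi
      rw [hcM x hi, hcw, hMw]
    have h2 := hinv.1 (h1.trans (map_zero _).symm)
    rw [h2] at hcw
    apply hw
    rw [← hcw]
    funext l
    simp [c]
  have hdetc : ContinuousOn (fun y => ‖(M y).det‖) (E.dom i) :=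
    (Continuous.comp_continuousOn (continuous_id.matrix_det) hM).norm
  let B : X → ℝ := fun y => ∑ l, ∑ k, ‖(M y).adjugate l k‖
  have hBc : ContinuousOn B (E.dom i) := by
    have h1 : Continuous fun N : Matrix (E.rk i) (E.rk i) ℂ => ∑ l, ∑ k, ‖N.adjugate l k‖ := by
      refine continuous_finsetSum _ fun l _ => continuous_finsetSum _ fun k _ => ?_
      exact (continuous_id.matrix_adjugate.matrix_elem l k).norm
    exact h1.comp_continuousOn hM
  have hB0 : ∀ y, 0 ≤ B y := fun y => Finset.sum_nonneg fun l _ => Finset.sum_nonneg fun k _ =>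
    norm_nonneg _
  have hbound : ∀ y w, ‖(M y).det‖ * ‖w‖ ≤ B y * ‖M y *ᵥ w‖ := by
    intro y w
    have h1 : (M y).det • w = (M y).adjugate *ᵥ (M y *ᵥ w) := by
      rw [Matrix.mulVec_mulVec, Matrix.adjugate_mul, Matrix.smul_mulVec, Matrix.one_mulVec]
    rw [← norm_smul, h1, pi_norm_le_iff_of_nonneg (mul_nonneg (hB0 y) (norm_nonneg _))]
    intro l
    calc ‖∑ k, (M y).adjugate l k * (M y *ᵥ w) k‖
        ≤ ∑ k, ‖(M y).adjugate l k‖ * ‖M y *ᵥ w‖ := by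
          refine norm_sum_le_of_le _ fun k _ => ?_
          rw [norm_mul]
          exact mul_le_mul_of_nonneg_left (norm_le_pi_norm _ k) (norm_nonneg _)
      _ = (∑ k, ‖(M y).adjugate l k‖) * ‖M y *ᵥ w‖ := by rw [Finset.sum_mul]
      _ ≤ B y * ‖M y *ᵥ w‖ := by
          refine mul_le_mul_of_nonneg_right ?_ (norm_nonneg _)
          exact Finset.single_le_sum (f := fun l => ∑ k, ‖(M y).adjugate l k‖)
            (fun l _ => Finset.sum_nonneg fun k _ => norm_nonneg _) (Finset.mem_univ l)
  set δ : ℝ := ‖(M x).det‖ / 2 with hδ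
  have hδ0 : 0 < δ := by have := norm_pos_iff.2 hdet; positivity
  set β : ℝ := B x + 1 with hβ
  have hβ0 : 0 < β := by have := hB0 x; positivity
  have hV1 : IsOpen (E.dom i ∩ (fun y => ‖(M y).det‖) ⁻¹' Ioi δ) :=
    hdetc.isOpen_inter_preimage (E.isOpen_dom i) isOpen_Ioi
  have hV2 : IsOpen (E.dom i ∩ B ⁻¹' Iio β) :=
    hBc.isOpen_inter_preimage (E.isOpen_dom i) isOpen_Iio
  refine ⟨_, hV1.inter hV2, ⟨⟨hi, ?_⟩, hi, ?_⟩, fun y hy => E.dom_subset i hy.1.1,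
    δ ^ 2 / β ^ 2, by positivity, ?_⟩
  · change δ < ‖(M x).det‖
    rw [hδ]; have := norm_pos_iff.2 hdet; linarith
  · change B x < β
    rw [hβ]; linarith
  rintro y ⟨⟨hyi, hy1⟩, -, hy2⟩
  replace hy1 : δ < ‖(M y).det‖ := hy1
  replace hy2 : B y < β := hy2
  have hb : ∀ w, δ * ‖w‖ ≤ β * ‖M y *ᵥ w‖ := fun w => by
    refine (mul_le_mul_of_nonneg_right hy1.le (norm_nonneg _)).trans ((hbound y w).trans ?_)
    exact mul_le_mul_of_nonneg_right hy2.le (norm_nonneg _)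
  have hyU := E.dom_subset i hyi
  constructor
  · refine E.inv_of_injective hyU fun v hv => hc0 y hyi v ?_
    have h1 := hb (c y v)
    rw [← hcM y hyi, hv] at h1
    have h2 : c y (0 : E.Fib y) = 0 := by funext k; simp [c]
    rw [h2, norm_zero, mul_zero] at h1
    have h3 : ‖c y v‖ = 0 := le_antisymm (by nlinarith [norm_nonneg (c y v)]) (norm_nonneg _)
    exact norm_eq_zero.1 h3
  · rw [eq_bot_iff]
    intro v hv
    refine lowSpace_induction hv (p := fun v => v ∈ (⊥ : Submodule ℂ (E.Fib y))) ?_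
      (Submodule.zero_mem _) fun v w => Submodule.add_mem _
    intro l hl v hv
    rw [Submodule.mem_bot]
    by_contra hv0
    -- the eigenvalue `l` is nonnegative since `l ‖v‖² = ‖h v‖²`
    have hl0 : 0 ≤ l := by
      have h1 : ⟪E.h y v, E.h y v⟫_ℂ = (l : ℂ) * ⟪v, v⟫_ℂ := by
        rw [E.h_symm y hyU, hv, inner_smul_right]
      rw [inner_self_eq_norm_sq_to_K, inner_self_eq_norm_sq_to_K] at h1
      have h2 : ‖E.h y v‖ ^ 2 = l * ‖v‖ ^ 2 :=
        Complex.ofReal_injective (by push_cast; exact h1)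
      have h3 : 0 < ‖v‖ ^ 2 := by have := norm_pos_iff.2 hv0; positivity
      nlinarith [sq_nonneg ‖E.h y v‖]
    have h1 : M y *ᵥ (M y *ᵥ c y v) = (l : ℂ) • c y v := by
      rw [← hcM y hyi, ← hcM y hyi, hv]
      funext k
      simp [c]
    have h2 := hb (c y v)
    have h3 := hb (M y *ᵥ c y v)
    rw [h1, norm_smul, Complex.norm_real, Real.norm_of_nonneg hl0] at h3
    have hcv : 0 < ‖c y v‖ := norm_pos_iff.2 fun h => hv0 (hc0 y hyi v h)
    have h4 : δ ^ 2 * ‖c y v‖ ≤ β ^ 2 * (l * ‖c y v‖) := by nlinarith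
    have h5 : l * β ^ 2 < δ ^ 2 := (lt_div_iff₀ (by positivity)).1 hl
    nlinarith

end HFObj

end Continuity

/-! ### Germs of morphisms -/

section Germs

variable {X : Type u} [TopologicalSpace X] {X' : Type u} [TopologicalSpace X']

namespace IsHFHom

variable {U U' U'' : Set X} {E : HFObj X U} {E' : HFObj X U'} {E'' : HFObj X U''} {W : Set X}

theorem mono {W' : Set X} {φ : ∀ x, E.Fib x →ₗ[ℂ] E'.Fib x} (h : IsHFHom E E' W φ)
    (hW : W' ⊆ W) : IsHFHom E E' W' φ :=
  ⟨h.1.mono hW, fun x hx => h.2.1 x (hW hx), fun x hx => h.2.2 x (hW hx)⟩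

theorem comp {φ : ∀ x, E.Fib x →ₗ[ℂ] E'.Fib x} {ψ : ∀ x, E'.Fib x →ₗ[ℂ] E''.Fib x}
    (hψ : IsHFHom E' E'' W ψ) (hφ : IsHFHom E E' W φ) (hW : W ⊆ U') :
    IsHFHom E E'' W fun x => ψ x ∘ₗ φ x :=
  ⟨hψ.1.comp hφ.1 hW,
    fun x hx v => by
      rw [LinearMap.comp_apply, hφ.2.1 x hx, hψ.2.1 x hx]; rfl,
    fun x hx v => by
      rw [LinearMap.comp_apply, hφ.2.2 x hx, hψ.2.2 x hx]; rfl⟩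

theorem id : IsHFHom E E W fun _ => LinearMap.id :=
  ⟨.of_frame _root_.id (fun _ => _root_.id) fun _ _ hx => ⟨hx.2, fun _ => rfl⟩,
    fun _ _ _ => rfl, fun _ _ _ => rfl⟩

theorem smulOn {φ : ∀ x, E.Fib x →ₗ[ℂ] E'.Fib x} (h : IsHFHom E E' W φ) {c : X → ℂ}
    (hc : ContinuousOn c W) : IsHFHom E E' W fun x => c x • φ x :=
  ⟨h.1.smulOn hc, fun x hx v => by simp [h.2.1 x hx], fun x hx v => by simp [h.2.2 x hx]⟩

theorem zero : IsHFHom E E' W fun _ => 0 :=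
  ⟨.zero _ _ _, fun _ _ _ => by simp, fun _ _ _ => by simp⟩

theorem ppull {φ : ∀ x, E.Fib x →ₗ[ℂ] E'.Fib x} (h : IsHFHom E E' W φ) {f : X' → X}
    {O : Set X'} (hO : IsOpen O) (hf : ContinuousOn f O) {W' : Set X'} (hW : MapsTo f W' W)
    (hWO : W' ⊆ O) : IsHFHom (E.ppull f O hO hf) (E'.ppull f O hO hf) W' fun x => φ (f x) :=
  ⟨h.1.ppull hO hf hW hWO, fun x hx => h.2.1 (f x) (hW hx), fun x hx => h.2.2 (f x) (hW hx)⟩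

theorem mem_low {φ : ∀ x, E.Fib x →ₗ[ℂ] E'.Fib x} (h : IsHFHom E E' W φ) {x : X} (hx : x ∈ W)
    {μ : ℝ} {v : E.Fib x} (hv : v ∈ E.low x μ) : φ x v ∈ E'.low x μ := by
  refine lowSpace_induction hv (p := fun v => φ x v ∈ E'.low x μ) (fun l hl v hv => ?_) ?_ ?_
  · refine mem_lowSpace hl ?_
    rw [← h.2.2 x hx, ← h.2.2 x hx, hv, map_smul]
  · rw [map_zero]; exact Submodule.zero_mem _
  · intro v w hv hw
    rw [map_add]; exact Submodule.add_mem _ hv hw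

end IsHFHom

variable {H : Type w} [NormedAddCommGroup H] [InnerProductSpace ℂ H]

namespace PreHom

variable {U U' U'' U''' : Set X} {E : HFObj X U} {E' : HFObj X U'} {E'' : HFObj X U''}
  {E''' : HFObj X U'''} {W : Set X} {x : X}

theorem Rel.mono {W' : Set X} (hW' : IsOpen W') {Φ Φ' : PreHom H E E'} (h : Rel W Φ Φ')
    (hW : W' ⊆ W) : Rel W' Φ Φ' := by
  obtain ⟨ζ, hζ, hg, hφ⟩ := h
  refine ⟨ζ, hζ.mono hW, fun x hx => hg x (hW hx), fun x hx => ?_⟩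
  obtain ⟨μ, hμ, V, hV, hxV, -, h⟩ := hφ x (hW hx)
  exact ⟨μ, hμ, V ∩ W', hV.inter hW', ⟨hxV, hx⟩, inter_subset_right, fun y hy => h y hy.1⟩

/-- Equality of the germs at `x` of the morphisms represented by `Φ` and `Φ'`. -/
def GEq (x : X) (Φ Φ' : PreHom H E E') : Prop := ∃ V, IsOpen V ∧ x ∈ V ∧ Rel V Φ Φ'

theorem Rel.geq {Φ Φ' : PreHom H E E'} (h : Rel W Φ Φ') (hW : IsOpen W) (hx : x ∈ W) :
    GEq x Φ Φ' := ⟨W, hW, hx, h⟩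

namespace GEq

theorem refl (x : X) (Φ : PreHom H E E') : GEq x Φ Φ :=
  ⟨univ, isOpen_univ, trivial, fun _ => 1, continuousOn_const, fun _ _ => by simp, fun _ _ =>
    ⟨1, one_pos, univ, isOpen_univ, trivial, Subset.rfl, fun _ _ _ _ => by simp⟩⟩

theorem of_eq {Φ Φ' : PreHom H E E'} (h : Φ = Φ') : GEq x Φ Φ' := h ▸ refl x Φ

theorem symm {Φ Φ' : PreHom H E E'} (h : GEq x Φ Φ') : GEq x Φ' Φ := by
  obtain ⟨W, hW, hx, ζ, hζ, hg, hφ⟩ := h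
  refine ⟨W, hW, hx, fun y => (ζ y)⁻¹, hζ.inv, fun y hy => ?_, fun y hy => ?_⟩
  · rw [hg y hy, mul_assoc, ← map_mul, mul_inv_cancel, map_one, mul_one]
  · obtain ⟨μ, hμ, V, hV, hyV, hVW, h⟩ := hφ y hy
    refine ⟨μ, hμ, V, hV, hyV, hVW, fun z hz v hv => ?_⟩
    rw [LinearMap.smul_apply, h z hz v hv, LinearMap.smul_apply, smul_smul, ← Circle.coe_mul,
      inv_mul_cancel, Circle.coe_one, one_smul]

theorem trans {Φ Φ' Φ'' : PreHom H E E'} (h : GEq x Φ Φ') (h' : GEq x Φ' Φ'') :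
    GEq x Φ Φ'' := by
  obtain ⟨W, hW, hx, h⟩ := h
  obtain ⟨W', hW', hx', h'⟩ := h'
  obtain ⟨ζ, hζ, hg, hφ⟩ := h.mono (hW.inter hW') inter_subset_left
  obtain ⟨ζ', hζ', hg', hφ'⟩ := h'.mono (hW.inter hW') inter_subset_right
  refine ⟨_, hW.inter hW', ⟨hx, hx'⟩, fun y => ζ' y * ζ y, hζ'.mul hζ, fun y hy => ?_,
    fun y hy => ?_⟩
  · rw [hg y hy, hg' y hy, mul_assoc, map_mul]
  · obtain ⟨μ, hμ, V, hV, hyV, hVW, h⟩ := hφ y hy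
    obtain ⟨μ', hμ', V', hV', hyV', hVW', h'⟩ := hφ' y hy
    refine ⟨min μ μ', lt_min hμ hμ', V ∩ V', hV.inter hV', ⟨hyV, hyV'⟩,
      inter_subset_left.trans hVW, fun z hz v hv => ?_⟩
    rw [h z hz.1 v (lowSpace_mono _ (min_le_left _ _) hv), LinearMap.smul_apply,
      h' z hz.2 v (lowSpace_mono _ (min_le_right _ _) hv), LinearMap.smul_apply, smul_smul,
      LinearMap.smul_apply, Circle.coe_mul, mul_comm]

theorem comp_left (Ψ : PreHom H E' E'') {Φ Φ' : PreHom H E E'} (h : GEq x Φ Φ') :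
    GEq x (Ψ.comp Φ) (Ψ.comp Φ') := by
  obtain ⟨W, hW, hx, ζ, hζ, hg, hφ⟩ := h
  refine ⟨W, hW, hx, ζ, hζ, fun y hy => ?_, fun y hy => ?_⟩
  · change Ψ.g y * Φ.g y = Ψ.g y * Φ'.g y * _
    rw [hg y hy, mul_assoc]
  · obtain ⟨μ, hμ, V, hV, hyV, hVW, h⟩ := hφ y hy
    refine ⟨μ, hμ, V, hV, hyV, hVW, fun z hz v hv => ?_⟩
    change Ψ.φ z (Φ.φ z v) = (ζ z : ℂ) • Ψ.φ z (Φ'.φ z v)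
    rw [h z hz v hv, LinearMap.smul_apply, map_smul]

/-- Composition on the right with a morphism preserves equality of germs, since morphisms preserve
the low eigenspaces. -/
theorem comp_right {Ψ Ψ' : PreHom H E' E''} (h : GEq x Ψ Ψ') {Φ : PreHom H E E'}
    (hΦ : IsHFHom E E' W Φ.φ) (hW : IsOpen W) (hx : x ∈ W) :
    GEq x (Ψ.comp Φ) (Ψ'.comp Φ) := by
  obtain ⟨W', hW', hx', h⟩ := h
  obtain ⟨ζ, hζ, hg, hφ⟩ := h.mono (hW'.inter hW) inter_subset_left
  refine ⟨_, hW'.inter hW, ⟨hx', hx⟩, ζ, hζ, fun y hy => ?_, fun y hy => ?_⟩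
  · change Ψ.g y * Φ.g y = Ψ'.g y * Φ.g y * _
    rw [hg y hy, mul_assoc, scalar_comm, mul_assoc]
  · obtain ⟨μ, hμ, V, hV, hyV, hVW, h⟩ := hφ y hy
    refine ⟨μ, hμ, V, hV, hyV, hVW, fun z hz v hv => ?_⟩
    exact h z hz _ (hΦ.mem_low (hVW hz).2 hv)

/-- Germs of morphisms from an object which is invertible at `x` depend only on the lifts `g`, since
the low eigenspaces vanish near `x`. -/
theorem of_inv {Φ Φ' : PreHom H E E'} (hxU : x ∈ U) (hE : E.Inv x) (hW : IsOpen W) (hx : x ∈ W)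
    {ζ : X → Circle} (hζ : ContinuousOn ζ W) (hg : ∀ y ∈ W, Φ.g y = Φ'.g y * scalar H (ζ y)) :
    GEq x Φ Φ' := by
  obtain ⟨V, hV, hxV, -, μ, hμ, h⟩ := E.exists_low_eq_bot hxU hE
  refine ⟨W ∩ V, hW.inter hV, ⟨hx, hxV⟩, ζ, hζ.mono inter_subset_left, fun y hy => hg y hy.1,
    fun y hy => ⟨μ, hμ, W ∩ V, hW.inter hV, hy, Subset.rfl, fun z hz v hv => ?_⟩⟩
  rw [(h z hz.2).2, Submodule.mem_bot] at hv
  rw [hv, map_zero, map_zero]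

end GEq

/-- Representatives with equal germs at every point of `W` represent the same morphism over `W`:
the local functions with values in `U(1)` are determined by the two lifts, and so they agree on
overlaps. -/
theorem rel_of_geq [Nontrivial H] {Φ Φ' : PreHom H E E'} (hW : IsOpen W)
    (h : ∀ x ∈ W, GEq x Φ Φ') : Rel W Φ Φ' := by
  classical
  choose! V hV hxV ζ hζ hg hφ using h
  have heq : ∀ x ∈ W, ∀ y ∈ W, y ∈ V x → ζ y y = ζ x y := fun x hx y hy hyV =>
    scalar_injective H (mul_left_cancel ((hg y hy y (hxV y hy)).symm.trans (hg x hx y hyV)))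
  refine ⟨fun x => ζ x x, fun x hx => ?_, fun x hx => hg x hx x (hxV x hx), fun x hx => ?_⟩
  · refine ContinuousAt.continuousWithinAt ?_
    refine ((hζ x hx).continuousAt ((hV x hx).mem_nhds (hxV x hx))).congr ?_
    filter_upwards [(hV x hx).mem_nhds (hxV x hx), hW.mem_nhds hx] with y hy hyW
    exact (heq x hx y hyW hy).symm
  · obtain ⟨μ, hμ, V', hV', hxV', hVW', h⟩ := hφ x hx x (hxV x hx)
    refine ⟨μ, hμ, V' ∩ W, hV'.inter hW, ⟨hxV', hx⟩, inter_subset_right, fun y hy v hv => ?_⟩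
    refine (h y hy.1 v hv).trans ?_
    change (ζ x y : ℂ) • Φ'.φ y v = (ζ y y : ℂ) • Φ'.φ y v
    rw [heq x hx y hy.2 (hVW' hy.1)]

theorem comp_assoc (Φ'' : PreHom H E'' E''') (Φ' : PreHom H E' E'') (Φ : PreHom H E E') :
    (Φ''.comp Φ').comp Φ = Φ''.comp (Φ'.comp Φ) :=
  congrArg₂ PreHom.mk (funext fun _ => mul_assoc _ _ _) rfl

theorem id_comp (Φ : PreHom H E E') : (PreHom.id E').comp Φ = Φ :=
  congrArg₂ PreHom.mk (funext fun _ => one_mul _) rfl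

theorem comp_id (Φ : PreHom H E E') : Φ.comp (PreHom.id E) = Φ :=
  congrArg₂ PreHom.mk (funext fun _ => mul_one _) rfl

namespace IsMor

variable {P : PrincipalBundle (PU H) X} {s s' s'' : X → P.Total}

theorem mono {W' : Set X} {Φ : PreHom H E E'} (h : Φ.IsMor P s s' W) (hW : W' ⊆ W) :
    Φ.IsMor P s s' W' :=
  ⟨h.1.mono hW, fun x hx => h.2.1 x (hW hx), h.2.2.mono hW⟩

theorem comp {Φ : PreHom H E E'} {Ψ : PreHom H E' E''} (hΨ : Ψ.IsMor P s' s'' W)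
    (hΦ : Φ.IsMor P s s' W) (hW : W ⊆ U') : (Ψ.comp Φ).IsMor P s s'' W :=
  ⟨hΨ.1.mul hΦ.1, fun x hx => by
    change P.act (s'' x) (toPU H (Ψ.g x * Φ.g x)) = s x
    rw [map_mul, P.act_mul, hΨ.2.1 x hx, hΦ.2.1 x hx], hΨ.2.2.comp hΦ.2.2 hW⟩

theorem geq_comp {Φ : PreHom H E E'} (hΦ : Φ.IsMor P s s' W) {Ψ Ψ' : PreHom H E' E''}
    (hW : IsOpen W) (hx : x ∈ W) (h : GEq x Ψ Ψ') : GEq x (Ψ.comp Φ) (Ψ'.comp Φ) :=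
  h.comp_right hΦ.2.2 hW hx

end IsMor

/-- Two lifts of the translation function of two local sections differ by a continuous function
with values in `U(1)`. -/
theorem exists_circle [Nontrivial H] {P : PrincipalBundle (PU H) X} {s s' : X → P.Total}
    {g g' : X → UGroup H} (hg : ContinuousOn g W) (hg' : ContinuousOn g' W)
    (h : ∀ x ∈ W, P.act (s' x) (toPU H (g x)) = s x)
    (h' : ∀ x ∈ W, P.act (s' x) (toPU H (g' x)) = s x) :
    ∃ ζ : X → Circle, ContinuousOn ζ W ∧ ∀ x ∈ W, g x = g' x * scalar H (ζ x) := by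
  have h1 : ∀ x ∈ W, ∃ z : Circle, g x = g' x * scalar H z := fun x hx => by
    refine toPU_eq_iff.1 ?_
    rw [← P.div_act (s' x) (toPU H (g x)), h x hx, ← h' x hx, P.div_act]
  choose! ζ hζ using h1
  exact ⟨ζ, continuousOn_of_eq_mul_scalar hg hg' hζ, hζ⟩

theorem IsMor.geq_of_inv [Nontrivial H] {P : PrincipalBundle (PU H) X} {s s' : X → P.Total}
    {Φ Φ' : PreHom H E E'} (h : Φ.IsMor P s s' W) (h' : Φ'.IsMor P s s' W) (hW : IsOpen W)
    (hx : x ∈ W) (hxU : x ∈ U) (hE : E.Inv x) : GEq x Φ Φ' := by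
  obtain ⟨ζ, hζ, hg⟩ := exists_circle h.1 h'.1 h.2.1 h'.2.1
  exact .of_inv hxU hE hW hx hζ hg

/-- If `Θ` has a left inverse near `x`, then `E` is invertible at `x` when `E'` is: the kernel of
`h` is contained in the low eigenspaces. -/
theorem GEq.inv_of_inv {Θ : PreHom H E E'} {Θ' : PreHom H E' E} (hΘ : IsHFHom E E' W Θ.φ)
    (hx : x ∈ W) (hxU : x ∈ U) (h : GEq x (Θ'.comp Θ) (PreHom.id E)) (hE : E'.Inv x) :
    E.Inv x := by
  refine E.inv_of_injective hxU fun v hv => ?_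
  obtain ⟨V, -, hxV, ζ, -, -, hφ⟩ := h
  obtain ⟨μ, hμ, V', -, hxV', -, hφ⟩ := hφ x hxV
  have h1 : Θ'.φ x (Θ.φ x v) = (ζ x : ℂ) • v := hφ x hxV' v (E.mem_low_of_h_eq_zero hμ hv)
  have h2 : Θ.φ x v = 0 := hE.1 (by rw [← hΘ.2.2 x hx, hv, map_zero, map_zero])
  rw [h2, map_zero] at h1
  exact (smul_eq_zero.1 h1.symm).resolve_left (Circle.coe_ne_zero _)

end PreHom

end Germs

/-! ### The category of germs -/

section GermCategory

variable {X : Type u} [TopologicalSpace X] {H : Type w} [NormedAddCommGroup H]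
  [InnerProductSpace ℂ H]

/-- An object of the category of germs at `x`: a local section of `P` with an object of `HF(U)`,
where `U` contains `x`. -/
structure GObj (P : PrincipalBundle (PU H) X) (x : X) where
  U : Set X
  E : HFObj X U
  s : X → P.Total
  mem : x ∈ U

namespace GObj

variable {P : PrincipalBundle (PU H) X} {x : X}

/-- `Φ` represents a morphism near `x`. -/
def IsRep (A B : GObj P x) (Φ : PreHom H A.E B.E) : Prop :=
  ∃ W, IsOpen W ∧ x ∈ W ∧ Φ.IsMor P A.s B.s W

theorem IsRep.comp {A B C : GObj P x} {Φ : PreHom H A.E B.E} {Ψ : PreHom H B.E C.E}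
    (h : IsRep A B Φ) (h' : IsRep B C Ψ) : IsRep A C (Ψ.comp Φ) := by
  obtain ⟨W, hW, hx, h⟩ := h
  obtain ⟨W', hW', hx', h'⟩ := h'
  exact ⟨W ∩ W' ∩ B.U, (hW.inter hW').inter B.E.isOpen, ⟨⟨hx, hx'⟩, B.mem⟩,
    (h'.mono fun _ h => h.1.2).comp (h.mono fun _ h => h.1.1) inter_subset_right⟩

theorem isRep_id (A : GObj P x) : IsRep A A (PreHom.id A.E) :=
  ⟨univ, isOpen_univ, trivial, continuousOn_const,
    fun y _ => by
      change P.act (A.s y) (toPU H 1) = A.s y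
      rw [map_one, P.act_one], .id⟩

instance setoid (A B : GObj P x) : Setoid {Φ : PreHom H A.E B.E // IsRep A B Φ} where
  r Φ Φ' := PreHom.GEq x Φ.1 Φ'.1
  iseqv := ⟨fun Φ => .refl x Φ.1, .symm, .trans⟩

/-- The germs at `x` of morphisms form a category. -/
instance : Category (GObj P x) where
  Hom A B := Quotient (setoid A B)
  id A := ⟦⟨PreHom.id A.E, A.isRep_id⟩⟧
  comp := Quotient.map₂ (fun Φ Ψ => ⟨Ψ.1.comp Φ.1, Φ.2.comp Ψ.2⟩) (by
    rintro ⟨Φ, hΦ⟩ ⟨Φ', hΦ'⟩ h ⟨Ψ, hΨ⟩ ⟨Ψ', hΨ'⟩ h'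
    obtain ⟨W, hW, hx, hm⟩ := hΦ'
    exact PreHom.GEq.trans (PreHom.GEq.comp_left Ψ h) (hm.geq_comp hW hx h'))
  id_comp := by rintro A B ⟨Φ, h⟩; exact congrArg _ (Subtype.ext Φ.comp_id)
  comp_id := by rintro A B ⟨Φ, h⟩; exact congrArg _ (Subtype.ext Φ.id_comp)
  assoc := by
    rintro A B C D ⟨Φ, h⟩ ⟨Ψ, h'⟩ ⟨Χ, h''⟩
    exact congrArg _ (Subtype.ext (PreHom.comp_assoc Χ Ψ Φ).symm)

/-- `φ` is the germ of `Φ`. -/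
def Rp {A B : GObj P x} (φ : A ⟶ B) (Φ : PreHom H A.E B.E) : Prop :=
  ∃ h : IsRep A B Φ, φ = Quotient.mk (setoid A B) ⟨Φ, h⟩

/-- The germ of `Φ`. -/
def germ {A B : GObj P x} {Φ : PreHom H A.E B.E} (h : IsRep A B Φ) : A ⟶ B :=
  Quotient.mk (setoid A B) ⟨Φ, h⟩

theorem germ_rp {A B : GObj P x} {Φ : PreHom H A.E B.E} (h : IsRep A B Φ) : Rp (germ h) Φ :=
  ⟨h, rfl⟩

theorem Rp.id (A : GObj P x) : Rp (𝟙 A) (PreHom.id A.E) := ⟨A.isRep_id, rfl⟩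

theorem Rp.comp {A B C : GObj P x} {φ : A ⟶ B} {ψ : B ⟶ C} {Φ : PreHom H A.E B.E}
    {Ψ : PreHom H B.E C.E} (h : Rp φ Φ) (h' : Rp ψ Ψ) : Rp (φ ≫ ψ) (Ψ.comp Φ) := by
  obtain ⟨h, rfl⟩ := h
  obtain ⟨h', rfl⟩ := h'
  exact ⟨h.comp h', rfl⟩

theorem Rp.geq_iff {A B : GObj P x} {φ ψ : A ⟶ B} {Φ Ψ : PreHom H A.E B.E} (h : Rp φ Φ)
    (h' : Rp ψ Ψ) : PreHom.GEq x Φ Ψ ↔ φ = ψ := by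
  obtain ⟨h, rfl⟩ := h
  obtain ⟨h', rfl⟩ := h'
  exact ⟨fun hg => Quotient.sound hg, fun hg => Quotient.exact hg⟩

theorem Rp.of_geq {A B : GObj P x} {φ : A ⟶ B} {Φ Ψ : PreHom H A.E B.E} (h : Rp φ Φ)
    (h' : IsRep A B Ψ) (hg : PreHom.GEq x Φ Ψ) : Rp φ Ψ := by
  obtain ⟨h, rfl⟩ := h
  exact ⟨h', Quotient.sound hg⟩

theorem exists_rp {A B : GObj P x} (φ : A ⟶ B) : ∃ Φ, Rp φ Φ := by
  obtain ⟨⟨Φ, h⟩, rfl⟩ := Quotient.exists_rep φ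
  exact ⟨Φ, h, rfl⟩

/-- All germs with an invertible source agree. -/
theorem hom_ext_of_inv [Nontrivial H] {A B : GObj P x} (hA : A.E.Inv x) (φ ψ : A ⟶ B) :
    φ = ψ := by
  obtain ⟨Φ, hΦ⟩ := exists_rp φ
  obtain ⟨Ψ, hΨ⟩ := exists_rp ψ
  rw [← hΦ.geq_iff hΨ]
  obtain ⟨⟨W, hW, hx, hm⟩, -⟩ := hΦ
  obtain ⟨⟨W', hW', hx', hm'⟩, -⟩ := hΨ
  exact (hm.mono inter_subset_left).geq_of_inv (hm'.mono inter_subset_right) (hW.inter hW')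
    ⟨hx, hx'⟩ A.mem hA

theorem inv_of_iso {A B : GObj P x} (i : A ≅ B) (hB : B.E.Inv x) : A.E.Inv x := by
  obtain ⟨Φ, hΦ⟩ := exists_rp i.hom
  obtain ⟨Ψ, hΨ⟩ := exists_rp i.inv
  have h := ((hΦ.comp hΨ).geq_iff (Rp.id A)).2 i.hom_inv_id
  obtain ⟨⟨W, hW, hx, hm⟩, -⟩ := hΦ
  exact h.inv_of_inv hm.2.2 hx A.mem hB

end GObj

end GermCategory

/-! ### Twisted vectorial bundles over open subsets -/

section TV

variable {X : Type u} [TopologicalSpace X] {X' : Type u} [TopologicalSpace X']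
  {H : Type w} [NormedAddCommGroup H] [InnerProductSpace ℂ H]

/-- The data `(𝒰, s_α, g_αβ)` as in `TwistData`, where the open sets `U_α` need not cover `X`. -/
structure LTD (P : PrincipalBundle (PU H) X) where
  ι : Type u
  U : ι → Set X
  isOpen_U : ∀ α, IsOpen (U α)
  s : ι → X → P.Total
  continuousOn_s : ∀ α, ContinuousOn (s α) (U α)
  proj_s : ∀ α, ∀ x ∈ U α, P.proj (s α x) = x
  g : ι → ι → X → UGroup H
  continuousOn_g : ∀ α β, ContinuousOn (g α β) (U α ∩ U β)
  act_g : ∀ α β, ∀ x ∈ U α ∩ U β, P.act (s α x) (toPU H (g α β x)) = s β x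

/-- The data `((E_α, h_α), φ_αβ)` as in `VBData`, with the conditions on the `Φ_αβ` expressed by
germs. -/
structure LVB {P : PrincipalBundle (PU H) X} (D : LTD P) where
  E : ∀ α, HFObj X (D.U α)
  φ : ∀ α β x, (E β).Fib x →ₗ[ℂ] (E α).Fib x
  isHFHom : ∀ α β, IsHFHom (E β) (E α) (D.U α ∩ D.U β) (φ α β)
  unit : ∀ α, ∀ x ∈ D.U α, PreHom.GEq x (⟨D.g α α, φ α α⟩ : PreHom H (E α) (E α)) (PreHom.id (E α))
  cocycle : ∀ α β γ x, x ∈ D.U α → x ∈ D.U β → x ∈ D.U γ → PreHom.GEq x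
    (PreHom.comp ⟨D.g α β, φ α β⟩ ⟨D.g β γ, φ β γ⟩ : PreHom H (E γ) (E α)) ⟨D.g α γ, φ α γ⟩

/-- A twisted vectorial bundle over an open subset of the base. -/
structure TV (P : PrincipalBundle (PU H) X) where
  D : LTD P
  V : LVB D

namespace TV

variable {P : PrincipalBundle (PU H) X} (𝔸 𝔹 ℂ' : TV P) {x : X}

/-- The open set covered by the charts. -/
def dom : Set X := ⋃ a, 𝔸.D.U a

variable {𝔸} in
theorem mem_dom : x ∈ 𝔸.dom ↔ ∃ a, x ∈ 𝔸.D.U a := mem_iUnion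

/-- The morphisms `Φ_αβ`. -/
def Φ (a b : 𝔸.D.ι) : PreHom H (𝔸.V.E b) (𝔸.V.E a) := ⟨𝔸.D.g a b, 𝔸.V.φ a b⟩

theorem isMor (a b : 𝔸.D.ι) :
    (𝔸.Φ a b).IsMor P (𝔸.D.s b) (𝔸.D.s a) (𝔸.D.U a ∩ 𝔸.D.U b) :=
  ⟨𝔸.D.continuousOn_g a b, 𝔸.D.act_g a b, 𝔸.V.isHFHom a b⟩

variable {𝔸}

/-- A chart as an object of the category of germs. -/
abbrev obj {a : 𝔸.D.ι} (ha : x ∈ 𝔸.D.U a) : GObj P x := ⟨_, 𝔸.V.E a, 𝔸.D.s a, ha⟩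

/-- The germ of a transition morphism. -/
def tr {a b : 𝔸.D.ι} (ha : x ∈ 𝔸.D.U a) (hb : x ∈ 𝔸.D.U b) : obj ha ⟶ obj hb :=
  GObj.germ (Φ := 𝔸.Φ b a)
    ⟨_, (𝔸.D.isOpen_U b).inter (𝔸.D.isOpen_U a), ⟨hb, ha⟩, 𝔸.isMor b a⟩

theorem tr_rp {a b : 𝔸.D.ι} (ha : x ∈ 𝔸.D.U a) (hb : x ∈ 𝔸.D.U b) :
    GObj.Rp (tr ha hb) (𝔸.Φ b a) := GObj.germ_rp _

@[simp] theorem tr_self {a : 𝔸.D.ι} (ha : x ∈ 𝔸.D.U a) : tr ha ha = 𝟙 _ :=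
  ((tr_rp ha ha).geq_iff (.id _)).1 (𝔸.V.unit a x ha)

@[simp] theorem tr_tr {a b c : 𝔸.D.ι} (ha : x ∈ 𝔸.D.U a) (hb : x ∈ 𝔸.D.U b)
    (hc : x ∈ 𝔸.D.U c) : tr ha hb ≫ tr hb hc = tr ha hc :=
  (((tr_rp ha hb).comp (tr_rp hb hc)).geq_iff (tr_rp ha hc)).1 (𝔸.V.cocycle c b a x hc hb ha)

@[simp] theorem tr_tr_assoc {a b c : 𝔸.D.ι} (ha : x ∈ 𝔸.D.U a) (hb : x ∈ 𝔸.D.U b)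
    (hc : x ∈ 𝔸.D.U c) {B : GObj P x} (f : obj hc ⟶ B) :
    tr ha hb ≫ tr hb hc ≫ f = tr ha hc ≫ f := by
  rw [← Category.assoc, tr_tr]

/-- The transition isomorphism. -/
def trIso {a b : 𝔸.D.ι} (ha : x ∈ 𝔸.D.U a) (hb : x ∈ 𝔸.D.U b) : obj ha ≅ obj hb :=
  ⟨tr ha hb, tr hb ha, by simp, by simp⟩

/-- A bundle is determined by charts, representatives of the transition morphisms, and the
cocycle condition in the category of germs. -/
def ofCocycle {ι : Type u} (U : ι → Set X) (E : ∀ a, HFObj X (U a)) (s : ι → X → P.Total)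
    (hs : ∀ a, ContinuousOn (s a) (U a)) (hp : ∀ a, ∀ x ∈ U a, P.proj (s a x) = x)
    (Φ : ∀ a b, PreHom H (E b) (E a))
    (hΦ : ∀ a b, (Φ a b).IsMor P (s b) (s a) (U a ∩ U b))
    (unit : ∀ a, ∀ x ∈ U a, PreHom.GEq x (Φ a a) (PreHom.id (E a)))
    (cocycle : ∀ a b c x, x ∈ U a → x ∈ U b → x ∈ U c →
      PreHom.GEq x ((Φ a b).comp (Φ b c)) (Φ a c)) : TV P where
  D := ⟨ι, U, fun a => (E a).isOpen, s, hs, hp, fun a b => (Φ a b).g, fun a b => (hΦ a b).1,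
    fun a b => (hΦ a b).2.1⟩
  V := ⟨E, fun a b => (Φ a b).φ, fun a b => (hΦ a b).2.2, unit, cocycle⟩

/-! ### Refinements -/

/-- The charts of `𝔸` are isomorphic to restrictions of charts of `𝔹`. -/
structure SubData (𝔸 𝔹 : TV P) where
  r : 𝔸.D.ι → 𝔹.D.ι
  le : ∀ a, 𝔸.D.U a ⊆ 𝔹.D.U (r a)
  Θ : ∀ a, PreHom H (𝔸.V.E a) (𝔹.V.E (r a))
  Θ' : ∀ a, PreHom H (𝔹.V.E (r a)) (𝔸.V.E a)
  mor : ∀ a, (Θ a).IsMor P (𝔸.D.s a) (𝔹.D.s (r a)) (𝔸.D.U a)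
  mor' : ∀ a, (Θ' a).IsMor P (𝔹.D.s (r a)) (𝔸.D.s a) (𝔸.D.U a)
  left : ∀ a, ∀ x ∈ 𝔸.D.U a, PreHom.GEq x ((Θ' a).comp (Θ a)) (.id _)
  right : ∀ a, ∀ x ∈ 𝔸.D.U a, PreHom.GEq x ((Θ a).comp (Θ' a)) (.id _)
  comm : ∀ a b x, x ∈ 𝔸.D.U a → x ∈ 𝔸.D.U b →
    PreHom.GEq x ((𝔹.Φ (r b) (r a)).comp (Θ a)) ((Θ b).comp (𝔸.Φ b a))

/-- `𝔸` refines a part of `𝔹`, up to isomorphism of charts. -/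
def Sub (𝔸 𝔹 : TV P) : Prop := Nonempty (SubData 𝔸 𝔹)

namespace SubData

variable {𝔸 𝔹 ℂ' : TV P} (S : SubData 𝔸 𝔹)

/-- The germ of the isomorphism between a chart of `𝔸` and a chart of `𝔹`. -/
def iso {a : 𝔸.D.ι} (ha : x ∈ 𝔸.D.U a) : obj ha ≅ obj (S.le a ha) where
  hom := GObj.germ (Φ := S.Θ a) ⟨_, 𝔸.D.isOpen_U a, ha, S.mor a⟩
  inv := GObj.germ (Φ := S.Θ' a) ⟨_, 𝔸.D.isOpen_U a, ha, S.mor' a⟩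
  hom_inv_id := (((GObj.germ_rp _).comp (GObj.germ_rp _)).geq_iff (.id _)).1 (S.left a x ha)
  inv_hom_id := (((GObj.germ_rp _).comp (GObj.germ_rp _)).geq_iff (.id _)).1 (S.right a x ha)

theorem hom_rp {a : 𝔸.D.ι} (ha : x ∈ 𝔸.D.U a) : GObj.Rp (S.iso ha).hom (S.Θ a) :=
  GObj.germ_rp _

theorem inv_rp {a : 𝔸.D.ι} (ha : x ∈ 𝔸.D.U a) : GObj.Rp (S.iso ha).inv (S.Θ' a) :=
  GObj.germ_rp _

theorem hom_tr {a b : 𝔸.D.ι} (ha : x ∈ 𝔸.D.U a) (hb : x ∈ 𝔸.D.U b) :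
    (S.iso ha).hom ≫ tr (S.le a ha) (S.le b hb) = tr ha hb ≫ (S.iso hb).hom :=
  (((S.hom_rp ha).comp (tr_rp _ _)).geq_iff ((tr_rp _ _).comp (S.hom_rp hb))).1
    (S.comm a b x ha hb)

/-- Refinements compose. -/
def trans (T : SubData 𝔹 ℂ') : SubData 𝔸 ℂ' where
  r a := T.r (S.r a)
  le a := (S.le a).trans (T.le _)
  Θ a := (T.Θ (S.r a)).comp (S.Θ a)
  Θ' a := (S.Θ' a).comp (T.Θ' (S.r a))
  mor a := ((T.mor _).mono (S.le a)).comp (S.mor a) (S.le a)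
  mor' a := (S.mor' a).comp ((T.mor' _).mono (S.le a)) (S.le a)
  left a x ha := by
    refine (((S.hom_rp ha).comp (T.hom_rp (S.le a ha))).comp
      ((T.inv_rp (S.le a ha)).comp (S.inv_rp ha))).geq_iff (.id _) |>.2 ?_
    simp
  right a x ha := by
    refine (((T.inv_rp (S.le a ha)).comp (S.inv_rp ha)).comp
      ((S.hom_rp ha).comp (T.hom_rp (S.le a ha)))).geq_iff (.id _) |>.2 ?_
    simp
  comm a b x ha hb := by
    refine (((S.hom_rp ha).comp (T.hom_rp (S.le a ha))).comp (tr_rp _ (T.le _ (S.le b hb)))).geq_iff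
      ((tr_rp _ _).comp ((S.hom_rp hb).comp (T.hom_rp (S.le b hb)))) |>.2 ?_
    rw [Category.assoc, T.hom_tr, ← Category.assoc, S.hom_tr, Category.assoc]

end SubData

theorem Sub.trans {𝔸 𝔹 ℂ' : TV P} (h : Sub 𝔸 𝔹) (h' : Sub 𝔹 ℂ') : Sub 𝔸 ℂ' :=
  ⟨h.some.trans h'.some⟩

theorem Sub.dom_le {𝔸 𝔹 : TV P} (h : Sub 𝔸 𝔹) : 𝔸.dom ⊆ 𝔹.dom := by
  obtain ⟨S⟩ := h
  exact iUnion_subset fun a => (S.le a).trans (subset_iUnion _ _)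

/-- A refinement all of whose comparison maps are given by honest isomorphisms of bundles. -/
theorem Sub.of_iso {𝔸 𝔹 : TV P} (r : 𝔸.D.ι → 𝔹.D.ι) (le : ∀ a, 𝔸.D.U a ⊆ 𝔹.D.U (r a))
    (hs : ∀ a, ∀ x ∈ 𝔸.D.U a, 𝔸.D.s a x = 𝔹.D.s (r a) x)
    (hg : ∀ a b, ∀ x ∈ 𝔸.D.U a ∩ 𝔸.D.U b, 𝔸.D.g a b x = 𝔹.D.g (r a) (r b) x)
    (θ : ∀ a x, (𝔸.V.E a).Fib x →ₗ[ℂ] (𝔹.V.E (r a)).Fib x)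
    (θ' : ∀ a x, (𝔹.V.E (r a)).Fib x →ₗ[ℂ] (𝔸.V.E a).Fib x)
    (hθ : ∀ a, IsHFHom (𝔸.V.E a) (𝔹.V.E (r a)) (𝔸.D.U a) (θ a))
    (hθ' : ∀ a, IsHFHom (𝔹.V.E (r a)) (𝔸.V.E a) (𝔸.D.U a) (θ' a))
    (left : ∀ a, ∀ x ∈ 𝔸.D.U a, ∀ v, θ' a x (θ a x v) = v)
    (right : ∀ a, ∀ x ∈ 𝔸.D.U a, ∀ v, θ a x (θ' a x v) = v)
    (comm : ∀ a b, ∀ x ∈ 𝔸.D.U a ∩ 𝔸.D.U b, ∀ v,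
      𝔹.V.φ (r a) (r b) x (θ b x v) = θ a x (𝔸.V.φ a b x v)) : Sub 𝔸 𝔹 := by
  have key : ∀ {x : X} {U U' : Set X} {E : HFObj X U} {E' : HFObj X U'} {Φ Φ' : PreHom H E E'}
      (W : Set X) (_ : IsOpen W) (_ : x ∈ W), (∀ y ∈ W, Φ.g y = Φ'.g y) →
      (∀ y ∈ W, ∀ v, Φ.φ y v = Φ'.φ y v) →
      PreHom.GEq x Φ Φ' := fun W hW hx h1 h2 =>
    ⟨W, hW, hx, fun _ => 1, continuousOn_const, fun y hy => by simp [h1 y hy], fun y hy =>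
      ⟨1, one_pos, W, hW, hy, Subset.rfl, fun z hz v _ => by simp [h2 z hz]⟩⟩
  refine ⟨⟨r, le, fun a => ⟨fun _ => 1, θ a⟩, fun a => ⟨fun _ => 1, θ' a⟩,
    fun a => ⟨continuousOn_const, fun x hx => ?_, hθ a⟩,
    fun a => ⟨continuousOn_const, fun x hx => ?_, hθ' a⟩, fun a x hx => ?_, fun a x hx => ?_,
    fun a b x ha hb => ?_⟩⟩
  · rw [map_one, P.act_one, hs a x hx]
  · rw [map_one, P.act_one, hs a x hx]
  · refine key _ (𝔸.D.isOpen_U a) hx (fun y _ => one_mul 1) (left a)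
  · refine key _ (𝔸.D.isOpen_U a) hx (fun y _ => one_mul 1) (right a)
  · refine key _ ((𝔸.D.isOpen_U b).inter (𝔸.D.isOpen_U a)) ⟨hb, ha⟩ (fun y hy => ?_)
      (comm b a)
    change 𝔹.D.g (r b) (r a) y * 1 = 1 * 𝔸.D.g b a y
    rw [mul_one, one_mul, hg b a y hy]

theorem Sub.refl (𝔸 : TV P) : Sub 𝔸 𝔸 :=
  .of_iso id (fun _ => Subset.rfl) (fun _ _ _ => rfl) (fun _ _ _ _ => rfl)
    (fun _ _ => LinearMap.id) (fun _ _ => LinearMap.id) (fun _ => .id) (fun _ => .id)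
    (fun _ _ _ _ => rfl) (fun _ _ _ _ => rfl) fun _ _ _ _ _ => rfl

/-! ### Invertibility -/

/-- The Hermitian maps of `𝔸` are invertible at `x`. -/
def InvAt (𝔸 : TV P) (x : X) : Prop := ∀ a, x ∈ 𝔸.D.U a → (𝔸.V.E a).Inv x

theorem InvAt.of_mem {𝔸 : TV P} {a : 𝔸.D.ι} (ha : x ∈ 𝔸.D.U a) (h : (𝔸.V.E a).Inv x) :
    𝔸.InvAt x := fun _ hb => GObj.inv_of_iso (trIso hb ha) h

theorem SubData.inv_iff {𝔸 𝔹 : TV P} (S : SubData 𝔸 𝔹) {a : 𝔸.D.ι} (ha : x ∈ 𝔸.D.U a) :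
    (𝔸.V.E a).Inv x ↔ (𝔹.V.E (S.r a)).Inv x :=
  ⟨GObj.inv_of_iso (S.iso ha).symm, GObj.inv_of_iso (S.iso ha)⟩

theorem Sub.invAt {𝔸 𝔹 : TV P} (h : Sub 𝔸 𝔹) (hx : 𝔹.InvAt x) : 𝔸.InvAt x := by
  obtain ⟨S⟩ := h
  exact fun a ha => (S.inv_iff ha).2 (hx _ (S.le a ha))

theorem Sub.invAt_of_mem {𝔸 𝔹 : TV P} (h : Sub 𝔸 𝔹) (hx : 𝔸.InvAt x) (hd : x ∈ 𝔸.dom) :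
    𝔹.InvAt x := by
  obtain ⟨S⟩ := h
  obtain ⟨a, ha⟩ := mem_dom.1 hd
  exact .of_mem (S.le a ha) ((S.inv_iff ha).1 (hx a ha))

theorem isOpen_invAt (𝔸 : TV P) : IsOpen {x | x ∈ 𝔸.dom ∧ 𝔸.InvAt x} := by
  refine isOpen_iff_mem_nhds.2 fun x hx => ?_
  obtain ⟨a, ha⟩ := mem_dom.1 hx.1
  obtain ⟨V, hV, hxV, hVU, μ, -, h⟩ := (𝔸.V.E a).exists_low_eq_bot ha (hx.2 a ha)
  filter_upwards [hV.mem_nhds hxV] with y hy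
  exact ⟨mem_dom.2 ⟨a, hVU hy⟩, .of_mem (hVU hy) (h y hy).1⟩

/-! ### Compatible bundles -/

/-- A compatible family of isomorphisms between the charts of `𝔸` and the charts of `𝔹`. -/
structure CompatData (𝔸 𝔹 : TV P) where
  Ψ : ∀ a b, PreHom H (𝔸.V.E a) (𝔹.V.E b)
  Ψ' : ∀ a b, PreHom H (𝔹.V.E b) (𝔸.V.E a)
  mor : ∀ a b, (Ψ a b).IsMor P (𝔸.D.s a) (𝔹.D.s b) (𝔸.D.U a ∩ 𝔹.D.U b)
  mor' : ∀ a b, (Ψ' a b).IsMor P (𝔹.D.s b) (𝔸.D.s a) (𝔸.D.U a ∩ 𝔹.D.U b)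
  left : ∀ a b x, x ∈ 𝔸.D.U a → x ∈ 𝔹.D.U b → PreHom.GEq x ((Ψ' a b).comp (Ψ a b)) (.id _)
  right : ∀ a b x, x ∈ 𝔸.D.U a → x ∈ 𝔹.D.U b → PreHom.GEq x ((Ψ a b).comp (Ψ' a b)) (.id _)
  comm : ∀ a a' b b' x, x ∈ 𝔸.D.U a → x ∈ 𝔸.D.U a' → x ∈ 𝔹.D.U b → x ∈ 𝔹.D.U b' →
    PreHom.GEq x ((Ψ a' b').comp (𝔸.Φ a' a)) ((𝔹.Φ b' b).comp (Ψ a b))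

/-- `𝔸` and `𝔹` are isomorphic over the intersection of their domains. -/
def Compat (𝔸 𝔹 : TV P) : Prop := Nonempty (CompatData 𝔸 𝔹)

namespace CompatData

variable {𝔸 𝔹 ℂ' : TV P} (C : CompatData 𝔸 𝔹)

/-- The germ of the isomorphism between two charts. -/
def iso {a : 𝔸.D.ι} {b : 𝔹.D.ι} (ha : x ∈ 𝔸.D.U a) (hb : x ∈ 𝔹.D.U b) : obj ha ≅ obj hb where
  hom := GObj.germ (Φ := C.Ψ a b)
    ⟨_, (𝔸.D.isOpen_U a).inter (𝔹.D.isOpen_U b), ⟨ha, hb⟩, C.mor a b⟩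
  inv := GObj.germ (Φ := C.Ψ' a b)
    ⟨_, (𝔸.D.isOpen_U a).inter (𝔹.D.isOpen_U b), ⟨ha, hb⟩, C.mor' a b⟩
  hom_inv_id := (((GObj.germ_rp _).comp (GObj.germ_rp _)).geq_iff (.id _)).1 (C.left a b x ha hb)
  inv_hom_id := (((GObj.germ_rp _).comp (GObj.germ_rp _)).geq_iff (.id _)).1 (C.right a b x ha hb)

theorem hom_rp {a : 𝔸.D.ι} {b : 𝔹.D.ι} (ha : x ∈ 𝔸.D.U a) (hb : x ∈ 𝔹.D.U b) :
    GObj.Rp (C.iso ha hb).hom (C.Ψ a b) := GObj.germ_rp _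

theorem inv_rp {a : 𝔸.D.ι} {b : 𝔹.D.ι} (ha : x ∈ 𝔸.D.U a) (hb : x ∈ 𝔹.D.U b) :
    GObj.Rp (C.iso ha hb).inv (C.Ψ' a b) := GObj.germ_rp _

theorem tr_hom {a a' : 𝔸.D.ι} {b b' : 𝔹.D.ι} (ha : x ∈ 𝔸.D.U a) (ha' : x ∈ 𝔸.D.U a')
    (hb : x ∈ 𝔹.D.U b) (hb' : x ∈ 𝔹.D.U b') :
    tr ha ha' ≫ (C.iso ha' hb').hom = (C.iso ha hb).hom ≫ tr hb hb' :=
  (((tr_rp _ _).comp (C.hom_rp ha' hb')).geq_iff ((C.hom_rp ha hb).comp (tr_rp _ _))).1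
    (C.comm a a' b b' x ha ha' hb hb')

@[simp] theorem tr_hom' {a a' : 𝔸.D.ι} {b : 𝔹.D.ι} (ha : x ∈ 𝔸.D.U a) (ha' : x ∈ 𝔸.D.U a')
    (hb : x ∈ 𝔹.D.U b) : tr ha ha' ≫ (C.iso ha' hb).hom = (C.iso ha hb).hom := by
  rw [C.tr_hom ha ha' hb hb, tr_self, Category.comp_id]

@[simp] theorem hom_tr {a : 𝔸.D.ι} {b b' : 𝔹.D.ι} (ha : x ∈ 𝔸.D.U a)
    (hb : x ∈ 𝔹.D.U b) (hb' : x ∈ 𝔹.D.U b') :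
    (C.iso ha hb).hom ≫ tr hb hb' = (C.iso ha hb').hom := by
  rw [← C.tr_hom ha ha hb hb', tr_self, Category.id_comp]

@[simp] theorem inv_tr {a a' : 𝔸.D.ι} {b : 𝔹.D.ι} (ha : x ∈ 𝔸.D.U a) (ha' : x ∈ 𝔸.D.U a')
    (hb : x ∈ 𝔹.D.U b) : (C.iso ha hb).inv ≫ tr ha ha' = (C.iso ha' hb).inv := by
  rw [Iso.inv_comp_eq, ← C.tr_hom' ha ha' hb, Category.assoc, Iso.hom_inv_id, Category.comp_id]

@[simp] theorem tr_inv {a : 𝔸.D.ι} {b b' : 𝔹.D.ι} (ha : x ∈ 𝔸.D.U a)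
    (hb : x ∈ 𝔹.D.U b) (hb' : x ∈ 𝔹.D.U b') :
    tr hb hb' ≫ (C.iso ha hb').inv = (C.iso ha hb).inv := by
  rw [Iso.comp_inv_eq, Iso.eq_inv_comp, C.hom_tr]

@[simp] theorem hom_inv {a a' : 𝔸.D.ι} {b : 𝔹.D.ι} (ha : x ∈ 𝔸.D.U a) (ha' : x ∈ 𝔸.D.U a')
    (hb : x ∈ 𝔹.D.U b) : (C.iso ha hb).hom ≫ (C.iso ha' hb).inv = tr ha ha' := by
  rw [Iso.comp_inv_eq, C.tr_hom']

@[simp] theorem inv_hom {a : 𝔸.D.ι} {b b' : 𝔹.D.ι} (ha : x ∈ 𝔸.D.U a) (hb : x ∈ 𝔹.D.U b)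
    (hb' : x ∈ 𝔹.D.U b') : (C.iso ha hb).inv ≫ (C.iso ha hb').hom = tr hb hb' := by
  rw [Iso.inv_comp_eq, C.hom_tr]

/-- The inverse family. -/
def symm : CompatData 𝔹 𝔸 where
  Ψ b a := C.Ψ' a b
  Ψ' b a := C.Ψ a b
  mor b a := inter_comm (𝔸.D.U a) _ ▸ C.mor' a b
  mor' b a := inter_comm (𝔸.D.U a) _ ▸ C.mor a b
  left b a x hb ha := C.right a b x ha hb
  right b a x hb ha := C.left a b x ha hb
  comm b b' a a' x hb hb' ha ha' := by
    refine ((tr_rp hb hb').comp (C.inv_rp ha' hb')).geq_iff ((C.inv_rp ha hb).comp (tr_rp _ _)) |>.2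
      ?_
    simp

/-- Compatibility passes to refinements. -/
def subLeft {𝔸' : TV P} (S : SubData 𝔸' 𝔸) : CompatData 𝔸' 𝔹 where
  Ψ a b := (C.Ψ (S.r a) b).comp (S.Θ a)
  Ψ' a b := (S.Θ' a).comp (C.Ψ' (S.r a) b)
  mor a b := ((C.mor _ b).mono (inter_subset_inter_left _ (S.le a))).comp
    ((S.mor a).mono inter_subset_left) (inter_subset_left.trans (S.le a))
  mor' a b := ((S.mor' a).mono inter_subset_left).comp
    ((C.mor' _ b).mono (inter_subset_inter_left _ (S.le a))) (inter_subset_left.trans (S.le a))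
  left a b x ha hb := by
    refine (((S.hom_rp ha).comp (C.hom_rp (S.le a ha) hb)).comp
      ((C.inv_rp (S.le a ha) hb).comp (S.inv_rp ha))).geq_iff (.id _) |>.2 ?_
    simp
  right a b x ha hb := by
    refine (((C.inv_rp (S.le a ha) hb).comp (S.inv_rp ha)).comp
      ((S.hom_rp ha).comp (C.hom_rp (S.le a ha) hb))).geq_iff (.id _) |>.2 ?_
    simp
  comm a a' b b' x ha ha' hb hb' := by
    refine ((tr_rp ha ha').comp ((S.hom_rp ha').comp (C.hom_rp (S.le a' ha') hb'))).geq_iff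
      (((S.hom_rp ha).comp (C.hom_rp (S.le a ha) hb)).comp (tr_rp hb hb')) |>.2 ?_
    rw [← Category.assoc, ← S.hom_tr ha ha', Category.assoc, Category.assoc, C.tr_hom', C.hom_tr]

end CompatData

theorem Compat.symm {𝔸 𝔹 : TV P} (h : Compat 𝔸 𝔹) : Compat 𝔹 𝔸 := ⟨h.some.symm⟩

theorem Compat.refl (𝔸 : TV P) : Compat 𝔸 𝔸 :=
  ⟨{ Ψ := fun a b => 𝔸.Φ b a
     Ψ' := fun a b => 𝔸.Φ a b
     mor := fun a b => inter_comm (𝔸.D.U a) _ ▸ 𝔸.isMor b a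
     mor' := fun a b => 𝔸.isMor a b
     left := fun a b x ha hb =>
      ((tr_rp ha hb).comp (tr_rp hb ha)).geq_iff (.id _) |>.2 (by simp)
     right := fun a b x ha hb =>
      ((tr_rp hb ha).comp (tr_rp ha hb)).geq_iff (.id _) |>.2 (by simp)
     comm := fun a a' b b' x ha ha' hb hb' =>
      ((tr_rp ha ha').comp (tr_rp ha' hb')).geq_iff ((tr_rp ha hb).comp (tr_rp hb hb')) |>.2
        (by simp) }⟩

theorem Compat.of_sub {𝔸 𝔹 𝔸' 𝔹' : TV P} (h : Compat 𝔸 𝔹) (hA : Sub 𝔸' 𝔸) (hB : Sub 𝔹' 𝔹) :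
    Compat 𝔸' 𝔹' :=
  ⟨((h.some.subLeft hA.some).symm.subLeft hB.some).symm⟩

end TV

end TV

namespace TV

/-! ### Gluing -/

section glue

variable {X : Type u} [TopologicalSpace X] {H : Type w} [NormedAddCommGroup H]
  [InnerProductSpace ℂ H] {P : PrincipalBundle (PU H) X} {𝔸 𝔹 : TV P} (C : CompatData 𝔸 𝔹) {x : X}

namespace CompatData

/-- The open sets of the union. -/
abbrev glueU (𝔸 𝔹 : TV P) : 𝔸.D.ι ⊕ 𝔹.D.ι → Set X := Sum.elim 𝔸.D.U 𝔹.D.U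

/-- The objects of the union. -/
abbrev glueE (𝔸 𝔹 : TV P) : ∀ i, HFObj X (glueU 𝔸 𝔹 i)
  | .inl a => 𝔸.V.E a
  | .inr b => 𝔹.V.E b

/-- The transition morphisms of the union. -/
abbrev glueΦ : ∀ i j, PreHom H (glueE 𝔸 𝔹 j) (glueE 𝔸 𝔹 i)
  | .inl a, .inl a' => 𝔸.Φ a a'
  | .inl a, .inr b => C.Ψ' a b
  | .inr b, .inl a => C.Ψ a b
  | .inr b, .inr b' => 𝔹.Φ b b'

/-- The union of two compatible bundles. -/
def glue : TV P :=
  ofCocycle (glueU 𝔸 𝔹) (glueE 𝔸 𝔹) (Sum.elim 𝔸.D.s 𝔹.D.s)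
    (by rintro (a | b); exacts [𝔸.D.continuousOn_s a, 𝔹.D.continuousOn_s b])
    (by rintro (a | b); exacts [𝔸.D.proj_s a, 𝔹.D.proj_s b]) C.glueΦ
    (by
      rintro (a | b) (a' | b')
      exacts [𝔸.isMor a a', C.mor' a b', inter_comm (𝔸.D.U a') _ ▸ C.mor a' b, 𝔹.isMor b b'])
    (by rintro (a | b); exacts [𝔸.V.unit a, 𝔹.V.unit b])
    (by
      rintro (a | b) (a' | b') (a'' | b'') x h h' h''
      · exact 𝔸.V.cocycle a a' a'' x h h' h''
      · exact ((C.inv_rp h' h'').comp (tr_rp h' h)).geq_iff (C.inv_rp h h'') |>.2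
          (C.inv_tr h' h h'')
      · exact ((C.hom_rp h'' h').comp (C.inv_rp h h')).geq_iff (tr_rp h'' h) |>.2
          (C.hom_inv h'' h h')
      · exact ((tr_rp h'' h').comp (C.inv_rp h h')).geq_iff (C.inv_rp h h'') |>.2
          (C.tr_inv h h'' h')
      · exact ((tr_rp h'' h').comp (C.hom_rp h' h)).geq_iff (C.hom_rp h'' h) |>.2
          (C.tr_hom' h'' h' h)
      · exact ((C.inv_rp h' h'').comp (C.hom_rp h' h)).geq_iff (tr_rp h'' h) |>.2
          (C.inv_hom h' h'' h)
      · exact ((C.hom_rp h'' h').comp (tr_rp h' h)).geq_iff (C.hom_rp h'' h) |>.2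
          (C.hom_tr h'' h' h)
      · exact 𝔹.V.cocycle b b' b'' x h h' h'')

theorem sub_glue_left : Sub 𝔸 C.glue :=
  .of_iso (𝔹 := C.glue) Sum.inl (fun _ => Subset.rfl) (fun _ _ _ => rfl) (fun _ _ _ _ => rfl)
    (fun _ _ => LinearMap.id) (fun _ _ => LinearMap.id) (fun _ => .id) (fun _ => .id)
    (fun _ _ _ _ => rfl) (fun _ _ _ _ => rfl) fun _ _ _ _ _ => rfl

theorem sub_glue_right : Sub 𝔹 C.glue :=
  .of_iso (𝔹 := C.glue) Sum.inr (fun _ => Subset.rfl) (fun _ _ _ => rfl) (fun _ _ _ _ => rfl)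
    (fun _ _ => LinearMap.id) (fun _ _ => LinearMap.id) (fun _ => .id) (fun _ => .id)
    (fun _ _ _ _ => rfl) (fun _ _ _ _ => rfl) fun _ _ _ _ _ => rfl

theorem dom_glue : C.glue.dom = 𝔸.dom ∪ 𝔹.dom := iUnion_sumElim 𝔸.D.U 𝔹.D.U

theorem invAt_glue (h : 𝔸.InvAt x) (h' : 𝔹.InvAt x) : C.glue.InvAt x := by
  rintro (a | b) hx
  exacts [h a hx, h' b hx]

end CompatData

/-- Two bundles over disjoint open sets are compatible. -/
theorem Compat.of_disjoint (𝔸 𝔹 : TV P) (h : Disjoint 𝔸.dom 𝔹.dom) : Compat 𝔸 𝔹 := by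
  have h0 : ∀ {a b x}, x ∈ 𝔸.D.U a → x ∈ 𝔹.D.U b → False := fun ha hb =>
    disjoint_left.1 h (mem_dom.2 ⟨_, ha⟩) (mem_dom.2 ⟨_, hb⟩)
  have h1 : ∀ a b, 𝔸.D.U a ∩ 𝔹.D.U b = ∅ := fun a b =>
    eq_empty_of_forall_notMem fun x hx => h0 hx.1 hx.2
  exact ⟨{
    Ψ := fun a b => ⟨1, fun _ => 0⟩
    Ψ' := fun a b => ⟨1, fun _ => 0⟩
    mor := fun a b => h1 a b ▸ ⟨continuousOn_empty _, fun _ h => h.elim, .zero⟩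
    mor' := fun a b => h1 a b ▸ ⟨continuousOn_empty _, fun _ h => h.elim, .zero⟩
    left := fun a b x ha hb => (h0 ha hb).elim
    right := fun a b x ha hb => (h0 ha hb).elim
    comm := fun a a' b b' x ha ha' hb hb' => (h0 ha hb).elim }⟩

/-- A union of two bundles is compatible with a third bundle when both pieces are, and the triple
intersection of the domains is empty or the bundles are invertible on it. -/
theorem Compat.glue [Nontrivial H] {ℰ : TV P} (h : Compat 𝔸 ℰ) (h' : Compat 𝔹 ℰ)
    (hinv : ∀ x, x ∈ 𝔸.dom → x ∈ 𝔹.dom → x ∈ ℰ.dom → 𝔸.InvAt x) : Compat C.glue ℰ := by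
  obtain ⟨K⟩ := h
  obtain ⟨K'⟩ := h'
  refine ⟨{
    Ψ := fun | .inl a, e => K.Ψ a e | .inr b, e => K'.Ψ b e
    Ψ' := fun | .inl a, e => K.Ψ' a e | .inr b, e => K'.Ψ' b e
    mor := by rintro (a | b) e; exacts [K.mor a e, K'.mor b e]
    mor' := by rintro (a | b) e; exacts [K.mor' a e, K'.mor' b e]
    left := by rintro (a | b) e; exacts [K.left a e, K'.left b e]
    right := by rintro (a | b) e; exacts [K.right a e, K'.right b e]
    comm := ?_ }⟩
  rintro (a | a) (a' | a') e e' x ha ha' he he'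
  · exact K.comm a a' e e' x ha ha' he he'
  · refine ((C.hom_rp ha ha').comp (K'.hom_rp ha' he')).geq_iff
      ((K.hom_rp ha he).comp (tr_rp he he')) |>.2 (GObj.hom_ext_of_inv ?_ _ _)
    exact hinv x (mem_dom.2 ⟨_, ha⟩) (mem_dom.2 ⟨_, ha'⟩) (mem_dom.2 ⟨_, he⟩) a ha
  · refine ((C.inv_rp ha' ha).comp (K.hom_rp ha' he')).geq_iff
      ((K'.hom_rp ha he).comp (tr_rp he he')) |>.2 (GObj.hom_ext_of_inv ?_ _ _)
    refine GObj.inv_of_iso (C.iso ha' ha).symm ?_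
    exact hinv x (mem_dom.2 ⟨_, ha'⟩) (mem_dom.2 ⟨_, ha⟩) (mem_dom.2 ⟨_, he⟩) a' ha'
  · exact K'.comm a a' e e' x ha ha' he he'

end glue

end TV

/-! ### Partial bundle maps -/

section PMap

variable {X : Type u} [TopologicalSpace X] {X' : Type u} [TopologicalSpace X']
  {X'' : Type u} [TopologicalSpace X'']
  {G : Type w} [Group G] [TopologicalSpace G] {P : PrincipalBundle G X}
  {P' : PrincipalBundle G X'} {P'' : PrincipalBundle G X''}

/-- A bundle map from the restriction of `P'` to an open set `O` to `P`. -/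
structure PMap (P' : PrincipalBundle G X') (P : PrincipalBundle G X) where
  f : X' → X
  O : Set X'
  isOpen_O : IsOpen O
  continuousOn_f : ContinuousOn f O
  F : P'.Total → P.Total
  continuousOn_F : ContinuousOn F (P'.proj ⁻¹' O)
  proj_F : ∀ p, P'.proj p ∈ O → P.proj (F p) = f (P'.proj p)
  F_act : ∀ p, P'.proj p ∈ O → ∀ a, F (P'.act p a) = P.act (F p) a

namespace PMap

/-- A bundle map as a partial bundle map. -/
def ofHom {f : C(X', X)} (F : P'.Hom P f) : PMap P' P where
  f := f
  O := univ
  isOpen_O := isOpen_univ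
  continuousOn_f := f.continuous.continuousOn
  F := F.toFun
  continuousOn_F := F.continuous_toFun.continuousOn
  proj_F p _ := F.proj_toFun p
  F_act p _ a := F.map_act p a

/-- The identity of the restriction of `P` to `O`. -/
def idOn (P : PrincipalBundle G X) (O : Set X) (hO : IsOpen O) : PMap P P where
  f := id
  O := O
  isOpen_O := hO
  continuousOn_f := continuousOn_id
  F := id
  continuousOn_F := continuousOn_id
  proj_F _ _ := rfl
  F_act _ _ _ := rfl

/-- The composition of partial bundle maps. -/
def comp (F : PMap P' P) (F' : PMap P'' P') : PMap P'' P where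
  f := F.f ∘ F'.f
  O := F'.O ∩ F'.f ⁻¹' F.O
  isOpen_O := F'.continuousOn_f.isOpen_inter_preimage F'.isOpen_O F.isOpen_O
  continuousOn_f := F.continuousOn_f.comp (F'.continuousOn_f.mono inter_subset_left) fun _ h => h.2
  F := F.F ∘ F'.F
  continuousOn_F := F.continuousOn_F.comp
    (F'.continuousOn_F.mono fun _ h => h.1) fun p h => by
      change P'.proj (F'.F p) ∈ F.O
      rw [F'.proj_F p h.1]; exact h.2
  proj_F p h := by
    have h1 := F'.proj_F p h.1
    change P.proj (F.F (F'.F p)) = _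
    rw [F.proj_F _ (by rw [h1]; exact h.2), h1]; rfl
  F_act p h a := by
    have h1 := F'.proj_F p h.1
    change F.F (F'.F _) = P.act (F.F (F'.F p)) a
    rw [F'.F_act p h.1, F.F_act _ (by rw [h1]; exact h.2)]

/-- The restriction of a partial bundle map. -/
def restr (F : PMap P' P) (O : Set X') (hO : IsOpen O) : PMap P' P := F.comp (idOn P' O hO)

/-- The section induced from a section by a partial bundle map. -/
def comapSection (F : PMap P' P) (s : X → P.Total) (x : X') : P'.Total :=
  P'.act (P'.exists_mem_fiber x).choose
    (P.div (F.F (P'.exists_mem_fiber x).choose) (s (F.f x)))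

variable (F : PMap P' P) (s : X → P.Total) {x : X'}

theorem proj_comapSection (x : X') : P'.proj (F.comapSection s x) = x := by
  rw [comapSection, P'.proj_act]
  exact (P'.exists_mem_fiber x).choose_spec

theorem F_comapSection (hx : x ∈ F.O) (hs : P.proj (s (F.f x)) = F.f x) :
    F.F (F.comapSection s x) = s (F.f x) := by
  have h := (P'.exists_mem_fiber x).choose_spec
  rw [comapSection, F.F_act _ (by rw [h]; exact hx), P.act_div]
  rw [F.proj_F _ (by rw [h]; exact hx), h, hs]

theorem injOn {p q : P'.Total} (hp : P'.proj p ∈ F.O) (h : P'.proj p = P'.proj q)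
    (hF : F.F p = F.F q) : p = q := by
  have h1 := P'.act_div p q h
  have h2 : F.F p = P.act (F.F p) (P'.div p q) := by rw [← F.F_act p hp, h1, ← hF]
  have h3 : P'.div p q = 1 := by
    have h4 := P.div_act (F.F p) (P'.div p q)
    have h5 := P.div_act (F.F p) 1
    rw [← h2] at h4
    rw [P.act_one] at h5
    exact h4.symm.trans h5
  rw [← h1, h3, P'.act_one]

theorem eq_comapSection (hx : x ∈ F.O) {p : P'.Total} (hp : P'.proj p = x)
    (hF : F.F p = s (F.f x)) : p = F.comapSection s x := by
  refine F.injOn (by rw [hp]; exact hx) (by rw [hp, F.proj_comapSection]) ?_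
  rw [hF, F.F_comapSection s hx]
  rw [← hF, F.proj_F _ (by rw [hp]; exact hx), hp]

/-- Pulled back sections are continuous: compared with a local section `τ` of `P'`, the difference
of `s ∘ f` and `F ∘ τ` is a continuous function with values in the group. -/
theorem continuousOn_comapSection {U : Set X} (hs : ContinuousOn s U)
    (hsp : ∀ x ∈ U, P.proj (s x) = x) : ContinuousOn (F.comapSection s) (F.O ∩ F.f ⁻¹' U) := by
  intro x hx
  obtain ⟨V, hV, hxV, τ, hτ, hτp⟩ := P'.exists_section x
  have hF : ∀ y ∈ F.O ∩ F.f ⁻¹' U ∩ V, P.proj (F.F (τ y)) = F.f y := fun y hy => by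
    rw [F.proj_F _ (by rw [hτp y hy.2]; exact hy.1.1), hτp y hy.2]
  have key : ContinuousOn (fun y => P'.act (τ y) (P.div (F.F (τ y)) (s (F.f y))))
      (F.O ∩ F.f ⁻¹' U ∩ V) := by
    have hτ' : ContinuousOn τ (F.O ∩ F.f ⁻¹' U ∩ V) := hτ.mono inter_subset_right
    refine P'.continuous_act.comp_continuousOn (hτ'.prodMk ?_)
    refine P.continuousOn_div.comp (f := fun y => (F.F (τ y), s (F.f y))) ?_ ?_
    · refine (F.continuousOn_F.comp hτ' fun y hy => ?_).prodMk ?_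
      · change P'.proj (τ y) ∈ F.O
        rw [hτp y hy.2]; exact hy.1.1
      · exact hs.comp (F.continuousOn_f.mono fun y hy => hy.1.1) fun y hy => hy.1.2
    · intro y hy
      change P.proj (F.F (τ y)) = P.proj (s (F.f y))
      rw [hF y hy, hsp _ hy.1.2]
  have key2 : ContinuousOn (F.comapSection s) (F.O ∩ F.f ⁻¹' U ∩ V) := by
    refine key.congr fun y hy => ?_
    symm
    apply F.eq_comapSection s hy.1.1
    · rw [P'.proj_act, hτp y hy.2]
    · rw [F.F_act _ (by rw [hτp y hy.2]; exact hy.1.1), P.act_div]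
      rw [hF y hy, hsp _ hy.1.2]
  exact (continuousWithinAt_inter (hV.mem_nhds hxV)).1 (key2 x ⟨hx, hxV⟩)

end PMap

end PMap

section pull

variable {X : Type u} [TopologicalSpace X] {X' : Type u} [TopologicalSpace X']
  {X'' : Type u} [TopologicalSpace X''] {H : Type w} [NormedAddCommGroup H]
  [InnerProductSpace ℂ H]

/-- The pull-back of a representative along a partially defined map. -/
def PreHom.ppull {U U' : Set X} {E : HFObj X U} {E' : HFObj X U'} (Φ : PreHom H E E') (f : X' → X)
    (O : Set X') (hO : IsOpen O) (hf : ContinuousOn f O) :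
    PreHom H (E.ppull f O hO hf) (E'.ppull f O hO hf) :=
  ⟨fun x => Φ.g (f x), fun x => Φ.φ (f x)⟩

theorem PreHom.GEq.ppull {U U' : Set X} {E : HFObj X U} {E' : HFObj X U'} {Φ Φ' : PreHom H E E'}
    {f : X' → X} {O : Set X'} (hO : IsOpen O) (hf : ContinuousOn f O) {x : X'} (hx : x ∈ O)
    (h : GEq (f x) Φ Φ') : GEq x (Φ.ppull f O hO hf) (Φ'.ppull f O hO hf) := by
  obtain ⟨W, hW, hxW, ζ, hζ, hg, hφ⟩ := h
  refine ⟨O ∩ f ⁻¹' W, hf.isOpen_inter_preimage hO hW, ⟨hx, hxW⟩, fun y => ζ (f y),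
    hζ.comp (hf.mono inter_subset_left) fun y hy => hy.2, fun y hy => hg _ hy.2, fun y hy => ?_⟩
  obtain ⟨μ, hμ, V, hV, hyV, hVW, h⟩ := hφ (f y) hy.2
  exact ⟨μ, hμ, O ∩ f ⁻¹' V, hf.isOpen_inter_preimage hO hV, ⟨hy.1, hyV⟩,
    fun z hz => ⟨hz.1, hVW hz.2⟩, fun z hz v hv => h (f z) hz.2 v hv⟩

variable {P : PrincipalBundle (PU H) X} {P' : PrincipalBundle (PU H) X'}
  {P'' : PrincipalBundle (PU H) X''}

theorem PreHom.IsMor.ppull {U U' : Set X} {E : HFObj X U} {E' : HFObj X U'} {Φ : PreHom H E E'}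
    (F : PMap P' P) {s s' : X → P.Total} {W : Set X} (h : Φ.IsMor P s s' W)
    (hs : ∀ x ∈ W, P.proj (s x) = x) (hs' : ∀ x ∈ W, P.proj (s' x) = x) {W' : Set X'}
    (hW : ∀ x ∈ W', x ∈ F.O ∧ F.f x ∈ W) :
    (Φ.ppull F.f F.O F.isOpen_O F.continuousOn_f).IsMor P' (F.comapSection s) (F.comapSection s')
      W' := by
  refine ⟨h.1.comp (F.continuousOn_f.mono fun x hx => (hW x hx).1) fun x hx => (hW x hx).2,
    fun x hx => ?_, h.2.2.ppull _ _ (fun x hx => (hW x hx).2) fun x hx => (hW x hx).1⟩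
  obtain ⟨hx, hxW⟩ := hW x hx
  apply F.injOn
  · rw [P'.proj_act, F.proj_comapSection]; exact hx
  · rw [P'.proj_act, F.proj_comapSection, F.proj_comapSection]
  · rw [F.F_act _ (by rw [F.proj_comapSection]; exact hx), F.F_comapSection _ hx (hs' _ hxW),
      F.F_comapSection _ hx (hs _ hxW)]
    exact h.2.1 _ hxW

namespace TV

/-- The pull-back of a bundle along a partial bundle map. -/
def pull (F : PMap P' P) (𝔸 : TV P) : TV P' :=
  ofCocycle (fun a => F.O ∩ F.f ⁻¹' 𝔸.D.U a)
    (fun a => (𝔸.V.E a).ppull F.f F.O F.isOpen_O F.continuousOn_f)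
    (fun a => F.comapSection (𝔸.D.s a))
    (fun a => F.continuousOn_comapSection _ (𝔸.D.continuousOn_s a) (𝔸.D.proj_s a))
    (fun _ x _ => F.proj_comapSection _ x)
    (fun a b => (𝔸.Φ a b).ppull F.f F.O F.isOpen_O F.continuousOn_f)
    (fun a b => (𝔸.isMor a b).ppull F (fun x hx => 𝔸.D.proj_s b x hx.2)
      (fun x hx => 𝔸.D.proj_s a x hx.1) fun _ hx => ⟨hx.1.1, hx.1.2, hx.2.2⟩)
    (fun a _ hx => (𝔸.V.unit a _ hx.2).ppull F.isOpen_O F.continuousOn_f hx.1)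
    (fun a b c _ ha hb hc =>
      (𝔸.V.cocycle a b c _ ha.2 hb.2 hc.2).ppull F.isOpen_O F.continuousOn_f ha.1)

variable {𝔸 𝔹 : TV P}

theorem dom_pull (F : PMap P' P) (𝔸 : TV P) : (pull F 𝔸).dom = F.O ∩ F.f ⁻¹' 𝔸.dom := by
  rw [dom, dom, preimage_iUnion, inter_iUnion]; rfl

theorem InvAt.pull (F : PMap P' P) {x : X'} (h : 𝔸.InvAt (F.f x)) : (pull F 𝔸).InvAt x :=
  fun a ha => h a ha.2

theorem Sub.pull (F : PMap P' P) (h : Sub 𝔸 𝔹) : Sub (pull F 𝔸) (pull F 𝔹) := by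
  obtain ⟨S⟩ := h
  exact ⟨{
    r := S.r
    le := fun a => inter_subset_inter_right _ (preimage_mono (S.le a))
    Θ := fun a => (S.Θ a).ppull F.f F.O F.isOpen_O F.continuousOn_f
    Θ' := fun a => (S.Θ' a).ppull F.f F.O F.isOpen_O F.continuousOn_f
    mor := fun a => (S.mor a).ppull F (𝔸.D.proj_s a) (fun x hx => 𝔹.D.proj_s _ x (S.le a hx))
      fun x hx => hx
    mor' := fun a => (S.mor' a).ppull F (fun x hx => 𝔹.D.proj_s _ x (S.le a hx)) (𝔸.D.proj_s a)
      fun x hx => hx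
    left := fun a x hx => (S.left a _ hx.2).ppull F.isOpen_O F.continuousOn_f hx.1
    right := fun a x hx => (S.right a _ hx.2).ppull F.isOpen_O F.continuousOn_f hx.1
    comm := fun a b x ha hb => (S.comm a b _ ha.2 hb.2).ppull F.isOpen_O F.continuousOn_f ha.1 }⟩

theorem Compat.pull (F : PMap P' P) (h : Compat 𝔸 𝔹) : Compat (pull F 𝔸) (pull F 𝔹) := by
  obtain ⟨C⟩ := h
  exact ⟨{
    Ψ := fun a b => (C.Ψ a b).ppull F.f F.O F.isOpen_O F.continuousOn_f
    Ψ' := fun a b => (C.Ψ' a b).ppull F.f F.O F.isOpen_O F.continuousOn_f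
    mor := fun a b => (C.mor a b).ppull F (fun x hx => 𝔸.D.proj_s a x hx.1)
      (fun x hx => 𝔹.D.proj_s b x hx.2) fun x hx => ⟨hx.1.1, hx.1.2, hx.2.2⟩
    mor' := fun a b => (C.mor' a b).ppull F (fun x hx => 𝔹.D.proj_s b x hx.2)
      (fun x hx => 𝔸.D.proj_s a x hx.1) fun x hx => ⟨hx.1.1, hx.1.2, hx.2.2⟩
    left := fun a b x ha hb => (C.left a b _ ha.2 hb.2).ppull F.isOpen_O F.continuousOn_f ha.1
    right := fun a b x ha hb => (C.right a b _ ha.2 hb.2).ppull F.isOpen_O F.continuousOn_f ha.1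
    comm := fun a a' b b' x ha ha' hb hb' =>
      (C.comm a a' b b' _ ha.2 ha'.2 hb.2 hb'.2).ppull F.isOpen_O F.continuousOn_f ha.1 }⟩

/-- A family of linear maps which carries local frames to local frames and commutes with the
gradings and with the Hermitian maps is a morphism. -/
theorem isHFHom_of_frame {U U' W : Set X} {E : HFObj X U} {E' : HFObj X U'}
    {A : ∀ x, E.Fib x →ₗ[ℂ] E'.Fib x} (r : E.ι → E'.ι) (e : ∀ i, E.rk i → E'.rk (r i))
    (h : ∀ i, ∀ x ∈ W ∩ E.dom i, x ∈ E'.dom (r i) ∧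
      ∀ k, A x (E.frame i k x) = E'.frame (r i) (e i k) x)
    (hε : ∀ x ∈ W, ∀ v, A x (E.ε x v) = E'.ε x (A x v))
    (hh : ∀ x ∈ W, ∀ v, A x (E.h x v) = E'.h x (A x v)) : IsHFHom E E' W A :=
  ⟨.of_frame r e h, hε, hh⟩

/-- The pull-backs along two partial bundle maps which agree where the first one is defined. -/
theorem Sub.pull_congr {F F' : PMap P' P} (hO : F.O ⊆ F'.O) (hf : ∀ x ∈ F.O, F.f x = F'.f x)
    (hF : ∀ p, P'.proj p ∈ F.O → F.F p = F'.F p) (𝔸 : TV P) : Sub (TV.pull F 𝔸) (TV.pull F' 𝔸) := by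
  refine .of_iso id (fun a x hx => ⟨hO hx.1, ?_⟩) (fun a x hx => ?_) (fun a b x hx => ?_)
    (fun a x => (𝔸.V.E a).move (F.f x) (F'.f x)) (fun a x => (𝔸.V.E a).move (F'.f x) (F.f x))
    (fun a => isHFHom_of_frame id (fun _ => id) (fun i x hx => ⟨⟨hO hx.1.1, ?_⟩, fun k => ?_⟩)
      (fun x hx v => ?_) fun x hx v => ?_)
    (fun a => isHFHom_of_frame id (fun _ => id) (fun i x hx => ⟨⟨hx.1.1, ?_⟩, fun k => ?_⟩)
      (fun x hx v => ?_) fun x hx v => ?_) (fun a x hx v => ?_) (fun a x hx v => ?_)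
      (fun a b x hx v => ?_)
  · change F'.f x ∈ 𝔸.D.U a
    rw [← hf x hx.1]; exact hx.2
  · change F.comapSection _ x = F'.comapSection _ x
    have hp := 𝔸.D.proj_s a _ hx.2
    refine F'.eq_comapSection _ (hO hx.1) (F.proj_comapSection _ x) ?_
    rw [← hF _ (by rw [F.proj_comapSection]; exact hx.1), F.F_comapSection _ hx.1 hp, hf x hx.1]
    rfl
  · change 𝔸.D.g a b (F.f x) = 𝔸.D.g a b (F'.f x)
    rw [hf x hx.1.1]
  · change F'.f x ∈ (𝔸.V.E a).dom i
    rw [← hf x hx.1.1]; exact hx.2.2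
  · exact HermBundle.move_frame _ (hf x hx.1.1) i k
  · exact HermBundle.move_comm _ _ (𝔸.V.E a).ε (hf x hx.1) v
  · exact HermBundle.move_comm _ _ (𝔸.V.E a).h (hf x hx.1) v
  · change F.f x ∈ (𝔸.V.E a).dom i
    rw [hf x hx.1.1]; exact hx.2.2
  · exact HermBundle.move_frame _ (hf x hx.1.1).symm i k
  · exact HermBundle.move_comm _ _ (𝔸.V.E a).ε (hf x hx.1).symm v
  · exact HermBundle.move_comm _ _ (𝔸.V.E a).h (hf x hx.1).symm v
  · exact HermBundle.move_move _ (hf x hx.1) v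
  · exact HermBundle.move_move _ (hf x hx.1).symm v
  · exact (HermBundle.move_comm _ _ (𝔸.V.φ a b) (hf x hx.1.1) v).symm

theorem Sub.pull_comp (F : PMap P' P) (F' : PMap P'' P') (𝔸 : TV P) :
    Sub (TV.pull (F.comp F') 𝔸) (TV.pull F' (TV.pull F 𝔸)) := by
  refine .of_iso id (fun a x hx => ⟨hx.1.1, hx.1.2, hx.2⟩) (fun a x hx => ?_)
    (fun a b x hx => rfl) (fun a x => LinearMap.id) (fun a x => LinearMap.id)
    (fun a => isHFHom_of_frame id (fun _ => id)
      (fun i x hx => ⟨⟨hx.1.1.1, hx.1.1.2, hx.2.2⟩, fun k => rfl⟩)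
      (fun x hx v => rfl) fun x hx v => rfl)
    (fun a => isHFHom_of_frame id (fun _ => id) (fun i x hx => ⟨⟨hx.1.1, hx.2.2.2⟩, fun k => rfl⟩)
      (fun x hx v => rfl) fun x hx v => rfl) (fun a x hx v => rfl) (fun a x hx v => rfl)
      (fun a b x hx v => rfl)
  symm
  refine (F.comp F').eq_comapSection _ hx.1 (F'.proj_comapSection _ x) ?_
  exact (congrArg F.F (F'.F_comapSection _ hx.1.1 (F.proj_comapSection _ _))).trans
    (F.F_comapSection _ hx.1.2 (𝔸.D.proj_s a _ hx.2))

theorem Sub.comp_pull (F : PMap P' P) (F' : PMap P'' P') (𝔸 : TV P) :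
    Sub (TV.pull F' (TV.pull F 𝔸)) (TV.pull (F.comp F') 𝔸) := by
  refine .of_iso id (fun a x hx => ⟨⟨hx.1, hx.2.1⟩, hx.2.2⟩) (fun a x hx => ?_)
    (fun a b x hx => rfl) (fun a x => LinearMap.id) (fun a x => LinearMap.id)
    (fun a => isHFHom_of_frame id (fun _ => id)
      (fun i x hx => ⟨⟨⟨hx.1.1, hx.1.2.1⟩, hx.2.2.2⟩, fun k => rfl⟩)
      (fun x hx v => rfl) fun x hx v => rfl)
    (fun a => isHFHom_of_frame id (fun _ => id)
      (fun i x hx => ⟨⟨hx.1.1, hx.1.2.1, hx.2.2⟩, fun k => rfl⟩)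
      (fun x hx v => rfl) fun x hx v => rfl) (fun a x hx v => rfl) (fun a x hx v => rfl)
      (fun a b x hx v => rfl)
  refine (F.comp F').eq_comapSection _ ⟨hx.1, hx.2.1⟩ (F'.proj_comapSection _ x) ?_
  exact (congrArg F.F (F'.F_comapSection _ hx.1 (F.proj_comapSection _ _))).trans
    (F.F_comapSection _ hx.2.1 (𝔸.D.proj_s a _ hx.2.2))

theorem Sub.pull_idOn (O : Set X) (hO : IsOpen O) (𝔸 : TV P) :
    Sub (TV.pull (PMap.idOn P O hO) 𝔸) 𝔸 := by
  refine .of_iso id (fun a x hx => hx.2) (fun a x hx => ?_)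
    (fun a b x hx => rfl) (fun a x => LinearMap.id) (fun a x => LinearMap.id)
    (fun a => isHFHom_of_frame id (fun _ => id) (fun i x hx => ⟨hx.2.2, fun k => rfl⟩)
      (fun x hx v => rfl) fun x hx v => rfl)
    (fun a => isHFHom_of_frame id (fun _ => id) (fun i x hx => ⟨⟨hx.1.1, hx.2⟩, fun k => rfl⟩)
      (fun x hx v => rfl) fun x hx v => rfl) (fun a x hx v => rfl) (fun a x hx v => rfl)
      (fun a b x hx v => rfl)
  exact PMap.F_comapSection (PMap.idOn P O hO) _ hx.1 (𝔸.D.proj_s a _ hx.2)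

theorem Sub.idOn_pull (O : Set X) (hO : IsOpen O) (𝔸 : TV P) (h : 𝔸.dom ⊆ O) :
    Sub 𝔸 (TV.pull (PMap.idOn P O hO) 𝔸) := by
  have h : ∀ a x, x ∈ 𝔸.D.U a → x ∈ O := fun a x hx => h (mem_dom.2 ⟨a, hx⟩)
  refine .of_iso id (fun a x hx => ⟨h a x hx, hx⟩) (fun a x hx => ?_)
    (fun a b x hx => rfl) (fun a x => LinearMap.id) (fun a x => LinearMap.id)
    (fun a => isHFHom_of_frame id (fun _ => id)
      (fun i x hx => ⟨⟨h a x hx.1, hx.2⟩, fun k => rfl⟩)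
      (fun x hx v => rfl) fun x hx v => rfl)
    (fun a => isHFHom_of_frame id (fun _ => id) (fun i x hx => ⟨hx.2.2, fun k => rfl⟩)
      (fun x hx v => rfl) fun x hx v => rfl) (fun a x hx v => rfl) (fun a x hx v => rfl)
      (fun a b x hx v => rfl)
  exact (PMap.F_comapSection (PMap.idOn P O hO) _ (h a x hx) (𝔸.D.proj_s a _ hx)).symm

/-- The comparison of iterated pull-backs along a commutative square of partial bundle maps. -/
theorem Sub.pull_pull {X₁ : Type u} [TopologicalSpace X₁] {P₁ : PrincipalBundle (PU H) X₁}
    {F : PMap P' P} {F' : PMap P'' P'} {K : PMap P₁ P} {K' : PMap P'' P₁}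
    (hO : ∀ x, x ∈ F'.O → F'.f x ∈ F.O → x ∈ K'.O ∧ K'.f x ∈ K.O)
    (hf : ∀ x, x ∈ F'.O → F'.f x ∈ F.O → F.f (F'.f x) = K.f (K'.f x))
    (hF : ∀ p, P''.proj p ∈ F'.O → F'.f (P''.proj p) ∈ F.O → F.F (F'.F p) = K.F (K'.F p))
    (𝔸 : TV P) : Sub (TV.pull F' (TV.pull F 𝔸)) (TV.pull K' (TV.pull K 𝔸)) :=
  (Sub.comp_pull F F' 𝔸).trans ((Sub.pull_congr (F := F.comp F') (F' := K.comp K')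
    (fun x hx => hO x hx.1 hx.2)
    (fun x hx => hf x hx.1 hx.2) (fun p hp => hF p hp.1 hp.2) 𝔸).trans (Sub.pull_comp K K' 𝔸))

end TV

end pull

/-! ### Comparison with bundles over the whole base -/

section full

variable {X : Type u} [TopologicalSpace X] {X' : Type u} [TopologicalSpace X']
  {H : Type w} [NormedAddCommGroup H] [InnerProductSpace ℂ H] {P : PrincipalBundle (PU H) X}
  {P' : PrincipalBundle (PU H) X'}

/-- `TwistData` without the covering condition. -/
def TwistData.toLTD (D : TwistData P) : LTD P :=
  ⟨D.ι, D.U, D.isOpen_U, D.s, D.continuousOn_s, D.proj_s, D.g, D.continuousOn_g, D.act_g⟩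

/-- `LTD` with the covering condition. -/
def LTD.toTwistData (D : LTD P) (h : ⋃ a, D.U a = univ) : TwistData P :=
  ⟨D.ι, D.U, D.isOpen_U, h, D.s, D.continuousOn_s, D.proj_s, D.g, D.continuousOn_g, D.act_g⟩

/-- The conditions on the transition morphisms, expressed by germs. -/
def VBData.toLVB {D : TwistData P} (V : VBData D) : LVB D.toLTD where
  E := V.E
  φ := V.φ
  isHFHom := V.isHFHom
  unit a _ hx := (((V.cocycle a a a).geq (((D.isOpen_U a).inter (D.isOpen_U a)).inter
    (D.isOpen_U a)) ⟨⟨hx, hx⟩, hx⟩).symm).trans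
    ((V.inv a a).geq ((D.isOpen_U a).inter (D.isOpen_U a)) ⟨hx, hx⟩)
  cocycle a b c _ ha hb hc := (V.cocycle a b c).geq
    (((D.isOpen_U a).inter (D.isOpen_U b)).inter (D.isOpen_U c)) ⟨⟨ha, hb⟩, hc⟩

/-- The conditions on the transition morphisms, expressed over the intersections of charts. -/
def LVB.toVBData [Nontrivial H] {D : LTD P} (V : LVB D) (h : ⋃ a, D.U a = univ) :
    VBData (D.toTwistData h) where
  E := V.E
  φ := V.φ
  isHFHom := V.isHFHom
  inv a b := PreHom.rel_of_geq ((D.isOpen_U a).inter (D.isOpen_U b)) fun x hx =>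
    (V.cocycle a b a x hx.1 hx.2 hx.1).trans (V.unit a x hx.1)
  cocycle a b c := PreHom.rel_of_geq (((D.isOpen_U a).inter (D.isOpen_U b)).inter (D.isOpen_U c))
    fun x hx => V.cocycle a b c x hx.1.1 hx.1.2 hx.2

namespace TV

/-- A twisted vectorial bundle as a bundle over an open subset. -/
def ofT (𝔼 : TwistedVB P) : TV P := ⟨𝔼.D.toLTD, 𝔼.V.toLVB⟩

theorem dom_ofT (𝔼 : TwistedVB P) : (ofT 𝔼).dom = univ := 𝔼.D.iUnion_U

/-- A bundle whose charts cover the base as a twisted vectorial bundle. -/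
def toT [Nontrivial H] (𝔸 : TV P) (h : 𝔸.dom = univ) : TwistedVB P :=
  ⟨𝔸.D.toTwistData h, 𝔸.V.toVBData h⟩

theorem compat_of_iso {𝔼' 𝔼 : TwistedVB P} (h : 𝔼'.Iso 𝔼) : Compat (ofT 𝔼') (ofT 𝔼) := by
  obtain ⟨Ψ, Ψ', hΨ, hΨ', hl, hr⟩ := h
  have o := 𝔼.D.isOpen_U
  have o' := 𝔼'.D.isOpen_U
  refine ⟨{
    Ψ := fun a b => Ψ b a
    Ψ' := fun a b => Ψ' a b
    mor := fun a b => inter_comm (𝔼.D.U b) _ ▸ hΨ.1 b a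
    mor' := fun a b => hΨ'.1 a b
    left := fun a b x ha hb => ((hr a b a).geq (((o' a).inter (o b)).inter (o' a))
      ⟨⟨ha, hb⟩, ha⟩).trans ((ofT 𝔼').V.unit a x ha)
    right := fun a b x ha hb => ((hl b a b).geq (((o b).inter (o' a)).inter (o b))
      ⟨⟨hb, ha⟩, hb⟩).trans ((ofT 𝔼).V.unit b x hb)
    comm := fun a a' b b' x ha ha' hb hb' => ?_ }⟩
  exact ((hΨ.2.1 b' a' a).geq (((o b').inter (o' a')).inter (o' a)) ⟨⟨hb', ha'⟩, ha⟩).trans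
    ((hΨ.2.2 b' b a).geq (((o b').inter (o b)).inter (o' a)) ⟨⟨hb', hb⟩, ha⟩).symm

/-- The identities of germs at each point which a compatibility of two bundles over the whole base
consists of are identities of morphisms over the intersections of charts. -/
theorem Compat.iso [Nontrivial H] {𝔸 𝔹 : TV P} (C : Compat 𝔸 𝔹) (h : 𝔸.dom = univ)
    (h' : 𝔹.dom = univ) : (toT 𝔸 h).Iso (toT 𝔹 h') := by
  obtain ⟨C⟩ := C
  have o := 𝔸.D.isOpen_U
  have o' := 𝔹.D.isOpen_U
  refine ⟨fun b a => C.Ψ a b, fun a b => C.Ψ' a b, ⟨fun b a => ?_, fun b a a' => ?_,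
    fun b b' a => ?_⟩, ⟨fun a b => C.mor' a b, fun a b b' => ?_, fun a a' b => ?_⟩,
    fun b a b' => ?_, fun a b a' => ?_⟩
  · exact inter_comm (𝔸.D.U a) (𝔹.D.U b) ▸ C.mor a b
  · exact PreHom.rel_of_geq (((o' b).inter (o a)).inter (o a')) fun x ⟨⟨hb, ha⟩, ha'⟩ =>
      ((tr_rp ha' ha).comp (C.hom_rp ha hb)).geq_iff (C.hom_rp ha' hb) |>.2 (C.tr_hom' _ _ _)
  · exact PreHom.rel_of_geq (((o' b).inter (o' b')).inter (o a)) fun x ⟨⟨hb, hb'⟩, ha⟩ =>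
      ((C.hom_rp ha hb').comp (tr_rp hb' hb)).geq_iff (C.hom_rp ha hb) |>.2 (C.hom_tr _ _ _)
  · exact PreHom.rel_of_geq (((o a).inter (o' b)).inter (o' b')) fun x ⟨⟨ha, hb⟩, hb'⟩ =>
      ((tr_rp hb' hb).comp (C.inv_rp ha hb)).geq_iff (C.inv_rp ha hb') |>.2 (C.tr_inv _ _ _)
  · exact PreHom.rel_of_geq (((o a).inter (o a')).inter (o' b)) fun x ⟨⟨ha, ha'⟩, hb⟩ =>
      ((C.inv_rp ha' hb).comp (tr_rp ha' ha)).geq_iff (C.inv_rp ha hb) |>.2 (C.inv_tr _ _ _)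
  · exact PreHom.rel_of_geq (((o' b).inter (o a)).inter (o' b')) fun x ⟨⟨hb, ha⟩, hb'⟩ =>
      ((C.inv_rp ha hb').comp (C.hom_rp ha hb)).geq_iff (tr_rp hb' hb) |>.2 (C.inv_hom _ _ _)
  · exact PreHom.rel_of_geq (((o a).inter (o' b)).inter (o a')) fun x ⟨⟨ha, hb⟩, ha'⟩ =>
      ((C.hom_rp ha' hb).comp (C.inv_rp ha hb)).geq_iff (tr_rp ha' ha) |>.2 (C.hom_inv _ _ _)

/-- The two pull-back constructions agree. -/
theorem sub_pullback (𝔼 : TwistedVB P) {f : C(X', X)} (F : P'.Hom P f) :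
    Sub (ofT (𝔼.pullback F)) (pull (.ofHom F) (ofT 𝔼)) := by
  refine .of_iso id (fun a x hx => ⟨trivial, hx⟩) (fun a x hx => rfl)
    (fun a b x hx => rfl) (fun a x => LinearMap.id) (fun a x => LinearMap.id)
    (fun a => isHFHom_of_frame id (fun _ => id) (fun i x hx => ⟨⟨trivial, hx.2⟩, fun k => rfl⟩)
      (fun x hx v => rfl) fun x hx v => rfl)
    (fun a => isHFHom_of_frame id (fun _ => id) (fun i x hx => ⟨hx.2.2, fun k => rfl⟩)
      (fun x hx v => rfl) fun x hx v => rfl) (fun a x hx v => rfl) (fun a x hx v => rfl)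
      (fun a b x hx v => rfl)

theorem pullback_sub (𝔼 : TwistedVB P) {f : C(X', X)} (F : P'.Hom P f) :
    Sub (pull (.ofHom F) (ofT 𝔼)) (ofT (𝔼.pullback F)) := by
  refine .of_iso id (fun a x hx => hx.2) (fun a x hx => rfl)
    (fun a b x hx => rfl) (fun a x => LinearMap.id) (fun a x => LinearMap.id)
    (fun a => isHFHom_of_frame id (fun _ => id) (fun i x hx => ⟨hx.2.2, fun k => rfl⟩)
      (fun x hx v => rfl) fun x hx v => rfl)
    (fun a => isHFHom_of_frame id (fun _ => id) (fun i x hx => ⟨⟨trivial, hx.2⟩, fun k => rfl⟩)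
      (fun x hx v => rfl) fun x hx v => rfl) (fun a x hx v => rfl) (fun a x hx v => rfl)
      (fun a b x hx v => rfl)

theorem supp_eq (𝔼 : TwistedVB P) : 𝔼.supp = {x | ¬ (ofT 𝔼).InvAt x} := by
  have h1 : {x | ∃ a, x ∈ 𝔼.D.U a ∧ ¬ Function.Bijective ((𝔼.V.E a).h x)} =
      {x | ¬ (ofT 𝔼).InvAt x} := by
    ext x
    simp only [InvAt, mem_ofPred_eq, not_forall, exists_prop]
    rfl
  have h2 : IsClosed {x | ¬ (ofT 𝔼).InvAt x} := by
    rw [← isOpen_compl_iff]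
    convert (ofT 𝔼).isOpen_invAt using 1
    ext x
    simp [dom_ofT]
  rw [TwistedVB.supp, h1, h2.closure_eq]

end TV

end full

/-! ### Change of the cover and of the sections -/

section gauge

variable {X : Type u} [TopologicalSpace X] {H : Type w} [NormedAddCommGroup H]
  [InnerProductSpace ℂ H] {P : PrincipalBundle (PU H) X}

/-- The restriction of a Hermitian vector bundle to a smaller open set. -/
def HermBundle.restrict {U : Set X} (E : HermBundle X U) (V : Set X) (hV : IsOpen V)
    (h : V ⊆ U) : HermBundle X V where
  Fib := E.Fib
  normed := E.normed
  inner := E.inner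
  ι := E.ι
  dom i := V ∩ E.dom i
  isOpen_dom i := hV.inter (E.isOpen_dom i)
  iUnion_dom := by rw [← inter_iUnion, E.iUnion_dom, inter_eq_left.2 h]
  rk := E.rk
  frame := E.frame
  orthonormal i x hx := E.orthonormal i x hx.2
  span_eq_top i x hx := E.span_eq_top i x hx.2
  continuousOn_transition i j k l :=
    (E.continuousOn_transition i j k l).mono fun _ h => ⟨h.1.2, h.2.2⟩

/-- The restriction of an object of `HF(U)` to a smaller open set. -/
def HFObj.restrict {U : Set X} (E : HFObj X U) (V : Set X) (hV : IsOpen V) (h : V ⊆ U) :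
    HFObj X V where
  toHermBundle := E.toHermBundle.restrict V hV h
  ε := E.ε
  h := E.h
  continuous_ε i j k l := (E.continuous_ε i j k l).mono fun _ hx => ⟨h hx.1, hx.2.1.2, hx.2.2.2⟩
  continuous_h i j k l := (E.continuous_h i j k l).mono fun _ hx => ⟨h hx.1, hx.2.1.2, hx.2.2.2⟩
  ε_symm x hx := E.ε_symm x (h hx)
  ε_sq x hx := E.ε_sq x (h hx)
  h_symm x hx := E.h_symm x (h hx)
  h_odd x hx := E.h_odd x (h hx)

theorem IsHFHom.restrict {U U' W V V' : Set X} {E : HFObj X U} {E' : HFObj X U'}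
    {φ : ∀ x, E.Fib x →ₗ[ℂ] E'.Fib x} (hφ : IsHFHom E E' W φ) (hV : IsOpen V) (h : V ⊆ U)
    (hV' : IsOpen V') (h' : V' ⊆ U') :
    IsHFHom (E.restrict V hV h) (E'.restrict V' hV' h') W φ :=
  ⟨fun i j k l => (hφ.1 i j k l).mono fun _ hx => ⟨hx.1, hx.2.1.2, hx.2.2.2⟩, hφ.2.1, hφ.2.2⟩

/-- A refinement of the cover together with a change of the local sections. -/
structure Gauge (D D₀ : LTD P) where
  r : D.ι → D₀.ι
  le : ∀ a, D.U a ⊆ D₀.U (r a)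
  u : D.ι → X → UGroup H
  continuousOn_u : ∀ a, ContinuousOn (u a) (D.U a)
  act_u : ∀ a, ∀ x ∈ D.U a, P.act (D₀.s (r a) x) (toPU H (u a x)) = D.s a x

/-- A bundle can be transported along a change of the cover and of the sections. -/
theorem Gauge.exists_sub [Nontrivial H] {D : LTD P} {𝔹 : TV P} (γ : Gauge D 𝔹.D) :
    ∃ V : LVB D, TV.Sub ⟨D, V⟩ 𝔹 := by
  have hinv : ∀ a, ∀ x ∈ D.U a,
      P.act (D.s a x) (toPU H (γ.u a x)⁻¹) = 𝔹.D.s (γ.r a) x := fun a x hx => by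
    rw [← γ.act_u a x hx, ← P.act_mul, ← map_mul, mul_inv_cancel, map_one, P.act_one]
  -- `ζ` compares the given lift `D.g a b` with the one transported from `𝔹`
  have hz : ∀ a b, ∃ ζ : X → Circle, ContinuousOn ζ (D.U a ∩ D.U b) ∧ ∀ x ∈ D.U a ∩ D.U b,
      D.g a b x = (γ.u a x)⁻¹ * (𝔹.D.g (γ.r a) (γ.r b) x * γ.u b x) * scalar H (ζ x) :=
    fun a b => by
      refine PreHom.exists_circle (D.continuousOn_g a b) (((γ.continuousOn_u a).mono
        inter_subset_left).inv.mul (((𝔹.D.continuousOn_g _ _).mono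
        (inter_subset_inter (γ.le a) (γ.le b))).mul ((γ.continuousOn_u b).mono
        inter_subset_right))) (D.act_g a b) fun x hx => ?_
      rw [map_mul, map_mul, P.act_mul, P.act_mul, hinv a x hx.1,
        𝔹.D.act_g _ _ x ⟨γ.le a hx.1, γ.le b hx.2⟩, γ.act_u b x hx.2]
  choose ζ hζ hg using hz
  let E : ∀ a, HFObj X (D.U a) := fun a => (𝔹.V.E (γ.r a)).restrict _ (D.isOpen_U a) (γ.le a)
  let Θ : ∀ a, PreHom H (E a) (𝔹.V.E (γ.r a)) := fun a => ⟨γ.u a, fun _ => LinearMap.id⟩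
  let Θ' : ∀ a, PreHom H (𝔹.V.E (γ.r a)) (E a) :=
    fun a => ⟨fun x => (γ.u a x)⁻¹, fun _ => LinearMap.id⟩
  have hΘ : ∀ a, (Θ a).IsMor P (D.s a) (𝔹.D.s (γ.r a)) (D.U a) := fun a =>
    ⟨γ.continuousOn_u a, γ.act_u a, TV.isHFHom_of_frame id (fun _ => id)
      (fun i x hx => ⟨hx.2.2, fun k => rfl⟩) (fun x hx v => rfl) fun x hx v => rfl⟩
  have hΘ' : ∀ a, (Θ' a).IsMor P (𝔹.D.s (γ.r a)) (D.s a) (D.U a) := fun a =>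
    ⟨(γ.continuousOn_u a).inv, hinv a, TV.isHFHom_of_frame id (fun _ => id)
      (fun i x hx => ⟨hx, fun k => rfl⟩) (fun x hx v => rfl) fun x hx v => rfl⟩
  have hl : ∀ a, (Θ' a).comp (Θ a) = .id _ := fun a =>
    congrArg₂ PreHom.mk (funext fun x => inv_mul_cancel (γ.u a x)) rfl
  have hr : ∀ a, (Θ a).comp (Θ' a) = .id _ := fun a =>
    congrArg₂ PreHom.mk (funext fun x => mul_inv_cancel (γ.u a x)) rfl
  let Φ : ∀ a b, PreHom H (E b) (E a) := fun a b =>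
    ⟨D.g a b, fun x => (ζ a b x : ℂ) • 𝔹.V.φ (γ.r a) (γ.r b) x⟩
  have hΦ : ∀ a b, (Φ a b).IsMor P (D.s b) (D.s a) (D.U a ∩ D.U b) := fun a b =>
    ⟨D.continuousOn_g a b, D.act_g a b, (((𝔹.V.isHFHom _ _).mono
      (inter_subset_inter (γ.le a) (γ.le b))).restrict (D.isOpen_U b) (γ.le b) (D.isOpen_U a)
      (γ.le a)).smulOn (continuous_subtype_val.comp_continuousOn (hζ a b))⟩
  have hgeq : ∀ a b x, x ∈ D.U a → x ∈ D.U b →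
      PreHom.GEq x (Φ a b) ((Θ' a).comp ((𝔹.Φ (γ.r a) (γ.r b)).comp (Θ b))) :=
    fun a b x ha hb => ⟨D.U a ∩ D.U b, (D.isOpen_U a).inter (D.isOpen_U b), ⟨ha, hb⟩, ζ a b,
      hζ a b, hg a b, fun y hy => ⟨1, one_pos, _, (D.isOpen_U a).inter (D.isOpen_U b), hy,
        Subset.rfl, fun z _ v _ => rfl⟩⟩
  let A : ∀ a x, x ∈ D.U a → GObj P x := fun a x hx => ⟨_, E a, D.s a, hx⟩
  let i : ∀ a x (hx : x ∈ D.U a), A a x hx ≅ TV.obj (γ.le a hx) := fun a x hx =>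
    { hom := GObj.germ (Φ := Θ a) ⟨_, D.isOpen_U a, hx, hΘ a⟩
      inv := GObj.germ (Φ := Θ' a) ⟨_, D.isOpen_U a, hx, hΘ' a⟩
      hom_inv_id := (((GObj.germ_rp _).comp (GObj.germ_rp _)).geq_iff (.id _)).1 (.of_eq (hl a))
      inv_hom_id := (((GObj.germ_rp _).comp (GObj.germ_rp _)).geq_iff (.id _)).1 (.of_eq (hr a)) }
  have hi : ∀ a x (hx : x ∈ D.U a), GObj.Rp (i a x hx).hom (Θ a) := fun a x hx => GObj.germ_rp _
  have hi' : ∀ a x (hx : x ∈ D.U a), GObj.Rp (i a x hx).inv (Θ' a) := fun a x hx =>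
    GObj.germ_rp _
  -- the germs of `Φ` are those of `𝔹`, conjugated by the isomorphisms `i`
  have key : ∀ a b x (ha : x ∈ D.U a) (hb : x ∈ D.U b), GObj.Rp
      (((i b x hb).hom ≫ TV.tr (γ.le b hb) (γ.le a ha)) ≫ (i a x ha).inv) (Φ a b) :=
    fun a b x ha hb => (((hi b x hb).comp (TV.tr_rp _ _)).comp (hi' a x ha)).of_geq
      ⟨_, (D.isOpen_U a).inter (D.isOpen_U b), ⟨ha, hb⟩, hΦ a b⟩ (hgeq a b x ha hb).symm
  refine ⟨⟨E, fun a b => (Φ a b).φ, fun a b => (hΦ a b).2.2, fun a x hx => ?_,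
    fun a b c x ha hb hc => ?_⟩, ⟨γ.r, γ.le, Θ, Θ', hΘ, hΘ', fun a x _ => .of_eq (hl a),
    fun a x _ => .of_eq (hr a), fun a b x ha hb => ?_⟩⟩
  · refine (key a a x hx hx).geq_iff (.id _) |>.2 ?_
    simp
  · refine ((key b c x hb hc).comp (key a b x ha hb)).geq_iff (key a c x ha hc) |>.2 ?_
    simp
  · refine ((hi a x ha).comp (TV.tr_rp _ _)).geq_iff ((key b a x hb ha).comp (hi b x hb)) |>.2 ?_
    simp

/-- Restriction of the open sets of a cover to the members of a family of open sets. -/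
def LTD.cut (D : LTD P) {κ : Type u} (C : κ → Set X) (hC : ∀ k, IsOpen (C k)) : LTD P where
  ι := D.ι × κ
  U i := D.U i.1 ∩ C i.2
  isOpen_U i := (D.isOpen_U i.1).inter (hC i.2)
  s i := D.s i.1
  continuousOn_s i := (D.continuousOn_s i.1).mono inter_subset_left
  proj_s i x hx := D.proj_s i.1 x hx.1
  g i j := D.g i.1 j.1
  continuousOn_g i j := (D.continuousOn_g i.1 j.1).mono fun _ h => ⟨h.1.1, h.2.1⟩
  act_g i j x h := D.act_g i.1 j.1 x ⟨h.1.1, h.2.1⟩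

/-- The refinement `D.cut C` of `D`. -/
def LTD.cutGauge (D : LTD P) {κ : Type u} (C : κ → Set X) (hC : ∀ k, IsOpen (C k)) :
    Gauge (D.cut C hC) D where
  r := Prod.fst
  le _ := inter_subset_left
  u _ _ := 1
  continuousOn_u _ := continuousOn_const
  act_u i x _ := by rw [map_one, P.act_one]; rfl

/-- The trivial change of the cover and of the sections. -/
def Gauge.refl (D : LTD P) : Gauge D D where
  r := id
  le _ := Subset.rfl
  u _ _ := 1
  continuousOn_u _ := continuousOn_const
  act_u i x _ := by rw [map_one, P.act_one]; rfl

/-- Two covers with local sections have a common refinement.  The transition functions between the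
sections of the two covers are lifted to `U(H)` locally, by local sections of `U(H) → PU(H)`. -/
theorem LTD.exists_gauge_gauge [Nontrivial H] (D₀ D₁ : LTD P) : ∃ D : LTD P,
    Nonempty (Gauge D D₀) ∧ Nonempty (Gauge D D₁) ∧
      ⋃ a, D.U a = (⋃ a, D₀.U a) ∩ ⋃ a, D₁.U a := by
  -- the transition functions from the sections of `D₀` to those of `D₁`
  let q : D₀.ι → D₁.ι → X → PU H := fun a b x => P.div (D₁.s b x) (D₀.s a x)
  have hq : ∀ a b, ContinuousOn (q a b) (D₀.U a ∩ D₁.U b) := fun a b => by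
    refine P.continuousOn_div.comp (f := fun x => (D₁.s b x, D₀.s a x))
      (((D₁.continuousOn_s b).mono inter_subset_right).prodMk
        ((D₀.continuousOn_s a).mono inter_subset_left)) fun x hx => ?_
    exact (D₁.proj_s b x hx.2).trans (D₀.proj_s a x hx.1).symm
  have hl := fun p : PU H => exists_local_section p
  choose O hO hpO l hlc hl using hl
  let ι : Type u := {i : (D₀.ι × D₁.ι) × X // i.2 ∈ D₀.U i.1.1 ∩ D₁.U i.1.2}
  let U : ι → Set X := fun i => (D₀.U i.1.1.1 ∩ D₁.U i.1.1.2) ∩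
    q i.1.1.1 i.1.1.2 ⁻¹' O (q i.1.1.1 i.1.1.2 i.1.2)
  have hU : ∀ i, IsOpen (U i) := fun i => (hq _ _).isOpen_inter_preimage
    ((D₀.isOpen_U _).inter (D₁.isOpen_U _)) (hO _)
  refine ⟨{
    ι := ι
    U := U
    isOpen_U := hU
    s := fun i => D₀.s i.1.1.1
    continuousOn_s := fun i => (D₀.continuousOn_s _).mono fun x hx => hx.1.1
    proj_s := fun i x hx => D₀.proj_s _ x hx.1.1
    g := fun i j => D₀.g i.1.1.1 j.1.1.1
    continuousOn_g := fun i j => (D₀.continuousOn_g _ _).mono fun x hx => ⟨hx.1.1.1, hx.2.1.1⟩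
    act_g := fun i j x hx => D₀.act_g _ _ x ⟨hx.1.1.1, hx.2.1.1⟩ },
    ⟨⟨fun i => i.1.1.1, fun i x hx => hx.1.1, fun _ _ => 1, fun _ => continuousOn_const,
      fun i x hx => by rw [map_one, P.act_one]⟩⟩,
    ⟨⟨fun i => i.1.1.2, fun i x hx => hx.1.2, fun i x => l (q i.1.1.1 i.1.1.2 i.1.2)
      (q i.1.1.1 i.1.1.2 x), fun i => (hlc _).comp ((hq _ _).mono inter_subset_left)
        fun x hx => hx.2, fun i x hx => ?_⟩⟩, ?_⟩
  · rw [hl _ _ hx.2]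
    exact P.act_div _ _ ((D₁.proj_s _ x hx.1.2).trans (D₀.proj_s _ x hx.1.1).symm)
  · ext x
    simp only [mem_iUnion, mem_inter_iff]
    constructor
    · rintro ⟨i, hi⟩
      exact ⟨⟨_, hi.1.1⟩, ⟨_, hi.1.2⟩⟩
    · rintro ⟨⟨a, ha⟩, ⟨b, hb⟩⟩
      exact ⟨⟨((a, b), x), ha, hb⟩, ⟨ha, hb⟩, hpO _⟩

/-- Bundles which are invertible on the intersection of their domains are compatible. -/
theorem Gauge.compat_of_inv [Nontrivial H] {D₀ : LTD P} {𝔸 𝔹 : TV P} (γ : Gauge 𝔸.D D₀)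
    (γ' : Gauge 𝔹.D D₀) (h : ∀ x ∈ 𝔸.dom, x ∈ 𝔹.dom → 𝔸.InvAt x)
    (h' : ∀ x ∈ 𝔸.dom, x ∈ 𝔹.dom → 𝔹.InvAt x) : TV.Compat 𝔸 𝔹 := by
  have lift : ∀ {D D' : LTD P} (γ : Gauge D D₀) (γ' : Gauge D' D₀) (a : D.ι) (b : D'.ι) (W : Set X),
      (∀ x ∈ W, x ∈ D.U a ∧ x ∈ D'.U b) →
      ContinuousOn (fun x => (γ'.u b x)⁻¹ * (D₀.g (γ'.r b) (γ.r a) x * γ.u a x)) W ∧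
      ∀ x ∈ W, P.act (D'.s b x)
        (toPU H ((γ'.u b x)⁻¹ * (D₀.g (γ'.r b) (γ.r a) x * γ.u a x))) = D.s a x := by
    intro D D' γ γ' a b W hW
    refine ⟨((γ'.continuousOn_u b).mono fun x hx => (hW x hx).2).inv.mul
      (((D₀.continuousOn_g _ _).mono fun x hx => ⟨γ'.le b (hW x hx).2, γ.le a (hW x hx).1⟩).mul
        ((γ.continuousOn_u a).mono fun x hx => (hW x hx).1)), fun x hx => ?_⟩
    obtain ⟨ha, hb⟩ := hW x hx
    have h1 : P.act (D'.s b x) (toPU H (γ'.u b x)⁻¹) = D₀.s (γ'.r b) x := by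
      rw [← γ'.act_u b x hb, ← P.act_mul, ← map_mul, mul_inv_cancel, map_one, P.act_one]
    rw [map_mul, map_mul, P.act_mul, P.act_mul, h1, D₀.act_g _ _ x ⟨γ'.le b hb, γ.le a ha⟩,
      γ.act_u a x ha]
  -- morphisms between invertible objects only depend on `g`, so the zero maps represent them
  let Ψ : ∀ a b, PreHom H (𝔸.V.E a) (𝔹.V.E b) := fun a b =>
    ⟨fun x => (γ'.u b x)⁻¹ * (D₀.g (γ'.r b) (γ.r a) x * γ.u a x), fun _ => 0⟩
  let Ψ' : ∀ a b, PreHom H (𝔹.V.E b) (𝔸.V.E a) := fun a b =>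
    ⟨fun x => (γ.u a x)⁻¹ * (D₀.g (γ.r a) (γ'.r b) x * γ'.u b x), fun _ => 0⟩
  have hm : ∀ a b, (Ψ a b).IsMor P (𝔸.D.s a) (𝔹.D.s b) (𝔸.D.U a ∩ 𝔹.D.U b) := fun a b =>
    ⟨(lift γ γ' a b _ fun x hx => hx).1, (lift γ γ' a b _ fun x hx => hx).2, .zero⟩
  have hm' : ∀ a b, (Ψ' a b).IsMor P (𝔹.D.s b) (𝔸.D.s a) (𝔸.D.U a ∩ 𝔹.D.U b) := fun a b =>
    ⟨(lift γ' γ b a _ fun x hx => hx.symm).1, (lift γ' γ b a _ fun x hx => hx.symm).2, .zero⟩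
  have ho : ∀ a b, IsOpen (𝔸.D.U a ∩ 𝔹.D.U b) := fun a b =>
    (𝔸.D.isOpen_U a).inter (𝔹.D.isOpen_U b)
  have hr : ∀ {a b x} (ha : x ∈ 𝔸.D.U a) (hb : x ∈ 𝔹.D.U b), GObj.IsRep (TV.obj ha)
    (TV.obj hb) (Ψ a b) := fun ha hb => ⟨_, ho _ _, ⟨ha, hb⟩, hm _ _⟩
  have hr' : ∀ {a b x} (ha : x ∈ 𝔸.D.U a) (hb : x ∈ 𝔹.D.U b), GObj.IsRep (TV.obj hb)
    (TV.obj ha) (Ψ' a b) := fun ha hb => ⟨_, ho _ _, ⟨ha, hb⟩, hm' _ _⟩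
  have hd : ∀ {a x}, x ∈ 𝔸.D.U a → x ∈ 𝔸.dom := fun ha => TV.mem_dom.2 ⟨_, ha⟩
  have hd' : ∀ {a x}, x ∈ 𝔹.D.U a → x ∈ 𝔹.dom := fun ha => TV.mem_dom.2 ⟨_, ha⟩
  refine ⟨⟨Ψ, Ψ', hm, hm', fun a b x ha hb => ?_, fun a b x ha hb => ?_,
    fun a a' b b' x ha ha' hb hb' => ?_⟩⟩
  · exact ((GObj.germ_rp (hr ha hb)).comp (GObj.germ_rp (hr' ha hb))).geq_iff (.id _) |>.2
      (GObj.hom_ext_of_inv (h x (hd ha) (hd' hb) a ha) _ _)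
  · exact ((GObj.germ_rp (hr' ha hb)).comp (GObj.germ_rp (hr ha hb))).geq_iff (.id _) |>.2
      (GObj.hom_ext_of_inv (h' x (hd ha) (hd' hb) b hb) _ _)
  · exact ((TV.tr_rp ha ha').comp (GObj.germ_rp (hr ha' hb'))).geq_iff
      ((GObj.germ_rp (hr ha hb)).comp (TV.tr_rp hb hb')) |>.2
      (GObj.hom_ext_of_inv (h x (hd ha) (hd' hb) a ha) _ _)

end gauge

/-! ### Direct sums and the Thom class -/

section sum

variable {X : Type u} [TopologicalSpace X] {X' : Type u} [TopologicalSpace X']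
  {H : Type w} [NormedAddCommGroup H] [InnerProductSpace ℂ H]

namespace PreHom

variable {U U' U'' : Set X} {E₁ E₂ : HFObj X U} {E₁' E₂' : HFObj X U'} {E₁'' E₂'' : HFObj X U''}
  {x : X}

/-- The direct sum of two representatives with the same lift. -/
def sum (Φ : PreHom H E₁ E₁') (Ψ : PreHom H E₂ E₂') : PreHom H (E₁.sum E₂) (E₁'.sum E₂') :=
  ⟨Φ.g, fun x => blockMap (Φ.φ x) 0 0 (Ψ.φ x)⟩

/-- The product of a representative with the identity of `F`. -/
def thom (Φ : PreHom H E₁ E₁') (z : C(X, ℂ)) : PreHom H (E₁.thom z) (E₁'.thom z) :=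
  ⟨Φ.g, fun x => blockMap (Φ.φ x) 0 0 (Φ.φ x)⟩

theorem sum_comp (Φ' : PreHom H E₁' E₁'') (Ψ' : PreHom H E₂' E₂'') (Φ : PreHom H E₁ E₁')
    (Ψ : PreHom H E₂ E₂') : (Φ'.sum Ψ').comp (Φ.sum Ψ) = (Φ'.comp Φ).sum (Ψ'.comp Ψ) :=
  congrArg (PreHom.mk _) (funext fun _ => blockMap_comp_diag _ _ _ _)

theorem thom_comp (Φ' : PreHom H E₁' E₁'') (Φ : PreHom H E₁ E₁') (z : C(X, ℂ)) :
    (Φ'.thom z).comp (Φ.thom z) = (Φ'.comp Φ).thom z :=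
  congrArg (PreHom.mk _) (funext fun _ => blockMap_comp_diag _ _ _ _)

theorem sum_id : (PreHom.id E₁ : PreHom H E₁ E₁).sum (PreHom.id E₂) = .id (E₁.sum E₂) :=
  congrArg (PreHom.mk _) (funext fun _ => blockMap_id)

theorem thom_id (z : C(X, ℂ)) : (PreHom.id E₁ : PreHom H E₁ E₁).thom z = .id (E₁.thom z) :=
  congrArg (PreHom.mk _) (funext fun _ => blockMap_id)

theorem GEq.sum [Nontrivial H] {Φ Φ' : PreHom H E₁ E₁'} {Ψ Ψ' : PreHom H E₂ E₂'}
    (h : GEq x Φ Φ') (h' : GEq x Ψ Ψ') (hg : Φ.g = Ψ.g) (hg' : Φ'.g = Ψ'.g) :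
    GEq x (Φ.sum Ψ) (Φ'.sum Ψ') := by
  obtain ⟨V, hV, hx, h⟩ := h
  obtain ⟨V', hV', hx', h'⟩ := h'
  obtain ⟨g, φ⟩ := Φ
  obtain ⟨g', φ'⟩ := Φ'
  obtain ⟨_, ψ⟩ := Ψ
  obtain ⟨_, ψ'⟩ := Ψ'
  obtain rfl : g = _ := hg
  obtain rfl : g' = _ := hg'
  exact ⟨V ∩ V', hV.inter hV', ⟨hx, hx'⟩, (h.mono (hV.inter hV') inter_subset_left).sum
    (h'.mono (hV.inter hV') inter_subset_right)⟩

theorem GEq.thom {Φ Φ' : PreHom H E₁ E₁'} (h : GEq x Φ Φ') (hx : x ∈ U) (z : C(X, ℂ)) :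
    GEq x (Φ.thom z) (Φ'.thom z) := by
  obtain ⟨V, hV, hxV, h⟩ := h
  exact ⟨V ∩ U, hV.inter E₁.isOpen, ⟨hxV, hx⟩,
    (h.mono (hV.inter E₁.isOpen) inter_subset_left).thom inter_subset_right z⟩

end PreHom

/-- `(E, h)` with the opposite grading. -/
def HFObj.neg {U : Set X} (E : HFObj X U) : HFObj X U where
  toHermBundle := E.toHermBundle
  ε x := (-1 : ℂ) • E.ε x
  h := E.h
  continuous_ε := E.continuous_ε.smul (.const X (-1))
  continuous_h := E.continuous_h
  ε_symm x hx v w := by simp [E.ε_symm x hx]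
  ε_sq x hx v := by simp [E.ε_sq x hx]
  h_symm := E.h_symm
  h_odd x hx v := by simp [E.h_odd x hx]

/-- The bundle of rank zero. -/
def HFObj.zero {U : Set X} (hU : IsOpen U) : HFObj X U where
  Fib _ := EuclideanSpace ℂ PEmpty.{u + 1}
  ι := PUnit
  dom _ := U
  isOpen_dom _ := hU
  iUnion_dom := iUnion_const U
  rk _ := Empty
  frame _ k := k.elim
  orthonormal _ _ _ := ⟨fun k => k.elim, fun k => k.elim⟩
  span_eq_top _ _ _ := Subsingleton.elim _ _
  continuousOn_transition _ _ k := k.elim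
  ε _ := 0
  h _ := 0
  continuous_ε _ _ k := k.elim
  continuous_h _ _ k := k.elim
  ε_symm _ _ _ _ := by simp
  ε_sq _ _ _ := Subsingleton.elim _ _
  h_symm _ _ _ _ := by simp
  h_odd _ _ _ := Subsingleton.elim _ _

theorem HFObj.inv_zero {U : Set X} (hU : IsOpen U) (x : X) : (HFObj.zero hU).Inv x :=
  ⟨fun v w _ => Subsingleton.elim (α := EuclideanSpace ℂ PEmpty.{u + 1}) v w,
    fun v => ⟨v, Subsingleton.elim (α := EuclideanSpace ℂ PEmpty.{u + 1}) _ v⟩⟩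

variable {P : PrincipalBundle (PU H) X} {P' : PrincipalBundle (PU H) X'} {D D' : LTD P}

namespace LVB

/-- The direct sum of bundles with the same cover and sections. -/
def sum [Nontrivial H] (V V' : LVB D) : LVB D where
  E a := (V.E a).sum (V'.E a)
  φ a b x := blockMap (V.φ a b x) 0 0 (V'.φ a b x)
  isHFHom a b := (V.isHFHom a b).sum (V'.isHFHom a b)
  unit a x hx := ((V.unit a x hx).sum (V'.unit a x hx) rfl rfl).trans (.of_eq PreHom.sum_id)
  cocycle a b c x ha hb hc := (PreHom.GEq.of_eq (PreHom.sum_comp _ _ _ _)).trans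
    ((V.cocycle a b c x ha hb hc).sum (V'.cocycle a b c x ha hb hc) rfl rfl)

/-- The product with `(F, T)`. -/
def thom (V : LVB D) (z : C(X, ℂ)) : LVB D where
  E a := (V.E a).thom z
  φ a b x := blockMap (V.φ a b x) 0 0 (V.φ a b x)
  isHFHom a b := (V.isHFHom a b).thom z
  unit a x hx := ((V.unit a x hx).thom hx z).trans (.of_eq (PreHom.thom_id z))
  cocycle a b c x ha hb hc := (PreHom.GEq.of_eq (PreHom.thom_comp _ _ z)).trans
    ((V.cocycle a b c x ha hb hc).thom hc z)

/-- The bundle with the opposite grading. -/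
def neg (V : LVB D) : LVB D where
  E a := (V.E a).neg
  φ := V.φ
  isHFHom a b := ⟨(V.isHFHom a b).1, fun x hx v => by
    exact (map_smul (V.φ a b x) (-1 : ℂ) ((V.E b).ε x v)).trans
      (congrArg ((-1 : ℂ) • ·) ((V.isHFHom a b).2.1 x hx v)), (V.isHFHom a b).2.2⟩
  unit := V.unit
  cocycle := V.cocycle

/-- The bundle of rank zero. -/
def zero [Nontrivial H] (D : LTD P) : LVB D where
  E a := HFObj.zero (D.isOpen_U a)
  φ _ _ _ := 0
  isHFHom _ _ := .zero
  unit a x hx := by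
    have h1 : (⟨D.g a a, fun _ => 0⟩ : PreHom H (HFObj.zero (D.isOpen_U a))
        (HFObj.zero (D.isOpen_U a))).IsMor P (D.s a) (D.s a) (D.U a ∩ D.U a) :=
      ⟨D.continuousOn_g a a, D.act_g a a, .zero⟩
    have h2 : (PreHom.id (HFObj.zero (D.isOpen_U a)) : PreHom H _ _).IsMor P (D.s a) (D.s a)
        (D.U a ∩ D.U a) := ⟨continuousOn_const, fun y _ => by
      change P.act (D.s a y) (toPU H 1) = D.s a y
      rw [map_one, P.act_one], .id⟩
    exact h1.geq_of_inv h2 ((D.isOpen_U a).inter (D.isOpen_U a)) ⟨hx, hx⟩ hx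
      (HFObj.inv_zero _ _)
  cocycle a b c x ha hb hc := by
    have h1 : ∀ a b, (⟨D.g a b, fun _ => 0⟩ : PreHom H (HFObj.zero (D.isOpen_U b))
        (HFObj.zero (D.isOpen_U a))).IsMor P (D.s b) (D.s a) (D.U a ∩ D.U b) := fun a b =>
      ⟨D.continuousOn_g a b, D.act_g a b, .zero⟩
    have ho := ((D.isOpen_U a).inter (D.isOpen_U b)).inter (D.isOpen_U c)
    exact ((((h1 a b).mono (W' := D.U a ∩ D.U b ∩ D.U c) inter_subset_left).comp
      ((h1 b c).mono fun x hx => ⟨hx.1.2, hx.2⟩) fun x hx => hx.1.2)).geq_of_inv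
      ((h1 a c).mono fun x hx => ⟨hx.1.1, hx.2⟩) ho ⟨⟨ha, hb⟩, hc⟩ hc (HFObj.inv_zero _ _)

end LVB

namespace TV

theorem invAt_zero [Nontrivial H] (D : LTD P) (x : X) : (⟨D, .zero D⟩ : TV P).InvAt x :=
  fun _ _ => HFObj.inv_zero _ _

theorem InvAt.sum [Nontrivial H] {V V' : LVB D} {x : X} (h : (⟨D, V⟩ : TV P).InvAt x)
    (h' : (⟨D, V'⟩ : TV P).InvAt x) : (⟨D, V.sum V'⟩ : TV P).InvAt x :=
  fun a ha => blockMap_bijective_diag (h a ha) (h' a ha)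

theorem InvAt.thom {V : LVB D} {x : X} {z : C(X, ℂ)} (h : z x ≠ 0 ∨ (⟨D, V⟩ : TV P).InvAt x) :
    (⟨D, V.thom z⟩ : TV P).InvAt x := fun a ha => by
  have hfin := (V.E a).finiteDimensional_fib ha
  exact blockMap_thom_bijective ((V.E a).ε_sq x ha) ((V.E a).h_odd x ha)
    ((V.E a).h_symm x ha) (h.imp_right fun h => h a ha)

/-- Isomorphisms of the summands, with different lifts of the transition functions, induce an
isomorphism of the sums, since the second family of lifts can be normalized by functions with values
in `U(1)`. -/
theorem Compat.sum [Nontrivial H] {V₁ V₂ : LVB D} {V₁' V₂' : LVB D'}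
    (h₁ : Compat ⟨D, V₁⟩ ⟨D', V₁'⟩) (h₂ : Compat ⟨D, V₂⟩ ⟨D', V₂'⟩) :
    Compat ⟨D, V₁.sum V₂⟩ ⟨D', V₁'.sum V₂'⟩ := by
  obtain ⟨C⟩ := h₁
  obtain ⟨K⟩ := h₂
  have ho : ∀ a b, IsOpen (D.U a ∩ D'.U b) := fun a b => (D.isOpen_U a).inter (D'.isOpen_U b)
  -- a representative of the same morphism as `Φ` with the lift of `Φ₁`
  have norm : ∀ {U U' W : Set X} {E : HFObj X U} {E' : HFObj X U'} {E₁ : HFObj X U}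
      {E₁' : HFObj X U'} {s s' : X → P.Total} {Φ : PreHom H E E'} {Φ₁ : PreHom H E₁ E₁'},
      IsOpen W → Φ.IsMor P s s' W → Φ₁.IsMor P s s' W → ∃ Φ' : PreHom H E E', Φ'.g = Φ₁.g ∧
        Φ'.IsMor P s s' W ∧ ∀ x ∈ W, PreHom.GEq x Φ Φ' := by
    intro U U' W E E' E₁ E₁' s s' Φ Φ₁ hW hΦ hΦ₁
    obtain ⟨ζ, hζ, hg⟩ := PreHom.exists_circle hΦ.1 hΦ₁.1 hΦ.2.1 hΦ₁.2.1
    refine ⟨⟨Φ₁.g, fun x => ((ζ x)⁻¹ : Circle) • Φ.φ x⟩, rfl, ⟨hΦ₁.1, hΦ₁.2.1,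
      hΦ.2.2.smulOn (continuous_subtype_val.comp_continuousOn hζ.inv)⟩, fun x hx =>
      ⟨W, hW, hx, ζ, hζ, hg, fun y hy => ⟨1, one_pos, W, hW, hy, Subset.rfl, fun z hz v _ => ?_⟩⟩⟩
    change Φ.φ z v = (ζ z : ℂ) • (((ζ z)⁻¹ : Circle) : ℂ) • Φ.φ z v
    rw [smul_smul, ← Circle.coe_mul, mul_inv_cancel, Circle.coe_one, one_smul]
  choose Ψ hΨg hΨ hΨK using fun a b => norm (ho a b) (K.mor a b) (C.mor a b)
  choose Ψ' hΨg' hΨ' hΨK' using fun a b => norm (ho a b) (K.mor' a b) (C.mor' a b)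
  have hr : ∀ {a b x} (ha : x ∈ D.U a) (hb : x ∈ D'.U b), GObj.Rp (K.iso ha hb).hom (Ψ a b) :=
    fun ha hb => (K.hom_rp ha hb).of_geq ⟨_, ho _ _, ⟨ha, hb⟩, hΨ _ _⟩ (hΨK _ _ _ ⟨ha, hb⟩)
  have hr' : ∀ {a b x} (ha : x ∈ D.U a) (hb : x ∈ D'.U b), GObj.Rp (K.iso ha hb).inv (Ψ' a b) :=
    fun ha hb => (K.inv_rp ha hb).of_geq ⟨_, ho _ _, ⟨ha, hb⟩, hΨ' _ _⟩ (hΨK' _ _ _ ⟨ha, hb⟩)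
  have hrg : ∀ a b, (C.Ψ a b).g = (Ψ a b).g := fun a b => (hΨg a b).symm
  have hrg' : ∀ a b, (C.Ψ' a b).g = (Ψ' a b).g := fun a b => (hΨg' a b).symm
  refine ⟨{
    Ψ := fun a b => (C.Ψ a b).sum (Ψ a b)
    Ψ' := fun a b => (C.Ψ' a b).sum (Ψ' a b)
    mor := fun a b => ⟨(C.mor a b).1, (C.mor a b).2.1, (C.mor a b).2.2.sum (hΨ a b).2.2⟩
    mor' := fun a b => ⟨(C.mor' a b).1, (C.mor' a b).2.1, (C.mor' a b).2.2.sum (hΨ' a b).2.2⟩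
    left := fun a b x ha hb => ?_
    right := fun a b x ha hb => ?_
    comm := fun a a' b b' x ha ha' hb hb' => ?_ }⟩
  · refine (PreHom.GEq.of_eq (PreHom.sum_comp _ _ _ _)).trans (PreHom.GEq.trans
      (PreHom.GEq.sum (C.left a b x ha hb) (((hr ha hb).comp (hr' ha hb)).geq_iff (.id _) |>.2
        (Iso.hom_inv_id _)) ?_ rfl) (.of_eq PreHom.sum_id))
    exact funext fun y => congrArg₂ (· * ·) (congrFun (hrg' a b) y) (congrFun (hrg a b) y)
  · refine (PreHom.GEq.of_eq (PreHom.sum_comp _ _ _ _)).trans (PreHom.GEq.trans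
      (PreHom.GEq.sum (C.right a b x ha hb) (((hr' ha hb).comp (hr ha hb)).geq_iff (.id _) |>.2
        (Iso.inv_hom_id _)) ?_ rfl) (.of_eq PreHom.sum_id))
    exact funext fun y => congrArg₂ (· * ·) (congrFun (hrg a b) y) (congrFun (hrg' a b) y)
  · refine (PreHom.GEq.of_eq (PreHom.sum_comp (C.Ψ a' b') (Ψ a' b') (Φ ⟨D, V₁⟩ a' a)
      (Φ ⟨D, V₂⟩ a' a))).trans (PreHom.GEq.trans (PreHom.GEq.sum (C.comm a a' b b' x ha ha' hb hb')
        (((tr_rp (𝔸 := ⟨D, V₂⟩) ha ha').comp (hr ha' hb')).geq_iff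
          ((hr ha hb).comp (tr_rp (𝔸 := ⟨D', V₂'⟩) hb hb')) |>.2 (K.tr_hom ha ha' hb hb')) ?_ ?_)
      (.of_eq (PreHom.sum_comp (Φ ⟨D', V₁'⟩ b' b) (Φ ⟨D', V₂'⟩ b' b) (C.Ψ a b) (Ψ a b)).symm))
    · exact funext fun y => congrArg (· * D.g a' a y) (congrFun (hrg a' b') y)
    · exact funext fun y => congrArg (D'.g b' b y * ·) (congrFun (hrg a b) y)

/-- Compatibilities are preserved by multiplication with the Thom class: `φ ↦ φ ⊗ 1` respects
compositions and germs. -/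
theorem Compat.thom {V : LVB D} {V' : LVB D'} (h : Compat ⟨D, V⟩ ⟨D', V'⟩) (z : C(X, ℂ)) :
    Compat ⟨D, V.thom z⟩ ⟨D', V'.thom z⟩ := by
  obtain ⟨C⟩ := h
  exact ⟨{
    Ψ := fun a b => (C.Ψ a b).thom z
    Ψ' := fun a b => (C.Ψ' a b).thom z
    mor := fun a b => ⟨(C.mor a b).1, (C.mor a b).2.1, (C.mor a b).2.2.thom z⟩
    mor' := fun a b => ⟨(C.mor' a b).1, (C.mor' a b).2.1, (C.mor' a b).2.2.thom z⟩
    left := fun a b x ha hb => (PreHom.GEq.of_eq (PreHom.thom_comp _ _ z)).trans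
      (((C.left a b x ha hb).thom ha z).trans (.of_eq (PreHom.thom_id z)))
    right := fun a b x ha hb => (PreHom.GEq.of_eq (PreHom.thom_comp _ _ z)).trans
      (((C.right a b x ha hb).thom hb z).trans (.of_eq (PreHom.thom_id z)))
    comm := fun a a' b b' x ha ha' hb hb' =>
      (PreHom.GEq.of_eq (PreHom.thom_comp (C.Ψ a' b') (Φ ⟨D, V⟩ a' a) z)).trans
        (((C.comm a a' b b' x ha ha' hb hb').thom ha z).trans
          (.of_eq (PreHom.thom_comp (Φ ⟨D', V'⟩ b' b) (C.Ψ a b) z).symm)) }⟩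

/-! The bundles in the following comparisons are equal up to the enumeration of local frames and
the order of summands. -/

theorem Sub.pull_sum [Nontrivial H] (F : PMap P' P) (V V' : LVB D) :
    Sub ⟨(TV.pull F ⟨D, V⟩).D, (TV.pull F ⟨D, V⟩).V.sum (TV.pull F ⟨D, V'⟩).V⟩
      (TV.pull F ⟨D, V.sum V'⟩) :=
  .of_iso id (fun a x hx => hx) (fun a x hx => rfl)
    (fun a b x hx => rfl) (fun a x => LinearMap.id) (fun a x => LinearMap.id)
    (fun a => isHFHom_of_frame id (fun _ => id)
      (fun i x hx => ⟨⟨hx.1.1, hx.2.1.2, hx.2.2.2⟩, fun k => by cases k <;> rfl⟩)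
      (fun x hx v => rfl) fun x hx v => rfl)
    (fun a => isHFHom_of_frame id (fun _ => id)
      (fun i x hx => ⟨⟨⟨hx.1.1, hx.2.2.1⟩, hx.1.1, hx.2.2.2⟩, fun k => by cases k <;> rfl⟩)
      (fun x hx v => rfl) fun x hx v => rfl) (fun a x hx v => rfl) (fun a x hx v => rfl)
      (fun a b x hx v => rfl)

theorem Sub.pull_thom {f : C(X', X)} (F : P'.Hom P f) (V : LVB D) (z : C(X, ℂ)) :
    Sub ⟨(TV.pull (.ofHom F) ⟨D, V⟩).D, (TV.pull (.ofHom F) ⟨D, V⟩).V.thom (z.comp f)⟩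
      (TV.pull (.ofHom F) ⟨D, V.thom z⟩) :=
  .of_iso id (fun a x hx => hx) (fun a x hx => rfl)
    (fun a b x hx => rfl) (fun a x => LinearMap.id) (fun a x => LinearMap.id)
    (fun a => isHFHom_of_frame id (fun _ => id)
      (fun i x hx => ⟨⟨hx.1.1, hx.2.1.2, hx.2.2.2⟩, fun k => by cases k <;> rfl⟩)
      (fun x hx v => rfl) fun x hx v => rfl)
    (fun a => isHFHom_of_frame id (fun _ => id)
      (fun i x hx => ⟨⟨⟨hx.1.1, hx.2.2.1⟩, hx.1.1, hx.2.2.2⟩, fun k => by cases k <;> rfl⟩)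
      (fun x hx v => rfl) fun x hx v => rfl) (fun a x hx v => rfl) (fun a x hx v => rfl)
      (fun a b x hx v => rfl)

section linear

variable {V₁ V₂ V₃ W₁ W₂ W₃ : Type u} [NormedAddCommGroup V₁] [InnerProductSpace ℂ V₁]
  [NormedAddCommGroup V₂] [InnerProductSpace ℂ V₂] [NormedAddCommGroup V₃] [InnerProductSpace ℂ V₃]
  [NormedAddCommGroup W₁] [InnerProductSpace ℂ W₁]
  [NormedAddCommGroup W₂] [InnerProductSpace ℂ W₂] [NormedAddCommGroup W₃] [InnerProductSpace ℂ W₃]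

variable (V₁ V₂ V₃) in
/-- The interchange of two summands. -/
def sumSwap : WithLp 2 (V₁ × V₂) →ₗ[ℂ] WithLp 2 (V₂ × V₁) where
  toFun v := WithLp.toLp 2 (v.snd, v.fst)
  map_add' _ _ := rfl
  map_smul' _ _ := rfl

variable (V₁ V₂ V₃) in
/-- The change of brackets in a triple sum. -/
def sumAssoc : WithLp 2 (WithLp 2 (V₁ × V₂) × V₃) →ₗ[ℂ] WithLp 2 (V₁ × WithLp 2 (V₂ × V₃)) where
  toFun v := WithLp.toLp 2 (v.fst.fst, WithLp.toLp 2 (v.fst.snd, v.snd))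
  map_add' _ _ := rfl
  map_smul' _ _ := rfl

variable (V₁ V₂ V₃) in
/-- The change of brackets in a triple sum. -/
def sumAssoc' : WithLp 2 (V₁ × WithLp 2 (V₂ × V₃)) →ₗ[ℂ] WithLp 2 (WithLp 2 (V₁ × V₂) × V₃) where
  toFun v := WithLp.toLp 2 (WithLp.toLp 2 (v.fst, v.snd.fst), v.snd.snd)
  map_add' _ _ := rfl
  map_smul' _ _ := rfl

variable (V₁ V₂) in
/-- The projection to the first summand. -/
def sumFst : WithLp 2 (V₁ × V₂) →ₗ[ℂ] V₁ where
  toFun v := v.fst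
  map_add' _ _ := rfl
  map_smul' _ _ := rfl

variable (V₁ V₂) in
/-- The inclusion of the first summand. -/
def sumInl : V₁ →ₗ[ℂ] WithLp 2 (V₁ × V₂) where
  toFun v := WithLp.toLp 2 (v, 0)
  map_add' _ _ := withLp_ext rfl (by simp)
  map_smul' _ _ := withLp_ext rfl (by simp)

theorem sumSwap_apply (v : WithLp 2 (V₁ × V₂)) :
    sumSwap V₁ V₂ v = WithLp.toLp 2 (v.snd, v.fst) := rfl

theorem sumAssoc_apply (v : WithLp 2 (WithLp 2 (V₁ × V₂) × V₃)) :
    sumAssoc V₁ V₂ V₃ v = WithLp.toLp 2 (v.fst.fst, WithLp.toLp 2 (v.fst.snd, v.snd)) := rfl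

theorem sumAssoc'_apply (v : WithLp 2 (V₁ × WithLp 2 (V₂ × V₃))) :
    sumAssoc' V₁ V₂ V₃ v = WithLp.toLp 2 (WithLp.toLp 2 (v.fst, v.snd.fst), v.snd.snd) := rfl

theorem sumFst_apply (v : WithLp 2 (V₁ × V₂)) : sumFst V₁ V₂ v = v.fst := rfl

theorem sumInl_apply (v : V₁) : sumInl V₁ V₂ v = WithLp.toLp 2 (v, 0) := rfl

variable (a : V₁ →ₗ[ℂ] W₁) (b : V₂ →ₗ[ℂ] W₂) (c : V₃ →ₗ[ℂ] W₃)

theorem sumSwap_blockMap (v : WithLp 2 (V₁ × V₂)) :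
    sumSwap W₁ W₂ (blockMap a 0 0 b v) = blockMap b 0 0 a (sumSwap V₁ V₂ v) :=
  withLp_ext (by simp [sumSwap_apply]) (by simp [sumSwap_apply])

theorem sumAssoc_blockMap (v : WithLp 2 (WithLp 2 (V₁ × V₂) × V₃)) :
    sumAssoc W₁ W₂ W₃ (blockMap (blockMap a 0 0 b) 0 0 c v) =
      blockMap a 0 0 (blockMap b 0 0 c) (sumAssoc V₁ V₂ V₃ v) :=
  withLp_ext (by simp [sumAssoc_apply]) (withLp_ext (by simp [sumAssoc_apply])
    (by simp [sumAssoc_apply]))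

theorem sumAssoc'_blockMap (v : WithLp 2 (V₁ × WithLp 2 (V₂ × V₃))) :
    sumAssoc' W₁ W₂ W₃ (blockMap a 0 0 (blockMap b 0 0 c) v) =
      blockMap (blockMap a 0 0 b) 0 0 c (sumAssoc' V₁ V₂ V₃ v) :=
  withLp_ext (withLp_ext (by simp [sumAssoc'_apply]) (by simp [sumAssoc'_apply]))
    (by simp [sumAssoc'_apply])

theorem sumFst_blockMap (v : WithLp 2 (V₁ × V₂)) :
    sumFst W₁ W₂ (blockMap a 0 0 b v) = a (sumFst V₁ V₂ v) := by
  simp [sumFst_apply]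

theorem sumInl_blockMap (v : V₁) :
    sumInl W₁ W₂ (a v) = blockMap a 0 0 b (sumInl V₁ V₂ v) :=
  withLp_ext (by simp [sumInl_apply]) (by simp [sumInl_apply])

end linear

/-- The distribution of the frames in a triple sum. -/
def frameAssoc {A B C : Type} : (A ⊕ B) ⊕ C → A ⊕ B ⊕ C
  | .inl (.inl a) => .inl a
  | .inl (.inr b) => .inr (.inl b)
  | .inr c => .inr (.inr c)

/-- The distribution of the frames in a triple sum. -/
def frameAssoc' {A B C : Type} : A ⊕ B ⊕ C → (A ⊕ B) ⊕ C
  | .inl a => .inl (.inl a)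
  | .inr (.inl b) => .inl (.inr b)
  | .inr (.inr c) => .inr c

theorem Sub.sum_comm [Nontrivial H] (V V' : LVB D) :
    Sub (⟨D, V.sum V'⟩ : TV P) ⟨D, V'.sum V⟩ := by
  have key : ∀ (V V' : LVB D) a, IsHFHom ((V.sum V').E a) ((V'.sum V).E a) (D.U a)
      fun x => sumSwap _ _ := fun V V' a =>
    isHFHom_of_frame (fun i => (i.2, i.1)) (fun _ k => k.swap)
      (fun i x hx => ⟨hx.2.symm, fun k => by cases k <;> rfl⟩)
      (fun x hx v => sumSwap_blockMap _ _ _) fun x hx v => sumSwap_blockMap _ _ _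
  exact .of_iso id (fun a x hx => hx) (fun a x hx => rfl) (fun a b x hx => rfl)
    (fun a x => sumSwap _ _) (fun a x => sumSwap _ _) (key V V') (key V' V)
    (fun a x hx v => rfl) (fun a x hx v => rfl) fun a b x hx v => (sumSwap_blockMap _ _ _).symm

theorem Sub.sum_assoc [Nontrivial H] (V V' V'' : LVB D) :
    Sub (⟨D, (V.sum V').sum V''⟩ : TV P) ⟨D, V.sum (V'.sum V'')⟩ :=
  .of_iso id (fun a x hx => hx) (fun a x hx => rfl) (fun a b x hx => rfl)
    (fun a x => sumAssoc _ _ _) (fun a x => sumAssoc' _ _ _)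
    (fun a => isHFHom_of_frame (fun i => (i.1.1, (i.1.2, i.2))) (fun _ => frameAssoc)
      (fun i x hx => ⟨⟨hx.2.1.1, hx.2.1.2, hx.2.2⟩, fun k => by
        rcases k with (k | k) | k <;> rfl⟩)
      (fun x hx v => sumAssoc_blockMap _ _ _ _) fun x hx v => sumAssoc_blockMap _ _ _ _)
    (fun a => isHFHom_of_frame (fun i => ((i.1, i.2.1), i.2.2)) (fun _ => frameAssoc')
      (fun i x hx => ⟨⟨⟨hx.2.1, hx.2.2.1⟩, hx.2.2.2⟩, fun k => by
        rcases k with k | k | k <;> rfl⟩)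
      (fun x hx v => sumAssoc'_blockMap _ _ _ _) fun x hx v => sumAssoc'_blockMap _ _ _ _)
    (fun a x hx v => rfl) (fun a x hx v => rfl) fun a b x hx v => (sumAssoc_blockMap _ _ _ _).symm

theorem Sub.sum_zero [Nontrivial H] (V : LVB D) :
    Sub (⟨D, V.sum (.zero D)⟩ : TV P) ⟨D, V⟩ :=
  .of_iso id (fun a x hx => hx) (fun a x hx => rfl) (fun a b x hx => rfl)
    (fun a x => sumFst _ _) (fun a x => sumInl _ _)
    (fun a => isHFHom_of_frame (fun i => i.1) (fun _ k => k.elim (fun k => k) Empty.elim)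
      (fun i x hx => ⟨hx.2.1, fun k => by rcases k with k | ⟨⟨⟩⟩; rfl⟩)
      (fun x hx v => sumFst_blockMap _ _ _) fun x hx v => sumFst_blockMap _ _ _)
    (fun a => isHFHom_of_frame (fun i => (i, PUnit.unit)) (fun _ k => .inl k)
      (fun i x hx => ⟨⟨hx.2, hx.1⟩, fun k => rfl⟩)
      (fun x hx v => sumInl_blockMap _ _ _) fun x hx v => sumInl_blockMap _ _ _)
    (fun a x hx v => withLp_ext rfl (Subsingleton.elim (α := EuclideanSpace ℂ PEmpty.{u + 1}) _ _))
    (fun a x hx v => rfl) fun a b x hx v => (sumFst_blockMap _ _ _).symm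

/-- For `z = 0` the multiplication with the Thom class gives the sum of the bundle and the bundle with
the opposite grading. -/
theorem Sub.sum_neg [Nontrivial H] (V : LVB D) :
    Sub (⟨D, V.sum V.neg⟩ : TV P) ⟨D, V.thom 0⟩ := by
  have h0 : ∀ a x, ((V.thom 0).E a).h x = ((V.sum V.neg).E a).h x := fun a x => by
    change blockMap _ (star (0 : ℂ) • (V.E a).ε x) ((0 : ℂ) • (V.E a).ε x) _ = blockMap _ 0 0 _
    rw [star_zero, zero_smul]; rfl
  exact .of_iso id (fun a x hx => hx) (fun a x hx => rfl)
    (fun a b x hx => rfl) (fun a x => LinearMap.id) (fun a x => LinearMap.id)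
    (fun a => isHFHom_of_frame id (fun _ => id)
      (fun i x hx => ⟨hx.2, fun k => by cases k <;> rfl⟩)
      (fun x hx v => rfl) fun x hx v => (LinearMap.congr_fun (h0 a x) v).symm)
    (fun a => isHFHom_of_frame id (fun _ => id)
      (fun i x hx => ⟨hx.2, fun k => by cases k <;> rfl⟩)
      (fun x hx v => rfl) fun x hx v => LinearMap.congr_fun (h0 a x) v) (fun a x hx v => rfl)
      (fun a x hx v => rfl) (fun a b x hx v => rfl)

end TV

end sum

/-! ### Bundle maps to products -/

section toProd

variable {X : Type u} [TopologicalSpace X] {X' : Type u} [TopologicalSpace X']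
  {G : Type w} [Group G] [TopologicalSpace G] {P : PrincipalBundle G X}
  {P' : PrincipalBundle G X'} {f : C(X', X)} {K : Type} [TopologicalSpace K]

namespace PrincipalBundle

/-- The bundle map `(F, k) : P' → P × K`. -/
def Hom.toProd (F : P'.Hom P f) (k : C(X', K)) : P'.Hom (P.prod K) (f.prodMk k) :=
  F.lift _ _ fun _ => rfl

/-- The projection `P × K → P`. -/
def prodProj (P : PrincipalBundle G X) (K : Type) [TopologicalSpace K] :
    (P.prod K).Hom P ⟨Prod.fst, continuous_fst⟩ := P.pullbackHom _

/-- The map `P × I → P × I` changing the parameter by `c`. -/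
def reparam (P : PrincipalBundle G X) (c : C(I, I)) :
    (P.prod I).Hom (P.prod I) (ContinuousMap.prodMk ⟨Prod.fst, continuous_fst⟩
      (c.comp ⟨Prod.snd, continuous_snd⟩)) :=
  (P.prodProj I).toProd _

theorem Hom.base_eq {f' : C(X', X)} (F : P'.Hom P f) (F' : P'.Hom P f')
    (h : ∀ p, F.toFun p = F'.toFun p) (x : X') : f x = f' x := by
  obtain ⟨p, rfl⟩ := P'.exists_mem_fiber x
  rw [← F.proj_toFun, h, F'.proj_toFun]

end PrincipalBundle

end toProd

namespace TV

section along

variable {X : Type u} [TopologicalSpace X] {X' : Type u} [TopologicalSpace X']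
  {X'' : Type u} [TopologicalSpace X''] {X₁ : Type u} [TopologicalSpace X₁] {H : Type w}
  [NormedAddCommGroup H] [InnerProductSpace ℂ H] {P : PrincipalBundle (PU H) X}
  {P' : PrincipalBundle (PU H) X'} {P'' : PrincipalBundle (PU H) X''}
  {P₁ : PrincipalBundle (PU H) X₁} {f : C(X', X)} {f' : C(X'', X')} {𝔸 𝔹 ℭ : TV P}

/-- The pull-back along a bundle map. -/
abbrev along (F : P'.Hom P f) (𝔸 : TV P) : TV P' := pull (.ofHom F) 𝔸

/-- The restriction to an open subset. -/
abbrev on (𝔸 : TV P) (O : Set X) (hO : IsOpen O) : TV P := pull (.idOn P O hO) 𝔸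

theorem dom_along (F : P'.Hom P f) (𝔸 : TV P) : (along F 𝔸).dom = f ⁻¹' 𝔸.dom := by
  rw [dom_pull]; exact univ_inter _

theorem Sub.along_along {k : C(X'', X)} {F : P'.Hom P f} {F' : P''.Hom P' f'} {K : P''.Hom P k}
    (h : ∀ p, F.toFun (F'.toFun p) = K.toFun p) (𝔸 : TV P) :
    Sub (along F' (along F 𝔸)) (along K 𝔸) :=
  (Sub.comp_pull _ _ 𝔸).trans (.pull_congr (F' := .ofHom K) (fun _ _ => trivial)
    (fun x _ => (F.comp F').base_eq K h x) (fun p _ => h p) 𝔸)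

theorem Sub.along_of_comp {k : C(X'', X)} {F : P'.Hom P f} {F' : P''.Hom P' f'} {K : P''.Hom P k}
    (h : ∀ p, F.toFun (F'.toFun p) = K.toFun p) (𝔸 : TV P) :
    Sub (along K 𝔸) (along F' (along F 𝔸)) :=
  (Sub.pull_congr (F := .ofHom K) (F' := (PMap.ofHom F).comp (.ofHom F'))
    (fun _ _ => ⟨trivial, trivial⟩) (fun x _ => ((F.comp F').base_eq K h x).symm)
    (fun p _ => (h p).symm) 𝔸).trans (Sub.pull_comp _ _ 𝔸)

theorem Sub.along_id {k : C(X, X)} {F : P.Hom P k} (h : ∀ p, F.toFun p = p) (𝔸 : TV P) :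
    Sub (along F 𝔸) 𝔸 :=
  (Sub.pull_congr (F := .ofHom F) (F' := .idOn P univ isOpen_univ) (fun _ h => h)
    (fun x _ => F.base_eq (.id P) h x) (fun p _ => h p) 𝔸).trans (Sub.pull_idOn _ _ 𝔸)

theorem Sub.id_along {k : C(X, X)} {F : P.Hom P k} (h : ∀ p, F.toFun p = p) (𝔸 : TV P) :
    Sub 𝔸 (along F 𝔸) :=
  (Sub.idOn_pull univ isOpen_univ 𝔸 (subset_univ _)).trans
    (Sub.pull_congr (F := .idOn P univ isOpen_univ) (F' := .ofHom F) (fun _ h => h)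
      (fun x _ => ((F.base_eq (.id P) h x)).symm) (fun p _ => (h p).symm) 𝔸)

/-- A pull-back along two bundle maps whose composition is the identity. -/
theorem Sub.along_left_inv {F : P'.Hom P f} {k : C(X, X')} {F' : P.Hom P' k}
    (h : ∀ p, F.toFun (F'.toFun p) = p) (𝔸 : TV P) : Sub 𝔸 (along F' (along F 𝔸)) :=
  (Sub.id_along (F := F.comp F') h 𝔸).trans (.along_of_comp (K := F.comp F') (fun _ => rfl) 𝔸)

theorem Sub.left_inv_along {F : P'.Hom P f} {k : C(X, X')} {F' : P.Hom P' k}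
    (h : ∀ p, F.toFun (F'.toFun p) = p) (𝔸 : TV P) : Sub (along F' (along F 𝔸)) 𝔸 :=
  (Sub.along_along (K := F.comp F') (fun _ => rfl) 𝔸).trans (Sub.along_id h 𝔸)

theorem Compat.of_subs (h : Sub 𝔸 ℭ) (h' : Sub 𝔹 ℭ) : Compat 𝔸 𝔹 := (Compat.refl ℭ).of_sub h h'

/-- Compatibility can be checked over an open set containing the intersection of the domains. -/
theorem Compat.of_on {O : Set X} {hO : IsOpen O} (h : Compat (𝔸.on O hO) 𝔹)
    (hd : ∀ x ∈ 𝔸.dom, x ∈ 𝔹.dom → x ∈ O) : Compat 𝔸 𝔹 := by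
  obtain ⟨C⟩ := h
  have hs : ∀ a x, x ∈ 𝔸.D.U a → x ∈ O → (𝔸.on O hO).D.s a x = 𝔸.D.s a x := fun a x hx hxO =>
    PMap.F_comapSection (PMap.idOn P O hO) _ hxO (𝔸.D.proj_s a _ hx)
  let T : ∀ a, PreHom H (𝔸.V.E a) ((𝔸.on O hO).V.E a) := fun a => ⟨fun _ => 1, fun _ => .id⟩
  let T' : ∀ a, PreHom H ((𝔸.on O hO).V.E a) (𝔸.V.E a) := fun a => ⟨fun _ => 1, fun _ => .id⟩
  have hT : ∀ a, (T a).IsMor P (𝔸.D.s a) ((𝔸.on O hO).D.s a) (O ∩ 𝔸.D.U a) := fun a =>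
    ⟨continuousOn_const, fun x hx => by rw [map_one, P.act_one, hs a x hx.2 hx.1],
      isHFHom_of_frame id (fun _ => id) (fun i x hx => ⟨⟨hx.1.1, hx.2⟩, fun k => rfl⟩)
        (fun x hx v => rfl) fun x hx v => rfl⟩
  have hT' : ∀ a, (T' a).IsMor P ((𝔸.on O hO).D.s a) (𝔸.D.s a) (O ∩ 𝔸.D.U a) := fun a =>
    ⟨continuousOn_const, fun x hx => by rw [map_one, P.act_one, hs a x hx.2 hx.1],
      isHFHom_of_frame id (fun _ => id) (fun i x hx => ⟨hx.2.2, fun k => rfl⟩)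
        (fun x hx v => rfl) fun x hx v => rfl⟩
  have hl : ∀ a, (T' a).comp (T a) = .id _ := fun a =>
    congrArg₂ PreHom.mk (funext fun x => mul_one (1 : UGroup H)) rfl
  have hr : ∀ a, (T a).comp (T' a) = .id _ := fun a =>
    congrArg₂ PreHom.mk (funext fun x => mul_one (1 : UGroup H)) rfl
  have hU : ∀ {a x}, x ∈ 𝔸.D.U a → x ∈ O → x ∈ (𝔸.on O hO).D.U a := fun hx hxO => ⟨hxO, hx⟩
  let i : ∀ a x (hx : x ∈ 𝔸.D.U a) (hxO : x ∈ O), obj hx ≅ obj (hU hx hxO) := fun a x hx hxO =>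
    { hom := GObj.germ (Φ := T a) ⟨_, hO.inter (𝔸.D.isOpen_U a), ⟨hxO, hx⟩, hT a⟩
      inv := GObj.germ (Φ := T' a) ⟨_, hO.inter (𝔸.D.isOpen_U a), ⟨hxO, hx⟩, hT' a⟩
      hom_inv_id := (((GObj.germ_rp _).comp (GObj.germ_rp _)).geq_iff (.id _)).1 (.of_eq (hl a))
      inv_hom_id := (((GObj.germ_rp _).comp (GObj.germ_rp _)).geq_iff (.id _)).1 (.of_eq (hr a)) }
  have hi : ∀ a x hx hxO, GObj.Rp (i a x hx hxO).hom (T a) := fun a x hx hxO => GObj.germ_rp _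
  have hi' : ∀ a x hx hxO, GObj.Rp (i a x hx hxO).inv (T' a) := fun a x hx hxO => GObj.germ_rp _
  have hO' : ∀ {a b x}, x ∈ 𝔸.D.U a → x ∈ 𝔹.D.U b → x ∈ O := fun ha hb =>
    hd _ (mem_dom.2 ⟨_, ha⟩) (mem_dom.2 ⟨_, hb⟩)
  refine ⟨{
    Ψ := fun a b => (C.Ψ a b).comp (T a)
    Ψ' := fun a b => (T' a).comp (C.Ψ' a b)
    mor := fun a b => ((C.mor a b).mono fun x hx => ⟨⟨hO' hx.1 hx.2, hx.1⟩, hx.2⟩).comp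
      ((hT a).mono fun x hx => ⟨hO' hx.1 hx.2, hx.1⟩) fun x hx => ⟨hO' hx.1 hx.2, hx.1⟩
    mor' := fun a b => ((hT' a).mono fun x hx => ⟨hO' hx.1 hx.2, hx.1⟩).comp
      ((C.mor' a b).mono fun x hx => ⟨⟨hO' hx.1 hx.2, hx.1⟩, hx.2⟩)
      fun x hx => ⟨hO' hx.1 hx.2, hx.1⟩
    left := fun a b x ha hb => ?_
    right := fun a b x ha hb => ?_
    comm := fun a a' b b' x ha ha' hb hb' => ?_ }⟩
  · have hx := hO' ha hb
    refine (((hi a x ha hx).comp (C.hom_rp (hU ha hx) hb)).comp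
      ((C.inv_rp (hU ha hx) hb).comp (hi' a x ha hx))).geq_iff (.id _) |>.2 ?_
    simp
  · have hx := hO' ha hb
    refine (((C.inv_rp (hU ha hx) hb).comp (hi' a x ha hx)).comp
      ((hi a x ha hx).comp (C.hom_rp (hU ha hx) hb))).geq_iff (.id _) |>.2 ?_
    simp
  · have hx := hO' ha hb
    have key : tr ha ha' ≫ (i a' x ha' hx).hom =
        (i a x ha hx).hom ≫ tr (hU ha hx) (hU ha' hx) := by
      refine (((tr_rp ha ha').comp (hi a' x ha' hx)).geq_iff
        ((hi a x ha hx).comp (tr_rp _ _))).1 (.of_eq ?_)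
      exact congrArg₂ PreHom.mk
        (funext fun x => (one_mul (𝔸.D.g a' a x)).trans (mul_one (𝔸.D.g a' a x)).symm) rfl
    refine ((tr_rp ha ha').comp ((hi a' x ha' hx).comp (C.hom_rp (hU ha' hx) hb'))).geq_iff
      (((hi a x ha hx).comp (C.hom_rp (hU ha hx) hb)).comp (tr_rp hb hb')) |>.2 ?_
    rw [← Category.assoc, key, Category.assoc, Category.assoc]
    exact congrArg ((i a x ha hx).hom ≫ ·) ((C.tr_hom' (hU ha hx) (hU ha' hx) hb').trans
      (C.hom_tr (hU ha hx) hb hb').symm)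

/-- If two partial bundle maps `F₁` and `F₂` satisfy `F₁ = i ∘ F₂` where both are defined, then the
pull-back of `𝔽` along `F₁` is compatible with the pull-back of `𝔹 ≅ i^*𝔽` along `F₂`. -/
theorem Compat.of_square {𝔽 : TV P₁} {i : PMap P P₁} {F₁ : PMap P' P₁} {F₂ : PMap P' P}
    (h : Compat (TV.pull i 𝔽) 𝔹)
    (hf : ∀ x ∈ F₁.O, x ∈ F₂.O → F₂.f x ∈ i.O ∧ F₁.f x = i.f (F₂.f x))
    (hF : ∀ p, P'.proj p ∈ F₁.O → P'.proj p ∈ F₂.O → F₁.F p = i.F (F₂.F p)) :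
    Compat (TV.pull F₁ 𝔽) (TV.pull F₂ 𝔹) := by
  refine .of_on (O := F₁.O ∩ F₂.O) (hO := F₁.isOpen_O.inter F₂.isOpen_O) ?_ fun x hx hx' => ?_
  · refine (h.pull F₂).of_sub (Sub.pull_pull ?_ ?_ ?_ 𝔽) (Sub.refl _)
    · exact fun x hx _ => ⟨hx.2, (hf x hx.1 hx.2).1⟩
    · exact fun x hx _ => (hf x hx.1 hx.2).2
    · exact fun p hp _ => hF p hp.1 hp.2
  · rw [dom_pull] at hx hx'
    exact ⟨hx.1, hx'.1⟩

theorem Compat.exists_glue (h : Compat 𝔸 𝔹) : ∃ ℰ : TV P, Sub 𝔸 ℰ ∧ Sub 𝔹 ℰ ∧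
    ℰ.dom = 𝔸.dom ∪ 𝔹.dom ∧ ∀ x, 𝔸.InvAt x → 𝔹.InvAt x → ℰ.InvAt x := by
  obtain ⟨C⟩ := h
  exact ⟨C.glue, C.sub_glue_left, C.sub_glue_right, C.dom_glue, fun _ => C.invAt_glue⟩

/-- The union of three bundles, the first and last of which do not meet. -/
theorem Compat.exists_glue₃ [Nontrivial H] (h : Compat 𝔸 𝔹) (h' : Compat 𝔹 ℭ)
    (hd : Disjoint 𝔸.dom ℭ.dom) :
    ∃ ℰ : TV P, Sub 𝔸 ℰ ∧ Sub 𝔹 ℰ ∧ Sub ℭ ℰ ∧ ℰ.dom = 𝔸.dom ∪ ℭ.dom ∪ 𝔹.dom ∧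
      ∀ x, 𝔸.InvAt x → 𝔹.InvAt x → ℭ.InvAt x → ℰ.InvAt x := by
  obtain ⟨C⟩ := Compat.of_disjoint 𝔸 ℭ hd
  obtain ⟨C'⟩ := Compat.glue C h h'.symm fun x hx hx' => (disjoint_left.1 hd hx hx').elim
  refine ⟨C'.glue, C.sub_glue_left.trans C'.sub_glue_left, C'.sub_glue_right,
    C.sub_glue_right.trans C'.sub_glue_left, by rw [C'.dom_glue, C.dom_glue],
    fun x h1 h2 h3 => C'.invAt_glue (C.invAt_glue h1 h3) h2⟩

end along

end TV

/-! ### Homotopy classes -/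

namespace TV

section classes

variable {X : Type u} [TopologicalSpace X] {X' : Type u} [TopologicalSpace X']
  {X'' : Type u} [TopologicalSpace X''] {H : Type w} [NormedAddCommGroup H]
  [InnerProductSpace ℂ H] {P : PrincipalBundle (PU H) X}
  {P' : PrincipalBundle (PU H) X'} {P'' : PrincipalBundle (PU H) X''}
  {f : C(X', X)} {f' : C(X'', X')} {𝔸 𝔹 ℭ : TV P} {Y : Set X} {Y' : Set X'}

theorem Sub.pull_of_comp {F : PMap P' P} {k : C(X'', X)} {F' : P''.Hom P' f'} {K : P''.Hom P k}
    (hO : ∀ x, f' x ∈ F.O) (h : ∀ p, F.F (F'.toFun p) = K.toFun p) (𝔸 : TV P) :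
    Sub (along K 𝔸) (along F' (TV.pull F 𝔸)) := by
  refine (Sub.pull_congr (F := .ofHom K) (F' := F.comp (.ofHom F'))
    (fun x _ => ⟨trivial, hO x⟩) (fun x _ => ?_)
    (fun p _ => (h p).symm) 𝔸).trans (Sub.pull_comp _ _ 𝔸)
  obtain ⟨p, rfl⟩ := P''.exists_mem_fiber x
  have h1 : P.proj (F.F (F'.toFun p)) = F.f (P'.proj (F'.toFun p)) :=
    F.proj_F _ (by rw [F'.proj_toFun]; exact hO _)
  rw [h, K.proj_toFun, F'.proj_toFun] at h1
  exact h1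

theorem Sub.pull_left_inv {F : PMap P' P} {k : C(X, X')} {F' : P.Hom P' k}
    (hO : ∀ x, k x ∈ F.O) (h : ∀ p, F.F (F'.toFun p) = p) (𝔸 : TV P) :
    Sub 𝔸 (along F' (TV.pull F 𝔸)) :=
  (Sub.id_along (F := .id P) (fun _ => rfl) 𝔸).trans (.pull_of_comp hO h 𝔸)

/-- The bundle `𝔸` is defined over the whole base and invertible over `Y`. -/
def Good (Y : Set X) (𝔸 : TV P) : Prop := 𝔸.dom = univ ∧ ∀ y ∈ Y, 𝔸.InvAt y

theorem Good.along (h : Good Y 𝔸) (F : P'.Hom P f) (hf : MapsTo f Y' Y) :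
    Good Y' (TV.along F 𝔸) :=
  ⟨by rw [dom_along, h.1, preimage_univ], fun y hy => InvAt.pull (.ofHom F) (h.2 _ (hf hy))⟩

theorem Good.of_sub (h : Good Y 𝔸) (hs : Sub 𝔸 𝔹) : Good Y 𝔹 :=
  ⟨univ_subset_iff.1 (h.1 ▸ hs.dom_le),
    fun y hy => hs.invAt_of_mem (h.2 y hy) (h.1 ▸ mem_univ y)⟩

theorem Good.sub (h : Good Y 𝔸) (hs : Sub 𝔹 𝔸) (hd : 𝔹.dom = univ) : Good Y 𝔹 :=
  ⟨hd, fun y hy => hs.invAt (h.2 y hy)⟩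

theorem good_ofT {𝔼 : TwistedVB P} (h : Disjoint 𝔼.supp Y) : Good Y (ofT 𝔼) := by
  refine ⟨dom_ofT 𝔼, fun y hy => by_contra fun hn => disjoint_left.1 h ?_ hy⟩
  rw [supp_eq]; exact hn

/-- The affine map `t ↦ a t + b`, cut off at `0` and `1`. -/
def stretch (a b : ℝ) : C(I, I) :=
  ⟨fun t => projIcc 0 1 zero_le_one (a * t + b), by
    exact continuous_projIcc.comp (by fun_prop)⟩

theorem stretch_eq_zero {a b : ℝ} {t : I} (h : a * t + b ≤ 0) : stretch a b t = 0 :=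
  projIcc_of_le_left zero_le_one h

theorem stretch_eq_one {a b : ℝ} {t : I} (h : 1 ≤ a * t + b) : stretch a b t = 1 :=
  projIcc_of_right_le zero_le_one h

theorem reparam_toFun {c : C(I, I)} {e : I} (p : (P.prod I).Total) (h : c p.1.1.2 = e) :
    (P.reparam c).toFun p = (P.slice e).toFun ((P.prodProj I).toFun p) :=
  Subtype.ext (Prod.ext (Prod.ext p.2 h) rfl)

/-- A concordance: the ends of the bundle over `X × I` contain the given bundles. -/
def Conc (Y : Set X) (𝔸 𝔹 : TV P) : Prop :=
  ∃ 𝔽 : TV (P.prod I), Good (Y ×ˢ univ) 𝔽 ∧ Sub 𝔸 (along (P.slice 0) 𝔽) ∧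
    Sub 𝔹 (along (P.slice 1) 𝔽)

theorem Conc.symm (h : Conc Y 𝔸 𝔹) : Conc Y 𝔹 𝔸 := by
  obtain ⟨𝔽, h, h0, h1⟩ := h
  have key : ∀ t e : I, stretch (-1) 1 t = e → Sub (along (P.slice e) 𝔽)
      (along (P.slice t) (along (P.reparam (stretch (-1) 1)) 𝔽)) := fun t e he =>
    .along_of_comp (fun p => reparam_toFun _ he) 𝔽
  exact ⟨along (P.reparam (stretch (-1) 1)) 𝔽, h.along _ fun x hx => ⟨hx.1, trivial⟩,
    h1.trans (key 0 1 (stretch_eq_one (by simp))),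
    h0.trans (key 1 0 (stretch_eq_zero (by simp)))⟩

variable [Nontrivial H]

/-- The homotopy class of `𝔸`. -/
def cls (Y : Set X) (𝔸 : TV P) (h : Good Y 𝔸) : KF P Y :=
  KF.mk ⟨toT 𝔸 h.1, by
    rw [supp_eq, disjoint_left]
    exact fun y hy hy' => hy (h.2 y hy')⟩

theorem exists_cls (a : KF P Y) : ∃ (𝔸 : TV P) (h : Good Y 𝔸), a = cls Y 𝔸 h := by
  induction a using Quot.ind with
  | mk 𝔼 => exact ⟨ofT 𝔼.𝔼, good_ofT 𝔼.disjoint, rfl⟩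

theorem cls_eq_of_homotopy {hA : Good Y 𝔸} {hB : Good Y 𝔹} (𝔽 : TV (P.prod I))
    (h : Good (Y ×ˢ univ) 𝔽) (h0 : Compat (along (P.slice 0) 𝔽) 𝔸)
    (h1 : Compat (along (P.slice 1) 𝔽) 𝔹) : cls Y 𝔸 hA = cls Y 𝔹 hB := by
  refine Quot.sound ⟨⟨toT 𝔽 h.1, ?_⟩, ?_, ?_⟩
  · rw [supp_eq, disjoint_left]
    exact fun y hy hy' => hy (h.2 y hy')
  · exact (h0.of_sub (sub_pullback (toT 𝔽 h.1) (P.slice 0)) (Sub.refl _)).iso (dom_ofT _) hA.1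
  · exact (h1.of_sub (sub_pullback (toT 𝔽 h.1) (P.slice 1)) (Sub.refl _)).iso (dom_ofT _) hB.1

theorem cls_eq_of_compat {hA : Good Y 𝔸} {hB : Good Y 𝔹} (h : Compat 𝔸 𝔹) :
    cls Y 𝔸 hA = cls Y 𝔹 hB :=
  cls_eq_of_homotopy (along (P.prodProj I) 𝔸) (hA.along _ fun _ hx => hx.1)
    ((Compat.refl 𝔸).of_sub (Sub.left_inv_along (F' := P.slice 0) (fun _ => rfl) 𝔸) (Sub.refl _))
    (h.of_sub (Sub.left_inv_along (F' := P.slice 1) (fun _ => rfl) 𝔸) (Sub.refl _))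

theorem cls_eq_of_sub {hA : Good Y 𝔸} {hB : Good Y 𝔹} (h : Sub 𝔸 𝔹) :
    cls Y 𝔸 hA = cls Y 𝔹 hB := cls_eq_of_compat (.of_subs h (Sub.refl _))

theorem map_cls (F : P'.Hom P f) (hf : MapsTo f Y' Y) (h : Good Y 𝔸) :
    KF.map F hf (cls Y 𝔸 h) = cls Y' (along F 𝔸) (h.along F hf) := by
  have h1 : Good Y' (ofT ((toT 𝔸 h.1).pullback F)) :=
    (h.along F hf).sub (sub_pullback (toT 𝔸 h.1) F) (dom_ofT _)
  exact (rfl : _ = cls Y' _ h1).trans (cls_eq_of_sub (sub_pullback (toT 𝔸 h.1) F))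

/-- The concatenation of two concordances.  Over `t < 1/2` it is the first one, run through in time
`1/3`, over `1/2 < t` it is the second one, run through from `t = 2/3` on, and over `1/3 < t < 2/3`
the constant bundle `𝔹` is glued in, since the ends of the concordances only contain `𝔹`. -/
theorem Conc.trans (h : Conc Y 𝔸 𝔹) (h' : Conc Y 𝔹 ℭ) (hB : Good Y 𝔹) : Conc Y 𝔸 ℭ := by
  obtain ⟨𝔽, h, h0, h1⟩ := h
  obtain ⟨𝔾, h', h0', h1'⟩ := h'
  have o1 : IsOpen {x : X × I | (x.2 : ℝ) < 1 / 2} := isOpen_lt (by fun_prop) continuous_const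
  have o2 : IsOpen {x : X × I | 1 / 3 < (x.2 : ℝ) ∧ (x.2 : ℝ) < 2 / 3} :=
    (isOpen_lt (g := fun x : X × I => (x.2 : ℝ)) continuous_const (by fun_prop)).inter
      (isOpen_lt (f := fun x : X × I => (x.2 : ℝ)) (by fun_prop) continuous_const)
  have o3 : IsOpen {x : X × I | 1 / 2 < (x.2 : ℝ)} := isOpen_lt continuous_const (by fun_prop)
  let F1 := (PMap.ofHom (P.reparam (stretch 3 0))).restr _ o1
  let F2 := (PMap.ofHom (P.prodProj I)).restr _ o2
  let F3 := (PMap.ofHom (P.reparam (stretch 3 (-2)))).restr _ o3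
  have c1 : ∀ t : I, 1 / 3 < (t : ℝ) → stretch 3 0 t = 1 := fun t ht =>
    stretch_eq_one (by linarith)
  have c3 : ∀ t : I, (t : ℝ) < 2 / 3 → stretch 3 (-2) t = 0 := fun t ht =>
    stretch_eq_zero (by linarith)
  have k1 : Compat (pull F1 𝔽) (pull F2 𝔹) :=
    .of_square (i := .ofHom (P.slice 1)) (.of_subs (Sub.refl _) h1)
      (fun x _ hx => ⟨trivial, Prod.ext rfl (c1 _ hx.1.1)⟩)
      fun p _ hp => reparam_toFun p (c1 _ hp.1.1)
  have k3 : Compat (pull F3 𝔾) (pull F2 𝔹) :=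
    .of_square (i := .ofHom (P.slice 0)) (.of_subs (Sub.refl _) h0')
      (fun x _ hx => ⟨trivial, Prod.ext rfl (c3 _ hx.1.2)⟩)
      fun p _ hp => reparam_toFun p (c3 _ hp.1.2)
  obtain ⟨ℰ, e1, -, e3, ed, ei⟩ := k1.exists_glue₃ k3.symm (by
    rw [dom_pull, dom_pull]
    exact disjoint_left.2 fun x hx hx' => lt_asymm (a := (x.2 : ℝ)) hx.1.1 hx'.1.1)
  refine ⟨ℰ, ⟨eq_univ_of_forall fun x => ?_, fun x hx => ei x ?_ ?_ ?_⟩, h0.trans ?_, h1'.trans ?_⟩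
  · rw [ed, dom_pull, dom_pull, dom_pull, h.1, h'.1, hB.1]
    rcases lt_trichotomy (x.2 : ℝ) (1 / 2) with hx | hx | hx
    · exact Or.inl (Or.inl ⟨⟨hx, trivial⟩, trivial⟩)
    · refine Or.inr ⟨⟨⟨?_, ?_⟩, trivial⟩, trivial⟩ <;> norm_num [hx]
    · exact Or.inl (Or.inr ⟨⟨hx, trivial⟩, trivial⟩)
  · exact InvAt.pull F1 (h.2 _ ⟨hx.1, trivial⟩)
  · exact InvAt.pull F2 (hB.2 _ hx.1)
  · exact InvAt.pull F3 (h'.2 _ ⟨hx.1, trivial⟩)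
  · refine Sub.trans ?_ (e1.pull _)
    have h00 : stretch 3 0 0 = 0 := stretch_eq_zero (by simp)
    exact .pull_of_comp (F := F1) (F' := P.slice 0) (K := P.slice 0)
      (fun x => ⟨by change ((0 : I) : ℝ) < 1 / 2; simp, trivial⟩)
      (fun p => reparam_toFun ((P.slice 0).toFun p) h00) 𝔽
  · refine Sub.trans ?_ (e3.pull _)
    have h11 : stretch 3 (-2) 1 = 1 := stretch_eq_one (by norm_num)
    exact .pull_of_comp (F := F3) (F' := P.slice 1) (K := P.slice 1)
      (fun x => ⟨by change 1 / 2 < ((1 : I) : ℝ); norm_num, trivial⟩)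
      (fun p => reparam_toFun ((P.slice 1).toFun p) h11) 𝔾

/-- The ends of a homotopy can be extended by constant bundles, which replaces isomorphisms by
inclusions. -/
theorem Conc.of_homotopic {𝔽 : TV (P.prod I)} (h : Good (Y ×ˢ univ) 𝔽)
    (h0 : Compat (along (P.slice 0) 𝔽) 𝔸) (h1 : Compat (along (P.slice 1) 𝔽) 𝔹) :
    Conc Y 𝔸 𝔹 := by
  have o1 : IsOpen {x : X × I | (x.2 : ℝ) < 1 / 3} := isOpen_lt (by fun_prop) continuous_const
  have o3 : IsOpen {x : X × I | 2 / 3 < (x.2 : ℝ)} := isOpen_lt continuous_const (by fun_prop)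
  -- the homotopy is run through in the middle third and `𝔸`, `𝔹` are glued to the outer thirds
  let F1 := (PMap.ofHom (P.prodProj I)).restr _ o1
  let F2 := PMap.ofHom (P.reparam (stretch 3 (-1)))
  let F3 := (PMap.ofHom (P.prodProj I)).restr _ o3
  have c1 : ∀ t : I, (t : ℝ) < 1 / 3 → stretch 3 (-1) t = 0 := fun t ht =>
    stretch_eq_zero (by linarith)
  have c3 : ∀ t : I, 2 / 3 < (t : ℝ) → stretch 3 (-1) t = 1 := fun t ht =>
    stretch_eq_one (by linarith)
  have k1 : Compat (pull F2 𝔽) (pull F1 𝔸) :=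
    .of_square (i := .ofHom (P.slice 0)) h0
      (fun x _ hx => ⟨trivial, Prod.ext rfl (c1 _ hx.1)⟩) fun p _ hp => reparam_toFun p (c1 _ hp.1)
  have k3 : Compat (pull F2 𝔽) (pull F3 𝔹) :=
    .of_square (i := .ofHom (P.slice 1)) h1
      (fun x _ hx => ⟨trivial, Prod.ext rfl (c3 _ hx.1)⟩) fun p _ hp => reparam_toFun p (c3 _ hp.1)
  obtain ⟨ℰ, e1, e2, e3, -, ei⟩ := k1.symm.exists_glue₃ k3 (by
    rw [dom_pull, dom_pull]
    refine disjoint_left.2 fun x hx hx' => lt_asymm (a := (x.2 : ℝ)) hx.1.1 ?_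
    exact lt_trans (by norm_num) hx'.1.1)
  have g2 : Good (Y ×ˢ (univ : Set I)) (pull F2 𝔽) := h.along _ fun x hx => ⟨hx.1, trivial⟩
  refine ⟨ℰ, g2.of_sub e2, Sub.trans ?_ (e1.pull _), Sub.trans ?_ (e3.pull _)⟩
  · exact .pull_left_inv (F := F1)
      (fun x => ⟨by change ((0 : I) : ℝ) < 1 / 3; simp, trivial⟩) (fun p => rfl) 𝔸
  · exact .pull_left_inv (F := F3)
      (fun x => ⟨by change 2 / 3 < ((1 : I) : ℝ); norm_num, trivial⟩) (fun p => rfl) 𝔹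

/-- Equality of classes amounts to the existence of a concordance. -/
theorem conc_of_cls_eq {hA : Good Y 𝔸} {hB : Good Y 𝔹} (h : cls Y 𝔸 hA = cls Y 𝔹 hB) :
    Conc Y 𝔸 𝔹 := by
  have key : ∀ a b : RelVB P Y, Relation.EqvGen RelVB.Homotopic a b →
      Conc Y (ofT a.𝔼) (ofT b.𝔼) := by
    intro a b hab
    induction hab with
    | rel a b hab =>
      obtain ⟨𝔽, h0, h1⟩ := hab
      exact .of_homotopic (good_ofT 𝔽.disjoint)
        ((compat_of_iso h0).of_sub (pullback_sub _ _) (Sub.refl _))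
        ((compat_of_iso h1).of_sub (pullback_sub _ _) (Sub.refl _))
    | refl a =>
      exact ⟨along (P.prodProj I) (ofT a.𝔼), (good_ofT a.disjoint).along _ fun _ hx => hx.1,
        .along_left_inv (fun _ => rfl) _, .along_left_inv (fun _ => rfl) _⟩
    | symm a b _ h => exact h.symm
    | trans a b c _ _ h h' => exact h.trans h' (good_ofT b.disjoint)
  exact key _ _ (Quot.eqvGen_exact h)

theorem Conc.cls_eq (h : Conc Y 𝔸 𝔹) {hA : Good Y 𝔸} {hB : Good Y 𝔹} :
    cls Y 𝔸 hA = cls Y 𝔹 hB := by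
  obtain ⟨𝔽, h, h0, h1⟩ := h
  exact cls_eq_of_homotopy 𝔽 h (.of_subs (Sub.refl _) h0) (.of_subs (Sub.refl _) h1)

end classes

end TV

namespace KF

section functor

variable {X : Type u} [TopologicalSpace X] {X' : Type u} [TopologicalSpace X']
  {X'' : Type u} [TopologicalSpace X''] {H : Type w} [NormedAddCommGroup H]
  [InnerProductSpace ℂ H] [Nontrivial H] {P : PrincipalBundle (PU H) X}
  {P' : PrincipalBundle (PU H) X'} {P'' : PrincipalBundle (PU H) X''}
  {f : C(X', X)} {f' : C(X'', X')} {Y : Set X} {Y' : Set X'} {Y'' : Set X''}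

theorem map_id {k : C(X, X)} (F : P.Hom P k) (h : ∀ p, F.toFun p = p) (hk : MapsTo k Y Y)
    (a : KF P Y) : map F hk a = a := by
  obtain ⟨𝔸, hA, rfl⟩ := TV.exists_cls a
  rw [TV.map_cls]
  exact TV.cls_eq_of_sub (.along_id h 𝔸)

theorem map_map {k : C(X'', X)} (F : P'.Hom P f) (F' : P''.Hom P' f') (K : P''.Hom P k)
    (h : ∀ p, F.toFun (F'.toFun p) = K.toFun p) (hf : MapsTo f Y' Y) (hf' : MapsTo f' Y'' Y')
    (hk : MapsTo k Y'' Y) (a : KF P Y) : map F' hf' (map F hf a) = map K hk a := by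
  obtain ⟨𝔸, hA, rfl⟩ := TV.exists_cls a
  rw [TV.map_cls, TV.map_cls, TV.map_cls]
  exact TV.cls_eq_of_sub (.along_along h 𝔸)

/-- Homotopic bundle maps of pairs induce the same map. -/
theorem map_eq_of_homotopy {f₀ f₁ : C(X', X)} {h : C(X' × I, X)} (K : (P'.prod I).Hom P h)
    (hY : MapsTo h (Y' ×ˢ univ) Y) (F₀ : P'.Hom P f₀) (F₁ : P'.Hom P f₁)
    (h₀ : ∀ p, K.toFun ((P'.slice 0).toFun p) = F₀.toFun p)
    (h₁ : ∀ p, K.toFun ((P'.slice 1).toFun p) = F₁.toFun p)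
    (hf₀ : MapsTo f₀ Y' Y) (hf₁ : MapsTo f₁ Y' Y) : map F₀ hf₀ = map F₁ hf₁ := by
  funext a
  obtain ⟨𝔸, hA, rfl⟩ := TV.exists_cls a
  rw [TV.map_cls, TV.map_cls]
  exact TV.Conc.cls_eq ⟨TV.along K 𝔸, hA.along _ hY, .along_of_comp h₀ 𝔸, .along_of_comp h₁ 𝔸⟩

end functor

end KF

/-! ### The group structure -/

section group

variable {X : Type u} [TopologicalSpace X] {X' : Type u} [TopologicalSpace X'] {H : Type w}
  [NormedAddCommGroup H] [InnerProductSpace ℂ H] [Nontrivial H] {P : PrincipalBundle (PU H) X}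
  {P' : PrincipalBundle (PU H) X'} {f : C(X', X)} {Y : Set X} {Y' : Set X'}

namespace TV

/-- Two bundles can be represented over a common cover with common sections and lifts. -/
theorem exists_common (𝔸 𝔹 : TV P) : ∃ (D : LTD P) (V V' : LVB D), Sub ⟨D, V⟩ 𝔸 ∧ Sub ⟨D, V'⟩ 𝔹 ∧
    ⋃ a, D.U a = 𝔸.dom ∩ 𝔹.dom := by
  obtain ⟨D, ⟨γ⟩, ⟨γ'⟩, h⟩ := LTD.exists_gauge_gauge 𝔸.D 𝔹.D
  obtain ⟨V, hV⟩ := γ.exists_sub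
  obtain ⟨V', hV'⟩ := γ'.exists_sub
  exact ⟨D, V, V', hV, hV', h⟩

variable {D D' : LTD P}

theorem Good.sum {V V' : LVB D} (h : Good Y ⟨D, V⟩) (h' : Good Y ⟨D, V'⟩) :
    Good Y ⟨D, V.sum V'⟩ := ⟨h.1, fun y hy => (h.2 y hy).sum (h'.2 y hy)⟩

theorem cls_slice {𝔽 : TV (P.prod I)} (h : Good (Y ×ˢ univ) 𝔽) :
    cls Y (along (P.slice 0) 𝔽) (h.along _ fun _ hy => ⟨hy, trivial⟩) =
      cls Y (along (P.slice 1) 𝔽) (h.along _ fun _ hy => ⟨hy, trivial⟩) :=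
  cls_eq_of_homotopy 𝔽 h (.refl _) (.refl _)

/-- The class of a direct sum depends only on the classes of the summands. -/
theorem cls_sum_congr {V₁ V₂ : LVB D} {V₁' V₂' : LVB D'} {h₁ : Good Y ⟨D, V₁⟩}
    {h₂ : Good Y ⟨D, V₂⟩} {h₁' : Good Y ⟨D', V₁'⟩} {h₂' : Good Y ⟨D', V₂'⟩}
    (e₁ : cls Y _ h₁ = cls Y _ h₁') (e₂ : cls Y _ h₂ = cls Y _ h₂') :
    cls Y _ (h₁.sum h₂) = cls Y _ (h₁'.sum h₂') := by
  obtain ⟨𝔽₁, g₁, s₁, s₁'⟩ := conc_of_cls_eq e₁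
  obtain ⟨𝔽₂, g₂, s₂, s₂'⟩ := conc_of_cls_eq e₂
  obtain ⟨D'', W₁, W₂, w₁, w₂, hd⟩ := exists_common 𝔽₁ 𝔽₂
  rw [g₁.1, g₂.1, univ_inter] at hd
  have q₁ : Good (Y ×ˢ univ) ⟨D'', W₁⟩ := g₁.sub w₁ hd
  have q₂ : Good (Y ×ˢ univ) ⟨D'', W₂⟩ := g₂.sub w₂ hd
  have key : ∀ (t : I) {D : LTD P} {V₁ V₂ : LVB D} (h₁ : Good Y ⟨D, V₁⟩) (h₂ : Good Y ⟨D, V₂⟩)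
      (_ : Sub ⟨D, V₁⟩ (along (P.slice t) 𝔽₁)) (_ : Sub ⟨D, V₂⟩ (along (P.slice t) 𝔽₂)),
      cls Y _ (h₁.sum h₂) = cls Y (along (P.slice t) ⟨D'', W₁.sum W₂⟩)
        ((q₁.sum q₂).along _ fun _ hy => ⟨hy, trivial⟩) := by
    intro t D V₁ V₂ h₁ h₂ s₁ s₂
    have r₁ := q₁.along (P.slice t) (Y' := Y) fun _ hy => ⟨hy, trivial⟩
    have r₂ := q₂.along (P.slice t) (Y' := Y) fun _ hy => ⟨hy, trivial⟩
    exact (cls_eq_of_compat (hB := Good.sum r₁ r₂)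
      (Compat.sum (.of_subs s₁ (w₁.pull _)) (.of_subs s₂ (w₂.pull _)))).trans
      (cls_eq_of_sub (.pull_sum _ _ _))
  exact (key 0 h₁ h₂ s₁ s₂).trans ((cls_slice (q₁.sum q₂)).trans (key 1 h₁' h₂' s₁' s₂').symm)

/-- Bundles which are invertible everywhere have the same class. -/
theorem cls_eq_of_inv {𝔸 𝔹 : TV P} {hA : Good Y 𝔸} {hB : Good Y 𝔹} (h : ∀ x, 𝔸.InvAt x)
    (h' : ∀ x, 𝔹.InvAt x) : cls Y 𝔸 hA = cls Y 𝔹 hB := by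
  obtain ⟨D, V, V', s, s', hd⟩ := exists_common 𝔸 𝔹
  rw [hA.1, hB.1, univ_inter] at hd
  have g : Good Y ⟨D, V⟩ := hA.sub s hd
  have g' : Good Y ⟨D, V'⟩ := hB.sub s' hd
  refine (cls_eq_of_sub (hA := g) s).symm.trans (Eq.trans ?_ (cls_eq_of_sub (hA := g') s'))
  exact cls_eq_of_compat ((Gauge.refl D).compat_of_inv (𝔸 := ⟨D, V⟩) (𝔹 := ⟨D, V'⟩) (Gauge.refl D)
    (fun x _ _ => s.invAt (h x)) fun x _ _ => s'.invAt (h' x))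

theorem exists_cls₂ (a b : KF P Y) : ∃ (D : LTD P) (V V' : LVB D) (h : Good Y ⟨D, V⟩)
    (h' : Good Y ⟨D, V'⟩), a = cls Y _ h ∧ b = cls Y _ h' := by
  obtain ⟨𝔸, hA, rfl⟩ := exists_cls a
  obtain ⟨𝔹, hB, rfl⟩ := exists_cls b
  obtain ⟨D, V, V', s, s', hd⟩ := exists_common 𝔸 𝔹
  rw [hA.1, hB.1, univ_inter] at hd
  exact ⟨D, V, V', hA.sub s hd, hB.sub s' hd, (cls_eq_of_sub s).symm, (cls_eq_of_sub s').symm⟩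

theorem exists_cls₃ (a b c : KF P Y) : ∃ (D : LTD P) (V V' V'' : LVB D) (h : Good Y ⟨D, V⟩)
    (h' : Good Y ⟨D, V'⟩) (h'' : Good Y ⟨D, V''⟩), a = cls Y _ h ∧ b = cls Y _ h' ∧
      c = cls Y _ h'' := by
  obtain ⟨D₀, V₀, V₀', h₀, h₀', rfl, rfl⟩ := exists_cls₂ a b
  obtain ⟨ℭ, hC, rfl⟩ := exists_cls c
  obtain ⟨D, ⟨γ⟩, ⟨γ'⟩, hd⟩ := LTD.exists_gauge_gauge D₀ ℭ.D
  have hd' : ⋃ a, D.U a = univ := hd.trans (by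
    rw [show ⋃ a, D₀.U a = univ from h₀.1, show ⋃ a, ℭ.D.U a = univ from hC.1, univ_inter])
  obtain ⟨V, s⟩ := γ.exists_sub (𝔹 := ⟨D₀, V₀⟩)
  obtain ⟨V', s'⟩ := γ.exists_sub (𝔹 := ⟨D₀, V₀'⟩)
  obtain ⟨V'', s''⟩ := γ'.exists_sub
  exact ⟨D, V, V', V'', h₀.sub s hd', h₀'.sub s' hd', hC.sub s'' hd', (cls_eq_of_sub s).symm,
    (cls_eq_of_sub s').symm, (cls_eq_of_sub s'').symm⟩

end TV

namespace KF

open TV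

theorem exists_add (a b : KF P Y) : ∃ c : KF P Y, ∀ (D : LTD P) (V V' : LVB D)
    (h : Good Y ⟨D, V⟩) (h' : Good Y ⟨D, V'⟩), a = cls Y _ h → b = cls Y _ h' →
      c = cls Y _ (h.sum h') := by
  obtain ⟨D, V, V', h, h', rfl, rfl⟩ := exists_cls₂ a b
  exact ⟨_, fun D₀ V₀ V₀' h₀ h₀' e e' => cls_sum_congr e e'⟩

/-- The sum of two classes, given by the direct sum of representatives over a common cover. -/
def add (a b : KF P Y) : KF P Y := (exists_add a b).choose

theorem add_cls {D : LTD P} {V V' : LVB D} (h : Good Y ⟨D, V⟩) (h' : Good Y ⟨D, V'⟩) :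
    add (cls Y _ h) (cls Y _ h') = cls Y _ (h.sum h') :=
  (exists_add _ _).choose_spec D V V' h h' rfl rfl

theorem map_add (F : P'.Hom P f) (hf : MapsTo f Y' Y) (a b : KF P Y) :
    map F hf (add a b) = add (map F hf a) (map F hf b) := by
  obtain ⟨D, V, V', h, h', rfl, rfl⟩ := exists_cls₂ a b
  rw [add_cls, map_cls, map_cls, map_cls]
  refine Eq.trans ?_ (add_cls (h.along F hf) (h'.along F hf)).symm
  exact (cls_eq_of_sub (.pull_sum _ _ _)).symm

theorem add_comm' (a b : KF P Y) : add a b = add b a := by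
  obtain ⟨D, V, V', h, h', rfl, rfl⟩ := exists_cls₂ a b
  rw [add_cls, add_cls]
  exact cls_eq_of_sub (.sum_comm _ _)

theorem add_assoc' (a b c : KF P Y) : add (add a b) c = add a (add b c) := by
  obtain ⟨D, V, V', V'', h, h', h'', rfl, rfl, rfl⟩ := exists_cls₃ a b c
  rw [add_cls, add_cls, add_cls, add_cls]
  exact cls_eq_of_sub (.sum_assoc _ _ _)

theorem add_of_inv (a : KF P Y) {𝔹 : TV P} (hB : Good Y 𝔹) (h : ∀ x, 𝔹.InvAt x) :
    add a (cls Y 𝔹 hB) = a := by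
  obtain ⟨𝔸, hA, rfl⟩ := exists_cls a
  obtain ⟨D, V, V', s, s', hd⟩ := exists_common 𝔸 𝔹
  rw [hA.1, hB.1, univ_inter] at hd
  have g : Good Y ⟨D, V⟩ := hA.sub s hd
  have g' : Good Y ⟨D, .zero D⟩ := ⟨hd, fun y _ => invAt_zero D y⟩
  rw [← cls_eq_of_sub (hA := g) s, cls_eq_of_inv (hB := g') h (invAt_zero D), add_cls]
  exact cls_eq_of_sub (.sum_zero V)

/-- `E ⊕ (E with the opposite grading)` is homotopic to an invertible bundle. -/
theorem exists_neg (a : KF P Y) : ∃ (b : KF P Y) (𝔹 : TV P) (hB : Good Y 𝔹),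
    (∀ x, 𝔹.InvAt x) ∧ add b a = cls Y 𝔹 hB := by
  obtain ⟨𝔸, hA, rfl⟩ := exists_cls a
  obtain ⟨D, V⟩ := 𝔸
  have hN : Good Y ⟨D, V.neg⟩ := ⟨hA.1, fun y hy a ha => hA.2 y hy a ha⟩
  have hT : ∀ z, Good Y ⟨D, V.thom z⟩ := fun z =>
    ⟨hA.1, fun y hy => InvAt.thom (V := V) (.inr (hA.2 y hy))⟩
  refine ⟨cls Y _ hN, ⟨D, V.thom 1⟩, hT 1, fun x => InvAt.thom (V := V) (.inl one_ne_zero), ?_⟩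
  rw [add_comm', add_cls, cls_eq_of_sub (hB := hT 0) (.sum_neg V)]
  -- the homotopy `t ↦ V.thom t` ends in `V.thom 1`, which is invertible everywhere
  let z : C(X × I, ℂ) := ⟨fun q => ((q.2 : ℝ) : ℂ), by fun_prop⟩
  have hG := hA.along (P.prodProj I) (Y' := Y ×ˢ (univ : Set I)) fun _ hy => hy.1
  have hF : Good (Y ×ˢ univ) ⟨_, (along (P.prodProj I) ⟨D, V⟩).V.thom z⟩ :=
    ⟨hG.1, fun y hy => InvAt.thom (.inr (hG.2 y hy))⟩
  have key : ∀ (t : I) (c : C(X, ℂ)), (∀ x, ((t : ℝ) : ℂ) = c x) → cls Y _ (hT c) =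
      cls Y (along (P.slice t) ⟨_, (along (P.prodProj I) ⟨D, V⟩).V.thom z⟩)
        (hF.along _ fun _ hy => ⟨hy, trivial⟩) := by
    intro t c hc
    obtain rfl : z.comp (PrincipalBundle.sliceMap X t) = c := ContinuousMap.ext fun x => hc x
    have hH := hG.along (P.slice t) (Y' := Y) fun _ hy => ⟨hy, trivial⟩
    have hH' : Good Y ⟨_, (along (P.slice t) (along (P.prodProj I) ⟨D, V⟩)).V.thom
        (z.comp (PrincipalBundle.sliceMap X t))⟩ :=
      ⟨hH.1, fun y hy => InvAt.thom (.inr (hH.2 y hy))⟩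
    refine (cls_eq_of_compat (hB := hH') (Compat.thom (V := V) ?_ _)).trans
      (cls_eq_of_sub (.pull_thom _ _ _))
    exact .of_subs (.along_left_inv (F := P.prodProj I) (F' := P.slice t) (fun _ => rfl) ⟨D, V⟩)
      (Sub.refl _)
  exact (key 0 0 fun x => by simp).trans ((cls_slice hF).trans (key 1 1 fun x => by simp).symm)

theorem good_zero (D : TwistData P) : Good Y ⟨D.toLTD, .zero D.toLTD⟩ :=
  ⟨D.iUnion_U, fun y _ => invAt_zero _ y⟩

/-- The zero bundle over a cover with sections and lifts. -/
def zeroCls (D : TwistData P) : KF P Y := cls Y _ (good_zero D)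

theorem cls_eq_zeroCls (D : TwistData P) {𝔸 : TV P} (hA : Good Y 𝔸) (h : ∀ x, 𝔸.InvAt x) :
    cls Y 𝔸 hA = zeroCls D := cls_eq_of_inv h (invAt_zero _)

/-- The group structure of `KF_P(X, Y)`. -/
abbrev addCommGroup (D : TwistData P) (Y : Set X) : AddCommGroup (KF P Y) :=
  letI : Zero (KF P Y) := ⟨zeroCls D⟩
  letI : Add (KF P Y) := ⟨add⟩
  letI : Neg (KF P Y) := ⟨fun a => (exists_neg a).choose⟩
  { add_assoc := add_assoc'
    zero_add := fun a => (add_comm' _ _).trans (add_of_inv a (good_zero D) (invAt_zero _))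
    add_zero := fun a => add_of_inv a (good_zero D) (invAt_zero _)
    nsmul := nsmulRec
    zsmul := zsmulRec
    neg_add_cancel := fun a => by
      obtain ⟨𝔹, hB, h, e⟩ := (exists_neg a).choose_spec
      exact e.trans (cls_eq_zeroCls D hB h)
    add_comm := add_comm' }

end KF

end group

/-! ### Extension by zero and excision -/

section inverse

variable {X : Type u} [TopologicalSpace X] {X' : Type u} [TopologicalSpace X']
  {G : Type w} [Group G] [TopologicalSpace G] {P : PrincipalBundle G X}
  {P' : PrincipalBundle G X'} {f : C(X', X)} {O : Set X}

theorem PrincipalBundle.div_act_right (P : PrincipalBundle G X) {p q : P.Total}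
    (h : P.proj p = P.proj q) (a : G) : P.div p (P.act q a) = P.div p q * a := by
  conv_lhs => rw [← P.act_div p q h, ← P.act_mul]
  exact P.div_act _ _

/-- The lift of a point of `P` along an embedding of bundles. -/
def PMap.invFun [Nonempty X'] (F : P'.Hom P f) (p : P.Total) : P'.Total :=
  P'.act (P'.exists_mem_fiber (Function.invFun f (P.proj p))).choose
    (P.div (F.toFun (P'.exists_mem_fiber (Function.invFun f (P.proj p))).choose) p)

theorem PMap.proj_invFun [Nonempty X'] (F : P'.Hom P f) (p : P.Total) :
    P'.proj (PMap.invFun F p) = Function.invFun f (P.proj p) := by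
  rw [PMap.invFun, P'.proj_act]
  exact (P'.exists_mem_fiber _).choose_spec

theorem PMap.toFun_invFun [Nonempty X'] (F : P'.Hom P f) {p : P.Total}
    (hp : P.proj p ∈ range f) : F.toFun (PMap.invFun F p) = p := by
  rw [PMap.invFun, F.map_act, P.act_div]
  rw [F.proj_toFun, (P'.exists_mem_fiber _).choose_spec, Function.invFun_eq hp]

theorem PMap.invFun_eq [Nonempty X'] (F : P'.Hom P f) (hf : IsEmbedding f) {p : P.Total}
    {q : P'.Total} (h : F.toFun q = p) : PMap.invFun F p = q := by
  have h1 : P.proj p = f (P'.proj q) := by rw [← h, F.proj_toFun]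
  refine F.injOn ?_ ?_
  · rw [PMap.proj_invFun, h1, Function.leftInverse_invFun hf.injective]
  · rw [PMap.toFun_invFun F ⟨_, h1.symm⟩, h]

/-- The inverse of a bundle map covering an embedding, over an open set contained in the image. -/
def PMap.inv [Nonempty X'] (F : P'.Hom P f) (hf : IsEmbedding f) (hO : IsOpen O)
    (hr : O ⊆ range f) : PMap P P' where
  f := Function.invFun f
  O := O
  isOpen_O := hO
  continuousOn_f := hf.isInducing.continuousOn_iff.2
    (continuousOn_id.congr fun x hx => Function.invFun_eq (hr hx))
  F := PMap.invFun F
  continuousOn_F := by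
    have hg : ContinuousOn (fun p : P.Total => Function.invFun f (P.proj p)) (P.proj ⁻¹' O) :=
      hf.isInducing.continuousOn_iff.2
        (P.continuous_proj.continuousOn.congr fun x hx => Function.invFun_eq (hr hx))
    intro p hp
    obtain ⟨V, hV, hxV, τ, hτ, hτp⟩ := P'.exists_section (Function.invFun f (P.proj p))
    have ho := hg.isOpen_inter_preimage (hO.preimage P.continuous_proj) hV
    have hs : ContinuousOn (fun p => τ (Function.invFun f (P.proj p))) (P.proj ⁻¹' O ∩
        (fun p : P.Total => Function.invFun f (P.proj p)) ⁻¹' V) :=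
      hτ.comp (hg.mono inter_subset_left) fun x hx => hx.2
    have hd : ∀ p ∈ P.proj ⁻¹' O ∩ (fun p : P.Total => Function.invFun f (P.proj p)) ⁻¹' V,
        P.proj (F.toFun (τ (Function.invFun f (P.proj p)))) = P.proj p := fun p hp => by
      rw [F.proj_toFun, hτp _ hp.2, Function.invFun_eq (hr hp.1)]
    have key : ContinuousOn (PMap.invFun F) (P.proj ⁻¹' O ∩
        (fun p : P.Total => Function.invFun f (P.proj p)) ⁻¹' V) := by
      refine (P'.continuous_act.comp_continuousOn (hs.prodMk (P.continuousOn_div.comp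
        ((F.continuous_toFun.comp_continuousOn hs).prodMk continuousOn_id) hd))).congr
        fun p hp => ?_
      refine PMap.invFun_eq F hf ?_
      change F.toFun (P'.act _ _) = p
      rw [F.map_act]
      exact P.act_div _ _ (hd p hp)
    exact (key.continuousAt (ho.mem_nhds ⟨hp, hxV⟩)).continuousWithinAt
  proj_F p _ := PMap.proj_invFun F p
  F_act p hp a := PMap.invFun_eq F hf (by rw [F.map_act, PMap.toFun_invFun F (hr hp)])

end inverse

section ext

variable {X : Type u} [TopologicalSpace X] {X' : Type u} [TopologicalSpace X'] {H : Type w}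
  [NormedAddCommGroup H] [InnerProductSpace ℂ H] {P : PrincipalBundle (PU H) X}
  {P' : PrincipalBundle (PU H) X'} {f : C(X', X)} {Y : Set X} {Y' : Set X'}

namespace TV

variable {𝔸 𝔹 ℂ' : TV P} {x : X}

theorem Compat.invAt (h : Compat 𝔸 𝔹) (hx : 𝔸.InvAt x) (hd : x ∈ 𝔸.dom) : 𝔹.InvAt x := by
  obtain ⟨C⟩ := h
  obtain ⟨a, ha⟩ := mem_dom.1 hd
  exact fun b hb => GObj.inv_of_iso (C.iso ha hb).symm (hx a ha)

theorem isClosed_not_invAt (h : 𝔸.dom = univ) : IsClosed {x | ¬ 𝔸.InvAt x} := by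
  rw [← isOpen_compl_iff]
  convert 𝔸.isOpen_invAt using 1
  ext x
  simp [h]

theorem Sub.inv_pull [Nonempty X'] {F : P'.Hom P f} {hf : IsEmbedding f} {O : Set X}
    {hO : IsOpen O} {hr : O ⊆ range f} (𝔸 : TV P) :
    Sub (TV.pull (.inv F hf hO hr) (along F 𝔸)) (𝔸.on O hO) :=
  (Sub.comp_pull _ _ 𝔸).trans (.pull_congr (F := (PMap.ofHom F).comp (.inv F hf hO hr))
    (F' := .idOn P O hO)
    (fun _ hx => hx.1)
    (fun _ hx => Function.invFun_eq (hr hx.1)) (fun _ hp => PMap.toFun_invFun F (hr hp.1)) 𝔸)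

theorem Sub.pull_inv [Nonempty X'] {F : P'.Hom P f} {hf : IsEmbedding f} {O : Set X}
    {hO : IsOpen O} {hr : O ⊆ range f} (𝔸 : TV P) :
    Sub (𝔸.on O hO) (TV.pull (.inv F hf hO hr) (along F 𝔸)) :=
  (Sub.pull_congr (F := .idOn P O hO) (F' := (PMap.ofHom F).comp (.inv F hf hO hr))
    (fun _ hx => ⟨hx, trivial⟩) (fun _ hx => (Function.invFun_eq (hr hx)).symm)
    (fun _ hp => (PMap.toFun_invFun F (hr hp)).symm) 𝔸).trans (.pull_comp _ _ 𝔸)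

theorem Sub.along_inv [Nonempty X'] {F : P'.Hom P f} {hf : IsEmbedding f} {O : Set X}
    {hO : IsOpen O} {hr : O ⊆ range f} (𝔸 : TV P') :
    Sub (along F (TV.pull (.inv F hf hO hr) 𝔸)) 𝔸 :=
  (Sub.comp_pull _ _ 𝔸).trans ((Sub.pull_congr (F' := .idOn P' univ isOpen_univ)
    (fun _ _ => trivial) (fun _ _ => Function.leftInverse_invFun hf.injective _)
    (fun _ _ => PMap.invFun_eq F hf rfl) 𝔸).trans (Sub.pull_idOn _ _ 𝔸))

/-- Lifts along an embedding are compatible with slices. -/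
theorem Sub.slice_inv [Nonempty X'] {F : P'.Hom P f} {hf : IsEmbedding f} {O : Set X}
    {hO : IsOpen O} {hr : O ⊆ range f} {hf' : IsEmbedding (f.prodMap (.id I))}
    {O' : Set (X × I)} {hO' : IsOpen O'} {hr' : O' ⊆ range (f.prodMap (.id I))}
    (h : ∀ x t, x ∈ O → (x, t) ∈ O') (𝔽 : TV (P'.prod I)) (t : I) :
    Sub (TV.pull (.inv F hf hO hr) (along (P'.slice t) 𝔽))
      (along (P.slice t) (TV.pull (.inv (F.prodMap I) hf' hO' hr') 𝔽)) := by
  have key : ∀ p, P.proj p ∈ O → PMap.invFun (F.prodMap I) ((P.slice t).toFun p) =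
      (P'.slice t).toFun (PMap.invFun F p) := fun p hp => by
    refine PMap.invFun_eq _ hf' ?_
    have h1 := PMap.toFun_invFun F (hr hp)
    refine Subtype.ext (Prod.ext (Prod.ext ?_ rfl) h1)
    exact (F.proj_toFun _).symm.trans (congrArg P.proj h1)
  refine .pull_pull (F := .ofHom (P'.slice t)) (F' := .inv F hf hO hr) (K' := .ofHom (P.slice t))
    (K := .inv (F.prodMap I) hf' hO' hr') (fun x hx _ => ⟨trivial, h x t hx⟩)
    (fun x hx _ => ?_) (fun p hp _ => ?_) 𝔽
  · obtain ⟨p, rfl⟩ := P.exists_mem_fiber x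
    have h1 := congrArg (P'.prod I).proj (key p hx)
    rw [PMap.proj_invFun] at h1
    refine Eq.trans ?_ h1.symm
    exact (congrArg (fun x => (x, t)) (PMap.proj_invFun F p)).symm
  · exact (key p hp).symm

variable [Nontrivial H]

/-- A bundle over an open set which is invertible outside of a closed subset `S` of `X` extends by
zero, and the extension is unique up to homotopy. -/
theorem exists_ext (D₀ : TwistData P) {S : Set X} (hS : IsClosed S) (hSO : S ⊆ ℂ'.dom)
    (hinv : ∀ x ∈ ℂ'.dom, x ∉ S → ℂ'.InvAt x) :
    ∃ ℰ ℂ'' : TV P, ℰ.dom = univ ∧ (∀ x, x ∉ S → ℰ.InvAt x) ∧ Sub ℂ'' ℂ' ∧ Sub ℂ'' ℰ ∧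
      ℂ''.dom = ℂ'.dom ∧ ∀ 𝔸 : TV P, Compat ℂ' 𝔸 → (∀ x, x ∉ S → 𝔸.InvAt x) →
        ∀ (hE : Good Y ℰ) (hA : Good Y 𝔸), cls Y ℰ hE = cls Y 𝔸 hA := by
  obtain ⟨D, ⟨γ⟩, ⟨γ₀⟩, hd⟩ := LTD.exists_gauge_gauge ℂ'.D D₀.toLTD
  rw [show ⋃ a, D₀.toLTD.U a = univ from D₀.iUnion_U, inter_univ] at hd
  obtain ⟨V, s⟩ := γ.exists_sub
  -- the extension is obtained by gluing with the zero bundle over the complement of `S`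
  let D₁ := D₀.toLTD.cut (fun _ : PUnit => Sᶜ) fun _ => hS.isOpen_compl
  have hd₁ : ⋃ a, D₁.U a = Sᶜ := by
    ext x
    simp only [mem_iUnion]
    constructor
    · rintro ⟨a, ha⟩; exact ha.2
    · intro hx
      obtain ⟨a, ha⟩ := mem_iUnion.1 (D₀.iUnion_U.symm ▸ mem_univ x)
      exact ⟨(a, ⟨⟩), ha, hx⟩
  have γ₁ : Gauge D₁ D₀.toLTD := D₀.toLTD.cutGauge _ _
  have i0 : ∀ x, x ∈ (⟨D, V⟩ : TV P).dom → x ∉ S → (⟨D, V⟩ : TV P).InvAt x := fun x hx hxS =>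
    s.invAt (hinv x (hd.subset hx) hxS)
  obtain ⟨C⟩ : Compat ⟨D, V⟩ ⟨D₁, .zero D₁⟩ := γ₀.compat_of_inv (𝔸 := ⟨D, V⟩)
    (𝔹 := ⟨D₁, .zero D₁⟩) γ₁ (fun x hx hx' => i0 x hx (hd₁ ▸ hx' : x ∈ Sᶜ))
    fun x _ _ => invAt_zero _ x
  refine ⟨C.glue, ⟨D, V⟩, ?_, fun x hx => C.invAt_glue (fun a ha => ?_) (invAt_zero _ x), s,
    C.sub_glue_left, hd, fun 𝔸 hC hi hE hA => ?_⟩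
  · rw [C.dom_glue, show (⟨D, V⟩ : TV P).dom = ℂ'.dom from hd,
      show (⟨D₁, .zero D₁⟩ : TV P).dom = Sᶜ from hd₁]
    exact eq_univ_of_forall fun x => (em (x ∈ S)).imp (fun h => hSO h) id
  · exact i0 x (mem_dom.2 ⟨a, ha⟩) hx a ha
  -- uniqueness: `𝔸` is compatible with both pieces, with the second one because both are invertible
  · obtain ⟨D₂, ⟨γ₂⟩, ⟨γ₂'⟩, hd₂⟩ := LTD.exists_gauge_gauge 𝔸.D D₀.toLTD
    rw [show ⋃ a, D₀.toLTD.U a = univ from D₀.iUnion_U, show ⋃ a, 𝔸.D.U a = univ from hA.1,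
      univ_inter] at hd₂
    obtain ⟨V₂, s₂⟩ := γ₂.exists_sub
    refine Eq.trans (cls_eq_of_compat (hB := hA.sub s₂ hd₂) ?_) (cls_eq_of_sub s₂)
    refine .glue C (hC.of_sub s s₂) (γ₁.compat_of_inv (𝔸 := ⟨D₁, .zero D₁⟩) (𝔹 := ⟨D₂, V₂⟩) γ₂'
      (fun x _ _ => invAt_zero _ x) fun x hx _ => s₂.invAt (hi x (hd₁ ▸ hx : x ∈ Sᶜ)))
      fun x hx hx' _ => i0 x hx (hd₁ ▸ hx' : x ∈ Sᶜ)

/-- Two bundles which are isomorphic over the complement of a closed set over which both are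
invertible have the same class. -/
theorem cls_eq_of_compat_compl (D₀ : TwistData P) {B : Set X} (hA : Good B 𝔸)
    (hB : Good B 𝔹) (hd : ℂ'.dom = Bᶜ) (h : Compat ℂ' 𝔸) (h' : Compat ℂ' 𝔹) :
    cls B 𝔸 hA = cls B 𝔹 hB := by
  let S := {x | ¬ 𝔸.InvAt x} ∪ {x | ¬ 𝔹.InvAt x}
  have hS : IsClosed S := (isClosed_not_invAt hA.1).union (isClosed_not_invAt hB.1)
  have hSB : S ⊆ Bᶜ := fun x hx hxB => hx.elim (fun hn => hn (hA.2 x hxB)) fun hn => hn (hB.2 x hxB)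
  have hn : ∀ x, x ∉ S → 𝔸.InvAt x ∧ 𝔹.InvAt x := fun x hx =>
    ⟨by_contra fun hn => hx (Or.inl hn), by_contra fun hn => hx (Or.inr hn)⟩
  obtain ⟨ℰ, -, he, hi, -, -, -, key⟩ := exists_ext (Y := B) D₀ hS (hd ▸ hSB)
    fun x _ hx => h.symm.invAt (hn x hx).1 (hA.1 ▸ mem_univ x)
  have hE : Good B ℰ := ⟨he, fun y hy => hi y fun hyS => hSB hyS hy⟩
  exact (key 𝔸 h (fun x hx => (hn x hx).1) hE hA).symm.trans
    (key 𝔹 h' (fun x hx => (hn x hx).2) hE hB)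

/-- A bundle over a closed subspace which is invertible over the intersection with a closed set `B`
extends over `X` when the subspace and `B` cover `X`. -/
theorem exists_ext_closed [Nonempty X'] (D₀ : TwistData P) {F : P'.Hom P f}
    (hf : IsClosedEmbedding f) {B : Set X} {hB : IsOpen Bᶜ} {hr : Bᶜ ⊆ range f}
    {𝔸' : TV P'} (hA : Good (f ⁻¹' B) 𝔸') :
    ∃ ℰ ℂ'' : TV P, Good B ℰ ∧ Sub ℂ'' ℰ ∧ Sub ℂ'' (pull (.inv F hf.isEmbedding hB hr) 𝔸') ∧
      ℂ''.dom = Bᶜ := by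
  have hd : (pull (.inv F hf.isEmbedding hB hr) 𝔸').dom = Bᶜ := by
    rw [dom_pull, hA.1, preimage_univ, inter_univ]; rfl
  have hS : f '' {x | ¬ 𝔸'.InvAt x} ⊆ Bᶜ := by
    rintro _ ⟨x, hx, rfl⟩ hxB
    exact hx (hA.2 x hxB)
  obtain ⟨ℰ, ℂ'', he, hi, s, s', hd', -⟩ := exists_ext (Y := B) D₀
    (hf.isClosedMap _ (isClosed_not_invAt hA.1)) (hd.symm ▸ hS) fun x hx hxS => by
      refine InvAt.pull (.inv F hf.isEmbedding hB hr) (by_contra fun hn => hxS ⟨_, hn, ?_⟩)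
      exact Function.invFun_eq (hr (hd ▸ hx))
  exact ⟨ℰ, ℂ'', ⟨he, fun y hy => hi y fun hyS => hS hyS hy⟩, s', s, hd'.trans hd⟩

end TV

namespace KF

open TV

variable [Nontrivial H]

theorem subsingleton_of_univ {Y : Set X} (hY : ∀ x, x ∈ Y) (a b : KF P Y) : a = b := by
  obtain ⟨𝔸, hA, rfl⟩ := exists_cls a
  obtain ⟨𝔹, hB, rfl⟩ := exists_cls b
  exact cls_eq_of_inv (fun x => hA.2 x (hY x)) fun x => hB.2 x (hY x)

/-- Excision. Bundles over the closed subspace `X'` which are invertible over `B` extend by zero,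
and the same holds for homotopies. -/
theorem map_bijective_of_excision (D₀ : TwistData P) {F : P'.Hom P f} (hf : IsClosedEmbedding f)
    {B : Set X} (hB : IsClosed B) (hr : ∀ x, x ∉ B → x ∈ range f) (h : MapsTo f Y' B)
    (hY : ∀ x, f x ∈ B → x ∈ Y') : Function.Bijective (map F h) := by
  obtain rfl : Y' = f ⁻¹' B := Subset.antisymm h hY
  rcases isEmpty_or_nonempty X' with he | hne
  · have hu : ∀ x, x ∈ B := fun x => by_contra fun hx => (hr x hx).elim fun x' _ => he.elim x'
    exact ⟨fun a b _ => subsingleton_of_univ hu a b, fun a =>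
      ⟨zeroCls D₀, subsingleton_of_univ (fun x => he.elim x) _ _⟩⟩
  have hr' : Bᶜ ⊆ range f := hr
  constructor
  · intro a b hab
    obtain ⟨𝔸, hA, rfl⟩ := exists_cls a
    obtain ⟨𝔹, hB', rfl⟩ := exists_cls b
    rw [map_cls, map_cls] at hab
    obtain ⟨𝔽, hF, s0, s1⟩ := conc_of_cls_eq hab
    -- injectivity: a concordance `𝔽` of the restrictions extends by zero to `ℰ`
    have hfI : IsClosedEmbedding (f.prodMap (.id I)) := hf.prodMap .id
    have hrI : (B ×ˢ (univ : Set I))ᶜ ⊆ range (f.prodMap (.id I)) := fun x hx => by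
      obtain ⟨x', hx'⟩ := hr x.1 fun h => hx ⟨h, trivial⟩
      exact ⟨(x', x.2), Prod.ext hx' rfl⟩
    have hFI : Good (f.prodMap (.id I) ⁻¹' (B ×ˢ (univ : Set I))) 𝔽 := hF
    obtain ⟨ℰ, ℂ'', hE, t, t', hd⟩ := exists_ext_closed (D₀.pullback (P.prodProj I))
      (F := F.prodMap I) hfI (hB := (hB.prod isClosed_univ).isOpen_compl) (hr := hrI) hFI
    have key : ∀ (e : I) (𝔸 : TV P) (hA : Good B 𝔸),
        Sub (along F 𝔸) (along (P'.slice e) 𝔽) →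
        cls B 𝔸 hA = cls B (along (P.slice e) ℰ) (hE.along _ fun _ hy => ⟨hy, trivial⟩) := by
      intro e 𝔸 hA s
      have hd' : (along (P.slice e) ℂ'').dom = Bᶜ := by
        rw [dom_along, hd]
        ext x
        exact not_congr (and_iff_left trivial)
      refine cls_eq_of_compat_compl D₀ hA _ hd' ?_ (.of_subs (t.pull _) (Sub.refl _))
      refine Compat.symm (.of_on (O := Bᶜ) (hO := hB.isOpen_compl) (.of_subs ?_ (t'.pull _))
        fun x _ hx => hd' ▸ hx)
      refine (Sub.pull_inv (F := F) (hf := hf.isEmbedding) (hr := hr') 𝔸).trans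
        ((s.pull _).trans ?_)
      exact .slice_inv (O := Bᶜ) (O' := (B ×ˢ univ)ᶜ) (fun x t hx h => hx h.1) 𝔽 e
    exact (key 0 𝔸 hA s0).trans ((cls_slice hE).trans (key 1 𝔹 hB' s1).symm)
  · intro a
    obtain ⟨𝔸, hA, rfl⟩ := exists_cls a
    obtain ⟨ℰ, ℂ'', hE, t, t', hd⟩ := exists_ext_closed D₀ (F := F) hf (hB := hB.isOpen_compl)
      (hr := hr') hA
    -- surjectivity: the extension by zero restricts to the given class
    refine ⟨cls B ℰ hE, ?_⟩
    rw [map_cls]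
    refine cls_eq_of_compat_compl (D₀.pullback F) (ℂ' := along F ℂ'') _ hA ?_
      (.of_subs (t.pull _) (Sub.refl _)) (.of_subs ((t'.pull _).trans (.along_inv 𝔸)) (Sub.refl _))
    rw [dom_along, hd]; rfl

end KF

end ext

/-! ### Disjoint unions -/

section sigma

variable {X : Type u} [TopologicalSpace X] {H : Type w}
  [NormedAddCommGroup H] [InnerProductSpace ℂ H] {P : PrincipalBundle (PU H) X}

namespace TV

section disjointUnion

variable {κ : Type u} (𝔸 : κ → TV P) {𝔹 : TV P}

/-- The open sets of a disjoint union. -/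
abbrev sigmaU (i : Σ l, (𝔸 l).D.ι) : Set X := (𝔸 i.1).D.U i.2

/-- The objects of a disjoint union. -/
abbrev sigmaE (i : Σ l, (𝔸 l).D.ι) : HFObj X (sigmaU 𝔸 i) := (𝔸 i.1).V.E i.2

open Classical in
/-- The transition morphisms of a disjoint union; those between different members play no role. -/
def sigmaΦ (i j : Σ l, (𝔸 l).D.ι) : PreHom H (sigmaE 𝔸 j) (sigmaE 𝔸 i) :=
  if h : j.1 = i.1 then
    match i, j, h with
    | ⟨_, a⟩, ⟨_, b⟩, rfl => (𝔸 _).Φ a b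
  else ⟨1, fun _ => 0⟩

theorem sigmaΦ_mk (l : κ) (a b : (𝔸 l).D.ι) : sigmaΦ 𝔸 ⟨l, a⟩ ⟨l, b⟩ = (𝔸 l).Φ a b :=
  dif_pos rfl

theorem sigmaΦ_of_ne {i j : Σ l, (𝔸 l).D.ι} (h : j.1 ≠ i.1) : sigmaΦ 𝔸 i j = ⟨1, fun _ => 0⟩ :=
  dif_neg h

variable {𝔸} (hd : ∀ l l' x, x ∈ (𝔸 l).dom → x ∈ (𝔸 l').dom → l = l')

include hd in
theorem eq_of_mem_sigmaU {i j : Σ l, (𝔸 l).D.ι} {x : X} (hi : x ∈ sigmaU 𝔸 i)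
    (hj : x ∈ sigmaU 𝔸 j) : i.1 = j.1 := hd _ _ x (mem_dom.2 ⟨_, hi⟩) (mem_dom.2 ⟨_, hj⟩)

/-- The union of a family of bundles over disjoint open sets. -/
def sigma : TV P :=
  ofCocycle (sigmaU 𝔸) (sigmaE 𝔸) (fun i => (𝔸 i.1).D.s i.2)
    (fun i => (𝔸 i.1).D.continuousOn_s i.2) (fun i => (𝔸 i.1).D.proj_s i.2) (sigmaΦ 𝔸)
    (by
      rintro ⟨l, a⟩ ⟨l', b⟩
      by_cases h : l' = l
      · subst h
        rw [sigmaΦ_mk]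
        exact (𝔸 l').isMor a b
      · have he : sigmaU 𝔸 ⟨l, a⟩ ∩ sigmaU 𝔸 ⟨l', b⟩ = ∅ :=
          eq_empty_of_forall_notMem fun x hx => h (eq_of_mem_sigmaU hd hx.2 hx.1)
        rw [sigmaΦ_of_ne 𝔸 h, he]
        exact ⟨continuousOn_empty _, fun _ h => h.elim, .zero⟩)
    (by
      rintro ⟨l, a⟩ x hx
      rw [sigmaΦ_mk]
      exact (𝔸 l).V.unit a x hx)
    (by
      rintro ⟨l, a⟩ ⟨l', b⟩ ⟨l'', c⟩ x ha hb hc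
      obtain rfl : l = l' := eq_of_mem_sigmaU hd ha hb
      obtain rfl : l = l'' := eq_of_mem_sigmaU hd ha hc
      rw [sigmaΦ_mk, sigmaΦ_mk, sigmaΦ_mk]
      exact (𝔸 l).V.cocycle a b c x ha hb hc)

theorem sigma_Φ (l : κ) (a b : (𝔸 l).D.ι) : (sigma hd).Φ ⟨l, a⟩ ⟨l, b⟩ = (𝔸 l).Φ a b :=
  sigmaΦ_mk 𝔸 l a b

theorem dom_sigma : (sigma hd).dom = ⋃ l, (𝔸 l).dom := iUnion_sigma (sigmaU 𝔸)

theorem sub_sigma (l : κ) : Sub (𝔸 l) (sigma hd) :=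
  .of_iso (𝔹 := sigma hd) (fun a => ⟨l, a⟩) (fun _ => Subset.rfl) (fun _ _ _ => rfl)
    (fun a b x _ => congrFun (congrArg PreHom.g (sigma_Φ hd l a b)).symm x)
    (fun _ _ => LinearMap.id) (fun _ _ => LinearMap.id) (fun _ => .id) (fun _ => .id)
    (fun _ _ _ _ => rfl) (fun _ _ _ _ => rfl)
    fun a b x _ v => congrArg (fun Φ : PreHom H _ _ => Φ.φ x v) (sigma_Φ hd l a b)

/-- The disjoint union of parts of `𝔹` is part of `𝔹`. -/
theorem sigma_sub (h : ∀ l, Sub (𝔸 l) 𝔹) : Sub (sigma hd) 𝔹 := by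
  let S : ∀ l, SubData (𝔸 l) 𝔹 := fun l => (h l).some
  exact ⟨{
    r := fun i => (S i.1).r i.2
    le := fun i => (S i.1).le i.2
    Θ := fun i => (S i.1).Θ i.2
    Θ' := fun i => (S i.1).Θ' i.2
    mor := fun i => (S i.1).mor i.2
    mor' := fun i => (S i.1).mor' i.2
    left := fun i => (S i.1).left i.2
    right := fun i => (S i.1).right i.2
    comm := by
      rintro ⟨l, a⟩ ⟨l', b⟩ x ha hb
      obtain rfl : l = l' := eq_of_mem_sigmaU hd ha hb
      rw [sigma_Φ]
      exact (S l).comm a b x ha hb }⟩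

end disjointUnion

variable {Λ : Type u} {B : Λ → Type u} [∀ l, TopologicalSpace (B l)]
  {Q : ∀ l, PrincipalBundle (PU H) (B l)} {j : ∀ l, C(B l, X)} {Y : Set X}

/-- Bundles over the members of a cover by disjoint open subspaces are induced from a bundle over
the whole space. -/
theorem exists_sigma (F : ∀ l, (Q l).Hom P (j l)) (hj : ∀ l, IsOpenEmbedding (j l))
    (hdj : ∀ l l' x x', j l x = j l' x' → l = l') (hu : ∀ x, ∃ l, x ∈ range (j l))
    (𝔸 : ∀ l, TV (Q l)) (h : ∀ l, Good (j l ⁻¹' Y) (𝔸 l)) : ∃ ℰ : TV P, Good Y ℰ ∧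
      (∀ l, Nonempty (B l) → Sub (𝔸 l) (along (F l) ℰ)) ∧
      ∀ 𝔹, (∀ (l) (_ : Nonempty (B l)), Sub (pull (.inv (F l) (hj l).isEmbedding
        (hj l).isOpen_range Subset.rfl) (𝔸 l)) 𝔹) → Sub ℰ 𝔹 := by
  let κ := {l // Nonempty (B l)}
  have hne : ∀ l : κ, Nonempty (B l.1) := fun l => l.2
  let 𝔾 : κ → TV P := fun l => pull (.inv (F l.1) (hj l.1).isEmbedding (hj l.1).isOpen_range
    Subset.rfl) (𝔸 l.1)
  have hdom : ∀ l, (𝔾 l).dom = range (j l.1) := fun l => by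
    rw [dom_pull, (h l.1).1, preimage_univ, inter_univ]; rfl
  have hd : ∀ l l' x, x ∈ (𝔾 l).dom → x ∈ (𝔾 l').dom → l = l' := by
    intro l l' x hx hx'
    rw [hdom] at hx hx'
    obtain ⟨y, rfl⟩ := hx
    obtain ⟨y', hy'⟩ := hx'
    exact Subtype.ext (hdj _ _ _ _ hy'.symm)
  refine ⟨sigma hd, ⟨?_, fun y hy => ?_⟩, fun l hl => ?_,
    fun 𝔹 h' => sigma_sub hd fun l => h' l.1 l.2⟩
  · rw [dom_sigma]
    refine eq_univ_of_forall fun x => ?_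
    obtain ⟨l, y, rfl⟩ := hu x
    exact mem_iUnion.2 ⟨⟨l, ⟨y⟩⟩, by rw [hdom]; exact mem_range_self y⟩
  · rintro ⟨l, a⟩ hi
    have hx : y ∈ range (j l.1) := hdom l ▸ mem_dom.2 ⟨a, hi⟩
    refine InvAt.pull (.inv (F l.1) (hj l.1).isEmbedding (hj l.1).isOpen_range
      Subset.rfl) ((h l.1).2 _ ?_) a hi
    change j l.1 (Function.invFun (j l.1) y) ∈ Y
    rwa [Function.invFun_eq hx]
  · refine Sub.trans ?_ ((sub_sigma hd ⟨l, hl⟩).pull (.ofHom (F l)))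
    exact .pull_left_inv (F' := F l) (fun x => mem_range_self x)
      (fun p => PMap.invFun_eq _ (hj l).isEmbedding rfl) _

end TV

/-- Additivity. -/
theorem KF.map_bijective_of_sigma [Nontrivial H] {Λ : Type u} {B : Λ → Type u}
    [∀ l, TopologicalSpace (B l)] {Q : ∀ l, PrincipalBundle (PU H) (B l)} {j : ∀ l, C(B l, X)}
    {Y : Set X} {Y' : ∀ l, Set (B l)} (F : ∀ l, (Q l).Hom P (j l))
    (hj : ∀ l, IsOpenEmbedding (j l))
    (hdj : ∀ l l' x x', j l x = j l' x' → l = l') (hu : ∀ x, ∃ l, x ∈ range (j l))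
    (hY : ∀ l, MapsTo (j l) (Y' l) Y) (hY' : ∀ l x, j l x ∈ Y → x ∈ Y' l) :
    Function.Bijective fun (a : KF P Y) l => map (F l) (hY l) a := by
  obtain rfl : Y' = fun l => j l ⁻¹' Y := funext fun l => Subset.antisymm (hY l) (hY' l)
  constructor
  · intro a b hab
    obtain ⟨𝔸, hA, rfl⟩ := TV.exists_cls a
    obtain ⟨𝔹, hB, rfl⟩ := TV.exists_cls b
    have hc : ∀ l, TV.Conc (j l ⁻¹' Y) (TV.along (F l) 𝔸) (TV.along (F l) 𝔹) := fun l => by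
      have h := congrFun hab l
      dsimp only at h
      rw [TV.map_cls, TV.map_cls] at h
      exact TV.conc_of_cls_eq h
    choose 𝔽 hF s0 s1 using hc
    obtain ⟨ℰ, hE, u, -⟩ := TV.exists_sigma (Y := Y ×ˢ (univ : Set I))
      (fun l => (F l).prodMap I) (fun l => (hj l).prodMap .id)
      (fun l l' x x' h => hdj l l' x.1 x'.1 (congrArg Prod.fst h))
      (fun x => (hu x.1).imp fun l ⟨y, hy⟩ => ⟨(y, x.2), Prod.ext hy rfl⟩) 𝔽 hF
    have key : ∀ (e : I) (𝔸 : TV P) (hA : TV.Good Y 𝔸),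
        (∀ l, TV.Sub (TV.along (F l) 𝔸) (TV.along ((Q l).slice e) (𝔽 l))) →
        TV.cls Y 𝔸 hA =
          TV.cls Y (TV.along (P.slice e) ℰ) (hE.along _ fun _ hy => ⟨hy, trivial⟩) := by
      intro e 𝔸 hA s
      obtain ⟨𝔾, hG, -, t⟩ := TV.exists_sigma F hj hdj hu (fun l => TV.along (F l) 𝔸)
        (fun l => hA.along (F l) (Y' := j l ⁻¹' Y) fun _ h => h)
      have s1 : TV.Sub 𝔾 𝔸 := t _ fun l _ => (TV.Sub.inv_pull _).trans (.pull_idOn _ _ _)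
      have s2 : TV.Sub 𝔾 (TV.along (P.slice e) ℰ) := t _ fun l hl =>
        (((s l).trans (((u l (hl.map fun x => (x, e))).pull (.ofHom ((Q l).slice e))).trans
          (TV.Sub.along_along (K := (P.slice e).comp (F l)) (fun p =>
            Subtype.ext (Prod.ext (Prod.ext ((F l).proj_toFun _).symm rfl) rfl)) ℰ))).pull _).trans
          (((TV.Sub.along_of_comp (fun _ => rfl) ℰ).pull _).trans
            ((TV.Sub.inv_pull _).trans (.pull_idOn _ _ _)))
      exact (TV.cls_eq_of_sub (hA := hG) s1).symm.trans (TV.cls_eq_of_sub s2)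
    exact (key 0 𝔸 hA s0).trans ((TV.cls_slice hE).trans (key 1 𝔹 hB s1).symm)
  · intro a
    choose 𝔸 hA h using fun l => TV.exists_cls (a l)
    obtain ⟨ℰ, hE, s, -⟩ := TV.exists_sigma F hj hdj hu 𝔸 hA
    refine ⟨TV.cls Y ℰ hE, funext fun l => ?_⟩
    dsimp only
    rw [TV.map_cls, h]
    rcases isEmpty_or_nonempty (B l) with hl | hl
    · exact TV.cls_eq_of_inv (fun x => hl.elim x) fun x => hl.elim x
    · exact (TV.cls_eq_of_sub (s l hl)).symm

end sigma

/-! ### Sections over cubes -/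

section cube

variable {X : Type u} [TopologicalSpace X] {G : Type w} [Group G] [TopologicalSpace G]

namespace PrincipalBundle

/-- A section of the pull-back of `P` along `c` over `S`. -/
def HasSection (P : PrincipalBundle G X) {n : ℕ} (c : (Fin n → ℝ) → X) (S : Set (Fin n → ℝ)) :
    Prop := ∃ τ : (Fin n → ℝ) → P.Total, ContinuousOn τ S ∧ ∀ v ∈ S, P.proj (τ v) = c v

variable {P : PrincipalBundle G X} {n : ℕ} {c : (Fin n → ℝ) → X} {S : Set (Fin n → ℝ)}

/-- Sections over the two halves of a box can be made to agree on the common wall. -/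
theorem HasSection.merge {a b : Fin n → ℝ} (i : Fin n) (m : ℝ)
    (h : P.HasSection c (Icc a b ∩ {v | v i ≤ m})) (h' : P.HasSection c (Icc a b ∩ {v | m ≤ v i})) :
    P.HasSection c (Icc a b) := by
  obtain ⟨s, hs, hs'⟩ := h
  obtain ⟨t, ht, ht'⟩ := h'
  by_cases hm : a i ≤ m ∧ m ≤ b i
  swap
  · rw [not_and_or, not_le, not_le] at hm
    rcases hm with hm | hm
    · exact ⟨t, ht.mono fun v hv => ⟨hv, hm.le.trans (hv.1 i)⟩,
        fun v hv => ht' v ⟨hv, hm.le.trans (hv.1 i)⟩⟩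
    · exact ⟨s, hs.mono fun v hv => ⟨hv, (hv.2 i).trans hm.le⟩,
        fun v hv => hs' v ⟨hv, (hv.2 i).trans hm.le⟩⟩
  -- the retraction to the wall
  let r : (Fin n → ℝ) → Fin n → ℝ := fun v => Function.update v i m
  have hr : Continuous r := continuous_id.update i continuous_const
  have hrm : ∀ v ∈ Icc a b, r v ∈ Icc a b ∩ {v | v i = m} := fun v hv => by
    refine ⟨⟨fun j => ?_, fun j => ?_⟩,
      show Function.update v i m i = m from Function.update_self ..⟩ <;>
      rcases eq_or_ne j i with rfl | hj
    · simpa only [r, Function.update_self] using hm.1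
    · simpa only [r, Function.update_of_ne hj] using hv.1 j
    · simpa only [r, Function.update_self] using hm.2
    · simpa only [r, Function.update_of_ne hj] using hv.2 j
  have hr1 : ∀ v ∈ Icc a b, r v ∈ Icc a b ∩ {v | v i ≤ m} := fun v hv =>
    ⟨(hrm v hv).1, (hrm v hv).2.le⟩
  have hr2 : ∀ v ∈ Icc a b, r v ∈ Icc a b ∩ {v | m ≤ v i} := fun v hv =>
    ⟨(hrm v hv).1, (hrm v hv).2.ge⟩
  let t' : (Fin n → ℝ) → P.Total := fun v => P.act (t v) (P.div (t (r v)) (s (r v)))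
  have htc : ContinuousOn t' (Icc a b ∩ {v | m ≤ v i}) := by
    refine P.continuous_act.comp_continuousOn (ht.prodMk ?_)
    refine P.continuousOn_div.comp (f := fun v => (t (r v), s (r v))) (.prodMk ?_ ?_) fun v hv => ?_
    · exact ht.comp hr.continuousOn fun v hv => hr2 v hv.1
    · exact hs.comp hr.continuousOn fun v hv => hr1 v hv.1
    · exact (ht' _ (hr2 v hv.1)).trans (hs' _ (hr1 v hv.1)).symm
  have hwall : ∀ v ∈ Icc a b, v i = m → t' v = s v := fun v hv h => by
    have hrv : r v = v := by simp only [r, ← h, Function.update_eq_self]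
    simp only [t', hrv]
    exact P.act_div _ _ ((ht' v ⟨hv, h.ge⟩).trans (hs' v ⟨hv, h.le⟩).symm)
  refine ⟨fun v => if v i ≤ m then s v else t' v, ?_, fun v hv => ?_⟩
  · have e : Icc a b = (Icc a b ∩ {v | v i ≤ m}) ∪ (Icc a b ∩ {v | m ≤ v i}) := by
      rw [← inter_union_distrib_left]
      exact (inter_eq_left.2 fun v _ => le_total (v i) m).symm
    rw [e]
    refine ContinuousOn.union_of_isClosed ?_ ?_ (isClosed_Icc.inter
      (isClosed_le (continuous_apply i) continuous_const)) (isClosed_Icc.inter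
      (isClosed_le continuous_const (continuous_apply i)))
    · exact hs.congr fun v hv => if_pos hv.2
    · refine htc.congr fun v hv => ?_
      split_ifs with h
      · exact (hwall v hv.1 (le_antisymm h hv.2)).symm
      · rfl
  · dsimp only
    split_ifs with h
    · exact hs' v ⟨hv, h⟩
    · exact (P.proj_act _ _).trans (ht' v ⟨hv, (not_le.1 h).le⟩)

theorem HasSection.mono {S' : Set (Fin n → ℝ)} (h : P.HasSection c S) (hS : S' ⊆ S) :
    P.HasSection c S' :=
  let ⟨τ, hτ, hτ'⟩ := h
  ⟨τ, hτ.mono hS, fun v hv => hτ' v (hS hv)⟩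

/-- A principal bundle over a cube has a section. -/
theorem hasSection_Icc (P : PrincipalBundle G X) (hc : Continuous c) (a b : Fin n → ℝ) :
    P.HasSection c (Icc a b) := by
  choose W hW hxW τ hτ hτ' using P.exists_section
  obtain ⟨δ, hδ, hL⟩ := lebesgue_number_lemma_of_metric (isCompact_Icc (a := a) (b := b))
    (fun x => (hW x).preimage hc) fun v _ => mem_iUnion.2 ⟨c v, hxW _⟩
  -- boxes with sides of length at most `d`
  let S : (Fin n → ℝ) → Prop := fun d => ∀ a' b', Icc a' b' ⊆ Icc a b →
    (∀ j, b' j - a' j ≤ d j) → P.HasSection c (Icc a' b')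
  have h0 : S fun _ => δ / 2 := fun a' b' h hd => by
    rcases (Icc a' b').eq_empty_or_nonempty with he | hne
    · exact ⟨fun v => τ (c v) (c v), by rw [he]; exact continuousOn_empty _, by simp [he]⟩
    have hab : a' ∈ Icc a' b' := left_mem_Icc.2 (nonempty_Icc.1 hne)
    obtain ⟨x, hx⟩ := hL a' (h hab)
    have hsub : Icc a' b' ⊆ c ⁻¹' W x := fun v hv => hx <| by
      rw [Metric.mem_ball]
      refine lt_of_le_of_lt ((dist_pi_le_iff (by positivity)).2 fun j => ?_) (half_lt_self hδ)
      rw [Real.dist_eq, abs_of_nonneg (sub_nonneg.2 (hv.1 j))]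
      exact (sub_le_sub_right (hv.2 j) _).trans (hd j)
    exact ⟨fun v => τ x (c v), (hτ x).comp hc.continuousOn hsub, fun v hv => hτ' x _ (hsub hv)⟩
  -- the length of one side can be doubled, by merging two boxes along a face
  have h1 : ∀ d i, 0 ≤ d i → S d → S (Function.update d i (2 * d i)) :=
      fun d i hdi hS a' b' h hd => by
    have hd' : ∀ j, j ≠ i → b' j - a' j ≤ d j := fun j hj => by
      simpa only [Function.update_of_ne hj] using hd j
    have hdi' := hd i
    rw [Function.update_self] at hdi'
    by_cases hm : b' i ≤ a' i + d i
    · refine hS a' b' h fun j => ?_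
      rcases eq_or_ne j i with rfl | hj
      · linarith
      · exact hd' j hj
    rw [not_le] at hm
    refine .merge i (a' i + d i) ?_ ?_
    · refine (hS a' (Function.update b' i (a' i + d i)) ((Icc_subset_Icc_right ?_).trans h)
        fun j => ?_).mono fun v hv => ⟨hv.1.1, ?_⟩
      · exact update_le_iff.2 ⟨hm.le, fun _ _ => le_rfl⟩
      · rcases eq_or_ne j i with rfl | hj
        · rw [Function.update_self]; linarith
        · rw [Function.update_of_ne hj]; exact hd' j hj
      · exact le_update_iff.2 ⟨hv.2, fun j _ => hv.1.2 j⟩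
    · refine (hS (Function.update a' i (a' i + d i)) b' ((Icc_subset_Icc_left ?_).trans h)
        fun j => ?_).mono fun v hv => ⟨?_, hv.1.2⟩
      · exact le_update_iff.2 ⟨by linarith, fun _ _ => le_rfl⟩
      · rcases eq_or_ne j i with rfl | hj
        · rw [Function.update_self]; linarith
        · rw [Function.update_of_ne hj]; exact hd' j hj
      · exact update_le_iff.2 ⟨hv.2, fun j _ => hv.1.1 j⟩
  -- the length of one side can be multiplied by `2 ^ m`
  have h2 : ∀ (m : ℕ) d i, 0 ≤ d i → S d → S (Function.update d i (2 ^ m * d i)) := by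
    intro m
    induction m with
    | zero => intro d i _ hS; simpa using hS
    | succ m ih =>
      intro d i hdi hS
      have := h1 _ i (by rw [Function.update_self]; positivity) (ih d i hdi hS)
      rwa [Function.update_idem, Function.update_self, ← mul_assoc, ← pow_succ'] at this
  -- the lengths of all sides with index in `s` can be multiplied by `2 ^ m`
  have h3 : ∀ (m : ℕ) (s : Finset (Fin n)),
      S fun j => if j ∈ s then 2 ^ m * (δ / 2) else δ / 2 := by
    intro m s
    induction s using Finset.induction_on with
    | empty => simpa using h0
    | insert i s hi ih =>
      have := h2 m _ i (by simp only [if_neg hi]; positivity) ih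
      convert this using 1
      funext j
      rcases eq_or_ne j i with rfl | hj
      · simp [hi]
      · simp [hj]
  obtain ⟨m, hm⟩ := pow_unbounded_of_one_lt (‖b - a‖ / (δ / 2)) (one_lt_two (α := ℝ))
  refine h3 m Finset.univ a b Subset.rfl fun j => ?_
  simp only [Finset.mem_univ, if_true]
  rw [div_lt_iff₀ (by positivity)] at hm
  exact ((le_abs_self _).trans (norm_le_pi_norm (b - a) j)).trans hm.le

end PrincipalBundle

end cube

/-! ### Cell structures -/

section cells

/-- The radial retraction of `ℝ^n` to its unit ball. -/
def ballProj {n : ℕ} (v : Fin n → ℝ) : Fin n → ℝ := (max 1 ‖v‖)⁻¹ • v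

theorem continuous_ballProj {n : ℕ} : Continuous (ballProj (n := n)) := by
  have h : ∀ v : Fin n → ℝ, max 1 ‖v‖ ≠ 0 := fun v => (lt_max_of_lt_left one_pos).ne'
  unfold ballProj
  fun_prop (disch := exact h _)

theorem ballProj_mem {n : ℕ} (v : Fin n → ℝ) : ballProj v ∈ Metric.closedBall 0 1 := by
  rw [mem_closedBall_zero_iff, ballProj, norm_smul, norm_inv, Real.norm_of_nonneg (by positivity)]
  exact inv_mul_le_one_of_le₀ (le_max_right _ _) (by positivity)

theorem ballProj_of_mem {n : ℕ} {v : Fin n → ℝ} (h : v ∈ Metric.closedBall 0 1) :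
    ballProj v = v := by
  rw [ballProj, max_eq_left (mem_closedBall_zero_iff.1 h), inv_one, one_smul]

theorem ballProj_mem_or {n : ℕ} (v : Fin n → ℝ) :
    ballProj v ∈ Metric.ball 0 1 ∨ ballProj v ∈ Metric.sphere 0 1 := by
  rw [mem_ball_zero_iff, mem_sphere_zero_iff_norm]
  exact (mem_closedBall_zero_iff.1 (ballProj_mem v)).lt_or_eq

/-- The cells of a CW complex `X`, with characteristic maps extended to `ℝ^n` by the radial
retraction; `co x` is the open cell of `x` with the coordinates of `x` there. -/
structure Cells (X : Type u) [TopologicalSpace X] where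
  C : Type u
  dim : C → ℕ
  c : ∀ e, (Fin (dim e) → ℝ) → X
  c_ballProj : ∀ e v, c e (ballProj v) = c e v
  continuous_c : ∀ e, Continuous (c e)
  co : X → Σ e, Fin (dim e) → ℝ
  co_mem : ∀ x, (co x).2 ∈ Metric.ball 0 1
  c_co : ∀ x, c (co x).1 (co x).2 = x
  co_c : ∀ e, ∀ v ∈ Metric.ball 0 1, co (c e v) = ⟨e, v⟩
  exists_finset : ∀ e, ∃ J : Finset C, (∀ j ∈ J, dim j < dim e) ∧
    ∀ v ∈ Metric.sphere 0 1, (co (c e v)).1 ∈ J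
  isClosed_of : ∀ A : Set X, (∀ e, IsClosed (c e ⁻¹' A)) → IsClosed A

section CWComplex

open Topology.RelCWComplex

variable {Z : Type u} [TopologicalSpace Z] {X : Set Z} [Topology.CWComplex X]

theorem exists_cell_coord [T2Space Z] (x : X) : ∃ q : Σ e : Σ n, cell X n, Fin e.1 → ℝ,
    q.2 ∈ Metric.ball 0 1 ∧ map q.1.1 q.1.2 q.2 = (x : Z) :=
  let ⟨n, i, v, hv, h⟩ := exists_openCell x.2
  ⟨⟨⟨n, i⟩, v⟩, hv, h⟩

theorem cell_coord_unique {q q' : Σ e : Σ n, cell X n, Fin e.1 → ℝ} (hq : q.2 ∈ Metric.ball 0 1)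
    (hq' : q'.2 ∈ Metric.ball 0 1) (h : map q.1.1 q.1.2 q.2 = map q'.1.1 q'.1.2 q'.2) :
    q = q' := by
  obtain ⟨⟨n, i⟩, v⟩ := q
  obtain ⟨⟨m, j⟩, w⟩ := q'
  have he : (⟨n, i⟩ : Σ n, cell X n) = ⟨m, j⟩ := eq_of_not_disjoint_openCell fun hd =>
    disjoint_left.1 hd (mem_image_of_mem (map n i) hq) (h ▸ mem_image_of_mem (map m j) hq')
  cases he
  refine congrArg (Sigma.mk _) ((map n i).injOn ?_ ?_ h) <;> rwa [source_eq]

end CWComplex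

open Topology.RelCWComplex in
/-- The cells of a CW complex. -/
def Cells.ofCW {Z : Type u} [TopologicalSpace Z] [T2Space Z] (X : Set Z)
    [Topology.CWComplex X] : Cells X where
  C := Σ n, cell X n
  dim e := e.1
  c e v := ⟨map e.1 e.2 (ballProj v),
    closedCell_subset_complex e.1 e.2 (mem_image_of_mem _ (ballProj_mem v))⟩
  c_ballProj e v := Subtype.ext (congrArg (map e.1 e.2) (ballProj_of_mem (ballProj_mem v)))
  continuous_c e := Continuous.subtype_mk
    ((continuousOn e.1 e.2).comp_continuous continuous_ballProj ballProj_mem) _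
  co x := (exists_cell_coord x).choose
  co_mem x := (exists_cell_coord x).choose_spec.1
  c_co x := by
    have h := (exists_cell_coord x).choose_spec
    refine Subtype.ext ?_
    dsimp only
    rw [ballProj_of_mem (Metric.ball_subset_closedBall h.1), h.2]
  co_c e v hv := by
    have h := (exists_cell_coord (X := X) ⟨map e.1 e.2 (ballProj v),
      closedCell_subset_complex e.1 e.2 (mem_image_of_mem _ (ballProj_mem v))⟩).choose_spec
    refine cell_coord_unique h.1 hv (h.2.trans (congrArg (map e.1 e.2) ?_))
    exact ballProj_of_mem (Metric.ball_subset_closedBall hv)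
  exists_finset := by
    rintro ⟨n, i⟩
    obtain ⟨J, hJ⟩ := Topology.CWComplex.cellFrontier_subset_finite_openCell (C := X) n i
    refine ⟨(Finset.range n).sigma J, fun j hj => ?_, fun v hv => ?_⟩
    · exact Finset.mem_range.1 (Finset.mem_sigma.1 hj).1
    · have h := hJ (mem_image_of_mem (map n i) hv)
      simp only [mem_iUnion] at h
      obtain ⟨m, hm, j, hj, w, hw, hwv⟩ := h
      have h := (exists_cell_coord (X := X) ⟨map n i (ballProj v),
        closedCell_subset_complex n i (mem_image_of_mem _ (ballProj_mem v))⟩).choose_spec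
      have e := cell_coord_unique (q' := ⟨⟨m, j⟩, w⟩) h.1 hw (h.2.trans <| by
        dsimp only
        rw [ballProj_of_mem (Metric.sphere_subset_closedBall hv), hwv])
      dsimp only at e ⊢
      rw [e]
      exact Finset.mem_sigma.2 ⟨Finset.mem_range.2 hm, hj⟩
  isClosed_of A h := by
    have h1 : IsClosed (Subtype.val '' A : Set Z) := by
      rw [Topology.CWComplex.closed X _ (by simp)]
      intro n i
      have h2 : IsCompact (map n i '' (Metric.closedBall 0 1 ∩ ballProj ⁻¹'
          ((fun v => (⟨map n i (ballProj v), closedCell_subset_complex n i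
            (mem_image_of_mem _ (ballProj_mem v))⟩ : X)) ⁻¹' A))) :=
        ((isCompact_closedBall _ _).inter_right ((h ⟨n, i⟩).preimage
          continuous_ballProj)).image_of_continuousOn
          ((continuousOn n i).mono inter_subset_left)
      convert h2.isClosed using 1
      ext z
      constructor
      · rintro ⟨⟨x, hx, rfl⟩, v, hv, hvx⟩
        refine ⟨v, ⟨hv, ?_⟩, hvx⟩
        have : (⟨map n i (ballProj (ballProj v)), closedCell_subset_complex n i
            (mem_image_of_mem _ (ballProj_mem _))⟩ : X) = x := Subtype.ext <| by
          dsimp only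
          rw [ballProj_of_mem (ballProj_mem v), ballProj_of_mem hv, hvx]
        rw [mem_preimage, mem_preimage, this]
        exact hx
      · rintro ⟨v, ⟨hv, hA⟩, rfl⟩
        refine ⟨⟨_, hA, ?_⟩, mem_image_of_mem _ hv⟩
        dsimp only
        rw [ballProj_of_mem (ballProj_mem v), ballProj_of_mem hv]
    convert h1.preimage continuous_subtype_val
    exact (preimage_image_eq A Subtype.val_injective).symm

namespace Cells

variable {X : Type u} [TopologicalSpace X] (K : Cells X)

/-- The map from the disjoint union of the cells. -/
def quot (q : Σ e, Fin (K.dim e) → ℝ) : X := K.c q.1 q.2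

theorem isQuotientMap_quot : IsQuotientMap K.quot := by
  refine isQuotientMap_iff_isClosed.2 ⟨fun x => ⟨K.co x, K.c_co x⟩, fun A => ⟨fun h => ?_,
    fun h => K.isClosed_of A fun e => isClosed_sigma_iff.1 h e⟩⟩
  exact h.preimage (continuous_sigma K.continuous_c)

theorem dim_co_c_le (e : K.C) (v) : K.dim (K.co (K.c e v)).1 ≤ K.dim e := by
  rw [← K.c_ballProj]
  rcases ballProj_mem_or v with h | h
  · rw [K.co_c e _ h]
  · obtain ⟨J, hJ, hs⟩ := K.exists_finset e
    exact (hJ _ (hs _ h)).le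

theorem dim_co_c_lt (e : K.C) {v} (h : v ∈ Metric.sphere 0 1) :
    K.dim (K.co (K.c e v)).1 < K.dim e :=
  let ⟨_, hJ, hs⟩ := K.exists_finset e
  hJ _ (hs _ h)

variable {G : Type w} [Group G] [TopologicalSpace G] {P : PrincipalBundle G X}

/-- A principal bundle is trivial over a cell. -/
theorem exists_lift (P : PrincipalBundle G X) (e : K.C) : ∃ τ : (Fin (K.dim e) → ℝ) → P.Total,
    Continuous τ ∧ (∀ v, τ (ballProj v) = τ v) ∧ ∀ v, P.proj (τ v) = K.c e v := by
  obtain ⟨τ, hτ, h⟩ := P.hasSection_Icc (K.continuous_c e) (-1) 1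
  have hm : ∀ v : Fin (K.dim e) → ℝ, ballProj v ∈ Icc (-1) 1 := fun v => by
    have h := fun i => abs_le.1 ((norm_le_pi_norm (ballProj v) i).trans
      (mem_closedBall_zero_iff.1 (ballProj_mem v)))
    exact ⟨fun i => (h i).1, fun i => (h i).2⟩
  refine ⟨fun v => τ (ballProj v), hτ.comp_continuous continuous_ballProj hm, fun v => ?_,
    fun v => (h _ (hm v)).trans (K.c_ballProj e v)⟩
  dsimp only
  rw [ballProj_of_mem (ballProj_mem v)]

variable {B : Type*} [TopologicalSpace B] {T : Type*} [TopologicalSpace T]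
  {act : B → G → B}

/-- An equivariant map which is continuous over a closed cell is continuous along every compact
family of points over this cell. -/
theorem continuousOn_of_cell [T2Space X] [CompactSpace T] [T2Space T]
    (hact : Continuous fun q : B × G => act q.1 q.2)
    {R : P.Total → T → B} {j : K.C} (hR : ∀ p g t, P.proj p ∈ range (K.c j) →
      R (P.act p g) t = act (R p t) g) {τ : (Fin (K.dim j) → ℝ) → P.Total} (hτ : Continuous τ)
    (hτ' : ∀ v, P.proj (τ v) = K.c j v)
    (hRτ : Continuous fun q : (Fin (K.dim j) → ℝ) × T => R (τ q.1) q.2)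
    {A : Type*} [TopologicalSpace A] [T2Space A] {S : Set A} (hS : IsCompact S) {f : A → P.Total}
    (hf : ContinuousOn f S) (h : ∀ v ∈ S, P.proj (f v) ∈ range (K.c j)) :
    ContinuousOn (fun q : A × T => R (f q.1) q.2) (S ×ˢ univ) := by
  have := isCompact_iff_compactSpace.1 hS
  have := isCompact_iff_compactSpace.1 (isCompact_closedBall (0 : Fin (K.dim j) → ℝ) 1)
  have hf' : Continuous fun v : S => f v := continuousOn_iff_continuous_domRestrict.1 hf
  let S' : Set (S × Metric.closedBall (0 : Fin (K.dim j) → ℝ) 1) :=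
    {q | P.proj (f q.1) = K.c j q.2}
  have hS' : IsClosed S' := isClosed_eq (P.continuous_proj.comp (hf'.comp continuous_fst))
    ((K.continuous_c j).comp (continuous_subtype_val.comp continuous_snd))
  have : CompactSpace S' := hS'.isClosedEmbedding_subtypeVal.compactSpace
  let π : S' × T → S × T := fun q => (q.1.1.1, q.2)
  have hπ : Continuous π := by fun_prop
  have hq : IsQuotientMap π := hπ.isClosedMap.isQuotientMap hπ fun ⟨v, t⟩ => by
    obtain ⟨w, hw⟩ := h v v.2
    exact ⟨(⟨(v, ⟨ballProj w, ballProj_mem w⟩), hw.symm.trans (K.c_ballProj j w).symm⟩, t), rfl⟩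
  have key : Continuous fun q : S × T => R (f q.1) q.2 := by
    rw [hq.continuous_iff]
    have e : (fun q : S × T => R (f q.1) q.2) ∘ π = fun q : S' × T =>
        act (R (τ q.1.1.2) q.2) (P.div (τ q.1.1.2) (f q.1.1.1)) := funext fun q => by
      have hp : P.proj (τ q.1.1.2) = P.proj (f q.1.1.1) := (hτ' _).trans q.1.2.symm
      rw [← hR _ _ _ ⟨_, (hτ' _).symm⟩, P.act_div _ _ hp]
      rfl
    rw [e]
    refine hact.comp (.prodMk (hRτ.comp (f := fun q : S' × T =>
      ((q.1.1.2 : Fin (K.dim j) → ℝ), q.2))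
      (by fun_prop)) ?_)
    exact P.continuousOn_div.comp_continuous
      (f := fun q : S' × T => (τ q.1.1.2, f q.1.1.1))
      (.prodMk (by fun_prop) (hf'.comp (f := fun q : S' × T => q.1.1.1) (by fun_prop)))
      fun q => (hτ' _).trans q.1.2.symm
  rw [continuousOn_iff_continuous_domRestrict]
  exact key.comp (f := fun q : (S ×ˢ univ : Set (A × T)) => ((⟨q.1.1, q.2.1⟩ : S), q.1.2))
    (by fun_prop)

/-- An equivariant map is continuous if it is continuous over every cell. -/
theorem continuous_of_cells [LocallyCompactSpace T]
    (hact : Continuous fun q : B × G => act q.1 q.2)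
    {R : P.Total → T → B} (hR : ∀ p g t, R (P.act p g) t = act (R p t) g)
    {τ : ∀ e, (Fin (K.dim e) → ℝ) → P.Total} (hτ : ∀ e, Continuous (τ e))
    (hτ' : ∀ e v, P.proj (τ e v) = K.c e v)
    (hRτ : ∀ e, Continuous fun q : (Fin (K.dim e) → ℝ) × T => R (τ e q.1) q.2) :
    Continuous fun q : P.Total × T => R q.1 q.2 := by
  rw [continuous_iff_continuousAt]
  rintro ⟨p, t⟩
  obtain ⟨U, hU, hpU, s, hs, hs'⟩ := P.exists_section (P.proj p)
  have hsU : Continuous fun y : U => s y := continuousOn_iff_continuous_domRestrict.1 hs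
  have key : Continuous fun q : U × T => R (s q.1) q.2 := by
    refine (K.isQuotientMap_quot.restrictPreimage_isOpen hU).continuous_lift_prod_left ?_
    have h1 : Continuous fun q : (Σ e, Fin (K.dim e) → ℝ) × T => R (τ q.1.1 q.1.2) q.2 := by
      rw [← (Homeomorph.sigmaProdDistrib (X := fun e => Fin (K.dim e) → ℝ)
        (Y := T)).symm.comp_continuous_iff']
      exact continuous_sigma hRτ
    have h2 : Continuous fun q : Σ e, Fin (K.dim e) → ℝ => τ q.1 q.2 := continuous_sigma hτ
    have e : (fun q : (K.quot ⁻¹' U) × T => R (s (U.restrictPreimage K.quot q.1)) q.2) = fun q =>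
        act (R (τ q.1.1.1 q.1.1.2) q.2)
          (P.div (τ q.1.1.1 q.1.1.2) (s (U.restrictPreimage K.quot q.1))) := funext fun q => by
      exact (congrArg (R · q.2) (P.act_div _ _ ((hτ' _ _).trans (hs' _ q.1.2).symm)).symm).trans
        (hR _ _ _)
    rw [e]
    refine hact.comp (.prodMk (h1.comp (f := fun q : (K.quot ⁻¹' U) × T => (q.1.1, q.2))
      (by fun_prop)) ?_)
    refine P.continuousOn_div.comp_continuous (f := fun q : (K.quot ⁻¹' U) × T =>
      (τ q.1.1.1 q.1.1.2, s (U.restrictPreimage K.quot q.1))) (.prodMk ?_ ?_) fun q =>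
      (hτ' _ _).trans (hs' _ q.1.2).symm
    · exact h2.comp (f := fun q : (K.quot ⁻¹' U) × T => q.1.1) (by fun_prop)
    · exact hsU.comp ((K.isQuotientMap_quot.continuous.restrictPreimage).comp continuous_fst)
  have hO : IsOpen {q : P.Total × T | P.proj q.1 ∈ U} :=
    hU.preimage (P.continuous_proj.comp continuous_fst)
  refine ContinuousOn.continuousAt ?_ (hO.mem_nhds hpU)
  have hc : ContinuousOn (fun q : P.Total × T => act (R (s (P.proj q.1)) q.2)
      (P.div (s (P.proj q.1)) q.1)) {q | P.proj q.1 ∈ U} := by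
    have h1 : ContinuousOn (fun q : P.Total × T => s (P.proj q.1)) {q | P.proj q.1 ∈ U} :=
      hs.comp (P.continuous_proj.comp continuous_fst).continuousOn fun _ h => h
    refine hact.comp_continuousOn (.prodMk ?_ ?_)
    · rw [continuousOn_iff_continuous_domRestrict]
      exact key.comp (f := fun q : {q : P.Total × T | P.proj q.1 ∈ U} =>
        ((⟨P.proj q.1.1, q.2⟩ : U), q.1.2)) (((P.continuous_proj.comp
          (continuous_fst.comp continuous_subtype_val)).subtype_mk _).prodMk
          (continuous_snd.comp continuous_subtype_val))
    · exact P.continuousOn_div.comp (h1.prodMk continuousOn_fst) fun q hq => hs' _ hq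
  refine hc.congr fun q hq => ?_
  exact (congrArg (R · q.2) (P.act_div _ _ (hs' _ hq)).symm).trans (hR _ _ _)

/-- The cell and the coordinates of the projection of a point. -/
abbrev coP (p : P.Total) : Σ e, Fin (K.dim e) → ℝ := K.co (P.proj p)

/-- Equivariant maps out of a principal bundle over a CW complex can be constructed by extending
them successively from the boundary to the interior of every cell. -/
theorem exists_extension [T2Space X] [CompactSpace T] [T2Space T]
    (hact : Continuous fun q : B × G => act q.1 q.2) (act_one : ∀ b, act b 1 = b)
    (act_mul : ∀ b g h, act b (g * h) = act (act b g) h) (C : P.Total → T → B → Prop)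
    (hC : ∀ p t b g, C p t b → C (P.act p g) t (act b g)) (d : P.Total → T → B)
    (ext : ∀ e (τ : (Fin (K.dim e) → ℝ) → P.Total), Continuous τ → (∀ v, P.proj (τ v) = K.c e v) →
      ∀ ψ : (Fin (K.dim e) → ℝ) → T → B,
        ContinuousOn (fun q : _ × T => ψ q.1 q.2) (Metric.sphere 0 1 ×ˢ univ) →
        (∀ v ∈ Metric.sphere 0 1, ∀ t, C (τ v) t (ψ v t)) → ∃ ψ' : (Fin (K.dim e) → ℝ) → T → B,
          ContinuousOn (fun q : _ × T => ψ' q.1 q.2) (Metric.closedBall 0 1 ×ˢ univ) ∧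
          (∀ v ∈ Metric.sphere 0 1, ∀ t, ψ' v t = ψ v t) ∧
          ∀ v ∈ Metric.ball 0 1, ∀ t, C (τ v) t (ψ' v t)) :
    ∃ φ : P.Total → T → B, Continuous (fun q : P.Total × T => φ q.1 q.2) ∧
      (∀ p g t, φ (P.act p g) t = act (φ p t) g) ∧ ∀ p t, C p t (φ p t) := by
  choose τ hτ hτb hτp using K.exists_lift P
  have hdim : ∀ e v, K.dim (K.coP (τ e v)).1 ≤ K.dim e := fun e v => by
    rw [coP, hτp]; exact K.dim_co_c_le e v
  -- maps with the required properties over the cells of dimension less than `n`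
  let Inv : ℕ → (P.Total → T → B) → Prop := fun n φ =>
    (∀ p, K.dim (K.coP p).1 < n → (∀ g t, φ (P.act p g) t = act (φ p t) g) ∧
      ∀ t, C p t (φ p t)) ∧
    ∀ e, K.dim e < n → Continuous fun q : (Fin (K.dim e) → ℝ) × T => φ (τ e q.1) q.2
  have step : ∀ n φ, Inv n φ → ∃ φ', Inv (n + 1) φ' ∧
      ∀ p, K.dim (K.coP p).1 < n → φ' p = φ p := by
    rintro n φ ⟨h1, h2⟩
    have hψ : ∀ e, ∃ ψ' : (Fin (K.dim e) → ℝ) → T → B, K.dim e = n →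
        ContinuousOn (fun q : _ × T => ψ' q.1 q.2) (Metric.closedBall 0 1 ×ˢ univ) ∧
          (∀ v ∈ Metric.sphere 0 1, ∀ t, ψ' v t = φ (τ e v) t) ∧
          ∀ v ∈ Metric.ball 0 1, ∀ t, C (τ e v) t (ψ' v t) := by
      intro e
      by_cases hn : K.dim e = n
      swap
      · exact ⟨fun v => d (τ e v), fun h => (hn h).elim⟩
      have hlt : ∀ v ∈ Metric.sphere 0 1, K.dim (K.coP (τ e v)).1 < n := fun v hv => by
        rw [coP, hτp]; exact hn ▸ K.dim_co_c_lt e hv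
      suffices hc : ContinuousOn (fun q : (Fin (K.dim e) → ℝ) × T => φ (τ e q.1) q.2)
          (Metric.sphere 0 1 ×ˢ univ) by
        obtain ⟨ψ', hψ'⟩ := ext e (τ e) (hτ e) (hτp e) (fun v => φ (τ e v)) hc
          fun v hv t => (h1 _ (hlt v hv)).2 t
        exact ⟨ψ', fun _ => hψ'⟩
      -- the boundary is a finite union of closed subsets mapped to cells of lower dimension
      obtain ⟨J, hJ, hs⟩ := K.exists_finset e
      have hS : (Metric.sphere 0 1 : Set (Fin (K.dim e) → ℝ)) = ⋃ j : J,
          Metric.sphere 0 1 ∩ K.c e ⁻¹' range (K.c j) := by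
        ext v
        simp only [mem_iUnion, mem_inter_iff, exists_and_left]
        exact ⟨fun h => ⟨h, ⟨_, hs v h⟩, _, K.c_co _⟩, fun h => h.1⟩
      have hcl : ∀ j, IsClosed (range (K.c j)) := fun j => by
        have : range (K.c j) = K.c j '' Metric.closedBall 0 1 := by
          refine Subset.antisymm ?_ (image_subset_range _ _)
          rintro _ ⟨v, rfl⟩
          exact ⟨_, ballProj_mem v, K.c_ballProj j v⟩
        rw [this]
        exact ((isCompact_closedBall _ _).image (K.continuous_c j)).isClosed
      rw [hS, iUnion_prod_const]
      refine LocallyFinite.continuousOn_iUnion (locallyFinite_of_finite _) (fun j => ?_) fun j => ?_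
      · exact (Metric.isClosed_sphere.inter
          ((hcl j).preimage (K.continuous_c e))).prod isClosed_univ
      · refine K.continuousOn_of_cell hact (j := j) (fun p g t hp => ?_) (hτ j) (hτp j)
          (h2 j (hn ▸ hJ j j.2))
          ((isCompact_sphere _ _).inter_right ((hcl j).preimage (K.continuous_c e)))
          (hτ e).continuousOn fun v hv => (hτp e v).symm ▸ hv.2
        refine (h1 p ?_).1 g t
        obtain ⟨w, hw⟩ := hp
        rw [coP, ← hw]
        exact (K.dim_co_c_le j w).trans_lt (hn ▸ hJ j j.2)
    choose ψ' hψ' using hψ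
    classical
    -- the extension to the cell `q.1`
    let Φ : P.Total → T → (Σ e, Fin (K.dim e) → ℝ) → B := fun p t q =>
      act (ψ' q.1 q.2 t) (P.div (τ q.1 q.2) p)
    let φ' : P.Total → T → B := fun p t =>
      if K.dim (K.coP p).1 = n then Φ p t (K.coP p) else φ p t
    have hlow : ∀ p, K.dim (K.coP p).1 < n → φ' p = φ p := fun p hp =>
      funext fun t => if_neg hp.ne
    have hcell : ∀ e, K.dim e = n → ∀ v t, φ' (τ e v) t = ψ' e (ballProj v) t := by
      intro e hn v t
      rw [← hτb]
      rcases ballProj_mem_or v with hv | hv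
      · have hco : K.coP (τ e (ballProj v)) = ⟨e, ballProj v⟩ := by
          rw [coP, hτp, K.co_c e _ hv]
        have : φ' (τ e (ballProj v)) t = Φ (τ e (ballProj v)) t ⟨e, ballProj v⟩ := by
          refine (if_pos ?_).trans ?_ <;> rw [hco]
          exact hn
        rw [this]
        have h1 := P.div_act (τ e (ballProj v)) 1
        rw [P.act_one] at h1
        simp only [Φ, h1, act_one]
      · rw [hlow, (hψ' e hn).2.1 _ hv]
        rw [coP, hτp]
        exact hn ▸ K.dim_co_c_lt e hv
    refine ⟨φ', ⟨fun p hp => ?_, fun e he => ?_⟩, hlow⟩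
    · rcases (Nat.lt_succ_iff_lt_or_eq.1 hp) with hp | hp
      · have hg : ∀ g, φ' (P.act p g) = φ (P.act p g) := fun g => hlow _ <| by
          rwa [coP, P.proj_act]
        refine ⟨fun g t => ?_, fun t => ?_⟩
        · rw [hg, hlow p hp]
          exact (h1 p hp).1 g t
        · rw [hlow p hp]
          exact (h1 p hp).2 t
      · have hproj : P.proj (τ (K.coP p).1 (K.coP p).2) = P.proj p := (hτp _ _).trans (K.c_co _)
        have hp' : ∀ t, φ' p t = Φ p t (K.coP p) := fun t => if_pos hp
        refine ⟨fun g t => ?_, fun t => ?_⟩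
        · have hco : K.coP (P.act p g) = K.coP p := by rw [coP, P.proj_act]
          have : φ' (P.act p g) t = Φ (P.act p g) t (K.coP p) := by
            refine (if_pos ?_).trans ?_ <;> rw [hco]
            exact hp
          rw [this, hp', ← act_mul]
          refine congrArg (act _) ?_
          exact P.div_act_right hproj g
        · rw [hp']
          have := hC _ t _ (P.div (τ (K.coP p).1 (K.coP p).2) p)
            ((hψ' _ hp).2.2 _ (K.co_mem _) t)
          rwa [P.act_div _ _ hproj] at this
    · rcases (Nat.lt_succ_iff_lt_or_eq.1 he) with he | he
      · refine (h2 e he).congr fun q => ?_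
        rw [hlow _ ((hdim e q.1).trans_lt he)]
      · simp only [hcell e he]
        exact (hψ' e he).1.comp_continuous (f := fun q : (Fin (K.dim e) → ℝ) × T =>
          (ballProj q.1, q.2)) ((continuous_ballProj.comp continuous_fst).prodMk continuous_snd)
          fun q => ⟨ballProj_mem _, trivial⟩
  choose next hnext hnext' using step
  let seq : ∀ n, {φ // Inv n φ} := fun n => Nat.rec
    ⟨d, fun _ h => (Nat.not_lt_zero _ h).elim, fun _ h => (Nat.not_lt_zero _ h).elim⟩
    (fun n φ => ⟨next n φ.1 φ.2, hnext n φ.1 φ.2⟩) n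
  have hseq : ∀ m n, n ≤ m → ∀ p, K.dim (K.coP p).1 < n → (seq m).1 p = (seq n).1 p := by
    intro m n h
    induction m, h using Nat.le_induction with
    | base => exact fun _ _ => rfl
    | succ m hm ih => exact fun p hp => (hnext' m _ _ p (hp.trans_le hm)).trans (ih p hp)
  let φ : P.Total → T → B := fun p => (seq (K.dim (K.coP p).1 + 1)).1 p
  have hφ : ∀ n p, K.dim (K.coP p).1 < n → φ p = (seq n).1 p := fun n p hp =>
    (hseq n _ hp p (Nat.lt_succ_self _)).symm
  have hequi : ∀ p g t, φ (P.act p g) t = act (φ p t) g := fun p g t => by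
    rw [hφ (K.dim (K.coP p).1 + 1) (P.act p g)]
    · exact ((seq _).2.1 p (Nat.lt_succ_self _)).1 g t
    · rw [coP, P.proj_act]; exact Nat.lt_succ_self _
  refine ⟨φ, K.continuous_of_cells hact hequi hτ hτp fun e => ?_, hequi, fun p t =>
    ((seq _).2.1 p (Nat.lt_succ_self _)).2 t⟩
  refine ((seq (K.dim e + 1)).2.2 e (Nat.lt_succ_self _)).congr fun q => ?_
  rw [hφ _ _ ((hdim e q.1).trans_lt (Nat.lt_succ_self _))]

end Cells

end cells

/-! ### Retractions of bundles onto subcomplexes -/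

section retraction

variable {X : Type u} [TopologicalSpace X] {G : Type w} [Group G] [TopologicalSpace G]

/-- Invariant maps out of a principal bundle descend to the base. -/
theorem PrincipalBundle.exists_descend (P : PrincipalBundle G X) {T B : Type*} [TopologicalSpace T]
    [TopologicalSpace B] {f : P.Total → T → B} (hf : Continuous fun q : P.Total × T => f q.1 q.2)
    (h : ∀ p g, f (P.act p g) = f p) : ∃ k : C(X × T, B), ∀ p t, k (P.proj p, t) = f p t := by
  choose m hm using P.exists_mem_fiber
  have key : ∀ p q, P.proj p = P.proj q → f p = f q := fun p q hpq => by
    rw [← P.act_div _ _ hpq, h]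
  refine ⟨⟨fun q => f (m q.1) q.2, continuous_iff_continuousAt.2 ?_⟩,
    fun p t => congrFun (key _ _ (hm _)) t⟩
  rintro ⟨x, t⟩
  obtain ⟨U, hU, hxU, s, hs, hs'⟩ := P.exists_section x
  refine ContinuousOn.continuousAt (s := Prod.fst ⁻¹' U) ?_
    ((hU.preimage continuous_fst).mem_nhds hxU)
  refine (hf.comp_continuousOn ((hs.comp continuousOn_fst fun _ h => h).prodMk
    continuousOn_snd)).congr fun q hq => ?_
  exact congrFun (key _ _ ((hm _).trans (hs' _ hq).symm)) _

/-- A deformation of a pair `(X, Y)` covered by a deformation of the bundle `P`: a retraction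
`(ρ, τ)` of `X × I` onto `X × {0} ∪ Y × I` with a lift `R` of `ρ` to `P`. -/
structure Retraction (P : PrincipalBundle G X) (Y : Set X) where
  ρ : C(X × I, X)
  R : (P.prod I).Hom P ρ
  τ : C(X × I, I)
  R_zero : ∀ p, R.toFun ((P.slice 0).toFun p) = p
  R_mem : ∀ p t, P.proj p ∈ Y → R.toFun ((P.slice t).toFun p) = p
  τ_zero : ∀ x, τ (x, 0) = 0
  τ_mem : ∀ x ∈ Y, ∀ t, τ (x, t) = t
  ρ_mem : ∀ q, τ q ≠ 0 → ρ q ∈ Y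

theorem Retraction.ρ_zero {P : PrincipalBundle G X} {Y : Set X} (D : Retraction P Y) (x : X) :
    D.ρ (x, 0) = x := by
  obtain ⟨p, rfl⟩ := P.exists_mem_fiber x
  exact (D.R.proj_toFun ((P.slice 0).toFun p)).symm.trans (congrArg P.proj (D.R_zero p))

theorem Retraction.ρ_of_mem {P : PrincipalBundle G X} {Y : Set X} (D : Retraction P Y) {x : X}
    (h : x ∈ Y) (t : I) : D.ρ (x, t) = x := by
  obtain ⟨p, rfl⟩ := P.exists_mem_fiber x
  exact (D.R.proj_toFun ((P.slice t).toFun p)).symm.trans (congrArg P.proj (D.R_mem p t h))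

/-- A union of closed cells. -/
def Cells.IsSub (K : Cells X) (Y : Set X) : Prop :=
  ∀ e, ∀ v ∈ Metric.ball 0 1, K.c e v ∈ Y → ∀ w, K.c e w ∈ Y

/-- The homotopy extension property for bundles: the retraction of `X × I` onto `X × 0 ∪ Y × I` is
constructed cell by cell together with an equivariant map covering it. -/
theorem Cells.exists_retraction [T2Space X] (K : Cells X) (P : PrincipalBundle G X) {Y : Set X}
    (hY : K.IsSub Y) : Nonempty (Retraction P Y) := by
  let C : P.Total → I → P.Total × I → Prop := fun p t b =>
    (t = 0 → b = (p, 0)) ∧ (P.proj p ∈ Y → b = (p, t)) ∧ (b.2 ≠ 0 → P.proj b.1 ∈ Y)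
  have key := K.exists_extension (P := P) (T := I) (B := P.Total × I)
    (act := fun b g => (P.act b.1 g, b.2)) (((P.continuous_act.comp
      (.prodMk (continuous_fst.comp continuous_fst) continuous_snd))).prodMk
      (continuous_snd.comp continuous_fst)) (fun b => by simp only [P.act_one])
      (fun b g h => by simp only [P.act_mul]) C ?_ (fun p t => (p, t)) ?_
  · obtain ⟨φ, hφ, hφG, hC⟩ := key
    obtain ⟨ρ, hρ⟩ := P.exists_descend (f := fun p t => P.proj (φ p t).1)
      (P.continuous_proj.comp (continuous_fst.comp hφ)) fun p g => funext fun t => by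
        rw [hφG, P.proj_act]
    obtain ⟨τ, hτ⟩ := P.exists_descend (f := fun p t => (φ p t).2) (continuous_snd.comp hφ)
      fun p g => funext fun t => by rw [hφG]
    refine ⟨{
      ρ := ρ
      R := {
        toFun := fun q => (φ q.1.2 q.1.1.2).1
        continuous_toFun := (continuous_fst.comp hφ).comp
          (f := fun q : (P.prod I).Total => (q.1.2, q.1.1.2)) (by
            have : Continuous fun q : (P.prod I).Total => q.1 := continuous_subtype_val
            fun_prop)
        proj_toFun := fun q => (hρ _ _).symm.trans (congrArg (fun x => ρ (x, q.1.1.2)) q.2.symm)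
        map_act := fun q g => congrArg Prod.fst (hφG q.1.2 g q.1.1.2) }
      τ := τ
      R_zero := fun p => congrArg Prod.fst ((hC p 0).1 rfl)
      R_mem := fun p t h => congrArg Prod.fst ((hC p t).2.1 h)
      τ_zero := fun x => ?_
      τ_mem := fun x hx t => ?_
      ρ_mem := ?_ }⟩
    · obtain ⟨p, rfl⟩ := P.exists_mem_fiber x
      exact (hτ p 0).trans (congrArg Prod.snd ((hC p 0).1 rfl))
    · obtain ⟨p, rfl⟩ := P.exists_mem_fiber x
      exact (hτ p t).trans (congrArg Prod.snd ((hC p t).2.1 hx))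
    · rintro ⟨x, t⟩ h
      obtain ⟨p, rfl⟩ := P.exists_mem_fiber x
      rw [hτ] at h
      rw [hρ]
      exact (hC p t).2.2 h
  · rintro p t b g ⟨h1, h2, h3⟩
    refine ⟨fun h => by rw [h1 h], fun h => ?_, fun h => ?_⟩
    · rw [P.proj_act] at h
      rw [h2 h]
    · rw [P.proj_act]
      exact h3 h
  -- extension over one cell: trivial for the cells of `Y`
  · intro e s hs hs' ψ hψ hψC
    by_cases he : ∀ w, K.c e w ∈ Y
    · exact ⟨fun v t => (s v, t), (hs.comp continuous_fst).continuousOn.prodMk continuousOn_snd,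
        fun v hv t => ((hψC v hv t).2.1 (hs' v ▸ he v)).symm,
        fun v hv t => ⟨fun h => by rw [h], fun _ => rfl, fun _ => hs' v ▸ he v⟩⟩
    have he' : ∀ v ∈ Metric.ball 0 1, P.proj (s v) ∉ Y := fun v hv h =>
      he (hY e v hv (hs' v ▸ h))
    -- the retraction of the cylinder over the disk is the projection from the point `(0, 2)`
    let m : (Fin (K.dim e) → ℝ) → I → ℝ := fun v t => max ‖v‖ ((2 - t) / 2)
    have hm0 : ∀ v t, 0 < m v t := fun v t =>
      lt_max_of_lt_right (by have := t.2.2; linarith)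
    have hmc : Continuous fun q : (Fin (K.dim e) → ℝ) × I => m q.1 q.2 := by fun_prop
    let r : (Fin (K.dim e) → ℝ) → I → Fin (K.dim e) → ℝ := fun v t => (m v t)⁻¹ • v
    have hrc : Continuous fun q : (Fin (K.dim e) → ℝ) × I => r q.1 q.2 :=
      (hmc.inv₀ fun q => (hm0 _ _).ne').smul continuous_fst
    let r' : (Fin (K.dim e) → ℝ) → I → I := fun v t =>
      projIcc 0 1 zero_le_one (2 - (2 - t) / m v t)
    have hrc' : Continuous fun q : (Fin (K.dim e) → ℝ) × I => r' q.1 q.2 :=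
      continuous_projIcc.comp (continuous_const.sub
        ((continuous_const.sub (continuous_subtype_val.comp continuous_snd)).div hmc
          fun q => (hm0 _ _).ne'))
    have hsph : ∀ v (t : I), (2 - (t : ℝ)) / 2 ≤ ‖v‖ → r v t ∈ Metric.sphere 0 1 := fun v t h => by
      have hm : m v t = ‖v‖ := max_eq_left h
      have := hm0 v t
      rw [mem_sphere_zero_iff_norm, norm_smul, norm_inv, hm, norm_norm]
      exact inv_mul_cancel₀ (hm ▸ this.ne')
    have hr0 : ∀ v (t : I), ‖v‖ ≤ (2 - (t : ℝ)) / 2 → r' v t = 0 := fun v t h => by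
      have hm : m v t = (2 - t) / 2 := max_eq_right h
      refine projIcc_of_le_left _ ?_
      have h2 : (2 - (t : ℝ)) ≠ 0 := by have := t.2.2; linarith
      rw [hm]
      field_simp
      norm_num
    have hm1 : ∀ v t, ‖v‖ = 1 → r v t = v ∧ r' v t = t := fun v t h => by
      have hm : m v t = 1 := by
        refine (max_eq_left ?_).trans h
        have := t.2.1
        linarith
      refine ⟨by simp only [r, hm, inv_one, one_smul], ?_⟩
      simp only [r', hm, div_one, sub_sub_cancel, projIcc_val]
    classical
    let ψ' : (Fin (K.dim e) → ℝ) → I → P.Total × I := fun v t =>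
      if ‖v‖ ≤ (2 - (t : ℝ)) / 2 then (s (r v t), 0) else ψ (r v t) (r' v t)
    refine ⟨ψ', ?_, fun v hv t => ?_, fun v hv t => ⟨fun ht => ?_, fun h => (he' v hv h).elim, ?_⟩⟩
    · let A : Set ((Fin (K.dim e) → ℝ) × I) := {q | ‖q.1‖ ≤ (2 - (q.2 : ℝ)) / 2}
      let A' : Set ((Fin (K.dim e) → ℝ) × I) := {q | (2 - (q.2 : ℝ)) / 2 ≤ ‖q.1‖}
      have hA : IsClosed A := isClosed_le (by fun_prop) (by fun_prop)
      have hA' : IsClosed A' := isClosed_le (by fun_prop) (by fun_prop)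
      have hu : A ∪ A' = univ := eq_univ_of_forall fun q =>
        le_total ‖q.1‖ ((2 - (q.2 : ℝ)) / 2)
      refine ContinuousOn.mono ?_ (subset_univ _)
      rw [← hu]
      refine ContinuousOn.union_of_isClosed ?_ ?_ hA hA'
      · exact ((hs.comp hrc).prodMk continuous_const).continuousOn.congr fun q hq => if_pos hq
      · have h1 : ContinuousOn (fun q : (Fin (K.dim e) → ℝ) × I => ψ (r q.1 q.2) (r' q.1 q.2)) A' :=
          hψ.comp (f := fun q : (Fin (K.dim e) → ℝ) × I => (r q.1 q.2, r' q.1 q.2))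
            (hrc.prodMk hrc').continuousOn fun q hq => ⟨hsph _ _ hq, trivial⟩
        refine h1.congr fun q hq => ?_
        dsimp only [ψ']
        split_ifs with h
        · rw [hr0 _ _ h]
          exact ((hψC _ (hsph _ _ hq) 0).1 rfl).symm
        · rfl
    · have hv1 := mem_sphere_zero_iff_norm.1 hv
      obtain ⟨h1, h2⟩ := hm1 v t hv1
      dsimp only [ψ']
      split_ifs with h
      · have ht : t = 0 := Subtype.ext (le_antisymm (by
          rw [hv1] at h; simpa using (by linarith : (t : ℝ) ≤ 0)) t.2.1)
        rw [h1, ht]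
        exact ((hψC _ hv 0).1 rfl).symm
      · rw [h1, h2]
    · have hv1 := mem_ball_zero_iff.1 hv
      subst ht
      have h : ‖v‖ ≤ (2 - ((0 : I) : ℝ)) / 2 := by simpa using hv1.le
      have hm : m v 0 = 1 := (max_eq_right h).trans (by simp)
      simp only [ψ', if_pos h, r, hm, inv_one, one_smul]
    · dsimp only [ψ']
      split_ifs with h
      · exact fun h => (h rfl).elim
      · exact (hψC _ (hsph _ _ (not_le.1 h).le) _).2.2

end retraction

/-! ### Existence of covers with sections and lifts -/

section existence

open Topology.RelCWComplex in
theorem Cells.isSub_ofCW {Z : Type u} [TopologicalSpace Z] [T2Space Z] {X : Set Z}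
    [Topology.CWComplex X] (Y : Topology.CWComplex.Subcomplex X) :
    (Cells.ofCW X).IsSub {x | (x : Z) ∈ Y} := by
  rintro ⟨n, i⟩ v hv h w
  have h1 : map n i v ∈ openCell n i := mem_image_of_mem _ hv
  have h2 : map n i v ∈ Y := by
    rw [← ballProj_of_mem (Metric.ball_subset_closedBall hv)]
    exact h
  exact Subcomplex.closedCell_subset_of_mem Y ((mem_subcomplex_iff Y h1).1 h2)
    (mem_image_of_mem _ (ballProj_mem w))

/-- Points of an infinite join of copies of `G` indexed by `C`: weights `t` and coordinates `g`,
where `g e` only matters if `t e > 0`. -/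
structure Join (C : Type*) (G : Type*) where
  t : lp (fun _ : C => ℝ) ⊤
  g : C → G

namespace Join

variable {C G : Type*} [TopologicalSpace G]

/-- The topology making `g e` continuous on the set `t e > 0`. -/
abbrev coordTop : TopologicalSpace (Join C G) :=
  .generateFrom {S | ∃ (e : C) (W : Set G), IsOpen W ∧ S = {b | 0 < b.t e ∧ b.g e ∈ W}}

/-- The coarsest topology for which `t`, and `g e` on the set `t e > 0`, are continuous. -/
instance : TopologicalSpace (Join C G) :=
  .induced t inferInstance ⊓ coordTop

variable {A : Type*} [TopologicalSpace A] {f : A → Join C G}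

theorem continuous_t : Continuous (t : Join C G → lp (fun _ : C => ℝ) ⊤) :=
  continuous_inf_dom_left (t₁ := .induced t inferInstance) (t₂ := coordTop) continuous_induced_dom

theorem continuous_t_apply (e : C) : Continuous fun t : lp (fun _ : C => ℝ) ⊤ => t e := by
  refine LipschitzWith.continuous (K := 1) (.of_dist_le_mul fun a b => ?_)
  rw [NNReal.coe_one, one_mul, dist_eq_norm, dist_eq_norm]
  exact lp.norm_apply_le_norm ENNReal.top_ne_zero (a - b) e

/-- A map to the join is continuous if and only if its coordinates are continuous where they are
defined. -/
theorem continuous_iff : Continuous f ↔ Continuous (fun a => (f a).t) ∧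
    ∀ e, ContinuousOn (fun a => (f a).g e) {a | 0 < (f a).t e} := by
  have ho : Continuous (fun a => (f a).t) → ∀ e, IsOpen {a | 0 < (f a).t e} := fun h e =>
    isOpen_lt continuous_const ((continuous_t_apply e).comp h)
  constructor
  · intro h
    refine ⟨continuous_t.comp h, fun e => (continuousOn_open_iff (ho (continuous_t.comp h) e)).2
      fun W hW => ?_⟩
    have h2 := (continuous_inf_rng (t₂ := .induced t inferInstance) (t₃ := coordTop)).1 h
    exact continuous_generateFrom_iff.1 h2.2 _ ⟨e, W, hW, rfl⟩
  · rintro ⟨h, h'⟩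
    refine (continuous_inf_rng (t₂ := .induced t inferInstance) (t₃ := coordTop)).2
      ⟨continuous_induced_rng.2 h, continuous_generateFrom_iff.2 ?_⟩
    rintro _ ⟨e, W, hW, rfl⟩
    exact (continuousOn_open_iff (ho h e)).1 (h' e) W hW

theorem continuousOn_iff {S : Set A} : ContinuousOn f S ↔ ContinuousOn (fun a => (f a).t) S ∧
    ∀ e, ContinuousOn (fun a => (f a).g e) (S ∩ {a | 0 < (f a).t e}) := by
  rw [continuousOn_iff_continuous_domRestrict, continuous_iff,
    continuousOn_iff_continuous_domRestrict]
  refine and_congr Iff.rfl (forall_congr' fun e => ?_)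
  rw [continuousOn_iff_continuous_domRestrict, continuousOn_iff_continuous_domRestrict]
  constructor
  · intro h
    exact h.comp (f := fun a : ↥(S ∩ {a | 0 < (f a).t e}) =>
      (⟨⟨a.1, a.2.1⟩, a.2.2⟩ : {a : S | 0 < (f a).t e})) (by fun_prop)
  · intro h
    exact h.comp (f := fun a : {a : S | 0 < (f a).t e} =>
      (⟨a.1.1, a.1.2, a.2⟩ : ↥(S ∩ {a | 0 < (f a).t e}))) (by fun_prop)

variable [Group G]

/-- The action of `G` on the join. -/
def act (b : Join C G) (h : G) : Join C G := ⟨b.t, fun e => b.g e * h⟩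

theorem continuous_act [ContinuousMul G] :
    Continuous fun q : Join C G × G => q.1.act q.2 := by
  refine continuous_iff.2 ⟨show Continuous fun q : Join C G × G => q.1.t from
    continuous_t.comp continuous_fst, fun e => ?_⟩
  exact (((continuous_iff (f := fun q : Join C G × G => q.1)).1 continuous_fst).2 e).mul
    continuous_snd.continuousOn

end Join

namespace Cells

variable {X : Type u} [TopologicalSpace X] {G : Type w} [Group G] [TopologicalSpace G]

open Classical in
/-- A principal bundle over a CW complex maps to the infinite join of copies of the structure group
indexed by the cells. On every cell the weight of the cell itself is `1 - ‖v‖` and the other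
coordinates are extended radially from the boundary. -/
theorem exists_map_join [ContinuousMul G] [T2Space X] (K : Cells X) (P : PrincipalBundle G X) :
    ∃ φ : P.Total → Join K.C G, Continuous φ ∧ (∀ p g, φ (P.act p g) = (φ p).act g) ∧
      ∀ p, (∃ e, 0 < (φ p).t e) ∧ {e | 0 < (φ p).t e}.Finite := by
  let S : P.Total → Unit → Join K.C G → Prop := fun p _ b => (∀ e, 0 ≤ b.t e) ∧ ‖b.t‖ ≤ 1 ∧
    {e | 0 < b.t e}.Finite ∧ (∃ e, 0 < b.t e) ∧ ∀ e, 0 < b.t e → K.dim e ≤ K.dim (K.coP p).1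
  have key := K.exists_extension (P := P) (T := Unit) (B := Join K.C G) (act := Join.act)
    Join.continuous_act (fun b => by simp only [Join.act, mul_one])
    (fun b g h => by simp only [Join.act, mul_assoc]) S ?_ (fun _ _ => ⟨0, fun _ => 1⟩) ?_
  · obtain ⟨φ, hφ, hG, hS⟩ := key
    exact ⟨fun p => φ p (), hφ.comp (f := fun p => (p, ())) (by fun_prop), fun p g => hG p g (),
      fun p => ⟨(hS p ()).2.2.2.1, (hS p ()).2.2.1⟩⟩
  · rintro p t b g ⟨h1, h2, h3, h4, h5⟩
    refine ⟨h1, h2, h3, h4, ?_⟩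
    rwa [coP, P.proj_act]
  · intro e s hs hs' ψ hψ hψS
    -- the radial extension of the weights
    let r : (Fin (K.dim e) → ℝ) → Fin (K.dim e) → ℝ := fun v => ‖v‖⁻¹ • v
    have hr : ∀ v, v ≠ 0 → r v ∈ Metric.sphere 0 1 := fun v hv => by
      rw [mem_sphere_zero_iff_norm, norm_smul, norm_inv, norm_norm]
      exact inv_mul_cancel₀ (norm_ne_zero_iff.2 hv)
    have hr1 : ∀ v, v ∈ Metric.sphere 0 1 → r v = v := fun v hv => by
      simp only [r, mem_sphere_zero_iff_norm.1 hv, inv_one, one_smul]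
    have hrq : ContinuousOn (fun q : (Fin (K.dim e) → ℝ) × Unit => r q.1) {q | q.1 ≠ 0} :=
      (continuous_norm.comp continuous_fst).continuousOn.inv₀
        (fun q hq => norm_ne_zero_iff.2 hq) |>.smul continuousOn_fst
    let l : (Fin (K.dim e) → ℝ) → Unit → lp (fun _ : K.C => ℝ) ⊤ := fun v t => ‖v‖ • (ψ (r v) t).t
    have hl : ∀ v t, (∀ i, 0 ≤ l v t i) ∧ ‖l v t‖ ≤ ‖v‖ ∧
        ∀ i, 0 < l v t i → v ≠ 0 ∧ 0 < (ψ (r v) t).t i := fun v t => by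
      rcases eq_or_ne v 0 with rfl | hv
      · have : l 0 t = 0 := by simp only [l, norm_zero, zero_smul]
        rw [this]
        exact ⟨fun i => le_rfl, by simp, fun i h => (lt_irrefl _ h).elim⟩
      · have h := hψS _ (hr v hv) t
        refine ⟨fun i => mul_nonneg (norm_nonneg v) (h.1 i), ?_, fun i hi => ⟨hv, ?_⟩⟩
        · rw [norm_smul, norm_norm]
          exact mul_le_of_le_one_right (norm_nonneg v) h.2.1
        · exact pos_of_mul_pos_right hi (norm_nonneg v)
    let ψ' : (Fin (K.dim e) → ℝ) → Unit → Join K.C G := fun v t =>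
      if ‖v‖ = 1 then ψ v t else
        ⟨(1 - ‖v‖) • lp.single ⊤ e 1 + l v t, Function.update (ψ (r v) t).g e 1⟩
    have ht : ∀ v t, (ψ' v t).t = (1 - ‖v‖) • lp.single ⊤ e 1 + l v t := fun v t => by
      dsimp only [ψ']
      split_ifs with h
      · simp only [l, hr1 v (mem_sphere_zero_iff_norm.2 h), h, sub_self, zero_smul, one_smul,
          zero_add]
      · rfl
    have hte : ∀ v t i, (ψ' v t).t i = (if i = e then 1 - ‖v‖ else 0) + l v t i := fun v t i => by
      rw [ht]
      change (1 - ‖v‖) * (lp.single ⊤ e (1 : ℝ) : lp (fun _ : K.C => ℝ) ⊤) i + l v t i = _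
      rw [lp.single_apply, Pi.single_apply]
      split_ifs <;> simp
    have hle : ∀ v t, l v t e = 0 := fun v t => by
      refine le_antisymm (not_lt.1 fun h => ?_) ((hl v t).1 e)
      obtain ⟨hv, h⟩ := (hl v t).2.2 e h
      have h2 := (hψS _ (hr v hv) t).2.2.2.2 e h
      rw [coP, hs'] at h2
      exact (K.dim_co_c_lt e (hr v hv)).not_ge h2
    refine ⟨ψ', Join.continuousOn_iff.2 ⟨?_, fun i => ?_⟩, fun v hv t =>
      if_pos (mem_sphere_zero_iff_norm.1 hv), fun v hv t => ?_⟩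
    · simp only [ht]
      have hl0 : Continuous fun q : (Fin (K.dim e) → ℝ) × Unit => l q.1 q.2 := by
        refine continuous_iff_continuousAt.2 ?_
        rintro ⟨v, t⟩
        rcases eq_or_ne v 0 with rfl | hv
        · have h0 : l 0 t = 0 := norm_le_zero_iff.1 (by simpa using (hl 0 t).2.1)
          change Filter.Tendsto _ _ (𝓝 (l 0 t))
          rw [h0]
          refine squeeze_zero_norm (fun q => (hl q.1 q.2).2.1) ?_
          exact (by fun_prop : Continuous fun q : (Fin (K.dim e) → ℝ) × Unit => ‖q.1‖).tendsto' _ _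
            (by simp)
        · have ho : IsOpen {q : (Fin (K.dim e) → ℝ) × Unit | q.1 ≠ 0} :=
            isOpen_ne.preimage continuous_fst
          refine ContinuousOn.continuousAt ?_ (ho.mem_nhds hv)
          exact (by fun_prop : Continuous fun q : (Fin (K.dim e) → ℝ) × Unit =>
            ‖q.1‖).continuousOn.smul (Join.continuous_t.comp_continuousOn (hψ.comp (hrq.prodMk
              continuousOn_snd) fun q hq => ⟨hr _ hq, trivial⟩))
      exact (((by fun_prop : Continuous fun q : (Fin (K.dim e) → ℝ) × Unit =>
        1 - ‖q.1‖).smul continuous_const).add hl0).continuousOn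
    · by_cases hi : i = e
      · subst hi
        refine (continuousOn_const (c := (1 : G))).congr fun q hq => ?_
        have hq : 0 < (ψ' q.1 q.2).t i := hq.2
        rw [hte, if_pos rfl, hle, add_zero] at hq
        have h1 : ‖q.1‖ ≠ 1 := fun h => by rw [h, sub_self] at hq; exact lt_irrefl _ hq
        simp only [ψ', if_neg h1, Function.update_self]
      · have hq : ∀ q ∈ (Metric.closedBall 0 1 ×ˢ univ ∩ {q : (Fin (K.dim e) → ℝ) × Unit |
            0 < (ψ' q.1 q.2).t i}), q.1 ≠ 0 ∧ 0 < (ψ (r q.1) q.2).t i := fun q hq => by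
          have hq : 0 < (ψ' q.1 q.2).t i := hq.2
          rw [hte, if_neg hi, zero_add] at hq
          exact (hl _ _).2.2 i hq
        refine ((Join.continuousOn_iff.1 hψ).2 i |>.comp (f := fun q : (Fin (K.dim e) → ℝ) × Unit =>
          (r q.1, q.2)) ((hrq.mono fun q h => (hq q h).1).prodMk continuousOn_snd)
          fun q h => ⟨⟨hr _ (hq q h).1, trivial⟩, (hq q h).2⟩).congr fun q h => ?_
        dsimp only [ψ']
        split_ifs with h1
        · exact (congrArg (fun v => (ψ v q.2).g i) (hr1 _ (mem_sphere_zero_iff_norm.2 h1))).symm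
        · exact Function.update_of_ne hi _ _
    · have hv1 := mem_ball_zero_iff.1 hv
      have hv0 : 0 < 1 - ‖v‖ := sub_pos.2 hv1
      have hpos : ∀ i, 0 < (ψ' v t).t i → i = e ∨ 0 < l v t i := fun i hi => by
        rw [hte] at hi
        split_ifs at hi with h
        · exact .inl h
        · rw [zero_add] at hi
          exact .inr hi
      refine ⟨fun i => ?_, ?_, ?_, ⟨e, ?_⟩, fun i hi => ?_⟩
      · rw [hte]
        refine add_nonneg ?_ ((hl v t).1 i)
        split_ifs
        exacts [hv0.le, le_rfl]
      · rw [ht]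
        refine (norm_add_le _ _).trans ?_
        rw [norm_smul, lp.norm_single (by simp), Real.norm_of_nonneg hv0.le, norm_one]
        linarith [(hl v t).2.1]
      · by_cases hv' : v = 0
        · exact (finite_singleton e).subset fun i hi => (hpos i hi).resolve_right
            fun h => ((hl v t).2.2 i h).1 hv'
        · refine ((hψS _ (hr v hv') t).2.2.1.insert e).subset fun i hi => (hpos i hi).imp id
            fun h => ((hl v t).2.2 i h).2
      · rw [hte, if_pos rfl, hle, add_zero]
        exact hv0
      · have hd : K.dim (K.coP (s v)).1 = K.dim e := by rw [coP, hs', K.co_c e v hv]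
        rw [hd]
        rcases hpos i hi with rfl | h
        · exact le_rfl
        · obtain ⟨h1, h2⟩ := (hl v t).2.2 i h
          refine ((hψS _ (hr v h1) t).2.2.2.2 i h2).trans ?_
          rw [coP, hs']
          exact K.dim_co_c_le e _

end Cells

variable {X : Type u} [TopologicalSpace X] {H : Type w} [NormedAddCommGroup H]
  [InnerProductSpace ℂ H]

theorem PrincipalBundle.continuousOn_of_comp_proj {G : Type w} [Group G] [TopologicalSpace G]
    (P : PrincipalBundle G X) {B : Type*} [TopologicalSpace B] {f : X → B} {F : P.Total → B}
    {W : Set X} (hW : IsOpen W) (hF : ContinuousOn F (P.proj ⁻¹' W))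
    (hfF : ∀ p, f (P.proj p) = F p) : ContinuousOn f W := by
  intro x hx
  obtain ⟨U, hU, hxU, s, hs, hs'⟩ := P.exists_section x
  refine ContinuousAt.continuousWithinAt (ContinuousOn.continuousAt (s := U ∩ W) ?_
    ((hU.inter hW).mem_nhds ⟨hxU, hx⟩))
  refine (hF.comp (hs.mono inter_subset_left) fun y hy => ?_).congr fun y hy => ?_
  · exact (congrArg (· ∈ W) (hs' y hy.1)).mpr hy.2
  · exact (congrArg f (hs' y hy.1)).symm.trans (hfF _)

/-- A principal bundle over a CW complex has a cover with local sections and lifts of all transition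
functions: the set around `x` is so small that the transition functions between the sections with
positive weight at `x` lift to `U(H)`, and that the weights differ from those at `x` by less than a
quarter of the greatest weight at `x`; the section is the one with the greatest weight at `x`. Then
for two such sets which meet, the section belonging to the smaller greatest weight and the other
one have positive weight at the point with the smaller greatest weight. -/
theorem Cells.nonempty_twistData [Nontrivial H] [T2Space X] (K : Cells X)
    (P : PrincipalBundle (PU H) X) : Nonempty (TwistData P) := by
  obtain ⟨φ, hφ, hG, hpos⟩ := K.exists_map_join P
  have hcoord := Join.continuous_iff.1 hφ
  choose m hm using P.exists_mem_fiber
  have hdiff : ∀ p q, P.proj p = P.proj q → φ q = (φ p).act (P.div p q) := fun p q h => by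
    rw [← hG, P.act_div _ _ h]
  -- the weights and the local sections
  let t : X → lp (fun _ : K.C => ℝ) ⊤ := fun x => (φ (m x)).t
  have htp : ∀ p, t (P.proj p) = (φ p).t := fun p =>
    (congrArg Join.t (hdiff _ _ (hm (P.proj p)))).symm
  have ht : Continuous t := by
    obtain ⟨k, hk⟩ := P.exists_descend (T := Unit) (f := fun p _ => (φ p).t)
      (hcoord.1.comp continuous_fst) fun p g => by rw [hG]; rfl
    refine (k.continuous.comp (f := fun x => (x, ())) (by fun_prop)).congr fun x => ?_
    have := hk (m x) ()
    rw [hm] at this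
    exact this
  let O : K.C → Set X := fun e => {x | 0 < t x e}
  have hO : ∀ e, IsOpen (O e) := fun e =>
    isOpen_lt continuous_const ((Join.continuous_t_apply e).comp ht)
  let s : K.C → X → P.Total := fun e x => P.act (m x) ((φ (m x)).g e)⁻¹
  let k : K.C → K.C → X → PU H := fun e e' x => (φ (m x)).g e * ((φ (m x)).g e')⁻¹
  -- in these formulas `m x` may be replaced by any other point of the fibre
  have hs : ∀ e p, s e (P.proj p) = P.act p ((φ p).g e)⁻¹ := fun e p => by
    have h := hdiff _ _ (hm (P.proj p))
    have h2 := P.act_div _ _ (hm (P.proj p))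
    generalize P.div (m (P.proj p)) p = g at h h2
    rw [h, ← h2, ← P.act_mul]
    change _ = P.act _ (_ * (_ * _)⁻¹)
    rw [mul_inv_rev, mul_inv_cancel_left]
    simp only [s, h2]
  have hk : ∀ e e' p, k e e' (P.proj p) = (φ p).g e * ((φ p).g e')⁻¹ := fun e e' p => by
    rw [hdiff _ _ (hm (P.proj p))]
    change _ = (_ * _) * (_ * _)⁻¹
    rw [mul_inv_rev, mul_assoc, mul_inv_cancel_left]
  have hsp : ∀ e x, P.proj (s e x) = x := fun e x => (P.proj_act _ _).trans (hm x)
  have hsk : ∀ e e' x, P.act (s e x) (k e e' x) = s e' x := fun e e' x => by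
    simp only [s, k, ← P.act_mul, inv_mul_cancel_left]
  have hOp : ∀ e, P.proj ⁻¹' O e = {p | 0 < (φ p).t e} := fun e => by
    ext p
    simp only [O, mem_preimage, mem_ofPred_eq, htp]
  have hsc : ∀ e, ContinuousOn (s e) (O e) := fun e => by
    refine P.continuousOn_of_comp_proj (hO e) ?_ (hs e)
    rw [hOp]
    exact P.continuous_act.comp_continuousOn (continuousOn_id.prodMk (hcoord.2 e).inv)
  have hkc : ∀ e e', ContinuousOn (k e e') (O e ∩ O e') := fun e e' => by
    refine P.continuousOn_of_comp_proj ((hO e).inter (hO e')) ?_ (hk e e')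
    rw [preimage_inter, hOp, hOp]
    exact ((hcoord.2 e).mono inter_subset_left).mul ((hcoord.2 e').mono inter_subset_right).inv
  have hmax : ∀ x, ∃ e, 0 < t x e ∧ ∀ e', t x e' ≤ t x e := fun x => by
    obtain ⟨⟨e₀, he₀⟩, hfin⟩ := hpos (m x)
    obtain ⟨e, he, hle⟩ := hfin.exists_maximalFor (fun e => t x e) _ ⟨e₀, he₀⟩
    refine ⟨e, he, fun e' => ?_⟩
    by_cases h : 0 < t x e'
    · exact le_of_not_gt fun h' => h'.not_ge (hle h h'.le)
    · exact (not_lt.1 h).trans (le_of_lt he)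
  choose e he hle using hmax
  have hV : ∀ x, ∃ V, IsOpen V ∧ x ∈ V ∧ (∀ y ∈ V, ‖t y - t x‖ < t x (e x) / 4) ∧
      ∀ i, 0 < t x i → ∀ j, 0 < t x j → V ⊆ O i ∩ O j ∧ ∃ h : X → UGroup H, ContinuousOn h V ∧
        ∀ y ∈ V, toPU H (h y) = k i j y := fun x => by
    have hN : ∀ i j, ∃ N, 0 < t x i → 0 < t x j → IsOpen N ∧ x ∈ N ∧ N ⊆ O i ∩ O j ∧
        ∃ h : X → UGroup H, ContinuousOn h N ∧ ∀ y ∈ N, toPU H (h y) = k i j y := fun i j => by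
      obtain ⟨W, hW, hxW, l, hl, hl'⟩ := exists_local_section (k i j x)
      refine ⟨(O i ∩ O j) ∩ k i j ⁻¹' W, fun hi hj => ⟨(hkc i j).isOpen_inter_preimage
        ((hO i).inter (hO j)) hW, ⟨⟨hi, hj⟩, hxW⟩, inter_subset_left, fun y => l (k i j y), ?_,
        fun y hy => hl' _ hy.2⟩⟩
      exact hl.comp ((hkc i j).mono inter_subset_left) fun y hy => hy.2
    choose N hN using hN
    have hfin : {i | 0 < t x i}.Finite := (hpos (m x)).2
    refine ⟨{y | ‖t y - t x‖ < t x (e x) / 4} ∩ ⋂ i ∈ {i | 0 < t x i}, ⋂ j ∈ {i | 0 < t x i},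
      N i j, (isOpen_lt (by fun_prop) continuous_const).inter (hfin.isOpen_biInter fun i hi =>
        hfin.isOpen_biInter fun j hj => (hN i j hi hj).1), ⟨?_, ?_⟩, fun y hy => hy.1,
        fun i hi j hj => ?_⟩
    · simpa using he x
    · exact mem_iInter₂.2 fun i hi => mem_iInter₂.2 fun j hj => (hN i j hi hj).2.1
    · obtain ⟨-, -, h1, h, h2, h3⟩ := hN i j hi hj
      have hsub : {y | ‖t y - t x‖ < t x (e x) / 4} ∩ ⋂ i ∈ {i | 0 < t x i},
          ⋂ j ∈ {i | 0 < t x i}, N i j ⊆ N i j := fun y hy =>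
        mem_iInter₂.1 (mem_iInter₂.1 hy.2 i hi) j hj
      exact ⟨hsub.trans h1, h, h2.mono hsub, fun y hy => h3 y (hsub hy)⟩
  choose V hVo hxV hVt hVl using hV
  have hpair : ∀ x x', (V x ∩ V x').Nonempty → t x (e x) ≤ t x' (e x') → 0 < t x (e x') := by
    rintro x x' ⟨y, hy, hy'⟩ h
    have h1 := (abs_lt.1 ((lp.norm_apply_le_norm ENNReal.top_ne_zero (t y - t x) (e x')).trans_lt
      (hVt x y hy))).2
    have h2 := (abs_lt.1 ((lp.norm_apply_le_norm ENNReal.top_ne_zero (t y - t x') (e x')).trans_lt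
      (hVt x' y hy'))).1
    have h3 : (t y - t x) (e x') = t y (e x') - t x (e x') := rfl
    have h4 : (t y - t x') (e x') = t y (e x') - t x' (e x') := rfl
    have h5 := he x'
    rw [h3] at h1
    rw [h4] at h2
    linarith
  have hg : ∀ x x', ∃ h : X → UGroup H, ContinuousOn h (V x ∩ V x') ∧
      ∀ y ∈ V x ∩ V x', toPU H (h y) = k (e x) (e x') y := fun x x' => by
    rcases (V x ∩ V x').eq_empty_or_nonempty with h0 | hne
    · rw [h0]
      exact ⟨fun _ => 1, continuousOn_empty _, by simp⟩
    rcases le_total (t x (e x)) (t x' (e x')) with h | h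
    · obtain ⟨-, l, h1, h2⟩ := hVl x (e x) (he x) (e x') (hpair x x' hne h)
      exact ⟨l, h1.mono inter_subset_left, fun y hy => h2 y hy.1⟩
    · obtain ⟨-, l, h1, h2⟩ := hVl x' (e x) (hpair x' x (inter_comm _ _ ▸ hne) h) (e x') (he x')
      exact ⟨l, h1.mono inter_subset_right, fun y hy => h2 y hy.2⟩
  choose g hg hg' using hg
  exact ⟨{
    ι := X
    U := V
    isOpen_U := hVo
    iUnion_U := eq_univ_of_forall fun x => mem_iUnion.2 ⟨x, hxV x⟩
    s := fun x => s (e x)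
    continuousOn_s := fun x => (hsc _).mono fun y hy => ((hVl x _ (he x) _ (he x)).1 hy).1
    proj_s := fun x y _ => hsp _ y
    g := g
    continuousOn_g := hg
    act_g := fun x x' y hy => by rw [hg' x x' y hy, hsk] }⟩

end existence

/-! ### Null-concordances -/

section preimage

variable {X : Type u} [TopologicalSpace X] {X' : Type u} [TopologicalSpace X']
  {B : Type u} [TopologicalSpace B] {G : Type w} [Group G] [TopologicalSpace G]
  {P : PrincipalBundle G X} {P' : PrincipalBundle G X'} {Q : PrincipalBundle G B} {f : C(X', X)}
  {g : C(B, X)} {O : Set B} {Y : Set X}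

/-- The lift of a bundle map `K : Q → P` along a bundle map `F : P' → P` covering an embedding, over
an open set which `K` maps to the image of `F`. -/
def PMap.liftOn [Nonempty X'] (F : P'.Hom P f) (hf : IsEmbedding f) (K : Q.Hom P g)
    (hO : IsOpen O) (hr : ∀ x ∈ O, g x ∈ range f) : PMap Q P' where
  f := Function.invFun f ∘ g
  O := O
  isOpen_O := hO
  continuousOn_f := hf.isInducing.continuousOn_iff.2
    (g.continuous.continuousOn.congr fun x hx => Function.invFun_eq (hr x hx))
  F := PMap.invFun F ∘ K.toFun
  continuousOn_F := by
    have hg : ContinuousOn (fun p : Q.Total => Function.invFun f (P.proj (K.toFun p)))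
        (Q.proj ⁻¹' O) := hf.isInducing.continuousOn_iff.2
      ((P.continuous_proj.comp K.continuous_toFun).continuousOn.congr fun p hp =>
        Function.invFun_eq (by rw [K.proj_toFun]; exact hr _ hp))
    intro p hp
    obtain ⟨V, hV, hxV, τ, hτ, hτp⟩ :=
      P'.exists_section (Function.invFun f (P.proj (K.toFun p)))
    have ho := hg.isOpen_inter_preimage (hO.preimage Q.continuous_proj) hV
    have hs : ContinuousOn (fun p => τ (Function.invFun f (P.proj (K.toFun p)))) (Q.proj ⁻¹' O ∩
        (fun p : Q.Total => Function.invFun f (P.proj (K.toFun p))) ⁻¹' V) :=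
      hτ.comp (hg.mono inter_subset_left) fun x hx => hx.2
    have hd : ∀ p ∈ Q.proj ⁻¹' O ∩
        (fun p : Q.Total => Function.invFun f (P.proj (K.toFun p))) ⁻¹' V,
        P.proj (F.toFun (τ (Function.invFun f (P.proj (K.toFun p))))) = P.proj (K.toFun p) :=
      fun p hp => by
        rw [F.proj_toFun, hτp _ hp.2]
        exact Function.invFun_eq (by rw [K.proj_toFun]; exact hr _ hp.1)
    have key : ContinuousOn (PMap.invFun F ∘ K.toFun) (Q.proj ⁻¹' O ∩
        (fun p : Q.Total => Function.invFun f (P.proj (K.toFun p))) ⁻¹' V) := by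
      refine (P'.continuous_act.comp_continuousOn (hs.prodMk (P.continuousOn_div.comp
        ((F.continuous_toFun.comp_continuousOn hs).prodMk K.continuous_toFun.continuousOn)
        hd))).congr fun p hp => ?_
      refine PMap.invFun_eq F hf ?_
      change F.toFun (P'.act _ _) = K.toFun p
      rw [F.map_act]
      exact P.act_div _ _ (hd p hp)
    exact (key.continuousAt (ho.mem_nhds ⟨hp, hxV⟩)).continuousWithinAt
  proj_F p _ := by
    refine (PMap.proj_invFun F _).trans ?_
    rw [K.proj_toFun]; rfl
  F_act p hp a := PMap.invFun_eq F hf (by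
    rw [F.map_act, K.map_act, Function.comp_apply, PMap.toFun_invFun F]
    rw [K.proj_toFun]; exact hr _ hp)

/-- A partial bundle map together with a function to `K`. -/
def PMap.toProd {K : Type} [TopologicalSpace K] (F : PMap Q P) (k : C(B, K)) :
    PMap Q (P.prod K) where
  f x := (F.f x, k x)
  O := F.O
  isOpen_O := F.isOpen_O
  continuousOn_f := F.continuousOn_f.prodMk k.continuous.continuousOn
  F p := ⟨((P.proj (F.F p), k (Q.proj p)), F.F p), rfl⟩
  continuousOn_F := by
    refine continuousOn_iff_continuous_domRestrict.2 (Continuous.subtype_mk ?_ _)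
    have h := continuousOn_iff_continuous_domRestrict.1 F.continuousOn_F
    exact ((P.continuous_proj.comp h).prodMk
      (k.continuous.comp (Q.continuous_proj.comp continuous_subtype_val))).prodMk h
  proj_F p hp := Prod.ext (F.proj_F p hp) rfl
  F_act p hp a := Subtype.ext (Prod.ext (Prod.ext
    ((congrArg P.proj (F.F_act p hp a)).trans (P.proj_act _ _)) (congrArg k (Q.proj_act p a)))
    (F.F_act p hp a))

/-- The product of a retraction with a space. -/
def Retraction.prod (D : Retraction P Y) (K : Type) [TopologicalSpace K] :
    Retraction (P.prod K) (Y ×ˢ (univ : Set K)) where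
  ρ := _
  R := (D.R.comp ((P.prodProj K).prodMap I)).toProd
    ⟨fun q => q.1.2, by fun_prop⟩
  τ := D.τ.comp ⟨fun q => (q.1.1, q.2), by fun_prop⟩
  R_zero p := by
    obtain ⟨⟨⟨x, k⟩, p⟩, rfl : x = P.proj p⟩ := p
    exact Subtype.ext (Prod.ext (Prod.ext (D.ρ_zero _) rfl) (D.R_zero p))
  R_mem p t hp := by
    obtain ⟨⟨⟨x, k⟩, p⟩, rfl : x = P.proj p⟩ := p
    exact Subtype.ext (Prod.ext (Prod.ext (D.ρ_of_mem hp.1 _) rfl) (D.R_mem p t hp.1))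
  τ_zero x := D.τ_zero _
  τ_mem x hx t := D.τ_mem _ hx.1 t
  ρ_mem q hq := ⟨D.ρ_mem _ hq, trivial⟩

end preimage

section null

variable {X : Type u} [TopologicalSpace X] {X' : Type u} [TopologicalSpace X'] {H : Type w}
  [NormedAddCommGroup H] [InnerProductSpace ℂ H] {P : PrincipalBundle (PU H) X}
  {P' : PrincipalBundle (PU H) X'} {f : C(X', X)} {Y C : Set X} {Y' : Set X'}

theorem TV.InvAt.of_along {F : P'.Hom P f} {𝔸 : TV P} {x : X'} (h : (along F 𝔸).InvAt x) :
    𝔸.InvAt (f x) := fun a ha => h a ⟨trivial, ha⟩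

/-- A concordance from `𝔸|_Y` to an invertible bundle can be extended to a concordance which starts
at `𝔸` and ends in a bundle which is invertible over `Y`. -/
theorem Retraction.exists_null_extension [Nonempty X'] (R : Retraction P Y) (F : P'.Hom P f)
    (hf : IsEmbedding f) (hr : Y ⊆ range f) {𝔸 : TV P} {𝔽 : TV (P'.prod I)}
    (hC : ∀ x ∈ C, ∀ t, R.ρ (x, t) ∈ C) (hA : 𝔸.Good C)
    (hF : 𝔽.Good ((f ⁻¹' C) ×ˢ univ)) (h0 : TV.Sub (TV.along F 𝔸) (TV.along (P'.slice 0) 𝔽))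
    (h1 : ∀ y, 𝔽.InvAt (y, 1)) :
    ∃ 𝔾 : TV (P.prod I), 𝔾.Good (C ×ˢ univ) ∧ TV.Sub 𝔸 (TV.along (P.slice 0) 𝔾) ∧
      ∀ y ∈ Y, 𝔾.InvAt (y, 1) := by
  -- `𝔾` is glued from the pull-back of `𝔸` along the retraction `R`, over `τ < 2/3`, and the
  -- pull-back of `𝔽` along the lift `L` of `R` to `P'` with parameter `3 τ - 2`, over `1/3 < τ`;
  -- where both are defined the parameter is `0`
  have o1 : IsOpen {q : X × I | (R.τ q : ℝ) < 2 / 3} := isOpen_lt (by fun_prop) continuous_const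
  have o2 : IsOpen {q : X × I | 1 / 3 < (R.τ q : ℝ)} := isOpen_lt continuous_const (by fun_prop)
  have hτ : ∀ q ∈ {q : X × I | 1 / 3 < (R.τ q : ℝ)}, R.ρ q ∈ range f := fun q hq =>
    hr (R.ρ_mem q fun h => by
      have hq' : 1 / 3 < (R.τ q : ℝ) := hq
      rw [h] at hq'
      norm_num at hq')
  let L := PMap.liftOn F hf R.R o2 hτ
  have hL : ∀ p, (P.prod I).proj p ∈ L.O → F.toFun (L.F p) = R.R.toFun p := fun p hp =>
    PMap.toFun_invFun F (by rw [R.R.proj_toFun]; exact hτ _ hp)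
  have hLf : ∀ q ∈ L.O, f (L.f q) = R.ρ q := fun q hq => Function.invFun_eq (hτ q hq)
  let F₁ := (PMap.ofHom R.R).restr _ o1
  let F₂ := L.toProd ((TV.stretch 3 (-2)).comp R.τ)
  let F₃ := L.restr _ o1
  have c : ∀ q ∈ {q : X × I | (R.τ q : ℝ) < 2 / 3}, TV.stretch 3 (-2) (R.τ q) = 0 := fun q hq =>
    TV.stretch_eq_zero (by have hq' : (R.τ q : ℝ) < 2 / 3 := hq; linarith)
  have k : TV.Compat (TV.pull F₁ 𝔸) (TV.pull F₂ 𝔽) := by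
    have k1 : TV.Compat (TV.pull F₂ 𝔽) (TV.pull F₃ (TV.along F 𝔸)) :=
      .of_square (i := .ofHom (P'.slice 0)) (.of_subs (TV.Sub.refl _) h0)
        (fun x _ hx => ⟨trivial, Prod.ext rfl (c x hx.1)⟩)
        fun p hp hp' => Subtype.ext (Prod.ext (Prod.ext rfl (c _ hp'.1)) rfl)
    refine .of_on (O := {q : X × I | 1 / 3 < (R.τ q : ℝ)}) (hO := o2) ?_ fun q _ hq => ?_
    · refine k1.symm.of_sub (.pull_pull ?_ ?_ ?_ 𝔸) (TV.Sub.refl _)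
      · exact fun x hx hx' => ⟨⟨hx'.1, hx⟩, trivial⟩
      · exact fun x hx _ => (hLf x hx).symm
      · exact fun p hp _ => (hL p hp).symm
    · rw [TV.dom_pull] at hq
      exact hq.1
  obtain ⟨𝔾, s₁, s₂, hd, hi⟩ := k.exists_glue
  refine ⟨𝔾, ⟨eq_univ_of_forall fun q => ?_, fun q hq => hi _ ?_ ?_⟩, ?_, fun y hy => ?_⟩
  · rw [hd, TV.dom_pull, TV.dom_pull, hA.1, hF.1]
    rcases lt_or_ge (R.τ q : ℝ) (2 / 3) with h | h
    · exact Or.inl ⟨⟨h, trivial⟩, trivial⟩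
    · refine Or.inr ⟨?_, trivial⟩
      change 1 / 3 < (R.τ q : ℝ)
      linarith
  · exact TV.InvAt.pull F₁ (hA.2 _ (hC _ hq.1 _))
  · intro a ha
    refine TV.InvAt.pull F₂ (hF.2 _ ⟨?_, trivial⟩) a ha
    change f (L.f q) ∈ C
    rw [hLf q ha.1]
    exact hC _ hq.1 _
  · refine TV.Sub.trans ?_ (s₁.pull _)
    refine .pull_left_inv (F := F₁) (F' := P.slice 0) (fun x => ⟨?_, trivial⟩) R.R_zero 𝔸
    change (R.τ (x, 0) : ℝ) < 2 / 3
    rw [R.τ_zero]; norm_num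
  · have hx : (R.τ (y, 1) : ℝ) = 1 := by rw [R.τ_mem y hy]; rfl
    refine s₂.invAt_of_mem (fun a ha => ?_) ?_
    · refine TV.InvAt.pull F₂ (x := (y, 1)) ?_ a ha
      change 𝔽.InvAt (L.f (y, 1), TV.stretch 3 (-2) (R.τ (y, 1)))
      rw [TV.stretch_eq_one (by rw [hx]; norm_num)]
      exact h1 _
    · rw [TV.dom_pull, hF.1]
      refine ⟨?_, trivial⟩
      change 1 / 3 < (R.τ (y, 1) : ℝ)
      rw [hx]; norm_num

end null

namespace KF

open TV

variable {X : Type u} [TopologicalSpace X] {X' : Type u} [TopologicalSpace X'] {H : Type w}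
  [NormedAddCommGroup H] [InnerProductSpace ℂ H] [Nontrivial H] {P : PrincipalBundle (PU H) X}
  {P' : PrincipalBundle (PU H) X'} {f : C(X', X)} {Y B C : Set X} {Y' : Set X'}

/-- A class vanishes on any space which is mapped to the part over which the class is invertible. -/
theorem map_eq_zeroCls (D : TwistData P') (F : P'.Hom P f) (hf : MapsTo f Y' Y) (a : KF P Y)
    (h : ∀ x, f x ∈ Y) : map F hf a = zeroCls D := by
  obtain ⟨𝔸, hA, rfl⟩ := exists_cls a
  rw [map_cls]
  exact cls_eq_zeroCls D _ fun x => InvAt.pull (.ofHom F) (hA.2 _ (h x))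

/-- If a class on `(X, B)` vanishes on `(X, C)`, where `C ⊆ B`, then it is the restriction to
`X × {0}` of a class on `X × I` which is invertible over `C × I`, `B × {0}` and `X × {1}`. -/
theorem exists_of_map_eq_zeroCls (D : TwistData P) {k : C(X, X)} {K : P.Hom P k}
    (hK : ∀ p, K.toFun p = p) (hk : MapsTo k C B) {a : KF P B}
    (h : map K hk a = zeroCls D) : ∃ g : KF (P.prod I)
      {q | q.1 ∈ C ∨ q.1 ∈ B ∧ q.2 = 0 ∨ q.2 = 1},
      map (P.slice 0) (fun _ hx => Or.inr (Or.inl ⟨hx, rfl⟩)) g = a := by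
  obtain ⟨𝔸, hA, rfl⟩ := exists_cls a
  rw [map_cls] at h
  obtain ⟨𝔽, hF, s, s'⟩ := conc_of_cls_eq h
  replace s := (Sub.id_along hK 𝔸).trans s
  have hG : 𝔽.Good {q | q.1 ∈ C ∨ q.1 ∈ B ∧ q.2 = 0 ∨ q.2 = 1} := by
    refine ⟨hF.1, ?_⟩
    rintro ⟨x, t⟩ (hx | ⟨hx, (rfl : t = 0)⟩ | (rfl : t = 1))
    · exact hF.2 _ ⟨hx, trivial⟩
    · exact (s.invAt_of_mem (hA.2 x hx) (hA.1 ▸ mem_univ x)).of_along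
    · exact (s'.invAt_of_mem (invAt_zero _ x) ((good_zero (Y := ∅) D).1 ▸ mem_univ x)).of_along
  exact ⟨cls _ 𝔽 hG, (map_cls _ _ hG).trans (cls_eq_of_sub s).symm⟩

/-- If `Y` is a retract of `X` in the strong sense, a class which vanishes on `Y` comes from a class
which is invertible over `Y`. -/
theorem exists_of_restrict_eq_zeroCls (R : Retraction P Y) (F : P'.Hom P f)
    (hf : IsEmbedding f) (hr : Y ⊆ range f) (hC : ∀ x ∈ C, ∀ t, R.ρ (x, t) ∈ C)
    (D : TwistData P') (hY : MapsTo f Y' C) (hY' : f ⁻¹' C ⊆ Y') {a : KF P C}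
    (h : map F hY a = zeroCls D) {k : C(X, X)} {K : P.Hom P k} (hK : ∀ p, K.toFun p = p)
    (hk : MapsTo k C (Y ∪ C)) : ∃ b : KF P (Y ∪ C), map K hk b = a := by
  rcases isEmpty_or_nonempty X' with hX | hX
  · have hYC : MapsTo (ContinuousMap.id X) (Y ∪ C) C := fun x hx =>
      hx.elim (fun h => (hX.false (hr h).choose).elim) id
    exact ⟨map (.id P) hYC a, (map_map (.id P) K K (fun _ => rfl) hYC hk
      (fun x hx => hYC (hk hx)) a).trans (map_id K hK _ a)⟩
  · obtain ⟨𝔸, hA, rfl⟩ := exists_cls a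
    rw [map_cls] at h
    obtain ⟨𝔽, hF, s, s'⟩ := conc_of_cls_eq h
    have hF' : 𝔽.Good ((f ⁻¹' C) ×ˢ univ) := ⟨hF.1, fun q hq => hF.2 q ⟨hY' hq.1, trivial⟩⟩
    obtain ⟨𝔾, hG, g, g'⟩ := R.exists_null_extension F hf hr hC hA hF' s fun y =>
      (s'.invAt_of_mem (invAt_zero _ y) ((good_zero (Y := ∅) D).1 ▸ mem_univ y)).of_along
    have h1 : (along (P.slice 1) 𝔾).Good (Y ∪ C) := by
      refine ⟨by rw [dom_along, hG.1, preimage_univ], ?_⟩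
      rintro x (hx | hx)
      · exact InvAt.pull (.ofHom (P.slice 1)) (g' x hx)
      · exact InvAt.pull (.ofHom (P.slice 1)) (hG.2 (x, 1) ⟨hx, trivial⟩)
    exact ⟨cls _ _ h1, (map_cls _ _ h1).trans
      (Conc.cls_eq ⟨𝔾, hG, g, .along_id hK _⟩).symm⟩

end KF

/-! ### The groups of a CW triple -/

section cube

variable {X : Type u} [TopologicalSpace X] {B : Type u} [TopologicalSpace B] {G : Type w} [Group G]
  [TopologicalSpace G] {P : PrincipalBundle G X}

theorem PrincipalBundle.prod_ext {K : Type} [TopologicalSpace K] {p q : (P.prod K).Total}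
    (h : p.1.2 = q.1.2) (hk : p.1.1.2 = q.1.1.2) : p = q :=
  Subtype.ext (Prod.ext (Prod.ext (p.2.trans ((congrArg P.proj h).trans q.2.symm)) hk) h)

theorem isClosed_boundary (n : ℕ) : IsClosed (Cube.boundary (Fin n)) := by
  have : Cube.boundary (Fin n) = ⋃ i, {y | y i = 0} ∪ {y | y i = 1} := by
    ext y
    simp [Cube.boundary]
  rw [this]
  exact isClosed_iUnion_of_finite fun i =>
    (isClosed_singleton.preimage (continuous_apply i)).union
      (isClosed_singleton.preimage (continuous_apply i))

/-- The map `(s, t)` to `I^{k+1} = I^k × I`. -/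
def snocMap {k : ℕ} (s : C(B, Fin k → I)) (t : C(B, I)) : C(B, Fin (k + 1) → I) :=
  ⟨fun b => Fin.snoc (α := fun _ => I) (s b) (t b), s.continuous.finSnoc t.continuous⟩

end cube

namespace CWTriple

variable {H : Type w} [NormedAddCommGroup H] [InnerProductSpace ℂ H] {T T' : CWTriple.{u} H}
  {k : ℕ} {B : Type u} [TopologicalSpace B] {Q : PrincipalBundle (PU H) B} {g : C(B, T.X)}

theorem initial_snoc (s : Fin k → I) (t : I) :
    initial (Fin.snoc (α := fun _ => I) s t) = s := Fin.init_snoc _ _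

theorem snoc_initial (s : Fin (k + 1) → I) :
    Fin.snoc (α := fun _ => I) (initial s) (s (Fin.last k)) = s := Fin.snoc_init_self _

theorem isClosed_YX (T : CWTriple.{u} H) : IsClosed T.YX :=
  T.Y.closed'.preimage continuous_subtype_val

theorem isClosed_relSet (T : CWTriple.{u} H) (k : ℕ) : IsClosed (T.relSet k) :=
  (T.isClosed_YX.prod isClosed_univ).union (isClosed_univ.prod (isClosed_boundary k))

/-- A retraction of the pair `(X, Y)`. -/
def retr (T : CWTriple.{u} H) : Retraction T.P T.YX :=
  ((Cells.ofCW T.X).exists_retraction T.P (Cells.isSub_ofCW T.Y)).some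

theorem bigX_ext {p q : (T.bigP k).Total} (h : p.1.2 = q.1.2) : p = q :=
  Subtype.ext (Prod.ext (Subtype.ext
    (p.2.trans ((congrArg (T.P.prod (Fin (k + 1) → I)).proj h).trans q.2.symm))) h)

/-- The coordinates of `I^k` on `X × I^k`. -/
def cubeCoord (T : CWTriple.{u} H) (k : ℕ) : C(T.X × (Fin k → I), Fin k → I) :=
  ⟨Prod.snd, continuous_snd⟩

/-- The coordinates of `I^k` on `𝒳`. -/
def bigCoord (T : CWTriple.{u} H) (k : ℕ) : C(T.bigX k, Fin k → I) :=
  ⟨fun q => initial q.1.2, by unfold initial; fun_prop⟩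

/-- The last coordinate on `𝒳`. -/
def bigLast (T : CWTriple.{u} H) (k : ℕ) : C(T.bigX k, I) :=
  ⟨fun q => q.1.2 (Fin.last k), by fun_prop⟩

/-- The projection of the bundle over `𝒳` to `P`. -/
def bigHom (T : CWTriple.{u} H) (k : ℕ) : (T.bigP k).Hom T.P ⟨fun q => q.1.1, by fun_prop⟩ :=
  (T.P.prodProj _).comp ((T.P.prod (Fin (k + 1) → I)).pullbackHom _)

theorem snocMap_mem_bigX {s : C(B, Fin k → I)} {t : C(B, I)} {b : B}
    (h : t b = 0 ∨ (g b, s b) ∈ T.relSet k) : (g b, snocMap s t b) ∈ T.bigX k := by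
  refine h.imp (fun h => ?_) fun h => ?_
  · exact (Fin.snoc_last (α := fun _ => I) _ _).trans h
  · change (g b, initial (Fin.snoc (α := fun _ => I) (s b) (t b))) ∈ _
    rw [initial_snoc]
    exact h

/-- The map `(g, s, t)` to `𝒳`. -/
def bigMk (g : C(B, T.X)) (s : C(B, Fin k → I)) (t : C(B, I))
    (h : ∀ b, t b = 0 ∨ (g b, s b) ∈ T.relSet k) : C(B, T.bigX k) :=
  ⟨fun b => ⟨(g b, snocMap s t b), snocMap_mem_bigX (h b)⟩,
    (g.prodMk (snocMap s t)).continuous.subtype_mk _⟩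

theorem bigCoord_bigMk {s : C(B, Fin k → I)} {t : C(B, I)}
    {h : ∀ b, t b = 0 ∨ (g b, s b) ∈ T.relSet k} (b : B) : T.bigCoord k (bigMk g s t h b) = s b :=
  initial_snoc _ _

theorem bigLast_bigMk {s : C(B, Fin k → I)} {t : C(B, I)}
    {h : ∀ b, t b = 0 ∨ (g b, s b) ∈ T.relSet k} (b : B) : T.bigLast k (bigMk g s t h b) = t b :=
  Fin.snoc_last (α := fun _ => I) _ _

theorem bigMk_mem_bigZ {s : C(B, Fin k → I)} {t : C(B, I)}
    {h : ∀ b, t b = 0 ∨ (g b, s b) ∈ T.relSet k} {b : B} : bigMk g s t h b ∈ T.bigZ k ↔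
      (g b ∈ T.YX ∧ t b = 1) ∨ s b ∈ Cube.boundary (Fin k) := by
  change (g b ∈ T.YX ∧ T.bigLast k (bigMk g s t h b) = 1) ∨ T.bigCoord k (bigMk g s t h b) ∈ _ ↔ _
  rw [bigCoord_bigMk, bigLast_bigMk]

/-- The bundle map to the bundle over `𝒳` with given components. -/
def toBig (G : Q.Hom T.P g) (s : C(B, Fin k → I)) (t : C(B, I))
    (h : ∀ b, t b = 0 ∨ (g b, s b) ∈ T.relSet k) : Q.Hom (T.bigP k) (bigMk g s t h) :=
  (G.toProd (snocMap s t)).lift _ _ fun _ => rfl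

theorem isOpenEmbedding_coprodInclMap {Λ : Type u} (T : Λ → CWTriple.{u, w} H) (l : Λ) :
    IsOpenEmbedding (coprodInclMap (fun l => (T l).X) l) := by
  refine ⟨.of_comp (ContinuousMap.continuous _) continuous_subtype_val
    ((@IsOpenEmbedding.sigmaMk Λ (fun l => (T l).Z) _ l).isEmbedding.comp .subtypeVal), ?_⟩
  convert (@IsOpenEmbedding.sigmaMk Λ (fun l => (T l).Z) _ l).isOpen_range.preimage
    (continuous_subtype_val (p := (· ∈ coprodSet fun l => (T l).X))) using 1
  ext ⟨⟨l', z⟩, hz⟩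
  constructor
  · rintro ⟨x, hx⟩
    exact ⟨x.1, congrArg Subtype.val hx⟩
  · rintro ⟨z', h⟩
    obtain rfl : l = l' := congrArg Sigma.fst h
    exact ⟨⟨z, hz⟩, rfl⟩

variable [Nontrivial H]

/-- A cover with sections and lifts for the bundle `P`. -/
def twist (T : CWTriple.{u} H) : TwistData T.P :=
  ((Cells.ofCW T.X).nonempty_twistData T.P).some

/-- The induced cover for `P × I^k`. -/
def cubeTwist (T : CWTriple.{u} H) (k : ℕ) : TwistData (T.P.prod (Fin k → I)) :=
  T.twist.pullback (T.P.prodProj _)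

/-- The induced cover for the bundle over `𝒳`. -/
def bigTwist (T : CWTriple.{u} H) (k : ℕ) : TwistData (T.bigP k) := T.twist.pullback (T.bigHom k)

/-- The group structure of `KF_P^{-k}(X, Y)`. -/
instance addCommGroup (T : CWTriple.{u} H) (k : ℕ) : AddCommGroup (T.KF k) :=
  KF.addCommGroup (T.cubeTwist k) (T.relSet k)

theorem cls_add_cls {D : TwistData (T.P.prod (Fin k → I))} {V V' : VBData D}
    (hV : Disjoint (TwistedVB.mk D V).supp (T.relSet k))
    (hV' : Disjoint (TwistedVB.mk D V').supp (T.relSet k)) :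
    T.cls k ⟨⟨D, V⟩, hV⟩ + T.cls k ⟨⟨D, V'⟩, hV'⟩ = T.cls k (RelVB.sum V V' hV hV') :=
  KF.add_cls (V := V.toLVB) (V' := V'.toLVB) (TV.good_ofT hV) (TV.good_ofT (𝔼 := ⟨D, V'⟩) hV')

namespace Hom

theorem map_add (φ : T'.Hom T) (a b : T.KF k) : φ.map k (a + b) = φ.map k a + φ.map k b :=
  KF.map_add _ _ a b

theorem map_id (a : T.KF k) : (Hom.id T).map k a = a := KF.map_id _ (fun _ => rfl) _ a

theorem map_comp {T'' : CWTriple.{u} H} (φ : T'.Hom T) (ψ : T''.Hom T') (a : T.KF k) :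
    (φ.comp ψ).map k a = ψ.map k (φ.map k a) := (KF.map_map _ _ _ (fun _ => rfl) _ _ _ a).symm

theorem map_eq_zero (φ : T'.Hom T) (a : T.KF k) (h : ∀ x, φ.f x ∈ T.YX) : φ.map k a = 0 :=
  KF.map_eq_zeroCls (T'.cubeTwist k) _ _ _ fun x => Or.inl ⟨h x.1, trivial⟩

theorem Homotopic.map_eq {φ₀ φ₁ : T'.Hom T} (h : φ₀.Homotopic φ₁) : φ₀.map k = φ₁.map k := by
  obtain ⟨h, K, hY, -, -, K0, K1⟩ := h
  let c : C((T'.X × (Fin k → I)) × I, Fin k → I) := ⟨fun q => q.1.2, by fun_prop⟩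
  refine KF.map_eq_of_homotopy ((K.comp ((T'.P.prodProj (Fin k → I)).prodMap I)).toProd c) ?_ _ _
    ?_ ?_ _ _
  · rintro q ⟨hq | hq, -⟩
    · exact Or.inl ⟨hY ⟨hq.1, trivial⟩, trivial⟩
    · exact Or.inr ⟨trivial, hq.2⟩
  · rintro ⟨⟨⟨x, s⟩, p⟩, rfl : x = T'.P.proj p⟩
    exact PrincipalBundle.prod_ext (K0 p) rfl
  · rintro ⟨⟨⟨x, s⟩, p⟩, rfl : x = T'.P.proj p⟩
    exact PrincipalBundle.prod_ext (K1 p) rfl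

end Hom

/-- `(A, A ∩ B) → (A ∪ B, B)` is a closed embedding whose image contains the complement of `B`. -/
theorem bijective_excisionHom_map (T : CWTriple.{u, w} H)
    (A B : Topology.CWComplex.Subcomplex T.X) (k : ℕ) :
    Function.Bijective ((T.excisionHom A B).map k) := by
  refine KF.map_bijective_of_excision ((T.restrict (subSup A B) B subset_union_right).cubeTwist k)
    ?_ (isClosed_relSet _ k) ?_ _ ?_
  · have hA : IsClosed (A : Set T.Z) := A.closed'
    have hi : IsClosedEmbedding (inclusion (subset_union_left : (A : Set T.Z) ⊆ A ∪ B)) :=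
      ⟨.inclusion _, by rw [range_inclusion]; exact hA.preimage continuous_subtype_val⟩
    exact hi.prodMap .id
  · rintro ⟨⟨x, hx | hx⟩, s⟩ h
    · exact ⟨(⟨x, hx⟩, s), rfl⟩
    · exact (h (Or.inl ⟨hx, trivial⟩)).elim
  · rintro ⟨⟨x, hx⟩, s⟩ (h | h)
    · exact Or.inl ⟨⟨hx, h.1⟩, trivial⟩
    · exact Or.inr ⟨trivial, h.2⟩

theorem bijective_coprodIncl_map {Λ : Type u} (T : Λ → CWTriple.{u, w} H) (k : ℕ) :
    Function.Bijective
      fun (a : (coprod T).KF k) (l : Λ) => (coprodIncl T l).map k a := by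
  refine KF.map_bijective_of_sigma (fun l => (coprodIncl T l).F.prodMap (Fin k → I))
    (fun l => (isOpenEmbedding_coprodInclMap T l).prodMap .id) ?_ ?_
    (fun l => (coprodIncl T l).mapsTo_relSet k) ?_
  · intro l l' x x' h
    exact congrArg (fun q : coprodSet (fun l => (T l).X) × (Fin k → I) => q.1.1.1) h
  · rintro ⟨⟨⟨l, z⟩, hz⟩, s⟩
    exact ⟨l, (⟨z, hz⟩, s), rfl⟩
  · rintro l ⟨x, s⟩ (h | h)
    · exact Or.inl ⟨h.1, trivial⟩
    · exact Or.inr ⟨trivial, h.2⟩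

end CWTriple

/-! ### The connecting homomorphism -/

/-- The map covered by a bundle map. -/
abbrev PrincipalBundle.Hom.base {X X' : Type u} [TopologicalSpace X] [TopologicalSpace X']
    {G : Type w} [Group G] [TopologicalSpace G] {P : PrincipalBundle G X}
    {P' : PrincipalBundle G X'} {f : C(X', X)} (_ : P'.Hom P f) : C(X', X) := f

namespace CWTriple

section bijective

variable {H : Type w} [NormedAddCommGroup H] [InnerProductSpace ℂ H] {T T' : CWTriple.{u} H}
  {k : ℕ} {B : Type u} [TopologicalSpace B] {Q : PrincipalBundle (PU H) B} {g : C(B, T.X)}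

theorem toBig_eq {G : Q.Hom T.P g} {s : C(B, Fin k → I)} {t : C(B, I)}
    {h : ∀ b, t b = 0 ∨ (g b, s b) ∈ T.relSet k} {p : Q.Total} {q : (T.bigP k).Total}
    (hG : G.toFun p = (T.bigHom k).toFun q)
    (hs : s (Q.proj p) = T.bigCoord k ((T.bigP k).proj q))
    (ht : t (Q.proj p) = T.bigLast k ((T.bigP k).proj q)) : (toBig G s t h).toFun p = q := by
  refine bigX_ext (PrincipalBundle.prod_ext hG ?_)
  refine Eq.trans ?_ (congrArg Prod.snd q.2)
  change Fin.snoc (α := fun _ => I) (s (Q.proj p)) (t (Q.proj p)) = _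
  rw [hs, ht]
  exact snoc_initial _

/-- A point of the bundle over `𝒳` is given by a point of `P` and a point of the cube. -/
theorem exists_eq_bigP (q : (T.bigP k).Total) : ∃ p s h,
    q = ⟨(⟨(T.P.proj p, s), h⟩, ⟨((T.P.proj p, s), p), rfl⟩), rfl⟩ := by
  obtain ⟨⟨⟨y, hb⟩, ⟨⟨⟨x, s⟩, p⟩, hx⟩⟩, hy⟩ := q
  obtain rfl : x = T.P.proj p := hx
  obtain rfl : y = (T.P.proj p, s) := hy
  exact ⟨p, s, hb, rfl⟩

/-- The inclusion of the bundle over `Y × I^{k+1}` into the bundle over `𝒳`. -/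
def bigSubHom (T : CWTriple.{u} H) (k : ℕ) :
    (T.sub.P.prod (Fin (k + 1) → I)).Hom (T.bigP k) (T.bigSubMap k) :=
  (T.subHom.F.prodMap (Fin (k + 1) → I)).lift _ (T.bigSubMap k) fun _ => rfl

/-- The projection of the bundle over `𝒳` to the bundle over `X × I^k`. -/
def bigProjHom (T : CWTriple.{u} H) (k : ℕ) :
    (T.bigP k).Hom (T.P.prod (Fin k → I)) (T.bigProjMap k) :=
  (T.bigHom k).lift _ (T.bigProjMap k) fun _ => rfl

/-- The bundle map `(x, s) ↦ (ρ_λ(x), s, τ(x, λ))` from `X × I^k` to `𝒳`, where `(ρ, τ)` is the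
retraction and `λ` is a function. -/
def toBigOfRetr (T : CWTriple.{u} H) (k : ℕ) {B : Type u} [TopologicalSpace B]
    {Q : PrincipalBundle (PU H) B} {g : C(B, T.X × (Fin k → I))}
    (F : Q.Hom (T.P.prod (Fin k → I)) g) (l : C(B, I)) :=
  toBig (T.retr.R.comp (((T.P.prodProj (Fin k → I)).comp F).toProd l)) ((T.cubeCoord k).comp g)
    ⟨fun b => T.retr.τ ((g b).1, l b), by fun_prop⟩ fun b => by
      by_cases h : T.retr.τ ((g b).1, l b) = 0
      · exact Or.inl h
      · exact Or.inr (Or.inl ⟨T.retr.ρ_mem _ h, trivial⟩)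

theorem bigCoord_toBigOfRetr {g : C(B, T.X × (Fin k → I))}
    (F : Q.Hom (T.P.prod (Fin k → I)) g) (l : C(B, I)) (b : B) :
    T.bigCoord k ((T.toBigOfRetr k F l).base b) = (g b).2 :=
  initial_snoc _ _

theorem bigLast_toBigOfRetr {g : C(B, T.X × (Fin k → I))}
    (F : Q.Hom (T.P.prod (Fin k → I)) g) (l : C(B, I)) (b : B) :
    T.bigLast k ((T.toBigOfRetr k F l).base b) = T.retr.τ ((g b).1, l b) :=
  Fin.snoc_last (α := fun _ => I) _ _

/-- The inverse up to homotopy of the projection of `𝒳` to `X × I^k`. -/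
def bigLift (T : CWTriple.{u} H) (k : ℕ) :=
  T.toBigOfRetr k (.id (T.P.prod (Fin k → I))) (.const _ 1)

theorem mapsTo_bigLift : MapsTo (T.bigLift k).base (T.relSet k) (T.bigZ k) := by
  rintro ⟨x, s⟩ h
  refine bigMk_mem_bigZ.2 (h.imp (fun h => ⟨?_, T.retr.τ_mem _ h.1 1⟩) fun h => h.2)
  change T.retr.ρ (x, 1) ∈ T.YX
  rw [T.retr.ρ_of_mem h.1]
  exact h.1

theorem isClosed_bigZ₀ (T : CWTriple.{u} H) (k : ℕ) : IsClosed (T.bigZ₀ k) := by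
  have hl : Continuous (T.bigLast k) := (T.bigLast k).continuous
  refine (isClosed_singleton.preimage hl).union (.union (.inter ?_
    (isClosed_singleton.preimage hl)) ((isClosed_boundary k).preimage (T.bigCoord k).continuous))
  exact T.isClosed_YX.preimage (continuous_fst.comp continuous_subtype_val)

/-- The homotopy on `𝒳` from the identity to the composition of the projection and its inverse up to
homotopy. -/
def bigHomotopy (T : CWTriple.{u} H) (k : ℕ) :=
  toBig (T.retr.R.comp (((T.bigHom k).comp ((T.bigP k).prodProj I)).toProd
    ⟨Prod.snd, continuous_snd⟩)) ((T.bigCoord k).comp ⟨Prod.fst, continuous_fst⟩)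
    ⟨fun q => projIcc 0 1 zero_le_one
      ((1 - q.2 : ℝ) * T.bigLast k q.1 + T.retr.τ (q.1.1.1, q.2)),
      continuous_projIcc.comp (by fun_prop)⟩ fun q => by
    obtain ⟨⟨⟨x, s⟩, h | h⟩, l⟩ := q
    · by_cases hτ : T.retr.τ (x, l) = 0
      · refine Or.inl (projIcc_of_le_left zero_le_one ?_)
        change (1 - l : ℝ) * (s (Fin.last k) : ℝ) + (T.retr.τ (x, l) : ℝ) ≤ 0
        have h' : s (Fin.last k) = 0 := h
        rw [hτ, h']
        simp
      · exact Or.inr (Or.inl ⟨T.retr.ρ_mem _ hτ, trivial⟩)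
    · refine Or.inr (h.imp (fun h => ⟨?_, trivial⟩) fun h => ⟨trivial, h.2⟩)
      change T.retr.ρ (x, l) ∈ T.YX
      rw [T.retr.ρ_of_mem h.1]
      exact h.1

theorem mapsTo_bigHomotopy :
    MapsTo (T.bigHomotopy k).base (T.bigZ k ×ˢ univ) (T.bigZ k) := by
  rintro ⟨⟨⟨x, s⟩, hx⟩, l⟩ ⟨h, -⟩
  refine bigMk_mem_bigZ.2 (h.imp (fun h => ⟨?_, projIcc_of_right_le zero_le_one ?_⟩) id)
  · change T.retr.ρ (x, l) ∈ T.YX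
    rw [T.retr.ρ_of_mem h.1]
    exact h.1
  · change 1 ≤ (1 - l : ℝ) * (s (Fin.last k) : ℝ) + (T.retr.τ (x, l) : ℝ)
    have h' : s (Fin.last k) = 1 := h.2
    rw [T.retr.τ_mem x h.1, h']
    simp

/-- The map of the spaces `𝒳` induced by a morphism. -/
def Hom.bigMap (φ : T'.Hom T) (k : ℕ) : C(T'.bigX k, T.bigX k) :=
  bigMk (φ.f.comp ⟨fun q => q.1.1, by fun_prop⟩) (T'.bigCoord k) (T'.bigLast k)
    fun q => Or.imp (fun h => h) (fun h => φ.mapsTo_relSet k h) q.2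

/-- The map of the bundles over the spaces `𝒳` induced by a morphism. -/
def Hom.big (φ : T'.Hom T) (k : ℕ) : (T'.bigP k).Hom (T.bigP k) (φ.bigMap k) :=
  toBig (φ.F.comp (T'.bigHom k)) (T'.bigCoord k) (T'.bigLast k) _

theorem Hom.bigCoord_bigMap (φ : T'.Hom T) (q : T'.bigX k) :
    T.bigCoord k (φ.bigMap k q) = T'.bigCoord k q := initial_snoc _ _

theorem Hom.bigLast_bigMap (φ : T'.Hom T) (q : T'.bigX k) :
    T.bigLast k (φ.bigMap k q) = T'.bigLast k q := Fin.snoc_last (α := fun _ => I) _ _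

theorem Hom.mapsTo_big (φ : T'.Hom T) : MapsTo (φ.bigMap k) (T'.bigZ k) (T.bigZ k) := by
  rintro q (h | h)
  · exact bigMk_mem_bigZ.2 (Or.inl ⟨φ.mapsTo h.1, h.2⟩)
  · exact bigMk_mem_bigZ.2 (Or.inr h)

theorem Hom.mapsTo_big₀ (φ : T'.Hom T) :
    MapsTo (φ.bigMap k) (T'.bigZ₀ k) (T.bigZ₀ k) := fun _ h =>
  h.imp (fun h => (φ.bigLast_bigMap _).trans h) fun h => φ.mapsTo_big h

variable [Nontrivial H]

/-- The lift of `X × I^k` to `𝒳`, followed by the projection, is homotopic to the identity, by the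
first component of the retraction. -/
theorem map_bigLift_bigProj (a : T.KF k) :
    KF.map (T.bigLift k) mapsTo_bigLift (T.bigProj k a) = a := by
  have hR : MapsTo (T.retr.prod (Fin k → I)).R.base (T.relSet k ×ˢ univ) (T.relSet k) := by
    rintro ⟨⟨x, s⟩, t⟩ ⟨h | h, -⟩
    · refine Or.inl ⟨?_, trivial⟩
      change T.retr.ρ (x, t) ∈ T.YX
      rw [T.retr.ρ_of_mem h.1]
      exact h.1
    · exact Or.inr ⟨trivial, h.2⟩
  have h1 : MapsTo ((T.bigProjHom k).comp (T.bigLift k)).base (T.relSet k) (T.relSet k) :=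
    (T.mapsTo_bigProjMap k).comp mapsTo_bigLift
  refine (KF.map_map (T.bigProjHom k) (T.bigLift k) ((T.bigProjHom k).comp (T.bigLift k))
    (fun _ => rfl) _ _ h1 a).trans ?_
  have h2 := KF.map_eq_of_homotopy (T.retr.prod (Fin k → I)).R hR (.id _)
    ((T.bigProjHom k).comp (T.bigLift k)) (T.retr.prod (Fin k → I)).R_zero (fun p => ?_)
    (fun _ h => h) h1
  · rw [← h2]
    exact KF.map_id _ (fun _ => rfl) _ a
  · refine PrincipalBundle.prod_ext rfl ?_
    exact (bigCoord_toBigOfRetr (.id (T.P.prod (Fin k → I))) (.const _ 1)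
      ((T.P.prod (Fin k → I)).proj p)).symm

/-- The projection of `𝒳` is a homotopy equivalence of pairs. -/
theorem bijective_bigProj (T : CWTriple.{u, w} H) (k : ℕ) : Function.Bijective (T.bigProj k) := by
  refine Function.bijective_iff_has_inverse.2 ⟨KF.map (T.bigLift k) mapsTo_bigLift,
    map_bigLift_bigProj, fun c => ?_⟩
  have h1 : MapsTo ((T.bigLift k).comp (T.bigProjHom k)).base (T.bigZ k) (T.bigZ k) :=
    mapsTo_bigLift.comp (T.mapsTo_bigProjMap k)
  refine (KF.map_map (T.bigLift k) (T.bigProjHom k) ((T.bigLift k).comp (T.bigProjHom k))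
    (fun _ => rfl) _ _ h1 c).trans ?_
  have h2 := KF.map_eq_of_homotopy (T.bigHomotopy k) mapsTo_bigHomotopy (.id _)
    ((T.bigLift k).comp (T.bigProjHom k)) (fun q => ?_) (fun q => ?_) (fun _ h => h) h1
  · rw [← h2]
    exact KF.map_id _ (fun _ => rfl) _ c
  · obtain ⟨p, s, h, rfl⟩ := exists_eq_bigP q
    refine toBig_eq (T.retr.R_zero p) rfl ?_
    change projIcc (0 : ℝ) 1 zero_le_one ((1 - ((0 : I) : ℝ)) * (s (Fin.last k) : ℝ) +
      (T.retr.τ (T.P.proj p, 0) : ℝ)) = s (Fin.last k)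
    rw [T.retr.τ_zero]
    simp
  · obtain ⟨p, s, h, rfl⟩ := exists_eq_bigP q
    refine toBig_eq rfl ?_ ?_
    · exact (bigCoord_toBigOfRetr (.id (T.P.prod (Fin k → I))) (.const _ 1)
        (T.P.proj p, initial s)).symm
    · refine Eq.trans ?_ (bigLast_toBigOfRetr (.id (T.P.prod (Fin k → I))) (.const _ 1)
        (T.P.proj p, initial s)).symm
      change projIcc (0 : ℝ) 1 zero_le_one ((1 - ((1 : I) : ℝ)) * (s (Fin.last k) : ℝ) +
        (T.retr.τ (T.P.proj p, 1) : ℝ)) = T.retr.τ (T.P.proj p, 1)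
      simp

/-- Excision: the complement of `Y × I^{k+1}` in `𝒳` lies in the part over which the bundles are
invertible. -/
theorem bijective_bigRes (T : CWTriple.{u, w} H) (k : ℕ) : Function.Bijective (T.bigRes k) := by
  have hi : IsClosedEmbedding (T.bigSubMap k) := by
    have h : IsClosedEmbedding (T.subHom.f.prodMap (.id (Fin (k + 1) → I))) :=
      IsClosedEmbedding.prodMap ⟨.inclusion
        (Topology.CWComplex.Subcomplex.subset_complex T.Y), (congrArg IsClosed (range_inclusion
        (Topology.CWComplex.Subcomplex.subset_complex T.Y))).mpr T.isClosed_YX⟩ .id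
    refine ⟨.of_comp (T.bigSubMap k).continuous continuous_subtype_val h.isEmbedding, ?_⟩
    convert h.isClosed_range.preimage (continuous_subtype_val (p := (· ∈ T.bigX k))) using 1
    ext q
    exact ⟨fun ⟨y, hy⟩ => ⟨y, congrArg Subtype.val hy⟩, fun ⟨y, hy⟩ => ⟨y, Subtype.ext hy⟩⟩
  refine KF.map_bijective_of_excision (T.bigTwist k) hi (T.isClosed_bigZ₀ k) ?_ _ ?_
  · rintro ⟨⟨x, s⟩, hx | hx | hx⟩ h
    · exact (h (Or.inl hx)).elim
    · exact ⟨(⟨x.1, hx.1⟩, s), rfl⟩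
    · exact (h (Or.inr (Or.inr hx.2))).elim
  · rintro ⟨x, s⟩ (h | ⟨-, h⟩ | ⟨i, h⟩)
    · exact Or.inr ⟨trivial, Fin.last k, Or.inl h⟩
    · exact Or.inr ⟨trivial, Fin.last k, Or.inr h⟩
    · exact Or.inr ⟨trivial, i.castSucc, h⟩

theorem bigProj_big (φ : T'.Hom T) (a : T.KF k) :
    T'.bigProj k (φ.map k a) = KF.map (φ.big k) φ.mapsTo_big (T.bigProj k a) := by
  have h := (T.mapsTo_bigProjMap k).comp (φ.mapsTo_big (k := k))
  refine Eq.trans ?_ (KF.map_map (T.bigProjHom k) (φ.big k) ((T.bigProjHom k).comp (φ.big k))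
    (fun _ => rfl) _ _ h a).symm
  refine KF.map_map (φ.F.prodMap _) (T'.bigProjHom k) _ (fun p => ?_) _ _ h a
  refine PrincipalBundle.prod_ext rfl ?_
  exact (φ.bigCoord_bigMap ((T'.bigP k).proj p)).symm

theorem bigIncl_big (φ : T'.Hom T) (c : TwK.KF (T.bigP k) (T.bigZ₀ k)) :
    T'.bigIncl k (KF.map (φ.big k) φ.mapsTo_big₀ c) =
      KF.map (φ.big k) φ.mapsTo_big (T.bigIncl k c) := by
  have h : MapsTo (φ.big k).base (T'.bigZ k) (T.bigZ₀ k) := fun _ h => Or.inr (φ.mapsTo_big h)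
  exact (KF.map_map (φ.big k) (.id _) (φ.big k) (fun _ => rfl) _ _ h c).trans
    (KF.map_map (.id _) (φ.big k) (φ.big k) (fun _ => rfl) _ _ h c).symm

theorem bigRes_big (φ : T'.Hom T) (c : TwK.KF (T.bigP k) (T.bigZ₀ k)) :
    T'.bigRes k (KF.map (φ.big k) φ.mapsTo_big₀ c) = φ.sub.map (k + 1) (T.bigRes k c) := by
  have h : MapsTo ((φ.big k).comp (T'.bigSubHom k)).base (T'.sub.relSet (k + 1)) (T.bigZ₀ k) :=
    (φ.mapsTo_big₀).comp (T'.mapsTo_bigSubMap k)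
  refine (KF.map_map (φ.big k) (T'.bigSubHom k) ((φ.big k).comp (T'.bigSubHom k)) (fun _ => rfl)
    _ _ h c).trans (KF.map_map (T.bigSubHom k) (φ.sub.F.prodMap _) _ (fun p => ?_) _ _ h c).symm
  refine Eq.symm (toBig_eq (T := T) (G := φ.F.comp (T'.bigHom k)) (s := T'.bigCoord k)
    (t := T'.bigLast k) (p := (T'.bigSubHom k).toFun p) ?_ ?_ ?_) <;> rfl

/-- The connecting homomorphism. -/
def delta (T : CWTriple.{u, w} H) (k : ℕ) : T.sub.KF (k + 1) →+ T.KF k :=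
  AddMonoidHom.mk' (fun a => (Equiv.ofBijective _ (T.bijective_bigProj k)).symm
    (T.bigIncl k ((Equiv.ofBijective _ (T.bijective_bigRes k)).symm a))) fun a b => by
    obtain ⟨a, rfl⟩ := (T.bijective_bigRes k).2 a
    obtain ⟨b, rfl⟩ := (T.bijective_bigRes k).2 b
    have h : T.bigRes k (a.add b) = T.bigRes k a + T.bigRes k b := KF.map_add _ _ a b
    rw [Equiv.symm_apply_eq, ← h, Equiv.ofBijective_symm_apply_apply,
      Equiv.ofBijective_symm_apply_apply, Equiv.ofBijective_symm_apply_apply]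
    refine (KF.map_add _ _ a b).trans (Eq.trans ?_ (KF.map_add _ _ _ _).symm)
    exact congrArg₂ KF.add
      (Equiv.apply_symm_apply (Equiv.ofBijective _ (T.bijective_bigProj k)) _).symm
      (Equiv.apply_symm_apply (Equiv.ofBijective _ (T.bijective_bigProj k)) _).symm

theorem bigProj_delta_bigRes (c : TwK.KF (T.bigP k) (T.bigZ₀ k)) :
    T.bigProj k (T.delta k (T.bigRes k c)) = T.bigIncl k c := by
  refine (Equiv.apply_symm_apply (Equiv.ofBijective _ (T.bijective_bigProj k)) _).trans ?_
  exact congrArg (T.bigIncl k) (Equiv.ofBijective_symm_apply_apply _ (T.bijective_bigRes k) c)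

theorem Hom.map_delta (φ : T'.Hom T) (a : T.sub.KF (k + 1)) :
    φ.map k (T.delta k a) = T'.delta k (φ.sub.map (k + 1) a) := by
  obtain ⟨c, rfl⟩ := (T.bijective_bigRes k).2 a
  apply (T'.bijective_bigProj k).1
  rw [bigProj_big, bigProj_delta_bigRes, ← bigRes_big, bigProj_delta_bigRes, bigIncl_big]

end bijective

end CWTriple

/-! ### Exactness -/

theorem KF.map_zeroCls {X X' : Type u} [TopologicalSpace X] [TopologicalSpace X'] {H : Type w}
    [NormedAddCommGroup H] [InnerProductSpace ℂ H] [Nontrivial H] {P : PrincipalBundle (PU H) X}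
    {P' : PrincipalBundle (PU H) X'} {f : C(X', X)} {Y : Set X} {Y' : Set X'} (D : TwistData P)
    (D' : TwistData P') (F : P'.Hom P f) (hf : MapsTo f Y' Y) :
    map F hf (zeroCls D) = zeroCls D' :=
  (TV.map_cls F hf (good_zero D)).trans <| TV.cls_eq_of_inv (hB := good_zero D')
    (fun _ => TV.InvAt.pull (.ofHom F) (TV.invAt_zero D.toLTD _)) (TV.invAt_zero _)

namespace CWTriple

section exact

variable {H : Type w} [NormedAddCommGroup H] [InnerProductSpace ℂ H] {T T' : CWTriple.{u} H}
  {k : ℕ}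

theorem mem_relSet_abs {q : T.X × (Fin k → I)} :
    q ∈ T.abs.relSet k ↔ q.2 ∈ Cube.boundary (Fin k) :=
  ⟨fun h => h.elim (fun h => h.1.elim) fun h => h.2, fun h => Or.inr ⟨trivial, h⟩⟩

theorem mem_boundary_succ {s : Fin (k + 1) → I} : s ∈ Cube.boundary (Fin (k + 1)) ↔
    initial s ∈ Cube.boundary (Fin k) ∨ s (Fin.last k) = 0 ∨ s (Fin.last k) = 1 :=
  Fin.exists_fin_succ'

variable [Nontrivial H]

/-- Exactness at `KF^{-k}(X)`, by the homotopy extension property. -/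
theorem exact_absHom_subHom (T : CWTriple.{u, w} H) (k : ℕ) :
    Function.Exact (T.absHom.map k) (T.subHom.map k) := by
  intro a
  constructor
  · intro h
    have hemb : IsEmbedding (T.subHom.f.prodMap (.id (Fin k → I))) :=
      IsEmbedding.prodMap (.inclusion (Topology.CWComplex.Subcomplex.subset_complex T.Y)) .id
    have hC : ∀ x ∈ T.abs.relSet k, ∀ t, (T.retr.prod (Fin k → I)).ρ (x, t) ∈ T.abs.relSet k :=
      fun x hx t => mem_relSet_abs.2 (mem_relSet_abs.1 hx :)
    obtain ⟨b, hb⟩ := KF.exists_of_restrict_eq_zeroCls (T.retr.prod (Fin k → I))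
      (T.subHom.F.prodMap (Fin k → I)) hemb (fun q hq => ⟨(⟨q.1.1, hq.1⟩, q.2), rfl⟩) hC
      (T.sub.cubeTwist k) (T.subHom.mapsTo_relSet k)
      (fun q hq => Or.inr ⟨trivial, mem_relSet_abs.1 hq⟩) h
      (K := .id (T.P.prod (Fin k → I))) (fun _ => rfl) fun _ h => Or.inr h
    have h1 : MapsTo (PrincipalBundle.Hom.id (T.P.prod (Fin k → I))).base (T.relSet k)
        ((T.YX ×ˢ univ) ∪ T.abs.relSet k) := fun q hq => hq.imp (fun h => h) Or.inr
    refine ⟨KF.map (.id _) h1 b, Eq.trans ?_ hb⟩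
    exact KF.map_map (.id (T.P.prod (Fin k → I))) (T.absHom.F.prodMap (Fin k → I)) (.id _)
      (fun _ => rfl) _ _ _ b
  · rintro ⟨b, rfl⟩
    rw [← Hom.map_comp]
    exact Hom.map_eq_zero _ _ fun x => x.2

/-- Exactness at `KF^{-k}(X, Y)`: a null-homotopy over `X` of a class on `(X, Y)` is a bundle over
`X × I^k × I` which is invertible over `Y × I^k × 0`, and its restriction to `𝒳` is a class whose
image under the connecting homomorphism is the given one. -/
theorem exact_delta_absHom (T : CWTriple.{u, w} H) (k : ℕ) :
    Function.Exact (T.delta k) (T.absHom.map k) := by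
  intro a
  constructor
  · intro h
    obtain ⟨g, rfl⟩ := KF.exists_of_map_eq_zeroCls (P := T.P.prod (Fin k → I)) (T.abs.cubeTwist k)
      (K := T.absHom.F.prodMap (Fin k → I)) (fun _ => rfl) (T.absHom.mapsTo_relSet k) h
    -- the inclusion of `𝒳` with the last coordinate reversed: `((x, s), λ) ↦ ((x, s), 1 - λ)`
    let m : (T.bigP k).Hom ((T.P.prod (Fin k → I)).prod I) _ :=
      (T.bigProjHom k).toProd (ContinuousMap.comp ⟨unitInterval.symm, by fun_prop⟩ (T.bigLast k))
    have hm : MapsTo m.base (T.bigZ₀ k)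
        {q | q.1 ∈ T.abs.relSet k ∨ q.1 ∈ T.relSet k ∧ q.2 = 0 ∨ q.2 = 1} := by
      rintro q (h | h | h)
      · refine Or.inr (Or.inr ?_)
        change unitInterval.symm (q.1.2 (Fin.last k)) = 1
        rw [show q.1.2 (Fin.last k) = 0 from h, unitInterval.symm_zero]
      · refine Or.inr (Or.inl ⟨Or.inl ⟨h.1, trivial⟩, ?_⟩)
        change unitInterval.symm (q.1.2 (Fin.last k)) = 0
        rw [h.2, unitInterval.symm_one]
      · exact Or.inl (mem_relSet_abs.2 h)
    -- the homotopy `((x, s), λ), t ↦ ((x, s), t (1 - λ))` from the projection to `m`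
    let K : ((T.bigP k).prod I).Hom ((T.P.prod (Fin k → I)).prod I) _ :=
      ((T.bigProjHom k).comp ((T.bigP k).prodProj I)).toProd
        ⟨fun q => q.2 * unitInterval.symm (T.bigLast k q.1), by fun_prop⟩
    have hK : MapsTo K.base (T.bigZ k ×ˢ univ)
        {q | q.1 ∈ T.abs.relSet k ∨ q.1 ∈ T.relSet k ∧ q.2 = 0 ∨ q.2 = 1} := by
      rintro q ⟨h | h, -⟩
      · refine Or.inr (Or.inl ⟨Or.inl ⟨h.1, trivial⟩, ?_⟩)
        change q.2 * unitInterval.symm (q.1.1.2 (Fin.last k)) = 0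
        rw [h.2, unitInterval.symm_one, mul_zero]
      · exact Or.inl (mem_relSet_abs.2 h)
    have h0 : MapsTo (((T.P.prod (Fin k → I)).slice 0).comp (T.bigProjHom k)).base (T.bigZ k)
        {q | q.1 ∈ T.abs.relSet k ∨ q.1 ∈ T.relSet k ∧ q.2 = 0 ∨ q.2 = 1} := fun q hq =>
      Or.inr (Or.inl ⟨T.mapsTo_bigProjMap k hq, rfl⟩)
    have h1 : MapsTo m.base (T.bigZ k)
        {q | q.1 ∈ T.abs.relSet k ∨ q.1 ∈ T.relSet k ∧ q.2 = 0 ∨ q.2 = 1} := fun q hq =>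
      hm (Or.inr hq)
    refine ⟨T.bigRes k (KF.map m hm g), (T.bijective_bigProj k).1 ?_⟩
    rw [bigProj_delta_bigRes]
    refine (KF.map_map m (.id _) m (fun _ => rfl) _ _ h1 g).trans (Eq.trans ?_
      (KF.map_map ((T.P.prod (Fin k → I)).slice 0) (T.bigProjHom k)
        (((T.P.prod (Fin k → I)).slice 0).comp (T.bigProjHom k)) (fun _ => rfl)
        _ _ h0 g).symm)
    refine (congrFun (KF.map_eq_of_homotopy K hK _ m (fun p => ?_) (fun p => ?_) h0 h1) g).symm
    · exact PrincipalBundle.prod_ext rfl (zero_mul _)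
    · exact PrincipalBundle.prod_ext rfl (one_mul _)
  -- over `X` without condition on `Y` the lift of `X × I^k` to `𝒳` is homotopic, along the
  -- retraction, to the inclusion of `X × I^k × 0`, over which classes in the image of `j^*` vanish
  · rintro ⟨b, rfl⟩
    obtain ⟨c, rfl⟩ := (T.bijective_bigRes k).2 b
    rw [← map_bigLift_bigProj (T.delta k _), bigProj_delta_bigRes]
    have h0 : MapsTo (T.toBigOfRetr k (.id (T.P.prod (Fin k → I))) (.const _ 0)).base
        (T.abs.relSet k) (T.bigZ₀ k) := fun q hq =>
      Or.inr (bigMk_mem_bigZ.2 (Or.inr (mem_relSet_abs.1 hq)))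
    have h1 : MapsTo (T.bigLift k).base (T.abs.relSet k) (T.bigZ₀ k) := fun q hq =>
      Or.inr (bigMk_mem_bigZ.2 (Or.inr (mem_relSet_abs.1 hq)))
    have hK : MapsTo (T.toBigOfRetr k ((T.P.prod (Fin k → I)).prodProj I)
        ⟨Prod.snd, continuous_snd⟩).base (T.abs.relSet k ×ˢ univ) (T.bigZ₀ k) := fun q hq =>
      Or.inr (bigMk_mem_bigZ.2 (Or.inr (mem_relSet_abs.1 hq.1)))
    have h2 : MapsTo (T.bigLift k).base (T.relSet k) (T.bigZ k) := mapsTo_bigLift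
    have h3 : MapsTo (T.bigLift k).base (T.abs.relSet k) (T.bigZ k) := fun q hq =>
      bigMk_mem_bigZ.2 (Or.inr (mem_relSet_abs.1 hq))
    refine (KF.map_map (T.bigLift k) (T.absHom.F.prodMap (Fin k → I)) (T.bigLift k)
      (fun _ => rfl) h2 (T.absHom.mapsTo_relSet k) h3 _).trans ?_
    refine (KF.map_map (.id (T.bigP k)) (T.bigLift k) (T.bigLift k) (fun _ => rfl) _ h3 h1
      c).trans ?_
    refine (congrFun (KF.map_eq_of_homotopy (T.toBigOfRetr k ((T.P.prod (Fin k → I)).prodProj I)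
        ⟨Prod.snd, continuous_snd⟩) hK (T.toBigOfRetr k (.id (T.P.prod (Fin k → I))) (.const _ 0))
      (T.bigLift k) (fun p => rfl) (fun p => rfl)
      h0 h1) c).symm.trans ?_
    refine KF.map_eq_zeroCls (T.abs.cubeTwist k) _ _ _ fun q => Or.inl ?_
    exact (bigLast_toBigOfRetr (T := T) (.id (T.P.prod (Fin k → I))) (.const _ 0) q).trans
      (T.retr.τ_zero _)

/-- Exactness at `KF^{-k-1}(Y)`: a null-homotopy over `𝒳` of a class from `Y × I^{k+1}` restricts to
a bundle over `X × I^k × 0 × I = X × I^{k+1}`, whose restriction to `Y` is the given class, by a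
rotation of the square spanned by the last coordinate of `𝒳` and the parameter of the homotopy. -/
theorem exact_subHom_delta (T : CWTriple.{u, w} H) (k : ℕ) :
    Function.Exact (T.subHom.map (k + 1)) (T.delta k) := by
  intro b
  constructor
  · intro h
    obtain ⟨c, rfl⟩ := (T.bijective_bigRes k).2 b
    have h1 := (T.bigProj_delta_bigRes c).symm.trans (congrArg (T.bigProj k) h)
    obtain ⟨g, rfl⟩ := KF.exists_of_map_eq_zeroCls (T.bigTwist k) (fun _ => rfl) _
      (h1.trans (KF.map_zeroCls (T.cubeTwist k) _ _ _))
    -- the inclusion `(x, s, t) ↦ ((x, s, 0), t)`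
    let e₀ : (T.P.prod (Fin (k + 1) → I)).Hom (T.bigP k) _ :=
      toBig (T.P.prodProj _) ⟨fun q => initial q.2, by unfold initial; fun_prop⟩ (.const _ 0)
        fun _ => Or.inl rfl
    let e : (T.P.prod (Fin (k + 1) → I)).Hom ((T.bigP k).prod I) _ :=
      e₀.toProd ⟨fun q => q.2 (Fin.last k), by fun_prop⟩
    have he : MapsTo e.base (T.abs.relSet (k + 1))
        {q | q.1 ∈ T.bigZ k ∨ q.1 ∈ T.bigZ₀ k ∧ q.2 = 0 ∨ q.2 = 1} := by
      rintro q hq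
      rcases mem_boundary_succ.1 (mem_relSet_abs.1 hq) with h | h | h
      · exact Or.inl (bigMk_mem_bigZ.2 (Or.inr h))
      · exact Or.inr (Or.inl ⟨Or.inl (Fin.snoc_last (α := fun _ => I) _ _), h⟩)
      · exact Or.inr (Or.inr h)
    -- the homotopy `(y, s, t), u ↦ ((y, s, t · min 1 (2 - 2 u)), t · min 1 (2 u))`
    let K₀ : ((T.sub.P.prod (Fin (k + 1) → I)).prod I).Hom (T.bigP k) _ :=
      toBig (T := T) (T.subHom.F.comp ((T.sub.P.prodProj _).comp (PrincipalBundle.prodProj _ I)))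
        ⟨fun q => initial q.1.2, by unfold initial; fun_prop⟩
        ⟨fun q => q.1.2 (Fin.last k) * TV.stretch (-2) 2 q.2, by fun_prop⟩
        fun q => Or.inr (Or.inl ⟨q.1.1.2, trivial⟩)
    let K : ((T.sub.P.prod (Fin (k + 1) → I)).prod I).Hom ((T.bigP k).prod I) _ :=
      K₀.toProd ⟨fun q => q.1.2 (Fin.last k) * TV.stretch 2 0 q.2, by fun_prop⟩
    have hK : MapsTo K.base (T.sub.relSet (k + 1) ×ˢ univ)
        {q | q.1 ∈ T.bigZ k ∨ q.1 ∈ T.bigZ₀ k ∧ q.2 = 0 ∨ q.2 = 1} := by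
      rintro ⟨⟨y, s⟩, t⟩ ⟨hq | hq, -⟩
      · exact hq.1.elim
      rcases mem_boundary_succ.1 hq.2 with h | h | h
      · exact Or.inl (bigMk_mem_bigZ.2 (Or.inr h))
      · refine Or.inr (Or.inl ⟨Or.inl ?_, ?_⟩)
        · refine (Fin.snoc_last (α := fun _ => I) _ _).trans ?_
          change s (Fin.last k) * _ = 0
          rw [show s (Fin.last k) = 0 from h, zero_mul]
        · change s (Fin.last k) * _ = 0
          rw [show s (Fin.last k) = 0 from h, zero_mul]
      · rcases le_total (t : ℝ) (1 / 2) with ht | ht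
        · refine Or.inl (bigMk_mem_bigZ.2 (Or.inl ⟨y.2, ?_⟩))
          change s (Fin.last k) * TV.stretch (-2) 2 t = 1
          rw [show s (Fin.last k) = 1 from h, one_mul]
          exact TV.stretch_eq_one (by linarith)
        · refine Or.inr (Or.inr ?_)
          change s (Fin.last k) * TV.stretch 2 0 t = 1
          rw [show s (Fin.last k) = 1 from h, one_mul]
          exact TV.stretch_eq_one (by linarith)
    have h0 : MapsTo (((T.bigP k).slice 0).comp (T.bigSubHom k)).base (T.sub.relSet (k + 1))
        {q | q.1 ∈ T.bigZ k ∨ q.1 ∈ T.bigZ₀ k ∧ q.2 = 0 ∨ q.2 = 1} := fun q hq =>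
      Or.inr (Or.inl ⟨T.mapsTo_bigSubMap k hq, rfl⟩)
    have h2 : MapsTo (e.comp (T.subHom.F.prodMap (Fin (k + 1) → I))).base (T.sub.relSet (k + 1))
        {q | q.1 ∈ T.bigZ k ∨ q.1 ∈ T.bigZ₀ k ∧ q.2 = 0 ∨ q.2 = 1} := fun q hq =>
      he (T.subHom.mapsTo_relSet (k + 1) hq)
    refine ⟨KF.map e he g, ?_⟩
    refine (KF.map_map e (T.subHom.F.prodMap _) (e.comp (T.subHom.F.prodMap _))
      (fun _ => rfl) _ _ h2 g).trans
      (Eq.trans ?_ (KF.map_map ((T.bigP k).slice 0) (T.bigSubHom k)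
        (((T.bigP k).slice 0).comp (T.bigSubHom k)) (fun _ => rfl)
        _ _ h0 g).symm)
    have c0 : TV.stretch (-2) 2 0 = 1 := TV.stretch_eq_one (by simp)
    have c1 : TV.stretch (-2) 2 1 = 0 := TV.stretch_eq_zero (by simp)
    have d0 : TV.stretch 2 0 0 = 0 := TV.stretch_eq_zero (by simp)
    have d1 : TV.stretch 2 0 1 = 1 := TV.stretch_eq_one (by simp)
    refine (congrFun (KF.map_eq_of_homotopy K hK _ _ (fun p => ?_) (fun p => ?_) h0 h2) g).symm
    · refine PrincipalBundle.prod_ext (toBig_eq rfl rfl ?_) ?_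
      · change _ * TV.stretch (-2) 2 0 = _
        rw [c0, mul_one]
        rfl
      · change _ * TV.stretch 2 0 0 = (0 : I)
        rw [d0, mul_zero]
    · refine PrincipalBundle.prod_ext (toBig_eq rfl ?_ ?_) ?_
      · exact (initial_snoc _ _).symm
      · refine Eq.trans ?_ (Fin.snoc_last (α := fun _ => I) _ _).symm
        change _ * TV.stretch (-2) 2 1 = (0 : I)
        rw [c1, mul_zero]
      · change _ * TV.stretch 2 0 1 = _
        rw [d1, mul_one]
        rfl
  -- a class from `X × I^{k+1}` restricts to `𝒳`, where the last coordinate can be pushed to `1`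
  · rintro ⟨b, rfl⟩
    let i : (T.bigP k).Hom (T.P.prod (Fin (k + 1) → I)) _ :=
      (T.P.prod (Fin (k + 1) → I)).pullbackHom _
    have hi : MapsTo i.base (T.bigZ₀ k) (T.abs.relSet (k + 1)) := by
      rintro q (h | h | h)
      · exact mem_relSet_abs.2 (mem_boundary_succ.2 (Or.inr (Or.inl h)))
      · exact mem_relSet_abs.2 (mem_boundary_succ.2 (Or.inr (Or.inr h.2)))
      · exact mem_relSet_abs.2 (mem_boundary_succ.2 (Or.inl h))
    have h0 : MapsTo i.base (T.bigZ k) (T.abs.relSet (k + 1)) := fun q hq => hi (Or.inr hq)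
    have hb : T.bigRes k (KF.map i hi b) = T.subHom.map (k + 1) b :=
      KF.map_map i (T.bigSubHom k) (T.subHom.F.prodMap _) (fun _ => rfl) _ _ _ b
    rw [← hb]
    apply (T.bijective_bigProj k).1
    rw [bigProj_delta_bigRes]
    refine Eq.trans ?_ (KF.map_zeroCls (T.cubeTwist k) (T.bigTwist k) _ _).symm
    refine (KF.map_map i (.id _) i (fun _ => rfl) _ _ h0 b).trans ?_
    let j : (T.bigP k).Hom (T.P.prod (Fin (k + 1) → I)) _ :=
      (T.bigHom k).toProd (snocMap (T.bigCoord k) (.const _ 1))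
    let K : ((T.bigP k).prod I).Hom (T.P.prod (Fin (k + 1) → I)) _ :=
      ((T.bigHom k).comp ((T.bigP k).prodProj I)).toProd
        (snocMap ((T.bigCoord k).comp ⟨Prod.fst, continuous_fst⟩)
          ⟨fun q => max (T.bigLast k q.1) q.2, by fun_prop⟩)
    have hj : ∀ q, j.base q ∈ T.abs.relSet (k + 1) := fun q =>
      mem_relSet_abs.2 (mem_boundary_succ.2
        (Or.inr (Or.inr (Fin.snoc_last (α := fun _ => I) _ _))))
    have hK : MapsTo K.base (T.bigZ k ×ˢ univ) (T.abs.relSet (k + 1)) := by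
      rintro q ⟨h | h, -⟩
      · refine mem_relSet_abs.2 (mem_boundary_succ.2 (Or.inr (Or.inr ?_)))
        refine (Fin.snoc_last (α := fun _ => I) _ _).trans ?_
        change max (q.1.1.2 (Fin.last k)) q.2 = 1
        rw [h.2]
        exact max_eq_left q.2.2.2
      · refine mem_relSet_abs.2 (mem_boundary_succ.2 (Or.inl ?_))
        exact (initial_snoc _ _).symm ▸ h
    refine (congrFun (KF.map_eq_of_homotopy K hK i j (fun p => ?_) (fun p => ?_) h0
      fun q _ => hj q) b).trans (KF.map_eq_zeroCls _ _ _ _ hj)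
    · obtain ⟨p, s, h, rfl⟩ := exists_eq_bigP p
      refine PrincipalBundle.prod_ext rfl ?_
      refine Eq.trans (congrArg (Fin.snoc (α := fun _ => I) (initial s)) ?_) (snoc_initial s)
      exact max_eq_left (s (Fin.last k)).2.1
    · refine PrincipalBundle.prod_ext rfl
        (congrArg (Fin.snoc (α := fun _ => I) (T.bigCoord k ((T.bigP k).proj p))) ?_)
      exact max_eq_right (T.bigLast k ((T.bigP k).proj p)).2.2

end exact

end CWTriple

/-! ### Multiplication with the Thom class -/

section interchange

variable {V₁ V₂ V₃ V₄ W₁ W₂ W₃ W₄ : Type u} [NormedAddCommGroup V₁] [InnerProductSpace ℂ V₁]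
  [NormedAddCommGroup V₂] [InnerProductSpace ℂ V₂] [NormedAddCommGroup V₃] [InnerProductSpace ℂ V₃]
  [NormedAddCommGroup V₄] [InnerProductSpace ℂ V₄] [NormedAddCommGroup W₁] [InnerProductSpace ℂ W₁]
  [NormedAddCommGroup W₂] [InnerProductSpace ℂ W₂] [NormedAddCommGroup W₃] [InnerProductSpace ℂ W₃]
  [NormedAddCommGroup W₄] [InnerProductSpace ℂ W₄]

variable (V₁ V₂ V₃ V₄) in
/-- The interchange of the two middle summands of a fourfold sum. -/
def sumMid : WithLp 2 (WithLp 2 (V₁ × V₂) × WithLp 2 (V₃ × V₄)) →ₗ[ℂ]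
    WithLp 2 (WithLp 2 (V₁ × V₃) × WithLp 2 (V₂ × V₄)) where
  toFun v := WithLp.toLp 2 (WithLp.toLp 2 (v.fst.fst, v.snd.fst),
    WithLp.toLp 2 (v.fst.snd, v.snd.snd))
  map_add' _ _ := rfl
  map_smul' _ _ := rfl

theorem sumMid_apply (v : WithLp 2 (WithLp 2 (V₁ × V₂) × WithLp 2 (V₃ × V₄))) :
    sumMid V₁ V₂ V₃ V₄ v = WithLp.toLp 2 (WithLp.toLp 2 (v.fst.fst, v.snd.fst),
      WithLp.toLp 2 (v.fst.snd, v.snd.snd)) := rfl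

theorem blockMap_zero : (blockMap 0 0 0 0 : WithLp 2 (V₁ × V₂) →ₗ[ℂ] WithLp 2 (W₁ × W₂)) = 0 :=
  LinearMap.ext fun v => withLp_ext (by simp) (by simp)

theorem sumMid_blockMap (a : V₁ →ₗ[ℂ] W₁) (b : V₂ →ₗ[ℂ] W₁) (c : V₁ →ₗ[ℂ] W₂) (d : V₂ →ₗ[ℂ] W₂)
    (a' : V₃ →ₗ[ℂ] W₃) (b' : V₄ →ₗ[ℂ] W₃) (c' : V₃ →ₗ[ℂ] W₄) (d' : V₄ →ₗ[ℂ] W₄)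
    (v : WithLp 2 (WithLp 2 (V₁ × V₂) × WithLp 2 (V₃ × V₄))) :
    sumMid W₁ W₂ W₃ W₄ (blockMap (blockMap a b c d) 0 0 (blockMap a' b' c' d') v) =
      blockMap (blockMap a 0 0 a') (blockMap b 0 0 b') (blockMap c 0 0 c') (blockMap d 0 0 d')
        (sumMid V₁ V₂ V₃ V₄ v) :=
  withLp_ext (withLp_ext (by simp [sumMid_apply]) (by simp [sumMid_apply]))
    (withLp_ext (by simp [sumMid_apply]) (by simp [sumMid_apply]))

theorem sumMid_blockMap' (a : V₁ →ₗ[ℂ] W₁) (b : V₂ →ₗ[ℂ] W₁) (c : V₁ →ₗ[ℂ] W₂) (d : V₂ →ₗ[ℂ] W₂)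
    (a' : V₃ →ₗ[ℂ] W₃) (b' : V₄ →ₗ[ℂ] W₃) (c' : V₃ →ₗ[ℂ] W₄) (d' : V₄ →ₗ[ℂ] W₄)
    (v : WithLp 2 (WithLp 2 (V₁ × V₃) × WithLp 2 (V₂ × V₄))) :
    sumMid W₁ W₃ W₂ W₄ (blockMap (blockMap a 0 0 a') (blockMap b 0 0 b') (blockMap c 0 0 c')
        (blockMap d 0 0 d') v) =
      blockMap (blockMap a b c d) 0 0 (blockMap a' b' c' d') (sumMid V₁ V₃ V₂ V₄ v) :=
  withLp_ext (withLp_ext (by simp [sumMid_apply]) (by simp [sumMid_apply]))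
    (withLp_ext (by simp [sumMid_apply]) (by simp [sumMid_apply]))

/-- The distribution of the frames in a fourfold sum. -/
def frameMid {A B C D : Type} : (A ⊕ B) ⊕ (C ⊕ D) → (A ⊕ C) ⊕ (B ⊕ D)
  | .inl (.inl a) => .inl (.inl a)
  | .inl (.inr b) => .inr (.inl b)
  | .inr (.inl c) => .inl (.inr c)
  | .inr (.inr d) => .inr (.inr d)

end interchange

section thom

variable {X : Type u} [TopologicalSpace X] {X' : Type u} [TopologicalSpace X'] {H : Type w}
  [NormedAddCommGroup H] [InnerProductSpace ℂ H] {P : PrincipalBundle (PU H) X}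
  {P' : PrincipalBundle (PU H) X'} {f : C(X', X)} {Y : Set X} {Y' : Set X'}

namespace TV

/-- The product of the pull-back of `𝔸` with the Thom class `z`. -/
def thomAlong (F : P'.Hom P f) (z : C(X', ℂ)) (𝔸 : TV P) : TV P' :=
  ⟨(along F 𝔸).D, (along F 𝔸).V.thom z⟩

theorem Good.thomAlong {𝔸 : TV P} (h : Good Y 𝔸) (F : P'.Hom P f) {z : C(X', ℂ)}
    (hz : ∀ y ∈ Y', f y ∈ Y ∨ z y ≠ 0) : Good Y' (thomAlong F z 𝔸) :=
  ⟨(dom_along F 𝔸).trans (by rw [h.1, preimage_univ]), fun y hy => InvAt.thom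
    ((hz y hy).symm.imp id fun hy => InvAt.pull (.ofHom F) (h.2 _ hy))⟩

variable [Nontrivial H]

/-- `(E ⊗ F) ⊕ (E' ⊗ F) = (E ⊕ E') ⊗ F`, by the interchange of the two summands in the middle. -/
theorem Sub.sum_thom {D : LTD P} (V V' : LVB D) (z : C(X, ℂ)) :
    Sub (⟨D, (V.thom z).sum (V'.thom z)⟩ : TV P) ⟨D, (V.sum V').thom z⟩ := by
  have hε : ∀ a x, (((V.sum V').thom z).E a).ε x = blockMap
      (blockMap ((V.E a).ε x) 0 0 ((V'.E a).ε x)) (blockMap 0 0 0 0) (blockMap 0 0 0 0)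
      (blockMap ((-1 : ℂ) • (V.E a).ε x) 0 0 ((-1 : ℂ) • (V'.E a).ε x)) := fun a x => by
    rw [← smul_blockMap_diag, blockMap_zero]
    rfl
  have hh : ∀ a x, (((V.sum V').thom z).E a).h x = blockMap
      (blockMap ((V.E a).h x) 0 0 ((V'.E a).h x))
      (blockMap (star z x • (V.E a).ε x) 0 0 (star z x • (V'.E a).ε x))
      (blockMap (z x • (V.E a).ε x) 0 0 (z x • (V'.E a).ε x))
      (blockMap ((V.E a).h x) 0 0 ((V'.E a).h x)) := fun a x => by
    rw [← smul_blockMap_diag, ← smul_blockMap_diag]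
    rfl
  have hφ : ∀ a b x, ((V.sum V').thom z).φ a b x = blockMap
      (blockMap (V.φ a b x) 0 0 (V'.φ a b x)) (blockMap 0 0 0 0) (blockMap 0 0 0 0)
      (blockMap (V.φ a b x) 0 0 (V'.φ a b x)) := fun a b x => by
    rw [blockMap_zero]
    rfl
  exact .of_iso id (fun a x hx => hx) (fun a x hx => rfl) (fun a b x hx => rfl)
    (fun a x => sumMid _ _ _ _) (fun a x => sumMid _ _ _ _)
    (fun a => isHFHom_of_frame (fun i => ((i.1.1, i.2.1), (i.1.2, i.2.2))) (fun _ => frameMid)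
      (fun i x hx => ⟨⟨⟨hx.2.1.1, hx.2.2.1⟩, ⟨hx.2.1.2, hx.2.2.2⟩⟩, fun k => by
        rcases k with (k | k) | (k | k) <;> rfl⟩)
      (fun x hx v => by rw [hε]; exact sumMid_blockMap _ _ _ _ _ _ _ _ _)
      fun x hx v => by rw [hh]; exact sumMid_blockMap _ _ _ _ _ _ _ _ _)
    (fun a => isHFHom_of_frame (fun i => ((i.1.1, i.2.1), (i.1.2, i.2.2))) (fun _ => frameMid)
      (fun i x hx => ⟨⟨⟨hx.2.1.1, hx.2.2.1⟩, ⟨hx.2.1.2, hx.2.2.2⟩⟩, fun k => by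
        rcases k with (k | k) | (k | k) <;> rfl⟩)
      (fun x hx v => by rw [hε]; exact sumMid_blockMap' _ _ _ _ _ _ _ _ _)
      fun x hx v => by rw [hh]; exact sumMid_blockMap' _ _ _ _ _ _ _ _ _)
    (fun a x hx v => rfl) (fun a x hx v => rfl)
    fun a b x hx v => (LinearMap.congr_fun (hφ a b x) _).trans
      (sumMid_blockMap _ _ _ _ _ _ _ _ _).symm

/-- The multiplication with the Thom class is compatible with homotopies: it can be applied to a
concordance, with the same function `z` at all times. -/
theorem cls_thomAlong_congr {𝔸 𝔹 : TV P} {hA : Good Y 𝔸} {hB : Good Y 𝔹} (F : P'.Hom P f)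
    {z : C(X', ℂ)} (hz : ∀ y ∈ Y', f y ∈ Y ∨ z y ≠ 0) (h : cls Y 𝔸 hA = cls Y 𝔹 hB) :
    cls Y' _ (hA.thomAlong F hz) = cls Y' _ (hB.thomAlong F hz) := by
  obtain ⟨𝔽, hF, s, s'⟩ := conc_of_cls_eq h
  have hG := hF.thomAlong (F.prodMap I) (Y' := Y' ×ˢ univ) (z := z.comp ⟨Prod.fst, continuous_fst⟩)
    fun q hq => (hz q.1 hq.1).imp (fun h => ⟨h, trivial⟩) id
  have key : ∀ (t : I) (𝔸 : TV P) (hA : Good Y 𝔸) (_ : Sub 𝔸 (along (P.slice t) 𝔽))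
      (c : C(X', ℂ)) (hc : ∀ y ∈ Y', f y ∈ Y ∨ c y ≠ 0), (∀ x, z x = c x) →
      cls Y' _ (hA.thomAlong F hc) = cls Y' (along (P'.slice t) (thomAlong (F.prodMap I)
        (z.comp ⟨Prod.fst, continuous_fst⟩) 𝔽)) (hG.along _ fun _ hy => ⟨hy, trivial⟩) := by
    intro t 𝔸 hA s c hc hzc
    obtain rfl : (z.comp ⟨Prod.fst, continuous_fst⟩).comp (PrincipalBundle.sliceMap X' t) = c :=
      ContinuousMap.ext hzc
    have hH := (hF.along (F.prodMap I) (Y' := (f ⁻¹' Y) ×ˢ univ) fun q hq => ⟨hq.1, trivial⟩).along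
      (P'.slice t) (Y' := f ⁻¹' Y) fun _ hy => ⟨hy, trivial⟩
    have hH' : Good Y' (⟨_, (along (P'.slice t) (along (F.prodMap I) 𝔽)).V.thom
        ((z.comp ⟨Prod.fst, continuous_fst⟩).comp (PrincipalBundle.sliceMap X' t))⟩ : TV P') :=
      ⟨hH.1, fun y hy => InvAt.thom ((hz y hy).symm.imp id (hH.2 y))⟩
    have hs : Compat (along F 𝔸) (along (P'.slice t) (along (F.prodMap I) 𝔽)) := by
      refine .of_subs (s.pull _) ?_
      have s₁ : Sub (along (P'.slice t) (along (F.prodMap I) 𝔽)) (along ((P.slice t).comp F) 𝔽) :=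
        Sub.along_along (fun p => PrincipalBundle.prod_ext rfl rfl) 𝔽
      have s₂ : Sub (along ((P.slice t).comp F) 𝔽) (along F (along (P.slice t) 𝔽)) :=
        Sub.along_of_comp (fun _ => rfl) 𝔽
      exact s₁.trans s₂
    refine (cls_eq_of_compat (hB := hH') (Compat.thom (V := (along F 𝔸).V) hs _)).trans
      (cls_eq_of_sub ?_)
    exact .pull_thom (P'.slice t) (along (F.prodMap I) 𝔽).V _
  exact (key 0 _ hA s z hz fun _ => rfl).trans
    ((cls_slice hG).trans (key 1 _ hB s' z hz fun _ => rfl).symm)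

end TV

namespace KF

open TV

variable [Nontrivial H]

/-- The multiplication with the Thom class is well-defined on classes. -/
theorem exists_thom (F : P'.Hom P f) {z : C(X', ℂ)} (hz : ∀ y ∈ Y', f y ∈ Y ∨ z y ≠ 0)
    (a : KF P Y) : ∃ b : KF P' Y', ∀ (𝔸 : TV P) (hA : Good Y 𝔸), a = cls Y 𝔸 hA →
      b = cls Y' _ (hA.thomAlong F hz) := by
  obtain ⟨𝔸, hA, rfl⟩ := exists_cls a
  exact ⟨_, fun 𝔹 hB h => cls_thomAlong_congr F hz h⟩

/-- Pull-back followed by the multiplication with the Thom class `z`. -/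
def thom (F : P'.Hom P f) {z : C(X', ℂ)} (hz : ∀ y ∈ Y', f y ∈ Y ∨ z y ≠ 0) (a : KF P Y) :
    KF P' Y' := (exists_thom F hz a).choose

theorem thom_cls (F : P'.Hom P f) {z : C(X', ℂ)} (hz : ∀ y ∈ Y', f y ∈ Y ∨ z y ≠ 0) {𝔸 : TV P}
    (hA : Good Y 𝔸) : thom F hz (cls Y 𝔸 hA) = cls Y' _ (hA.thomAlong F hz) :=
  (exists_thom F hz _).choose_spec 𝔸 hA rfl

theorem thom_add (F : P'.Hom P f) {z : C(X', ℂ)} (hz : ∀ y ∈ Y', f y ∈ Y ∨ z y ≠ 0)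
    (a b : KF P Y) : thom F hz (add a b) = add (thom F hz a) (thom F hz b) := by
  obtain ⟨D, V, V', h, h', rfl, rfl⟩ := exists_cls₂ a b
  rw [add_cls, thom_cls, thom_cls, thom_cls]
  have hg : Good Y' ⟨(along F ⟨D, V⟩).D, ((along F ⟨D, V⟩).V.sum (along F ⟨D, V'⟩).V).thom z⟩ :=
    ⟨(h.thomAlong F hz).1, fun y hy => InvAt.thom ((hz y hy).symm.imp id fun hy =>
      InvAt.sum (InvAt.pull (.ofHom F) (h.2 _ hy)) (InvAt.pull (.ofHom F) (h'.2 _ hy)))⟩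
  refine Eq.trans (cls_eq_of_compat (hB := hg) (Compat.symm (Compat.thom ?_ z))) (Eq.trans ?_
    (add_cls (h.thomAlong F hz) (h'.thomAlong F hz)).symm)
  · exact .of_subs (.pull_sum _ _ _) (Sub.refl _)
  · exact (cls_eq_of_sub (.sum_thom _ _ _)).symm

theorem map_thom {X₁ X₂ : Type u} [TopologicalSpace X₁] [TopologicalSpace X₂]
    {P₁ : PrincipalBundle (PU H) X₁} {P₂ : PrincipalBundle (PU H) X₂} {Y₁ : Set X₁} {Y₂ : Set X₂}
    {g : C(X₂, X')} {g₁ : C(X₁, X)} {f₁ : C(X₂, X₁)} (F : P'.Hom P f) (G : P₂.Hom P' g)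
    (G₁ : P₁.Hom P g₁) (F₁ : P₂.Hom P₁ f₁) (h : ∀ p, F.toFun (G.toFun p) = G₁.toFun (F₁.toFun p))
    {z : C(X', ℂ)} {z₁ : C(X₂, ℂ)} (hz : ∀ y ∈ Y', f y ∈ Y ∨ z y ≠ 0)
    (hz₁ : ∀ y ∈ Y₂, f₁ y ∈ Y₁ ∨ z₁ y ≠ 0) (hzz : z.comp g = z₁) (hg : MapsTo g Y₂ Y')
    (hg₁ : MapsTo g₁ Y₁ Y) (a : KF P Y) :
    map G hg (thom F hz a) = thom F₁ hz₁ (map G₁ hg₁ a) := by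
  subst hzz
  obtain ⟨𝔸, hA, rfl⟩ := exists_cls a
  rw [thom_cls, map_cls, map_cls, thom_cls]
  have s₁ : Sub (along G (along F 𝔸)) (along (F.comp G) 𝔸) := Sub.along_along (fun _ => rfl) 𝔸
  have s₂ : Sub (along F₁ (along G₁ 𝔸)) (along (F.comp G) 𝔸) :=
    Sub.along_along (fun p => (h p).symm) 𝔸
  have hC : Good Y₂ (⟨_, (along G (along F 𝔸)).V.thom (z.comp g)⟩ : TV P₂) :=
    ((hA.thomAlong F hz).along G hg).sub (Sub.pull_thom G (along F 𝔸).V z)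
      ((hA.thomAlong F hz).along G hg).1
  exact (cls_eq_of_sub (hA := hC) (Sub.pull_thom G (along F 𝔸).V z)).symm.trans
    (cls_eq_of_compat (Compat.thom (Compat.of_subs s₁ s₂) _))

end KF

end thom

namespace CWTriple

section beta

variable {H : Type w} [NormedAddCommGroup H] [InnerProductSpace ℂ H] (T T' : CWTriple.{u} H)

/-- Over the boundary of the square the function `z` has absolute value one, so that the Hermitian
map of the product is invertible there. -/
theorem mem_relSet_or_z_ne_zero (θ : DiskParam) : ∀ q ∈ T.relSet 2,
    (q.1, (Fin.elim0 : Fin 0 → I)) ∈ T.relSet 0 ∨ θ.z T q ≠ 0 := by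
  rintro q (h | h)
  · exact Or.inl (Or.inl ⟨h.1, trivial⟩)
  · refine Or.inr fun h0 => ?_
    have h1 := (θ.mem_sphere q.2).2 h.2
    rw [show (θ.θ q.2 : ℂ) = 0 from h0] at h1
    simp at h1

variable [Nontrivial H]

/-- Multiplication with the Thom class. -/
def beta (θ : DiskParam) : T.KF 0 →+ T.KF 2 :=
  AddMonoidHom.mk' (KF.thom T.squareProj (T.mem_relSet_or_z_ne_zero θ)) (KF.thom_add _ _)

theorem beta_cls (θ : DiskParam) (𝔼 : RelVB (T.P.prod (Fin 0 → I)) (T.relSet 0)) :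
    T.beta θ (T.cls 0 𝔼) = T.cls 2 (T.thom θ 𝔼) :=
  (KF.thom_cls T.squareProj (T.mem_relSet_or_z_ne_zero θ) (TV.good_ofT 𝔼.disjoint)).trans
    (TV.cls_eq_of_compat (hB := TV.good_ofT (T.thom θ 𝔼).disjoint) (TV.Compat.thom
      (TV.Compat.of_subs (TV.Sub.refl _) (TV.sub_pullback 𝔼.𝔼 T.squareProj)) _))

variable {T T'}

theorem Hom.map_beta (θ : DiskParam) (φ : T'.Hom T) (a : T.KF 0) :
    φ.map 2 (T.beta θ a) = T'.beta θ (φ.map 0 a) :=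
  KF.map_thom T.squareProj (φ.F.prodMap (Fin 2 → I)) (φ.F.prodMap (Fin 0 → I)) T'.squareProj
    (fun _ => PrincipalBundle.prod_ext rfl rfl) (T.mem_relSet_or_z_ne_zero θ)
    (T'.mem_relSet_or_z_ne_zero θ) rfl _ _ a

variable (T)

/-- The homomorphism `δ₀ = δ₋₂ ∘ β`. -/
def deltaZero (θ : DiskParam) : T.sub.KF 0 →+ T.KFone := (T.delta 1).comp (T.sub.beta θ)

variable {T}

theorem Hom.map_deltaZero (θ : DiskParam) (φ : T'.Hom T) (a : T.sub.KF 0) :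
    φ.map 1 (T.deltaZero θ a) = T'.deltaZero θ (φ.sub.map 0 a) :=
  (φ.map_delta _).trans (congrArg (T'.delta 1) (φ.sub.map_beta θ a))

theorem deltaZero_subHom (θ : DiskParam) (a : T.abs.KF 0) :
    T.deltaZero θ (T.subHom.map 0 a) = 0 :=
  (congrArg (T.delta 1) (T.subHom.map_beta θ a)).symm.trans
    ((T.exact_subHom_delta 1).apply_apply_eq_zero _)

end beta

end CWTriple

end TwK

end

theorem mainTheorem4 {H : Type w} [NormedAddCommGroup H] [InnerProductSpace ℂ H] [CompleteSpace H]
    [TopologicalSpace.SeparableSpace H] [Nontrivial H] (hH : ¬ FiniteDimensional ℂ H) :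
    -- the abelian group structures; the addition is induced by the direct sum
    ∃ grp : ∀ (T : CWTriple.{u, w} H) (k : ℕ), AddCommGroup (T.KF k),
      (∀ (T : CWTriple.{u, w} H) (k : ℕ) (D : TwistData (T.P.prod (Fin k → unitInterval)))
        (V V' : VBData D) (hV : Disjoint (TwistedVB.mk D V).supp (T.relSet k))
        (hV' : Disjoint (TwistedVB.mk D V').supp (T.relSet k)),
        T.cls k ⟨⟨D, V⟩, hV⟩ + T.cls k ⟨⟨D, V'⟩, hV'⟩ = T.cls k (RelVB.sum V V' hV hV')) ∧
      -- the induced maps are homomorphisms and functorial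
      (∀ (T' T : CWTriple.{u, w} H) (φ : T'.Hom T) (k : ℕ) (a b : T.KF k),
        φ.map k (a + b) = φ.map k a + φ.map k b) ∧
      (∀ (T : CWTriple.{u, w} H) (k : ℕ) (a : T.KF k), (CWTriple.Hom.id T).map k a = a) ∧
      (∀ (T'' T' T : CWTriple.{u, w} H) (φ : T'.Hom T) (ψ : T''.Hom T') (k : ℕ) (a : T.KF k),
        (φ.comp ψ).map k a = ψ.map k (φ.map k a)) ∧
      -- homotopy axiom
      (∀ (T' T : CWTriple.{u, w} H) (φ₀ φ₁ : T'.Hom T), φ₀.Homotopic φ₁ →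
        ∀ k : ℕ, φ₀.map k = φ₁.map k) ∧
      -- excision axiom
      (∀ (T : CWTriple.{u, w} H) (A B : Topology.CWComplex.Subcomplex T.X) (k : ℕ),
        Function.Bijective ((T.excisionHom A B).map k)) ∧
      -- exactness axiom: the connecting homomorphisms `δ_{-k-1}`
      (∃ δ : ∀ (T : CWTriple.{u, w} H) (k : ℕ), T.sub.KF (k + 1) →+ T.KF k,
        (∀ (T : CWTriple.{u, w} H) (k : ℕ), Function.Bijective (T.bigRes k) ∧
          Function.Bijective (T.bigProj k) ∧
          ∀ c, T.bigProj k (δ T k (T.bigRes k c)) = T.bigIncl k c) ∧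
        (∀ (T' T : CWTriple.{u, w} H) (φ : T'.Hom T) (k : ℕ) (a : T.sub.KF (k + 1)),
          φ.map k (δ T k a) = δ T' k (φ.sub.map (k + 1) a)) ∧
        (∀ (T : CWTriple.{u, w} H) (k : ℕ),
          Function.Exact (T.absHom.map k) (T.subHom.map k) ∧
          Function.Exact (δ T k) (T.absHom.map k) ∧
          Function.Exact (T.subHom.map (k + 1)) (δ T k)) ∧
        -- the last map `δ_0 = δ_{-2} ∘ β`
        (∀ θ : CWTriple.DiskParam, ∃ β : ∀ T : CWTriple.{u, w} H, T.KF 0 →+ T.KF 2,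
          (∀ (T : CWTriple.{u, w} H)
            (𝔼 : RelVB (T.P.prod (Fin 0 → unitInterval)) (T.relSet 0)),
            β T (T.cls 0 𝔼) = T.cls 2 (T.thom θ 𝔼)) ∧
          (∀ (T' T : CWTriple.{u, w} H) (φ : T'.Hom T) (a : T.KF 0),
            φ.map 2 (β T a) = β T' (φ.map 0 a)) ∧
          ∃ δ₀ : ∀ T : CWTriple.{u, w} H, T.sub.KF 0 →+ T.KFone,
            (∀ T : CWTriple.{u, w} H, δ₀ T = (δ T 1).comp (β T.sub)) ∧
            (∀ (T' T : CWTriple.{u, w} H) (φ : T'.Hom T) (a : T.sub.KF 0),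
              φ.map 1 (δ₀ T a) = δ₀ T' (φ.sub.map 0 a)) ∧
            ∀ (T : CWTriple.{u, w} H) (a : T.abs.KF 0), δ₀ T (T.subHom.map 0 a) = 0)) ∧
      -- additivity axiom
      (∀ (Λ : Type u) (T : Λ → CWTriple.{u, w} H) (k : ℕ), Function.Bijective
        fun (a : (CWTriple.coprod T).KF k) (l : Λ) => (CWTriple.coprodIncl T l).map k a) := by
  exact ⟨CWTriple.addCommGroup, fun T k D V V' hV hV' => CWTriple.cls_add_cls hV hV',
    fun T' T φ k a b => φ.map_add a b, fun T k a => CWTriple.Hom.map_id a,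
    fun T'' T' T φ ψ k a => φ.map_comp ψ a, fun T' T φ₀ φ₁ h k => h.map_eq,
    fun T A B k => T.bijective_excisionHom_map A B k,
    ⟨CWTriple.delta, fun T k => ⟨T.bijective_bigRes k, T.bijective_bigProj k,
        fun c => CWTriple.bigProj_delta_bigRes c⟩,
      fun T' T φ k a => φ.map_delta a,
      fun T k => ⟨T.exact_absHom_subHom k, T.exact_delta_absHom k, T.exact_subHom_delta k⟩,
      fun θ => ⟨fun T => T.beta θ, fun T 𝔼 => T.beta_cls θ 𝔼, fun T' T φ a => φ.map_beta θ a,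
        fun T => T.deltaZero θ, fun T => rfl, fun T' T φ a => φ.map_deltaZero θ a,
        fun T a => CWTriple.deltaZero_subHom θ a⟩⟩,
    fun Λ T k => CWTriple.bijective_coprodIncl_map T k⟩
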